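/- **Terms.** Variables $x,y,z$ are of two disjoint kinds, multiplicative ($m,n$) and exponential ($e,f$). Values are $v ::= x \mid \lambda x.t \mid {!}t$ and terms are $t ::= v \mid [v{\to}x]t$ (cut) $\mid [m\,v,x]t$ (subtraction) $\mid [e?x]t$ (dereliction); abstractions, cuts, subtractions and derelictions bind $x$ in $t$. Multiplicative values are $m$ and $\lambda x.t$, exponential values are $e$ and ${!}t$. The size $|t|$ is the number of constructors of $t$ (variable occurrences included). A term is proper if every binder for a multiplicative variable has it free in its body, $t$ has no free multiplicative variable in every sub-term ${!}t$, $m$ is not free in $t$ for every $[m\,v,x]t$, and for every $[v{\to}x]t$ and $[m\,v,x]t$ no multiplicative variable other than $x$ is free in both $v$ and $t$. Every term is uniquely $L\langle v\rangle$ with $v$ a value and $L$ a sequence of cuts, subtractions and derelictions; we write $L\langle t\rangle$ for $L$ followed by $t$. **Machine.** A multi-context $\mathbb C$ is a term in which some values may be named holes $\langle\cdot\rangle_a$; $\mathbb C\langle \mathbb D\rangle_a$ is the capture-allowing replacement of $\langle\cdot\rangle_a$ by $\mathbb D$ (with $[L\langle v\rangle{\to}x]\mathbb C'$ read as $L\langle[v{\to}x]\mathbb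 C'\rangle$, and similarly for subtractions). Its domain $\mathrm{dom}(\mathbb C)$ is the set of variables $x$ having a cut $[\cdot{\to}x]\mathbb C'$ in $\mathbb C$, not inside another cut's left value nor in a hole-free right-hand side of a cut, with at least one hole in $\mathbb C'$. A state of SESAME is a pair $(\mathbb C\mid P)$ of a multi-context and a pool, i.e. a list of named terms $\langle t\rangle_a$. A term $t$ is initialized to $(\langle\cdot\rangle_a\mid\langle t'\rangle_a)$ for any $t'=_\alpha t$ whose bound names are pairwise distinct and not free in $t$. Below, $\mathbb E\langle\cdot\rangle_\circ$ has exactly one occurrence of its hole $\circ$, displayed cut values are hole-free, and $\cdot^\alpha$ is an $\alpha$-renaming with pairwise distinct bound names that do not occur in the state. Search transitions: - $(\mathbb C\mid\langle[v{\to}x]t\rangle_a{:}P)\to(\mathbb C\langle[v{\to}x]\langle\cdot\rangle_a\rangle_a\mid\langle t\rangle_a{:}P)$; - $(\mathbb C\mid\langle[m\,v,x]t\rangle_a{:}P)\to(\mathbb C\langle[m\,\langle\cdot\rangle_b,x]\langle\cdot\rangle_a\rangle_a\mid\langle v\rangle_b{:}\langle t\rangle_a{:}P)$ if $m\notin\mathrm{dom}(\mathbb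 C)$, $b$ fresh; - $(\mathbb C\mid\langle[e?x]t\rangle_a{:}P)\to(\mathbb C\langle[e?x]\langle\cdot\rangle_a\rangle_a\mid\langle t\rangle_a{:}P)$ if $e\notin\mathrm{dom}(\mathbb C)$; - $(\mathbb C\mid\langle\lambda x.t\rangle_a{:}P)\to(\mathbb C\langle\lambda x.\langle\cdot\rangle_a\rangle_a\mid\langle t\rangle_a{:}P)$ and $(\mathbb C\mid\langle{!}t\rangle_a{:}P)\to(\mathbb C\langle{!}\langle\cdot\rangle_a\rangle_a\mid\langle t\rangle_a{:}P)$; - $(\mathbb C\mid\langle x\rangle_a{:}P)\to(\mathbb C\langle x\rangle_a\mid P)$ if $x\notin\mathrm{dom}(\mathbb C)$. Principal transitions: - $(\mathbb E\langle[n{\to}m]\mathbb C'\rangle_\circ\mid\langle[m\,v,x]t\rangle_a{:}P)\to(\mathbb E\langle\mathbb C'\rangle_\circ\mid\langle[n\,v,x]t\rangle_a{:}P)$; - $(\mathbb E\langle[\lambda y.L\langle v'\rangle{\to}m]\mathbb C'\rangle_\circ\mid\langle[m\,v,x]t\rangle_a{:}P)\to(\mathbb E\langle\mathbb C'\rangle_\circ\mid\langle[v{\to}y]L\langle[v'{\to}x]t\rangle\rangle_a{:}P)$;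 - $(\mathbb C\mid\langle[e?x]t\rangle_a{:}P)\to(\mathbb C\mid\langle[f?x]t\rangle_a{:}P)$ if $\mathbb C=\mathbb E\langle[f{\to}e]\mathbb C'\rangle_\circ$; - $(\mathbb C\mid\langle[e?x]t\rangle_a{:}P)\to(\mathbb C\mid\langle L'\langle[v'{\to}x]t\rangle\rangle_a{:}P)$ if $\mathbb C=\mathbb E\langle[{!}s{\to}e]\mathbb C'\rangle_\circ$ and $L'\langle v'\rangle=s^\alpha$; - $(\mathbb E\langle[v{\to}m]\mathbb C'\rangle_\circ\mid\langle m\rangle_a{:}P)\to(\mathbb E\langle\mathbb C'\rangle_\circ\mid\langle v\rangle_a{:}P)$, $v$ a multiplicative value; - $(\mathbb C\mid\langle e\rangle_a{:}P)\to(\mathbb C\mid\langle v^\alpha\rangle_a{:}P)$ if $\mathbb C=\mathbb E\langle[v{\to}e]\mathbb C'\rangle_\circ$, $v$ an exponential value. For a run $r$ let $|r|_{pr}$ and $|r|_{sea}$ be its numbers of principal and of search transitions. **Representation.** RAMs have unit cost instructions: load a constant, add, (truncated) subtract, indirect load, indirect store, jump on zero. States are stored as pointer graphs in which only variables are shared,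 in aligned disjoint blocks of eight cells (cells not mentioned are arbitrary). A variable $x$ is a block, an occurrence of it is the address of that block, and the block records the kind of $x$, whether $x$ is bound by a cut, and, for a cut $[v{\to}x]$, the value $v$. Every other constructor is a block with a tag, pointers to its variables, and slots for its sub-terms; a named hole is a slot, a job $\langle t\rangle_a$ is a pointer to the slot of $a$, which contains $t$, and the pool is a linked list of jobs. Three registers hold the slot of the multi-context, the pool, and the start of unused memory. **Theorem (SESAME bi-linear overhead bound).** Every initial state of a proper term is represented by some memory. Moreover, there are a RAM program and a constant $K$ such that, for every proper term $t$ and every SESAME run $r$ starting from a state to which $t$ is initialized, $|r|_{sea}\le|t|\cdot(|r|_{pr}+1)$ and, started on any memory that represents the first state of $r$, the program implements $r$ in at most $K\cdot|t|\cdot(|r|_{pr}+1)$ steps, that is, in $O(|t|\cdot(|r|_{pr}+1))$. Here implementing $r$ means passing, at strictly increasing times, through configurations that represent the successive states of $r$ (with the free variables of $t$ kept at their locations), the last one being a halting one if its pool is empty; and each search transition of $r$ takes at most $K$ steps, i.e. $O(1)$, and each principal one at most $K\cdot|t|$ steps, i.e. $O(|t|)$. -/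

import Mathlib

namespace Sesame

/-! ### Variables, pre-terms and multi-contexts of the exponential substitution calculus -/

/-- The two disjoint kinds of variables: multiplicative `m` and exponential `e`. -/
inductive Var : Type where
  | m (n : ℕ)
  | e (n : ℕ)
  deriving DecidableEq

/-- A code for the kind of a variable. -/
def Var.kind : Var → ℕ
  | .m _ => 0
  | .e _ => 1

mutual
/-- Value multi-contexts: named holes, variables, abstractions `λx.C`, promotions `!C`. -/
inductive Val : Type where
  | hole (a : ℕ)
  | var (x : Var)
  | lam (x : Var) (C : Ctx)
  | bang (C : Ctx)
/-- Multi-contexts: value multi-contexts, cuts `[V→x]C`, subtractions `[m V, x]C` on a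
multiplicative variable `m`, derelictions `[e?x]C` on an exponential variable `e`.
Cuts and subtractions are split: their left sub-term is a value.
The (pre-)terms are the multi-contexts without holes. -/
inductive Ctx : Type where
  | val (v : Val)
  | cut (v : Val) (x : Var) (C : Ctx)
  | sub (m : ℕ) (v : Val) (x : Var) (C : Ctx)
  | der (e : ℕ) (x : Var) (C : Ctx)
end

mutual
/-- The names of the holes, listed with multiplicity. -/
def Val.holes : Val → List ℕ
  | .hole a => [a]
  | .var _ => []
  | .lam _ C => C.holes
  | .bang C => C.holes
def Ctx.holes : Ctx → List ℕ
  | .val v => v.holes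
  | .cut v _ C => v.holes ++ C.holes
  | .sub _ v _ C => v.holes ++ C.holes
  | .der _ _ C => C.holes
end

/-- A pre-term is a multi-context without holes. -/
def Ctx.IsTerm (t : Ctx) : Prop := t.holes = []

mutual
/-- The size: the number of constructors (variable occurrences as values included). -/
def Val.size : Val → ℕ
  | .hole _ => 0
  | .var _ => 1
  | .lam _ C => C.size + 1
  | .bang C => C.size + 1
def Ctx.size : Ctx → ℕ
  | .val v => v.size
  | .cut v _ C => v.size + C.size + 1
  | .sub _ v _ C => v.size + C.size + 1
  | .der _ _ C => C.size + 1
end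

mutual
/-- Free variables, listed with multiplicity. -/
def Val.fv : Val → List Var
  | .hole _ => []
  | .var x => [x]
  | .lam x C => C.fv.filter (· ≠ x)
  | .bang C => C.fv
def Ctx.fv : Ctx → List Var
  | .val v => v.fv
  | .cut v x C => v.fv ++ C.fv.filter (· ≠ x)
  | .sub m v x C => .m m :: (v.fv ++ C.fv.filter (· ≠ x))
  | .der e x C => .e e :: C.fv.filter (· ≠ x)
end

mutual
/-- Bound variables: one entry for every binder. -/
def Val.bv : Val → List Var
  | .hole _ => []
  | .var _ => []
  | .lam x C => x :: C.bv
  | .bang C => C.bv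
def Ctx.bv : Ctx → List Var
  | .val v => v.bv
  | .cut v x C => x :: (v.bv ++ C.bv)
  | .sub _ v x C => x :: (v.bv ++ C.bv)
  | .der _ x C => x :: C.bv
end

mutual
/-- All variables that occur, be it as a binder, bound or free. -/
def Val.vars : Val → List Var
  | .hole _ => []
  | .var x => [x]
  | .lam x C => x :: C.vars
  | .bang C => C.vars
def Ctx.vars : Ctx → List Var
  | .val v => v.vars
  | .cut v x C => x :: (v.vars ++ C.vars)
  | .sub m v x C => .m m :: x :: (v.vars ++ C.vars)
  | .der e x C => .e e :: x :: C.vars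
end

/-- A binder for a multiplicative variable has to bind an occurrence of it. -/
def BindsLinearly (x : Var) (t : Ctx) : Prop := ∀ n : ℕ, x = Var.m n → x ∈ t.fv

/-- The multiplicative free variables of `v` and those of `t` other than `x` are disjoint. -/
def MulDisjoint (v : Val) (x : Var) (t : Ctx) : Prop :=
  ∀ n : ℕ, Var.m n ∈ v.fv → Var.m n ∈ t.fv → Var.m n = x

mutual
/-- Proper values and terms. -/
def Val.Proper : Val → Prop
  | .hole _ => True
  | .var _ => True
  | .lam x t => t.Proper ∧ BindsLinearly x t
  | .bang t => t.Proper ∧ ∀ n : ℕ, Var.m n ∉ t.fv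
def Ctx.Proper : Ctx → Prop
  | .val v => v.Proper
  | .cut v x t => v.Proper ∧ t.Proper ∧ MulDisjoint v x t ∧ BindsLinearly x t
  | .sub m v x t => v.Proper ∧ t.Proper ∧ MulDisjoint v x t ∧ Var.m m ∉ t.fv ∧ BindsLinearly x t
  | .der _ x t => t.Proper ∧ BindsLinearly x t
end

/-- `x` and `y` denote the same variable under the list `l` of pairs of corresponding binders,
innermost first. -/
def AlphaVar : List (Var × Var) → Var → Var → Prop
  | [], x, y => x = y
  | (a, b) :: l, x, y => (x = a ∧ y = b) ∨ (x ≠ a ∧ y ≠ b ∧ AlphaVar l x y)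

mutual
/-- `α`-equivalence under a list of pairs of corresponding binders. -/
def Val.Alpha : List (Var × Var) → Val → Val → Prop
  | _, .hole a, .hole b => a = b
  | l, .var x, .var y => AlphaVar l x y
  | l, .lam x C, .lam y D => x.kind = y.kind ∧ C.Alpha ((x, y) :: l) D
  | l, .bang C, .bang D => C.Alpha l D
  | _, _, _ => False
def Ctx.Alpha : List (Var × Var) → Ctx → Ctx → Prop
  | l, .val v, .val w => v.Alpha l w
  | l, .cut v x C, .cut w y D => v.Alpha l w ∧ x.kind = y.kind ∧ C.Alpha ((x, y) :: l) D
  | l, .sub m v x C, .sub n w y D =>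
      AlphaVar l (.m m) (.m n) ∧ v.Alpha l w ∧ x.kind = y.kind ∧ C.Alpha ((x, y) :: l) D
  | l, .der e x C, .der f y D =>
      AlphaVar l (.e e) (.e f) ∧ x.kind = y.kind ∧ C.Alpha ((x, y) :: l) D
  | _, _, _ => False
end

/-- `t'` is a fresh well-bound renaming of `t`, away from the variables in `l`: it is
`α`-equivalent to `t`, its bound names are pairwise distinct, and none of them is in `l`. -/
def Ctx.Renaming (t t' : Ctx) (l : List Var) : Prop :=
  t.Alpha [] t' ∧ t'.bv.Nodup ∧ ∀ x ∈ t'.bv, x ∉ l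

/-! ### Splitting and plugging -/

/-- Every multi-context is uniquely of the form `L⟨v⟩` with `L` a left context and `v` a value;
`(L⟨v⟩).splice f` is `L⟨f v⟩`. -/
def Ctx.splice : Ctx → (Val → Ctx) → Ctx
  | .val v, f => f v
  | .cut v x C, f => .cut v x (C.splice f)
  | .sub m v x C, f => .sub m v x (C.splice f)
  | .der e x C, f => .der e x (C.splice f)

mutual
/-- Plugging: the capture-allowing substitution of `D` for the hole of name `a`. To keep cuts
and subtractions split, plugging `L⟨v⟩` in `[⟨·⟩→x]C` gives `L⟨[v→x]C⟩`, and similarly for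
subtractions. -/
def Val.plug : Val → ℕ → Ctx → Ctx
  | .hole b, a, D => if b = a then D else .val (.hole b)
  | .var x, _, _ => .val (.var x)
  | .lam x C, a, D => .val (.lam x (C.plug a D))
  | .bang C, a, D => .val (.bang (C.plug a D))
def Ctx.plug : Ctx → ℕ → Ctx → Ctx
  | .val v, a, D => v.plug a D
  | .cut v x C, a, D => (v.plug a D).splice fun w => .cut w x (C.plug a D)
  | .sub m v x C, a, D => (v.plug a D).splice fun w => .sub m w x (C.plug a D)
  | .der e x C, a, D => .der e x (C.plug a D)
end

/-- The named hole, as a multi-context. -/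
abbrev Ctx.hole (a : ℕ) : Ctx := .val (.hole a)

mutual
/-- The domain: the variables on which there is a cut, not inside a cut value, whose right-hand
side is not a term, that is, has some holes. -/
def Val.dom : Val → List Var
  | .hole _ => []
  | .var _ => []
  | .lam _ C => C.dom
  | .bang C => C.dom
def Ctx.dom : Ctx → List Var
  | .val v => v.dom
  | .cut _ x C => if C.holes = [] then [] else x :: C.dom
  | .sub _ v _ C => v.dom ++ C.dom
  | .der _ _ C => C.dom
end

/-- `C = E⟨[v→x]C'⟩` and `D = E⟨C'⟩` for a multi-context `E` with a distinguished hole that occurs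
exactly once, where the cut value `v` is a term: `D` is `C` with a cut `[v→x]` removed. -/
def CutIn (C : Ctx) (v : Val) (x : Var) (D : Ctx) : Prop :=
  v.holes = [] ∧ ∃ (E : Ctx) (o : ℕ) (C' : Ctx), E.holes.count o = 1 ∧
    C = E.plug o (.cut v x C') ∧ D = E.plug o C'

/-- Multiplicative values: multiplicative variables and abstractions. -/
def Val.IsMul : Val → Prop
  | .var (.m _) => True
  | .lam _ _ => True
  | _ => False

/-- Exponential values: exponential variables and promotions. -/
def Val.IsExp : Val → Prop
  | .var (.e _) => True
  | .bang _ => True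
  | _ => False

/-! ### The abstract machine -/

/-- A job is a named term; a pool is a last-in first-out list of jobs. -/
abbrev Pool : Type := List (ℕ × Ctx)

/-- A state: a multi-context and a pool. -/
structure State : Type where
  ctx : Ctx
  pool : Pool

/-- The variables that occur in a state. -/
def State.vars (Q : State) : List Var :=
  Q.ctx.vars ++ Q.pool.flatMap fun j => j.2.vars

/-- The variables bound in a state. -/
def State.bv (Q : State) : List Var :=
  Q.ctx.bv ++ Q.pool.flatMap fun j => j.2.bv

/-- The variables that occur in a state but are not bound in it (no repetitions). -/
def State.free (Q : State) : List Var :=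
  (Q.vars.filter (· ∉ Q.bv)).dedup

/-- The hole names and job names of a state. -/
def State.names (Q : State) : List ℕ :=
  Q.ctx.holes ++ Q.pool.map Prod.fst

/-- `t` initializes the machine on `Q`. -/
def Init (t : Ctx) (Q : State) : Prop :=
  ∃ (a : ℕ) (t' : Ctx), t.Renaming t' t.fv ∧ Q = ⟨.hole a, [(a, t')]⟩

/-- The names of the transitions. -/
inductive Label : Type where
  | sea1 | sea2 | sea3 | sea4 | sea5 | sea6
  | axm1 | axm2 | lolli | axe1 | axe2 | bang
  deriving DecidableEq

/-- The search transitions are the six `sea` ones, the others are principal. -/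
def Label.isPrincipal : Label → Bool
  | .sea1 | .sea2 | .sea3 | .sea4 | .sea5 | .sea6 => false
  | .axm1 | .axm2 | .lolli | .axe1 | .axe2 | .bang => true

/-- The transitions. -/
inductive Step : Label → State → State → Prop where
  | sea1 (C : Ctx) (a : ℕ) (v : Val) (x : Var) (t : Ctx) (P : Pool) :
      Step .sea1 ⟨C, (a, .cut v x t) :: P⟩ ⟨C.plug a (.cut v x (.hole a)), (a, t) :: P⟩
  | sea2 (C : Ctx) (a b : ℕ) (m : ℕ) (v : Val) (x : Var) (t : Ctx) (P : Pool)
      (hm : Var.m m ∉ C.dom) (hb : b ∉ State.names ⟨C, (a, .sub m v x t) :: P⟩) :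
      Step .sea2 ⟨C, (a, .sub m v x t) :: P⟩
        ⟨C.plug a (.sub m (.hole b) x (.hole a)), (b, .val v) :: (a, t) :: P⟩
  | sea3 (C : Ctx) (a : ℕ) (e : ℕ) (x : Var) (t : Ctx) (P : Pool) (he : Var.e e ∉ C.dom) :
      Step .sea3 ⟨C, (a, .der e x t) :: P⟩ ⟨C.plug a (.der e x (.hole a)), (a, t) :: P⟩
  | sea4 (C : Ctx) (a : ℕ) (x : Var) (t : Ctx) (P : Pool) :
      Step .sea4 ⟨C, (a, .val (.lam x t)) :: P⟩
        ⟨C.plug a (.val (.lam x (.hole a))), (a, t) :: P⟩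
  | sea5 (C : Ctx) (a : ℕ) (t : Ctx) (P : Pool) :
      Step .sea5 ⟨C, (a, .val (.bang t)) :: P⟩ ⟨C.plug a (.val (.bang (.hole a))), (a, t) :: P⟩
  | sea6 (C : Ctx) (a : ℕ) (x : Var) (P : Pool) (hx : x ∉ C.dom) :
      Step .sea6 ⟨C, (a, .val (.var x)) :: P⟩ ⟨C.plug a (.val (.var x)), P⟩
  | axm2 (C D : Ctx) (a : ℕ) (m n : ℕ) (v : Val) (x : Var) (t : Ctx) (P : Pool)
      (hC : CutIn C (.var (.m n)) (.m m) D) :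
      Step .axm2 ⟨C, (a, .sub m v x t) :: P⟩ ⟨D, (a, .sub n v x t) :: P⟩
  | lolli (C D : Ctx) (a : ℕ) (m : ℕ) (y : Var) (s : Ctx) (v : Val) (x : Var) (t : Ctx) (P : Pool)
      (hC : CutIn C (.lam y s) (.m m) D) :
      Step .lolli ⟨C, (a, .sub m v x t) :: P⟩
        ⟨D, (a, .cut v y (s.splice fun v' => .cut v' x t)) :: P⟩
  | axe2 (C D : Ctx) (a : ℕ) (e f : ℕ) (x : Var) (t : Ctx) (P : Pool)
      (hC : CutIn C (.var (.e f)) (.e e) D) :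
      Step .axe2 ⟨C, (a, .der e x t) :: P⟩ ⟨C, (a, .der f x t) :: P⟩
  | bang (C D : Ctx) (a : ℕ) (e : ℕ) (s s' : Ctx) (x : Var) (t : Ctx) (P : Pool)
      (hC : CutIn C (.bang s) (.e e) D)
      (hs : s.Renaming s' (State.vars ⟨C, (a, .der e x t) :: P⟩)) :
      Step .bang ⟨C, (a, .der e x t) :: P⟩ ⟨C, (a, s'.splice fun v' => .cut v' x t) :: P⟩
  | axm1 (C D : Ctx) (a : ℕ) (m : ℕ) (v : Val) (P : Pool) (hv : v.IsMul)
      (hC : CutIn C v (.m m) D) :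
      Step .axm1 ⟨C, (a, .val (.var (.m m))) :: P⟩ ⟨D, (a, .val v) :: P⟩
  | axe1 (C D : Ctx) (a : ℕ) (e : ℕ) (v v' : Val) (P : Pool) (hv : v.IsExp)
      (hC : CutIn C v (.e e) D)
      (hv' : (Ctx.val v).Renaming (.val v') (State.vars ⟨C, (a, .val (.var (.e e))) :: P⟩)) :
      Step .axe1 ⟨C, (a, .val (.var (.e e))) :: P⟩ ⟨C, (a, .val v') :: P⟩

/-- A run: `state 0 → state 1 → ⋯ → state length` (later entries are irrelevant). -/
structure Run : Type where
  length : ℕ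
  state : ℕ → State
  label : ℕ → Label
  step : ∀ i < length, Step (label i) (state i) (state (i + 1))

/-- The number of principal transitions of a run. -/
def Run.principal (r : Run) : ℕ :=
  ((Finset.range r.length).filter fun i => (r.label i).isPrincipal = true).card

/-- The number of search transitions of a run. -/
def Run.search (r : Run) : ℕ :=
  ((Finset.range r.length).filter fun i => (r.label i).isPrincipal = false).card

/-! ### Random access machines, with unit cost instructions -/

/-- Instructions, on registers `d`, `a`, `b`, constants `c` and program addresses `l`. -/
inductive Instr : Type where
  /-- `d := c` -/
  | const (d c : ℕ)
  /-- `d := a + b` -/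
  | add (d a b : ℕ)
  /-- `d := a - b`, truncated at zero -/
  | sub (d a b : ℕ)
  /-- `d := memory[a]` -/
  | load (d a : ℕ)
  /-- `memory[a] := b` -/
  | store (a b : ℕ)
  /-- if `a = 0` then continue at `l` -/
  | jz (a l : ℕ)

/-- A program is a finite list of instructions. -/
abbrev Program : Type := List Instr

/-- A configuration: program counter, registers, memory. -/
structure Config : Type where
  pc : ℕ
  reg : ℕ → ℕ
  mem : ℕ → ℕ

/-- Executing one instruction. -/
def Instr.exec (σ : Config) : Instr → Config
  | .const d c => ⟨σ.pc + 1, Function.update σ.reg d c, σ.mem⟩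
  | .add d a b => ⟨σ.pc + 1, Function.update σ.reg d (σ.reg a + σ.reg b), σ.mem⟩
  | .sub d a b => ⟨σ.pc + 1, Function.update σ.reg d (σ.reg a - σ.reg b), σ.mem⟩
  | .load d a => ⟨σ.pc + 1, Function.update σ.reg d (σ.mem (σ.reg a)), σ.mem⟩
  | .store a b => ⟨σ.pc + 1, σ.reg, Function.update σ.mem (σ.reg a) (σ.reg b)⟩
  | .jz a l => ⟨if σ.reg a = 0 then l else σ.pc + 1, σ.reg, σ.mem⟩

/-- One step of a program; nothing happens when the program counter is outside the program. -/
def Program.next (p : Program) (σ : Config) : Config :=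
  match p[σ.pc]? with
  | some i => i.exec σ
  | none => σ

/-- The configuration after `k` steps. -/
def Program.after (p : Program) (k : ℕ) (σ : Config) : Config := (p.next)^[k] σ

/-- The program has halted: its program counter is outside the program. -/
def Program.Halted (p : Program) (σ : Config) : Prop := p.length ≤ σ.pc

/-! ### The representation of states in memory

Memory is used in aligned blocks of eight cells. A variable `x` is a block, at address `ρ x`; a
variable occurrence is the address `ρ x`; a cut `[v→x]` is the fact that the block of `x` contains
`v`. A multi-context is stored in a memory cell `s`, its slot, which holds the address of the block
of its topmost constructor. A named hole `a` is a slot, at address `η a`, and a job of name `a` is a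
pointer to `η a` and expresses that the slot `η a` contains the term of the job. The cells of a
block that are not mentioned below are unconstrained. -/

mutual
/-- In the memory `M`, the given multi-context is stored in the slot `s`.

Layout of the block of a constructor: cell 0 is a tag, cell 1 refers to the bound (or, for a
variable, the occurring) variable, cell 2 is the slot of the value of a subtraction, cell 3 is the
slot of the body, cell 4 refers to the variable acted upon by a subtraction or a dereliction.
Layout of the block of a variable: cell 0 tells whether the variable is bound by a cut, cell 1
is in that case the slot of the cut value, cell 2 is the kind of the variable. -/
def Val.At (M : ℕ → ℕ) (ρ : Var → ℕ) (η : ℕ → ℕ) : Val → ℕ → Prop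
  | .hole a, s => η a = s
  | .var x, s => M (M s) = 1 ∧ M (M s + 1) = ρ x
  | .lam x C, s => M (M s) = 2 ∧ M (M s + 1) = ρ x ∧ M (ρ x) = 0 ∧ C.At M ρ η (M s + 3)
  | .bang C, s => M (M s) = 3 ∧ C.At M ρ η (M s + 3)
def Ctx.At (M : ℕ → ℕ) (ρ : Var → ℕ) (η : ℕ → ℕ) : Ctx → ℕ → Prop
  | .val v, s => v.At M ρ η s
  | .cut v x C, s => M (M s) = 4 ∧ M (M s + 1) = ρ x ∧ M (ρ x) = 1 ∧
      v.At M ρ η (ρ x + 1) ∧ C.At M ρ η (M s + 3)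
  | .sub m v x C, s => M (M s) = 5 ∧ M (M s + 1) = ρ x ∧ M (M s + 4) = ρ (.m m) ∧ M (ρ x) = 0 ∧
      v.At M ρ η (M s + 2) ∧ C.At M ρ η (M s + 3)
  | .der e x C, s => M (M s) = 6 ∧ M (M s + 1) = ρ x ∧ M (M s + 4) = ρ (.e e) ∧ M (ρ x) = 0 ∧
      C.At M ρ η (M s + 3)
end

mutual
/-- The blocks (of constructors and of bound variables) occupied by a multi-context stored in the
slot `s`. -/
def Val.blocks (M : ℕ → ℕ) (ρ : Var → ℕ) : Val → ℕ → List ℕ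
  | .hole _, _ => []
  | .var _, s => [M s]
  | .lam x C, s => M s :: ρ x :: C.blocks M ρ (M s + 3)
  | .bang C, s => M s :: C.blocks M ρ (M s + 3)
def Ctx.blocks (M : ℕ → ℕ) (ρ : Var → ℕ) : Ctx → ℕ → List ℕ
  | .val v, s => v.blocks M ρ s
  | .cut v x C, s => M s :: ρ x :: (v.blocks M ρ (ρ x + 1) ++ C.blocks M ρ (M s + 3))
  | .sub _ v x C, s => M s :: ρ x :: (v.blocks M ρ (M s + 2) ++ C.blocks M ρ (M s + 3))
  | .der _ x C, s => M s :: ρ x :: C.blocks M ρ (M s + 3)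
end

/-- The pool is stored as a linked list at `p`: the empty list is the null address, and a cell of
the list is a block with the address of the slot of a job and the address of the next cell. -/
def PoolAt (M : ℕ → ℕ) (ρ : Var → ℕ) (η : ℕ → ℕ) : Pool → ℕ → Prop
  | [], p => p = 0
  | (a, t) :: P, p => M p = η a ∧ t.At M ρ η (η a) ∧ PoolAt M ρ η P (M (p + 1))

/-- The blocks occupied by a pool stored at `p`. -/
def poolBlocks (M : ℕ → ℕ) (ρ : Var → ℕ) (η : ℕ → ℕ) : Pool → ℕ → List ℕ
  | [], _ => []
  | (a, t) :: P, p => p :: (t.blocks M ρ (η a) ++ poolBlocks M ρ η P (M (p + 1)))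

/-- The configuration `σ` represents the state `Q`, with `ρ x` the location of the variable `x`.
Register 0 is the slot of the multi-context, register 1 the pool, and register 2 the address from
which on the memory is unused. All occupied blocks are distinct: nothing but variables is shared. -/
def Represents (σ : Config) (ρ : Var → ℕ) (Q : State) : Prop :=
  ∃ η : ℕ → ℕ,
    Q.ctx.At σ.mem ρ η (σ.reg 0) ∧
    PoolAt σ.mem ρ η Q.pool (σ.reg 1) ∧
    (∀ x ∈ Q.free, σ.mem (ρ x) = 0) ∧
    (∀ x ∈ Q.vars, σ.mem (ρ x + 2) = x.kind) ∧
    (σ.reg 0 :: (Q.ctx.blocks σ.mem ρ (σ.reg 0) ++ poolBlocks σ.mem ρ η Q.pool (σ.reg 1) ++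
      Q.free.map ρ)).Nodup ∧
    (∀ b ∈ σ.reg 0 :: (Q.ctx.blocks σ.mem ρ (σ.reg 0) ++
      poolBlocks σ.mem ρ η Q.pool (σ.reg 1) ++ Q.free.map ρ),
      8 ∣ b ∧ 0 < b ∧ b < σ.reg 2) ∧
    8 ∣ σ.reg 2

/-- Started on `σ`, in which the location of a variable `x` is `ρ₀ x`, the program `p` implements
the run `r` of the initial term `t`, with cost constant `K`: the configurations reached at the
increasing times `τ 0 < τ 1 < ⋯` represent the successive states of `r`, with the free variables of
`t` kept at their locations; a search transition takes at most `K` steps, a principal one at most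
`K * |t|`; the whole run takes at most `K * (|t| * (|r|_pr + 1))` steps; and if the pool is empty in
the end then the program has halted. -/
def Implements (p : Program) (K : ℕ) (t : Ctx) (r : Run) (σ : Config) (ρ₀ : Var → ℕ) : Prop :=
  ∃ τ : ℕ → ℕ,
    (∀ i ≤ r.length, ∃ ρ : Var → ℕ, (∀ x ∈ t.fv, ρ x = ρ₀ x) ∧
      Represents (p.after (τ i) σ) ρ (r.state i)) ∧
    (∀ i < r.length, τ i < τ (i + 1) ∧
      τ (i + 1) ≤ τ i + if (r.label i).isPrincipal then K * t.size else K) ∧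
    τ r.length ≤ K * (t.size * (r.principal + 1)) ∧
    ((r.state r.length).pool = [] → p.Halted (p.after (τ r.length) σ))

end Sesame

namespace Sesame

/-! ### Free variables, holes and sizes -/

mutual
/-- Free variables of a multi-context whose hole `a` stands for a term with free variables `J a`. -/
def Val.FV (J : ℕ → Var → Prop) : Val → Var → Prop
  | .hole a, y => J a y
  | .var x, y => y = x
  | .lam x C, y => C.FV J y ∧ y ≠ x
  | .bang C, y => C.FV J y
def Ctx.FV (J : ℕ → Var → Prop) : Ctx → Var → Prop
  | .val v, y => v.FV J y
  | .cut v x C, y => v.FV J y ∨ (C.FV J y ∧ y ≠ x)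
  | .sub m v x C, y => y = .m m ∨ v.FV J y ∨ (C.FV J y ∧ y ≠ x)
  | .der e x C, y => y = .e e ∨ (C.FV J y ∧ y ≠ x)
end

mutual
theorem Val.FV_iff_of_term {J : ℕ → Var → Prop} {y : Var} :
    ∀ {v : Val}, v.holes = [] → (v.FV J y ↔ y ∈ v.fv)
  | .hole _, h => by simp [Val.holes] at h
  | .var _, _ => by simp [Val.FV, Val.fv]
  | .lam _ C, h => by
      simp [Val.FV, Val.fv, Ctx.FV_iff_of_term (v := C) (by simpa [Val.holes] using h)]
  | .bang C, h => by
      simp [Val.FV, Val.fv, Ctx.FV_iff_of_term (v := C) (by simpa [Val.holes] using h)]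
theorem Ctx.FV_iff_of_term {J : ℕ → Var → Prop} {y : Var} :
    ∀ {v : Ctx}, v.holes = [] → (v.FV J y ↔ y ∈ v.fv)
  | .val v, h => by simp [Ctx.FV, Ctx.fv, Val.FV_iff_of_term (v := v) h]
  | .cut v _ C, h => by
      simp only [Ctx.holes, List.append_eq_nil_iff] at h
      simp [Ctx.FV, Ctx.fv, Val.FV_iff_of_term (v := v) h.1, Ctx.FV_iff_of_term (v := C) h.2]
  | .sub _ v _ C, h => by
      simp only [Ctx.holes, List.append_eq_nil_iff] at h
      simp [Ctx.FV, Ctx.fv, Val.FV_iff_of_term (v := v) h.1, Ctx.FV_iff_of_term (v := C) h.2]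
  | .der _ _ C, h => by
      simp [Ctx.FV, Ctx.fv, Ctx.FV_iff_of_term (v := C) h]
end

mutual
theorem Val.FV_of_mem_fv {J : ℕ → Var → Prop} {y : Var} : ∀ {v : Val}, y ∈ v.fv → v.FV J y
  | .hole _, h => by simp [Val.fv] at h
  | .var _, h => by simpa [Val.FV, Val.fv] using h
  | .lam _ C, h => by
      simp [Val.fv] at h; exact ⟨Ctx.FV_of_mem_fv h.1, h.2⟩
  | .bang C, h => Ctx.FV_of_mem_fv (v := C) h
theorem Ctx.FV_of_mem_fv {J : ℕ → Var → Prop} {y : Var} : ∀ {v : Ctx}, y ∈ v.fv → v.FV J y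
  | .val v, h => Val.FV_of_mem_fv (v := v) h
  | .cut v _ C, h => by
      simp [Ctx.fv] at h
      exact h.imp Val.FV_of_mem_fv fun h => ⟨Ctx.FV_of_mem_fv h.1, h.2⟩
  | .sub _ v _ C, h => by
      simp [Ctx.fv] at h
      exact h.imp id (.imp Val.FV_of_mem_fv fun h => ⟨Ctx.FV_of_mem_fv h.1, h.2⟩)
  | .der _ _ C, h => by
      simp [Ctx.fv] at h
      exact h.imp id fun h => ⟨Ctx.FV_of_mem_fv h.1, h.2⟩
end

mutual
theorem Val.mem_vars_iff {y : Var} : ∀ {v : Val}, y ∈ v.vars ↔ y ∈ v.fv ∨ y ∈ v.bv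
  | .hole _ => by simp [Val.fv, Val.bv, Val.vars]
  | .var _ => by simp [Val.fv, Val.bv, Val.vars]
  | .lam x C => by
      simp [Val.fv, Val.bv, Val.vars, Ctx.mem_vars_iff (v := C)]; tauto
  | .bang C => by simp [Val.fv, Val.bv, Val.vars, Ctx.mem_vars_iff (v := C)]
theorem Ctx.mem_vars_iff {y : Var} : ∀ {v : Ctx}, y ∈ v.vars ↔ y ∈ v.fv ∨ y ∈ v.bv
  | .val v => by simp [Ctx.fv, Ctx.bv, Ctx.vars, Val.mem_vars_iff (v := v)]
  | .cut v _ C => by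
      simp [Ctx.fv, Ctx.bv, Ctx.vars, Val.mem_vars_iff (v := v), Ctx.mem_vars_iff (v := C)]; tauto
  | .sub _ v _ C => by
      simp [Ctx.fv, Ctx.bv, Ctx.vars, Val.mem_vars_iff (v := v), Ctx.mem_vars_iff (v := C)]; tauto
  | .der _ _ C => by
      simp [Ctx.fv, Ctx.bv, Ctx.vars, Ctx.mem_vars_iff (v := C)]; tauto
end

mutual
theorem Val.FV_or_bv {J : ℕ → Var → Prop} {y : Var} {a : ℕ} (hy : J a y) :
    ∀ {v : Val}, a ∈ v.holes → v.FV J y ∨ y ∈ v.bv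
  | .hole _, h => by simp [Val.holes] at h; subst h; exact .inl hy
  | .var _, h => by simp [Val.holes] at h
  | .lam x C, h => by
      have := Ctx.FV_or_bv hy (v := C) h
      simp only [Val.FV, Val.bv, List.mem_cons]; tauto
  | .bang C, h => Ctx.FV_or_bv hy (v := C) h
theorem Ctx.FV_or_bv {J : ℕ → Var → Prop} {y : Var} {a : ℕ} (hy : J a y) :
    ∀ {v : Ctx}, a ∈ v.holes → v.FV J y ∨ y ∈ v.bv
  | .val v, h => Val.FV_or_bv hy (v := v) h
  | .cut v _ C, h => by
      have h1 := Val.FV_or_bv hy (v := v)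
      have h2 := Ctx.FV_or_bv hy (v := C)
      simp only [Ctx.holes, Ctx.FV, Ctx.bv, List.mem_append, List.mem_cons] at *; tauto
  | .sub _ v _ C, h => by
      have h1 := Val.FV_or_bv hy (v := v)
      have h2 := Ctx.FV_or_bv hy (v := C)
      simp only [Ctx.holes, Ctx.FV, Ctx.bv, List.mem_append, List.mem_cons] at *; tauto
  | .der _ _ C, h => by
      have h2 := Ctx.FV_or_bv hy (v := C)
      simp only [Ctx.holes, Ctx.FV, Ctx.bv, List.mem_cons] at *; tauto
end

mutual
theorem Val.FV_mono {J J' : ℕ → Var → Prop} {S : Prop} {y : Var} :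
    ∀ {v : Val}, (∀ a ∈ v.holes, J a y → J' a y ∨ S) → v.FV J y → v.FV J' y ∨ S
  | .hole a, h, hy => h a (by simp [Val.holes]) hy
  | .var _, _, hy => .inl hy
  | .lam _ C, h, hy => (Ctx.FV_mono (v := C) h hy.1).imp (fun h => ⟨h, hy.2⟩) id
  | .bang C, h, hy => Ctx.FV_mono (v := C) h hy
theorem Ctx.FV_mono {J J' : ℕ → Var → Prop} {S : Prop} {y : Var} :
    ∀ {v : Ctx}, (∀ a ∈ v.holes, J a y → J' a y ∨ S) → v.FV J y → v.FV J' y ∨ S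
  | .val v, h, hy => Val.FV_mono (v := v) h hy
  | .cut v _ C, h, hy => by
      have h1 := Val.FV_mono (v := v) fun a ha => h a (by simp [Ctx.holes, ha])
      have h2 := Ctx.FV_mono (v := C) fun a ha => h a (by simp [Ctx.holes, ha])
      simp only [Ctx.FV] at *; tauto
  | .sub _ v _ C, h, hy => by
      have h1 := Val.FV_mono (v := v) fun a ha => h a (by simp [Ctx.holes, ha])
      have h2 := Ctx.FV_mono (v := C) fun a ha => h a (by simp [Ctx.holes, ha])
      simp only [Ctx.FV] at *; tauto
  | .der _ _ C, h, hy => by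
      have h2 := Ctx.FV_mono (v := C) fun a ha => h a (by simpa [Ctx.holes] using ha)
      simp only [Ctx.FV] at *; tauto
end

theorem Ctx.FV_congr {J J' : ℕ → Var → Prop} {y : Var} {C : Ctx}
    (h : ∀ a ∈ C.holes, J a y ↔ J' a y) : C.FV J y ↔ C.FV J' y :=
  ⟨fun hy => (Ctx.FV_mono (S := False) (fun a ha h1 => .inl ((h a ha).1 h1)) hy).elim id nofun,
   fun hy => (Ctx.FV_mono (S := False) (fun a ha h1 => .inl ((h a ha).2 h1)) hy).elim id nofun⟩

theorem Val.FV_congr {J J' : ℕ → Var → Prop} {y : Var} {C : Val}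
    (h : ∀ a ∈ C.holes, J a y ↔ J' a y) : C.FV J y ↔ C.FV J' y :=
  Ctx.FV_congr (C := .val C) h

/-! ### `α`-equivalence -/

mutual
theorem Val.Alpha.holes_eq : ∀ {l : List (Var × Var)} {v w : Val}, v.Alpha l w → v.holes = w.holes
  | _, .hole _, w, h => by cases w <;> simp_all [Val.Alpha, Val.holes]
  | _, .var _, w, h => by cases w <;> simp_all [Val.Alpha, Val.holes]
  | _, .lam _ C, w, h => by
      cases w <;> simp only [Val.Alpha] at h
      exact Ctx.Alpha.holes_eq (v := C) h.2
  | _, .bang C, w, h => by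
      cases w <;> simp only [Val.Alpha] at h
      exact Ctx.Alpha.holes_eq (v := C) h
theorem Ctx.Alpha.holes_eq : ∀ {l : List (Var × Var)} {v w : Ctx}, v.Alpha l w → v.holes = w.holes
  | _, .val v, w, h => by
      cases w <;> simp only [Ctx.Alpha] at h
      exact Val.Alpha.holes_eq (v := v) h
  | _, .cut v _ C, w, h => by
      cases w <;> simp only [Ctx.Alpha] at h
      simp [Ctx.holes, Val.Alpha.holes_eq (v := v) h.1, Ctx.Alpha.holes_eq (v := C) h.2.2]
  | _, .sub _ v _ C, w, h => by
      cases w <;> simp only [Ctx.Alpha] at h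
      simp [Ctx.holes, Val.Alpha.holes_eq (v := v) h.2.1, Ctx.Alpha.holes_eq (v := C) h.2.2.2]
  | _, .der _ _ C, w, h => by
      cases w <;> simp only [Ctx.Alpha] at h
      simp [Ctx.holes, Ctx.Alpha.holes_eq (v := C) h.2.2]
end

mutual
theorem Val.Alpha.size_eq : ∀ {l : List (Var × Var)} {v w : Val}, v.Alpha l w → v.size = w.size
  | _, .hole _, w, h => by cases w <;> simp_all [Val.Alpha, Val.size]
  | _, .var _, w, h => by cases w <;> simp_all [Val.Alpha, Val.size]
  | _, .lam _ C, w, h => by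
      cases w <;> simp only [Val.Alpha] at h
      simp [Val.size, Ctx.Alpha.size_eq (v := C) h.2]
  | _, .bang C, w, h => by
      cases w <;> simp only [Val.Alpha] at h
      simp [Val.size, Ctx.Alpha.size_eq (v := C) h]
theorem Ctx.Alpha.size_eq : ∀ {l : List (Var × Var)} {v w : Ctx}, v.Alpha l w → v.size = w.size
  | _, .val v, w, h => by
      cases w <;> simp only [Ctx.Alpha] at h
      exact Val.Alpha.size_eq (v := v) h
  | _, .cut v _ C, w, h => by
      cases w <;> simp only [Ctx.Alpha] at h
      simp [Ctx.size, Val.Alpha.size_eq (v := v) h.1, Ctx.Alpha.size_eq (v := C) h.2.2]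
  | _, .sub _ v _ C, w, h => by
      cases w <;> simp only [Ctx.Alpha] at h
      simp [Ctx.size, Val.Alpha.size_eq (v := v) h.2.1, Ctx.Alpha.size_eq (v := C) h.2.2.2]
  | _, .der _ _ C, w, h => by
      cases w <;> simp only [Ctx.Alpha] at h
      simp [Ctx.size, Ctx.Alpha.size_eq (v := C) h.2.2]
end

theorem AlphaVar.eq_of_nil {x y : Var} (h : AlphaVar [] x y) : x = y := h

theorem AlphaVar.cons_iff {l : List (Var × Var)} {a b x y : Var} :
    AlphaVar ((a, b) :: l) x y ↔ (x = a ∧ y = b) ∨ (x ≠ a ∧ y ≠ b ∧ AlphaVar l x y) := Iff.rfl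

mutual
/-- Free variables are in correspondence along `α`-equivalence. -/
theorem Val.Alpha.fv_left : ∀ {l : List (Var × Var)} {v w : Val}, v.Alpha l w →
    ∀ y ∈ v.fv, ∃ z ∈ w.fv, AlphaVar l y z
  | _, .hole _, w, h, y, hy => by simp [Val.fv] at hy
  | _, .var x, w, h, y, hy => by
      cases w <;> simp only [Val.Alpha] at h
      simp [Val.fv] at hy ⊢; subst hy; exact h
  | l, .lam x C, w, h, y, hy => by
      cases w <;> simp only [Val.Alpha] at h
      simp only [Val.fv, List.mem_filter, decide_eq_true_eq] at hy ⊢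
      obtain ⟨z, hz, hzz⟩ := Ctx.Alpha.fv_left h.2 y hy.1
      simp only [AlphaVar.cons_iff] at hzz
      exact ⟨z, by tauto, by tauto⟩
  | _, .bang C, w, h, y, hy => by
      cases w <;> simp only [Val.Alpha] at h
      exact Ctx.Alpha.fv_left h y hy
theorem Ctx.Alpha.fv_left : ∀ {l : List (Var × Var)} {v w : Ctx}, v.Alpha l w →
    ∀ y ∈ v.fv, ∃ z ∈ w.fv, AlphaVar l y z
  | _, .val v, w, h, y, hy => by
      cases w <;> simp only [Ctx.Alpha] at h
      exact Val.Alpha.fv_left h y hy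
  | _, .cut v x C, w, h, y, hy => by
      cases w <;> simp only [Ctx.Alpha] at h
      simp only [Ctx.fv, List.mem_append, List.mem_filter, decide_eq_true_eq] at hy ⊢
      rcases hy with hy | hy
      · obtain ⟨z, hz, hzz⟩ := Val.Alpha.fv_left h.1 y hy
        exact ⟨z, .inl hz, hzz⟩
      · obtain ⟨z, hz, hzz⟩ := Ctx.Alpha.fv_left h.2.2 y hy.1
        simp only [AlphaVar.cons_iff] at hzz
        exact ⟨z, by tauto, by tauto⟩
  | _, .sub m v x C, w, h, y, hy => by
      cases w with
      | sub n w x' C' =>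
        simp only [Ctx.Alpha] at h
        simp only [Ctx.fv, List.mem_cons, List.mem_append, List.mem_filter,
          decide_eq_true_eq] at hy ⊢
        rcases hy with rfl | hy | hy
        · exact ⟨.m n, .inl rfl, h.1⟩
        · obtain ⟨z, hz, hzz⟩ := Val.Alpha.fv_left h.2.1 y hy
          exact ⟨z, .inr (.inl hz), hzz⟩
        · obtain ⟨z, hz, hzz⟩ := Ctx.Alpha.fv_left h.2.2.2 y hy.1
          simp only [AlphaVar.cons_iff] at hzz
          exact ⟨z, by tauto, by tauto⟩
      | _ => simp only [Ctx.Alpha] at h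
  | _, .der e x C, w, h, y, hy => by
      cases w with
      | der f x' C' =>
        simp only [Ctx.Alpha] at h
        simp only [Ctx.fv, List.mem_cons, List.mem_filter, decide_eq_true_eq] at hy ⊢
        rcases hy with rfl | hy
        · exact ⟨.e f, .inl rfl, h.1⟩
        · obtain ⟨z, hz, hzz⟩ := Ctx.Alpha.fv_left h.2.2 y hy.1
          simp only [AlphaVar.cons_iff] at hzz
          exact ⟨z, by tauto, by tauto⟩
      | _ => simp only [Ctx.Alpha] at h
end

mutual
theorem Val.Alpha.fv_right : ∀ {l : List (Var × Var)} {v w : Val}, v.Alpha l w →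
    ∀ z ∈ w.fv, ∃ y ∈ v.fv, AlphaVar l y z
  | _, .hole _, w, h, z, hz => by cases w <;> simp_all [Val.Alpha, Val.fv]
  | _, .var x, w, h, z, hz => by
      cases w <;> simp only [Val.Alpha] at h
      simp [Val.fv] at hz ⊢; subst hz; exact h
  | l, .lam x C, w, h, z, hz => by
      cases w <;> simp only [Val.Alpha] at h
      simp only [Val.fv, List.mem_filter, decide_eq_true_eq] at hz ⊢
      obtain ⟨y, hy, hzz⟩ := Ctx.Alpha.fv_right h.2 z hz.1
      simp only [AlphaVar.cons_iff] at hzz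
      exact ⟨y, by tauto, by tauto⟩
  | _, .bang C, w, h, z, hz => by
      cases w <;> simp only [Val.Alpha] at h
      exact Ctx.Alpha.fv_right h z hz
theorem Ctx.Alpha.fv_right : ∀ {l : List (Var × Var)} {v w : Ctx}, v.Alpha l w →
    ∀ z ∈ w.fv, ∃ y ∈ v.fv, AlphaVar l y z
  | _, .val v, w, h, z, hz => by
      cases w <;> simp only [Ctx.Alpha] at h
      exact Val.Alpha.fv_right h z hz
  | _, .cut v x C, w, h, z, hz => by
      cases w <;> simp only [Ctx.Alpha] at h
      simp only [Ctx.fv, List.mem_append, List.mem_filter, decide_eq_true_eq] at hz ⊢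
      rcases hz with hz | hz
      · obtain ⟨y, hy, hzz⟩ := Val.Alpha.fv_right h.1 z hz
        exact ⟨y, .inl hy, hzz⟩
      · obtain ⟨y, hy, hzz⟩ := Ctx.Alpha.fv_right h.2.2 z hz.1
        simp only [AlphaVar.cons_iff] at hzz
        exact ⟨y, by tauto, by tauto⟩
  | _, .sub m v x C, w, h, z, hz => by
      cases w with
      | sub n w x' C' =>
        simp only [Ctx.Alpha] at h
        simp only [Ctx.fv, List.mem_cons, List.mem_append, List.mem_filter,
          decide_eq_true_eq] at hz ⊢
        rcases hz with rfl | hz | hz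
        · exact ⟨.m m, .inl rfl, h.1⟩
        · obtain ⟨y, hy, hzz⟩ := Val.Alpha.fv_right h.2.1 z hz
          exact ⟨y, .inr (.inl hy), hzz⟩
        · obtain ⟨y, hy, hzz⟩ := Ctx.Alpha.fv_right h.2.2.2 z hz.1
          simp only [AlphaVar.cons_iff] at hzz
          exact ⟨y, by tauto, by tauto⟩
      | _ => simp only [Ctx.Alpha] at h
  | _, .der e x C, w, h, z, hz => by
      cases w with
      | der f x' C' =>
        simp only [Ctx.Alpha] at h
        simp only [Ctx.fv, List.mem_cons, List.mem_filter, decide_eq_true_eq] at hz ⊢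
        rcases hz with rfl | hz
        · exact ⟨.e e, .inl rfl, h.1⟩
        · obtain ⟨y, hy, hzz⟩ := Ctx.Alpha.fv_right h.2.2 z hz.1
          simp only [AlphaVar.cons_iff] at hzz
          exact ⟨y, by tauto, by tauto⟩
      | _ => simp only [Ctx.Alpha] at h
end

theorem Ctx.Alpha.mem_fv_iff {t t' : Ctx} (h : t.Alpha [] t') (y : Var) : y ∈ t.fv ↔ y ∈ t'.fv := by
  constructor
  · intro hy
    obtain ⟨z, hz, e⟩ := h.fv_left y hy
    rwa [e.eq_of_nil]
  · intro hy
    obtain ⟨z, hz, e⟩ := h.fv_right y hy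
    rwa [← e.eq_of_nil]

/-! ### Splicing and sizes -/

/-- The values on the spine of a multi-context have size at most `N`. -/
def Ctx.Bdd (N : ℕ) : Ctx → Prop
  | .val v => v.size ≤ N
  | .cut v _ C => v.size ≤ N ∧ C.Bdd N
  | .sub _ v _ C => v.size ≤ N ∧ C.Bdd N
  | .der _ _ C => C.Bdd N

theorem Ctx.Bdd.of_size_le {N : ℕ} : ∀ {C : Ctx}, C.size ≤ N → C.Bdd N
  | .val _, h => h
  | .cut _ _ C, h => by
      simp only [Ctx.size] at h; exact ⟨by omega, of_size_le (C := C) (by omega)⟩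
  | .sub _ _ _ C, h => by
      simp only [Ctx.size] at h; exact ⟨by omega, of_size_le (C := C) (by omega)⟩
  | .der _ _ C, h => by
      simp only [Ctx.size] at h; exact of_size_le (C := C) (by omega)

section Splice

variable {x : Var} {t : Ctx}

theorem Ctx.Bdd.splice {N : ℕ} (ht : t.Bdd N) : ∀ {C : Ctx}, C.Bdd N →
    (C.splice fun v => .cut v x t).Bdd N
  | .val _, h => ⟨h, ht⟩
  | .cut _ _ _, h => ⟨h.1, splice ht h.2⟩
  | .sub _ _ _ _, h => ⟨h.1, splice ht h.2⟩
  | .der _ _ C, h => splice ht (C := C) h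

theorem Ctx.splice_holes : ∀ {C : Ctx}, (C.splice fun v => .cut v x t).holes = C.holes ++ t.holes
  | .val _ => by simp [Ctx.splice, Ctx.holes]
  | .cut _ _ C => by simp [Ctx.splice, Ctx.holes, Ctx.splice_holes (C := C)]
  | .sub _ _ _ C => by simp [Ctx.splice, Ctx.holes, Ctx.splice_holes (C := C)]
  | .der _ _ C => by simp [Ctx.splice, Ctx.holes, Ctx.splice_holes (C := C)]

theorem Ctx.splice_size :
    ∀ {C : Ctx}, (C.splice fun v => .cut v x t).size = C.size + t.size + 1
  | .val _ => by simp [Ctx.splice, Ctx.size]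
  | .cut _ _ C => by simp [Ctx.splice, Ctx.size, Ctx.splice_size (C := C)]; omega
  | .sub _ _ _ C => by simp [Ctx.splice, Ctx.size, Ctx.splice_size (C := C)]; omega
  | .der _ _ C => by simp [Ctx.splice, Ctx.size, Ctx.splice_size (C := C)]; omega

theorem Ctx.splice_count_bv (y : Var) : ∀ {C : Ctx}, (C.splice fun v => .cut v x t).bv.count y =
    C.bv.count y + (x :: t.bv).count y
  | .val _ => by simp [Ctx.splice, Ctx.bv, List.count_cons]; omega
  | .cut _ _ C => by
      simp [Ctx.splice, Ctx.bv, Ctx.splice_count_bv y (C := C), List.count_cons]; omega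
  | .sub _ _ _ C => by
      simp [Ctx.splice, Ctx.bv, Ctx.splice_count_bv y (C := C), List.count_cons]; omega
  | .der _ _ C => by
      simp [Ctx.splice, Ctx.bv, Ctx.splice_count_bv y (C := C), List.count_cons]; omega

theorem Ctx.splice_mem_bv {y : Var} {C : Ctx} : y ∈ (C.splice fun v => .cut v x t).bv ↔
    y ∈ C.bv ∨ y = x ∨ y ∈ t.bv := by
  have := Ctx.splice_count_bv (x := x) (t := t) y (C := C)
  rw [← List.count_pos_iff, this, ← List.mem_cons, ← List.count_pos_iff (l := C.bv),
    ← List.count_pos_iff (l := x :: t.bv)]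
  omega

theorem Ctx.splice_mem_vars {y : Var} : ∀ {C : Ctx}, y ∈ (C.splice fun v => .cut v x t).vars ↔
    y ∈ C.vars ∨ y = x ∨ y ∈ t.vars
  | .val _ => by simp [Ctx.splice, Ctx.vars]; tauto
  | .cut _ _ C => by simp [Ctx.splice, Ctx.vars, Ctx.splice_mem_vars (C := C)]; tauto
  | .sub _ _ _ C => by simp [Ctx.splice, Ctx.vars, Ctx.splice_mem_vars (C := C)]; tauto
  | .der _ _ C => by simp [Ctx.splice, Ctx.vars, Ctx.splice_mem_vars (C := C)]; tauto

theorem Ctx.splice_fv_subset {y : Var} : ∀ {C : Ctx}, y ∈ (C.splice fun v => .cut v x t).fv →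
    y ∈ C.fv ∨ (y ∈ t.fv ∧ y ≠ x)
  | .val _ => by simp [Ctx.splice, Ctx.fv]
  | .cut _ _ C => by
      have := Ctx.splice_fv_subset (C := C) (y := y)
      simp [Ctx.splice, Ctx.fv]; tauto
  | .sub _ _ _ C => by
      have := Ctx.splice_fv_subset (C := C) (y := y)
      simp [Ctx.splice, Ctx.fv]; tauto
  | .der _ _ C => by
      have := Ctx.splice_fv_subset (C := C) (y := y)
      simp [Ctx.splice, Ctx.fv]; tauto

end Splice

end Sesame
namespace Sesame

/-! ### Plugging a job in its hole -/

mutual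
/-- The invariant on multi-contexts: cut values are terms of size at most `N`, and the holes on the
left of a subtraction satisfy `G`. The flag `top` tells that a value is not the left sub-term of a
subtraction. -/
def Val.Shape (N : ℕ) (G : ℕ → Prop) : Val → Prop → Prop
  | .hole a, top => top ∨ G a
  | .var _, _ => True
  | .lam _ C, _ => C.Shape N G
  | .bang C, _ => C.Shape N G
def Ctx.Shape (N : ℕ) (G : ℕ → Prop) : Ctx → Prop
  | .val v => v.Shape N G True
  | .cut v _ C => v.holes = [] ∧ v.size ≤ N ∧ C.Shape N G
  | .sub _ v _ C => v.Shape N G False ∧ C.Shape N G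
  | .der _ _ C => C.Shape N G
end

mutual
theorem Val.Shape.mono {N : ℕ} {G G' : ℕ → Prop} : ∀ {v : Val} {top : Prop},
    (∀ a ∈ v.holes, G a → G' a) → v.Shape N G top → v.Shape N G' top
  | .hole a, _, h, hv => hv.imp id (h a (by simp [Val.holes]))
  | .var _, _, _, _ => trivial
  | .lam _ C, _, h, hv => Ctx.Shape.mono (C := C) h hv
  | .bang C, _, h, hv => Ctx.Shape.mono (C := C) h hv
theorem Ctx.Shape.mono {N : ℕ} {G G' : ℕ → Prop} : ∀ {C : Ctx},
    (∀ a ∈ C.holes, G a → G' a) → C.Shape N G → C.Shape N G'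
  | .val v, h, hv => Val.Shape.mono (v := v) h hv
  | .cut v _ C, h, hv => ⟨hv.1, hv.2.1,
      Ctx.Shape.mono (C := C) (fun a ha => h a (by simp [Ctx.holes, ha])) hv.2.2⟩
  | .sub _ v _ C, h, hv => ⟨Val.Shape.mono (v := v) (fun a ha => h a (by simp [Ctx.holes, ha])) hv.1,
      Ctx.Shape.mono (C := C) (fun a ha => h a (by simp [Ctx.holes, ha])) hv.2⟩
  | .der _ _ C, h, hv => Ctx.Shape.mono (C := C) (fun a ha => h a (by simpa [Ctx.holes] using ha)) hv
end

mutual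
theorem Val.plug_of_not_mem {a : ℕ} {D : Ctx} :
    ∀ {v : Val}, a ∉ v.holes → v.plug a D = .val v
  | .hole b, h => by simp [Val.holes] at h; simp [Val.plug, Ne.symm h]
  | .var _, _ => rfl
  | .lam _ C, h => by simp [Val.plug, Ctx.plug_of_not_mem (C := C) h]
  | .bang C, h => by simp [Val.plug, Ctx.plug_of_not_mem (C := C) h]
theorem Ctx.plug_of_not_mem {a : ℕ} {D : Ctx} : ∀ {C : Ctx}, a ∉ C.holes → C.plug a D = C
  | .val v, h => by simpa [Ctx.plug] using Val.plug_of_not_mem (v := v) h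
  | .cut v _ C, h => by
      simp [Ctx.holes] at h
      simp [Ctx.plug, Ctx.splice, Val.plug_of_not_mem (v := v) h.1, Ctx.plug_of_not_mem (C := C) h.2]
  | .sub _ v _ C, h => by
      simp [Ctx.holes] at h
      simp [Ctx.plug, Ctx.splice, Val.plug_of_not_mem (v := v) h.1, Ctx.plug_of_not_mem (C := C) h.2]
  | .der _ _ C, h => by
      simp [Ctx.plug, Ctx.plug_of_not_mem (C := C) h]
end

/-- `Plug a D C R`: the hole `a` occurs exactly once in `C`, not in a cut value, and `R` is `C` with
that hole replaced by `D`, which is a value if the hole is the left sub-term of a subtraction. -/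
inductive Plug (a : ℕ) (D : Ctx) : Ctx → Ctx → Prop where
  | top : Plug a D (.val (.hole a)) D
  | lam {C R : Ctx} (x : Var) : Plug a D C R → Plug a D (.val (.lam x C)) (.val (.lam x R))
  | bang {C R : Ctx} : Plug a D C R → Plug a D (.val (.bang C)) (.val (.bang R))
  | cut {C R : Ctx} (v : Val) (x : Var) : v.holes = [] → Plug a D C R →
      Plug a D (.cut v x C) (.cut v x R)
  | sub {C R : Ctx} (m : ℕ) (v : Val) (x : Var) : a ∉ v.holes → Plug a D C R →
      Plug a D (.sub m v x C) (.sub m v x R)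
  | subHole {w : Val} (m : ℕ) (x : Var) (C : Ctx) : a ∉ C.holes → (∀ b, w ≠ .hole b) →
      D = .val w → Plug a D (.sub m (.hole a) x C) (.sub m w x C)
  | subLam {C R : Ctx} (m : ℕ) (y : Var) (x : Var) (E : Ctx) : a ∉ E.holes → Plug a D C R →
      Plug a D (.sub m (.lam y C) x E) (.sub m (.lam y R) x E)
  | subBang {C R : Ctx} (m : ℕ) (x : Var) (E : Ctx) : a ∉ E.holes → Plug a D C R →
      Plug a D (.sub m (.bang C) x E) (.sub m (.bang R) x E)
  | der {C R : Ctx} (e : ℕ) (x : Var) : Plug a D C R → Plug a D (.der e x C) (.der e x R)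

theorem Ctx.plug_spec {N : ℕ} {G : ℕ → Prop} {a : ℕ} {D : Ctx}
    (hD : G a → ∃ w, (∀ b, w ≠ .hole b) ∧ D = .val w) :
    ∀ {C : Ctx}, C.Shape N G → C.holes.count a = 1 → Plug a D C (C.plug a D)
  | .val (.hole b), _, h => by
      simp [Ctx.holes, Val.holes, List.count_singleton] at h; subst h
      simpa [Ctx.plug, Val.plug] using Plug.top
  | .val (.var _), _, h => by simp [Ctx.holes, Val.holes] at h
  | .val (.lam _ C), hs, h => .lam _ (plug_spec hD (C := C) hs h)
  | .val (.bang C), hs, h => .bang (plug_spec hD (C := C) hs h)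
  | .der _ _ C, hs, h => .der _ _ (plug_spec hD (C := C) hs h)
  | .cut v x C, hs, h => by
      have hv : a ∉ v.holes := by simp [hs.1]
      simp only [Ctx.plug, Val.plug_of_not_mem hv, Ctx.splice]
      simp only [Ctx.holes, hs.1, List.nil_append] at h
      exact .cut _ _ hs.1 (plug_spec hD hs.2.2 h)
  | .sub m v x C, hs, h => by
      simp only [Ctx.holes, List.count_append] at h
      by_cases hv : a ∈ v.holes
      · have hC : a ∉ C.holes := by
          have := List.count_pos_iff.2 hv
          exact List.count_eq_zero.1 (by omega)
        rw [List.count_eq_zero.2 hC] at h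
        simp only [Ctx.plug, Ctx.plug_of_not_mem hC]
        match v with
        | .hole b =>
          simp [Val.holes] at hv; subst hv
          obtain ⟨w, hw, rfl⟩ := hD (by simpa [Ctx.Shape, Val.Shape] using hs.1)
          simpa [Val.plug, Ctx.splice] using Plug.subHole m x C hC hw rfl
        | .var _ => simp [Val.holes] at hv
        | .lam _ E => exact .subLam _ _ _ _ hC (plug_spec hD (C := E) hs.1 h)
        | .bang E => exact .subBang _ _ _ hC (plug_spec hD (C := E) hs.1 h)
      · rw [List.count_eq_zero.2 hv] at h
        simp only [Ctx.plug, Val.plug_of_not_mem hv, Ctx.splice]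
        exact .sub _ _ _ hv (plug_spec hD hs.2 (by omega))

namespace Plug

variable {a : ℕ} {D C R : Ctx}

theorem holes (h : Plug a D C R) :
    ∃ l l', C.holes = l ++ a :: l' ∧ R.holes = l ++ D.holes ++ l' := by
  induction h with
  | top => exact ⟨[], [], by simp [Ctx.holes, Val.holes]⟩
  | lam _ _ ih | bang _ ih | der _ _ _ ih => simpa [Ctx.holes, Val.holes] using ih
  | cut v x hv _ ih => simpa [Ctx.holes, hv] using ih
  | @sub C R m v x hv _ ih =>
    obtain ⟨l, l', h1, h2⟩ := ih
    exact ⟨v.holes ++ l, l', by simp [Ctx.holes, h1], by simp [Ctx.holes, h2]⟩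
  | subHole m x C hC hw hD => exact ⟨[], C.holes, by simp [Ctx.holes, Val.holes, hD]⟩
  | subLam m y x E hE _ ih | subBang m x E hE _ ih =>
    obtain ⟨l, l', h1, h2⟩ := ih
    exact ⟨l, l' ++ E.holes, by simp [Ctx.holes, Val.holes, h1], by simp [Ctx.holes, Val.holes, h2]⟩

theorem count_bv (h : Plug a D C R) (y : Var) : R.bv.count y = C.bv.count y + D.bv.count y := by
  induction h with
  | top => simp [Ctx.bv, Val.bv]
  | subHole m x C hC hw hD =>
    simp [Ctx.bv, Val.bv, List.count_cons, hD]; omega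
  | _ => simp_all [Ctx.bv, Val.bv, List.count_cons]; try omega

theorem mem_bv (h : Plug a D C R) (y : Var) : y ∈ R.bv ↔ y ∈ C.bv ∨ y ∈ D.bv := by
  have := h.count_bv y
  rw [← List.count_pos_iff, this, ← List.count_pos_iff (l := C.bv),
    ← List.count_pos_iff (l := D.bv)]
  omega

theorem mem_vars (h : Plug a D C R) (y : Var) : y ∈ R.vars ↔ y ∈ C.vars ∨ y ∈ D.vars := by
  induction h with
  | top => simp [Ctx.vars, Val.vars]
  | subHole m x C hC hw hD => simp [Ctx.vars, Val.vars, hD]; tauto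
  | _ => simp_all [Ctx.vars, Val.vars]; try tauto

theorem fv (h : Plug a D C R) {J J' : ℕ → Var → Prop} {y : Var} (ha : D.FV J' y ↔ J a y)
    (hJ : ∀ b ∈ C.holes, b ≠ a → (J' b y ↔ J b y)) : R.FV J' y ↔ C.FV J y := by
  induction h with
  | top => exact ha
  | lam x _ ih => simp only [Ctx.FV, Val.FV]; rw [ih hJ]
  | bang _ ih => simp only [Ctx.FV, Val.FV]; rw [ih hJ]
  | der _ _ _ ih => simp only [Ctx.FV]; rw [ih hJ]
  | cut v x hv _ ih =>
    simp only [Ctx.FV]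
    rw [ih fun b hb => hJ b (by simp [Ctx.holes, hb]), Val.FV_congr (J' := J) (by simp [hv])]
  | sub m v x hv _ ih =>
    simp only [Ctx.FV]
    rw [ih fun b hb => hJ b (by simp [Ctx.holes, hb]), Val.FV_congr fun b hb =>
      hJ b (by simp [Ctx.holes, hb]) fun e => hv (e ▸ hb)]
  | subHole m x C hC hw hD =>
    subst hD
    simp only [Ctx.FV, Val.FV] at ha ⊢
    rw [ha, Ctx.FV_congr fun b hb => hJ b (by simp [Ctx.holes, hb]) fun e => hC (e ▸ hb)]
  | subLam m z x E hE _ ih | subBang m x E hE _ ih =>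
    simp only [Ctx.FV, Val.FV]
    rw [ih fun b hb => hJ b (by simp [Ctx.holes, Val.holes, hb]), Ctx.FV_congr (C := E) fun b hb =>
      hJ b (by simp [Ctx.holes, hb]) fun e => hE (e ▸ hb)]

theorem shape (h : Plug a D C R) {N : ℕ} {G G' : ℕ → Prop} (hC : C.Shape N G) (hD : D.Shape N G')
    (hG : ∀ b ∈ C.holes, b ≠ a → G b → G' b) : R.Shape N G' := by
  induction h with
  | top => exact hD
  | lam x _ ih => exact ih hC hG
  | bang _ ih => exact ih hC hG
  | der _ _ _ ih => exact ih hC hG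
  | cut v x hv _ ih =>
    exact ⟨hC.1, hC.2.1, ih hC.2.2 fun b hb => hG b (by simp [Ctx.holes, hb])⟩
  | sub m v x hv _ ih =>
    exact ⟨hC.1.mono fun b hb => hG b (by simp [Ctx.holes, hb]) fun e => hv (e ▸ hb),
      ih hC.2 fun b hb => hG b (by simp [Ctx.holes, hb])⟩
  | @subHole w m x C h1 hw h2 =>
    subst h2
    refine ⟨?_, hC.2.mono fun b hb => hG b (by simp [Ctx.holes, hb]) fun e => h1 (e ▸ hb)⟩
    match w with
    | .hole b => exact absurd rfl (hw b)
    | .var _ | .lam _ _ | .bang _ => exact hD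
  | subLam m z x E hE _ ih | subBang m x E hE _ ih =>
    exact ⟨ih hC.1 fun b hb => hG b (by simp [Ctx.holes, Val.holes, hb]),
      hC.2.mono fun b hb => hG b (by simp [Ctx.holes, hb]) fun e => hE (e ▸ hb)⟩

end Plug

/-! ### Removing a cut -/

/-- `D` is `C` with a cut `[v→x]` removed, wherever this cut is. -/
inductive CutAt (v : Val) (x : Var) : Ctx → Ctx → Prop where
  | here (C : Ctx) : CutAt v x (.cut v x C) C
  | lam {C D : Ctx} (y : Var) : CutAt v x C D → CutAt v x (.val (.lam y C)) (.val (.lam y D))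
  | bang {C D : Ctx} : CutAt v x C D → CutAt v x (.val (.bang C)) (.val (.bang D))
  | cut {C D : Ctx} (w : Val) (y : Var) : CutAt v x C D → CutAt v x (.cut w y C) (.cut w y D)
  | cutLam {C D : Ctx} (z y : Var) (E : Ctx) : CutAt v x C D →
      CutAt v x (.cut (.lam z C) y E) (.cut (.lam z D) y E)
  | cutBang {C D : Ctx} (y : Var) (E : Ctx) : CutAt v x C D →
      CutAt v x (.cut (.bang C) y E) (.cut (.bang D) y E)
  | sub {C D : Ctx} (m : ℕ) (w : Val) (y : Var) : CutAt v x C D →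
      CutAt v x (.sub m w y C) (.sub m w y D)
  | subLam {C D : Ctx} (m : ℕ) (z y : Var) (E : Ctx) : CutAt v x C D →
      CutAt v x (.sub m (.lam z C) y E) (.sub m (.lam z D) y E)
  | subBang {C D : Ctx} (m : ℕ) (y : Var) (E : Ctx) : CutAt v x C D →
      CutAt v x (.sub m (.bang C) y E) (.sub m (.bang D) y E)
  | der {C D : Ctx} (e : ℕ) (y : Var) : CutAt v x C D → CutAt v x (.der e y C) (.der e y D)

theorem CutAt.mem_bv {v : Val} {x : Var} {C D : Ctx} (h : CutAt v x C D) : x ∈ C.bv := by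
  induction h <;> simp_all [Ctx.bv, Val.bv]

theorem Ctx.cutAt_plug {v : Val} {x : Var} {o : ℕ} {C' : Ctx} : ∀ {E : Ctx}, E.holes.count o = 1 →
    CutAt v x (E.plug o (.cut v x C')) (E.plug o C')
  | .val (.hole b), h => by
      simp [Ctx.holes, Val.holes, List.count_singleton] at h; subst h
      simpa [Ctx.plug, Val.plug] using CutAt.here C'
  | .val (.var _), h => by simp [Ctx.holes, Val.holes] at h
  | .val (.lam _ C), h => .lam _ (cutAt_plug (E := C) h)
  | .val (.bang C), h => .bang (cutAt_plug (E := C) h)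
  | .der _ _ C, h => .der _ _ (cutAt_plug (E := C) h)
  | .cut w y E, h => by
      simp only [Ctx.holes, List.count_append] at h
      by_cases hw : o ∈ w.holes
      · have hE : o ∉ E.holes := by
          have := List.count_pos_iff.2 hw
          exact List.count_eq_zero.1 (by omega)
        rw [List.count_eq_zero.2 hE] at h
        simp only [Ctx.plug, Ctx.plug_of_not_mem hE]
        match w with
        | .hole b =>
          simp [Val.holes] at hw; subst hw
          simpa [Val.plug, Ctx.splice] using CutAt.here _
        | .var _ => simp [Val.holes] at hw
        | .lam _ C => exact .cutLam _ _ _ (cutAt_plug (E := C) h)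
        | .bang C => exact .cutBang _ _ (cutAt_plug (E := C) h)
      · rw [List.count_eq_zero.2 hw] at h
        simp only [Ctx.plug, Val.plug_of_not_mem hw, Ctx.splice]
        exact .cut _ _ (cutAt_plug (by omega))
  | .sub m w y E, h => by
      simp only [Ctx.holes, List.count_append] at h
      by_cases hw : o ∈ w.holes
      · have hE : o ∉ E.holes := by
          have := List.count_pos_iff.2 hw
          exact List.count_eq_zero.1 (by omega)
        rw [List.count_eq_zero.2 hE] at h
        simp only [Ctx.plug, Ctx.plug_of_not_mem hE]
        match w with
        | .hole b =>
          simp [Val.holes] at hw; subst hw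
          simpa [Val.plug, Ctx.splice] using CutAt.here _
        | .var _ => simp [Val.holes] at hw
        | .lam _ C => exact .subLam _ _ _ _ (cutAt_plug (E := C) h)
        | .bang C => exact .subBang _ _ _ (cutAt_plug (E := C) h)
      · rw [List.count_eq_zero.2 hw] at h
        simp only [Ctx.plug, Val.plug_of_not_mem hw, Ctx.splice]
        exact .sub _ _ _ (cutAt_plug (by omega))

theorem CutIn.cutAt {v : Val} {x : Var} {C D : Ctx} (h : CutIn C v x D) : CutAt v x C D := by
  obtain ⟨_, E, o, C', hE, rfl, rfl⟩ := h
  exact Ctx.cutAt_plug hE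

/-- `D` is `C` with a cut `[v→x]B` replaced by `B`, where this cut is not inside a cut value and
the hole `a` occurs in `B`. -/
inductive Spine (v : Val) (x : Var) (a : ℕ) (B : Ctx) : Ctx → Ctx → Prop where
  | here : a ∈ B.holes → v.holes = [] → Spine v x a B (.cut v x B) B
  | lam {C D : Ctx} (y : Var) : Spine v x a B C D →
      Spine v x a B (.val (.lam y C)) (.val (.lam y D))
  | bang {C D : Ctx} : Spine v x a B C D → Spine v x a B (.val (.bang C)) (.val (.bang D))
  | cut {C D : Ctx} (w : Val) (y : Var) : x ≠ y → w.holes = [] → Spine v x a B C D →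
      Spine v x a B (.cut w y C) (.cut w y D)
  | sub {C D : Ctx} (m : ℕ) (w : Val) (y : Var) : Spine v x a B C D →
      Spine v x a B (.sub m w y C) (.sub m w y D)
  | subLam {C D : Ctx} (m : ℕ) (z y : Var) (E : Ctx) : Spine v x a B C D →
      Spine v x a B (.sub m (.lam z C) y E) (.sub m (.lam z D) y E)
  | subBang {C D : Ctx} (m : ℕ) (y : Var) (E : Ctx) : Spine v x a B C D →
      Spine v x a B (.sub m (.bang C) y E) (.sub m (.bang D) y E)
  | der {C D : Ctx} (e : ℕ) (y : Var) : Spine v x a B C D →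
      Spine v x a B (.der e y C) (.der e y D)

theorem CutAt.spine {v : Val} {x : Var} {C D : Ctx} (h : CutAt v x C D) {N : ℕ} {G : ℕ → Prop}
    {J : ℕ → Var → Prop} {a : ℕ} (hJ : J a x) (hs : C.Shape N G) (ha : a ∈ C.holes)
    (hx : ¬ C.FV J x) (hn : C.bv.Nodup) : ∃ B, Spine v x a B C D := by
  induction h with
  | here C => exact ⟨C, .here (by simpa [Ctx.holes, hs.1] using ha) hs.1⟩
  | lam y h ih =>
    simp only [Ctx.bv, Val.bv, List.nodup_cons] at hn
    obtain ⟨B, hB⟩ := ih hs ha (fun h' => hx ⟨h', fun e => hn.1 (e ▸ h.mem_bv)⟩) hn.2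
    exact ⟨B, .lam _ hB⟩
  | bang h ih =>
    obtain ⟨B, hB⟩ := ih hs ha hx hn
    exact ⟨B, .bang hB⟩
  | der e y h ih =>
    simp only [Ctx.bv, List.nodup_cons] at hn
    obtain ⟨B, hB⟩ := ih hs ha (fun h' => hx (.inr ⟨h', fun e => hn.1 (e ▸ h.mem_bv)⟩)) hn.2
    exact ⟨B, .der _ _ hB⟩
  | cut w y h ih =>
    simp only [Ctx.bv, List.nodup_cons, List.mem_append, not_or, List.nodup_append'] at hn
    have hxy : x ≠ y := fun e => hn.1.2 (e ▸ h.mem_bv)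
    obtain ⟨B, hB⟩ := ih hs.2.2 (by simpa [Ctx.holes, hs.1] using ha)
      (fun h' => hx (.inr ⟨h', hxy⟩)) hn.2.2.1
    exact ⟨B, .cut _ _ hxy hs.1 hB⟩
  | @cutLam C D z y E h ih | @cutBang C D y E h ih =>
    exfalso
    simp only [Ctx.bv, Val.bv, List.nodup_cons, List.mem_append, List.mem_cons, not_or,
      List.nodup_append'] at hn
    have hC := h.mem_bv
    have hxy : x ≠ y := by rintro rfl; tauto
    rcases Ctx.FV_or_bv hJ (v := E) (by simpa [Ctx.holes, hs.1] using ha) with h1 | h1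
    · exact hx (.inr ⟨h1, hxy⟩)
    · exact hn.2.2.2 (by simp [hC]) h1
  | @sub C D m w y h ih =>
    simp only [Ctx.bv, List.nodup_cons, List.mem_append, not_or, List.nodup_append'] at hn
    have hxy : x ≠ y := fun e => hn.1.2 (e ▸ h.mem_bv)
    by_cases haw : a ∈ w.holes
    · exfalso
      rcases Val.FV_or_bv hJ haw with h1 | h1
      · exact hx (.inr (.inl h1))
      · exact hn.2.2.2 h1 h.mem_bv
    · obtain ⟨B, hB⟩ := ih hs.2 (by simpa [Ctx.holes, haw] using ha)
        (fun h' => hx (.inr (.inr ⟨h', hxy⟩))) hn.2.2.1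
      exact ⟨B, .sub _ _ _ hB⟩
  | @subLam C D m z y E h ih =>
    simp only [Ctx.bv, Val.bv, List.nodup_cons, List.mem_append, List.mem_cons, not_or,
      List.nodup_append'] at hn
    have hC := h.mem_bv
    have hxy : x ≠ y := by rintro rfl; tauto
    have hxz : x ≠ z := by rintro rfl; tauto
    by_cases haE : a ∈ E.holes
    · exfalso
      rcases Ctx.FV_or_bv hJ haE with h1 | h1
      · exact hx (.inr (.inr ⟨h1, hxy⟩))
      · exact hn.2.2.2 (by simp [hC]) h1
    · obtain ⟨B, hB⟩ := ih hs.1 (by simpa [Ctx.holes, Val.holes, haE] using ha)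
        (fun h' => hx (.inr (.inl ⟨h', hxz⟩))) hn.2.1.2
      exact ⟨B, .subLam _ _ _ _ hB⟩
  | @subBang C D m y E h ih =>
    simp only [Ctx.bv, Val.bv, List.nodup_cons, List.mem_append, not_or, List.nodup_append'] at hn
    have hC := h.mem_bv
    have hxy : x ≠ y := by rintro rfl; tauto
    by_cases haE : a ∈ E.holes
    · exfalso
      rcases Ctx.FV_or_bv hJ haE with h1 | h1
      · exact hx (.inr (.inr ⟨h1, hxy⟩))
      · exact hn.2.2.2 hC h1
    · obtain ⟨B, hB⟩ := ih hs.1 (by simpa [Ctx.holes, Val.holes, haE] using ha)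
        (fun h' => hx (.inr (.inl h'))) hn.2.1
      exact ⟨B, .subBang _ _ _ hB⟩

namespace Spine

variable {v : Val} {x : Var} {a : ℕ} {B C D : Ctx}

theorem value_term (h : Spine v x a B C D) : v.holes = [] := by induction h <;> assumption

theorem mem_body (h : Spine v x a B C D) : a ∈ B.holes := by induction h <;> assumption

theorem holes_eq (h : Spine v x a B C D) : D.holes = C.holes := by
  induction h <;> simp_all [Ctx.holes, Val.holes]

theorem mem_holes (h : Spine v x a B C D) : a ∈ D.holes := by
  induction h <;> simp_all [Ctx.holes, Val.holes]

theorem count_bv (h : Spine v x a B C D) (y : Var) :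
    C.bv.count y = (x :: v.bv).count y + D.bv.count y := by
  induction h <;> simp_all [Ctx.bv, Val.bv, List.count_cons] <;> omega

theorem mem_bv (h : Spine v x a B C D) (y : Var) : y ∈ C.bv ↔ y = x ∨ y ∈ v.bv ∨ y ∈ D.bv := by
  have := h.count_bv y
  rw [← or_assoc, ← List.mem_cons, ← List.count_pos_iff, this, ← List.count_pos_iff (l := D.bv),
    ← List.count_pos_iff (l := x :: v.bv)]
  omega

theorem mem_vars (h : Spine v x a B C D) (y : Var) :
    y ∈ C.vars ↔ y = x ∨ y ∈ v.vars ∨ y ∈ D.vars := by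
  induction h <;> simp_all [Ctx.vars, Val.vars] <;> tauto

theorem size_le (h : Spine v x a B C D) {N : ℕ} {G : ℕ → Prop} (hs : C.Shape N G) :
    v.size ≤ N := by
  induction h with
  | here => exact hs.2.1
  | lam _ _ ih | bang _ ih | der _ _ _ ih => exact ih hs
  | cut _ _ _ _ _ ih => exact ih hs.2.2
  | sub _ _ _ _ ih => exact ih hs.2
  | subLam _ _ _ _ _ ih | subBang _ _ _ _ ih => exact ih hs.1

theorem shape (h : Spine v x a B C D) {N : ℕ} {G : ℕ → Prop} (hs : C.Shape N G) : D.Shape N G := by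
  induction h with
  | here => exact hs.2.2
  | lam _ _ ih | bang _ ih | der _ _ _ ih => exact ih hs
  | cut _ _ _ _ _ ih => exact ⟨hs.1, hs.2.1, ih hs.2.2⟩
  | sub _ _ _ _ ih => exact ⟨hs.1, ih hs.2⟩
  | subLam _ _ _ _ _ ih | subBang _ _ _ _ ih => exact ⟨ih hs.1, hs.2⟩

theorem fv_remove (h : Spine v x a B C D) {J J' : ℕ → Var → Prop} {y : Var}
    (hn : C.holes.Nodup) (hJ : ∀ b ∈ C.holes, J' b y → J b y ∨ (b = a ∧ y ∈ v.fv))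
    (hy : D.FV J' y) : C.FV J y ∨ y = x := by
  induction h with
  | here h1 h2 =>
    rcases Ctx.FV_mono (fun b hb h => (hJ b (by simp [Ctx.holes, hb]) h).imp_right And.right) hy
      with h3 | h3
    · by_cases hyx : y = x
      · exact .inr hyx
      · exact .inl (.inr ⟨h3, hyx⟩)
    · exact .inl (.inl (Val.FV_of_mem_fv h3))
  | lam z _ ih => exact (ih hn hJ hy.1).imp (fun h => ⟨h, hy.2⟩) id
  | bang _ ih => exact ih hn hJ hy
  | der e z _ ih =>
    rcases hy with hy | hy
    · exact .inl (.inl hy)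
    · exact (ih hn hJ hy.1).imp (fun h => .inr ⟨h, hy.2⟩) id
  | cut w z hz hw h ih =>
    rcases hy with hy | hy
    · exact .inl (.inl ((Val.FV_congr (by simp [hw])).1 hy))
    · simp only [Ctx.holes, hw, List.nil_append] at hn hJ
      exact (ih hn hJ hy.1).imp (fun h => .inr ⟨h, hy.2⟩) id
  | @sub C D m w z h ih =>
    have ha : a ∈ C.holes := h.holes_eq ▸ h.mem_holes
    simp only [Ctx.holes, List.nodup_append', List.mem_append] at hn hJ
    rcases hy with hy | hy | hy
    · exact .inl (.inl hy)
    · refine .inl (.inr (.inl ((Val.FV_mono (S := False) (fun b hb h1 => ?_) hy).resolve_right id)))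
      exact .inl ((hJ b (.inl hb) h1).resolve_right fun e => hn.2.2 hb (e.1 ▸ ha))
    · exact (ih hn.2.1 (fun b hb => hJ b (.inr hb)) hy.1).imp (fun h => .inr (.inr ⟨h, hy.2⟩)) id
  | @subLam C D m u z E h ih =>
    have ha : a ∈ C.holes := h.holes_eq ▸ h.mem_holes
    simp only [Ctx.holes, Val.holes, List.nodup_append', List.mem_append] at hn hJ
    rcases hy with hy | hy | hy
    · exact .inl (.inl hy)
    · exact (ih hn.1 (fun b hb => hJ b (.inl hb)) hy.1).imp
        (fun h => .inr (.inl ⟨h, hy.2⟩)) id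
    · refine .inl (.inr (.inr ⟨(Ctx.FV_mono (S := False) (fun b hb h1 => ?_) hy.1).resolve_right id,
        hy.2⟩))
      exact .inl ((hJ b (.inr hb) h1).resolve_right fun e => hn.2.2 ha (e.1 ▸ hb))
  | @subBang C D m z E h ih =>
    have ha : a ∈ C.holes := h.holes_eq ▸ h.mem_holes
    simp only [Ctx.holes, Val.holes, List.nodup_append', List.mem_append] at hn hJ
    rcases hy with hy | hy | hy
    · exact .inl (.inl hy)
    · exact (ih hn.1 (fun b hb => hJ b (.inl hb)) hy).imp (fun h => .inr (.inl h)) id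
    · refine .inl (.inr (.inr ⟨(Ctx.FV_mono (S := False) (fun b hb h1 => ?_) hy.1).resolve_right id,
        hy.2⟩))
      exact .inl ((hJ b (.inr hb) h1).resolve_right fun e => hn.2.2 ha (e.1 ▸ hb))

/-- The free variables of a cut value may be used in the scope of the cut. -/
theorem fv_use (h : Spine v x a B C D) {J J' : ℕ → Var → Prop} {y : Var}
    (hn : C.holes.Nodup) (hJ : ∀ b ∈ C.holes, J' b y → J b y ∨ (b = a ∧ y ∈ v.fv))
    (hy : C.FV J' y) : C.FV J y := by
  induction h with
  | here h1 h2 =>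
    rcases hy with hy | hy
    · exact .inl ((Val.FV_congr (by simp [h2])).1 hy)
    · rcases Ctx.FV_mono (fun b hb h => (hJ b (by simp [Ctx.holes, hb]) h).imp_right And.right) hy.1
        with h3 | h3
      · exact .inr ⟨h3, hy.2⟩
      · exact .inl (Val.FV_of_mem_fv h3)
  | lam z _ ih => exact ⟨ih hn hJ hy.1, hy.2⟩
  | bang _ ih => exact ih hn hJ hy
  | der e z _ ih =>
    rcases hy with hy | hy
    · exact .inl hy
    · exact .inr ⟨ih hn hJ hy.1, hy.2⟩
  | cut w z hz hw h ih =>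
    rcases hy with hy | hy
    · exact .inl ((Val.FV_congr (by simp [hw])).1 hy)
    · simp only [Ctx.holes, hw, List.nil_append] at hn hJ
      exact .inr ⟨ih hn hJ hy.1, hy.2⟩
  | @sub C D m w z h ih =>
    have ha : a ∈ C.holes := h.holes_eq ▸ h.mem_holes
    simp only [Ctx.holes, List.nodup_append', List.mem_append] at hn hJ
    rcases hy with hy | hy | hy
    · exact .inl hy
    · refine .inr (.inl ((Val.FV_mono (S := False) (fun b hb h1 => ?_) hy).resolve_right id))
      exact .inl ((hJ b (.inl hb) h1).resolve_right fun e => hn.2.2 hb (e.1 ▸ ha))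
    · exact .inr (.inr ⟨ih hn.2.1 (fun b hb => hJ b (.inr hb)) hy.1, hy.2⟩)
  | @subLam C D m u z E h ih =>
    have ha : a ∈ C.holes := h.holes_eq ▸ h.mem_holes
    simp only [Ctx.holes, Val.holes, List.nodup_append', List.mem_append] at hn hJ
    rcases hy with hy | hy | hy
    · exact .inl hy
    · exact .inr (.inl ⟨ih hn.1 (fun b hb => hJ b (.inl hb)) hy.1, hy.2⟩)
    · refine .inr (.inr ⟨(Ctx.FV_mono (S := False) (fun b hb h1 => ?_) hy.1).resolve_right id, hy.2⟩)
      exact .inl ((hJ b (.inr hb) h1).resolve_right fun e => hn.2.2 ha (e.1 ▸ hb))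
  | @subBang C D m z E h ih =>
    have ha : a ∈ C.holes := h.holes_eq ▸ h.mem_holes
    simp only [Ctx.holes, Val.holes, List.nodup_append', List.mem_append] at hn hJ
    rcases hy with hy | hy | hy
    · exact .inl hy
    · exact .inr (.inl (ih hn.1 (fun b hb => hJ b (.inl hb)) hy))
    · refine .inr (.inr ⟨(Ctx.FV_mono (S := False) (fun b hb h1 => ?_) hy.1).resolve_right id, hy.2⟩)
      exact .inl ((hJ b (.inr hb) h1).resolve_right fun e => hn.2.2 ha (e.1 ▸ hb))

end Spine

end Sesame
namespace Sesame

/-! ### The invariant of the machine -/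

/-- Free variables of the jobs of a given name. -/
def jobFV (P : Pool) (a : ℕ) (y : Var) : Prop := ∃ u, (a, u) ∈ P ∧ y ∈ u.fv

/-- All jobs of name `a` are values. -/
def ValueJob (P : Pool) (a : ℕ) : Prop := ∀ u, (a, u) ∈ P → ∃ w, u = .val w

/-- Holes and jobs correspond to each other, terms and values are bounded by `N`, bound names are
distinct, and bound variables occur in the scope of their binders only. -/
structure AInv (N : ℕ) (Q : State) : Prop where
  holes : Q.ctx.holes = Q.pool.map Prod.fst
  nodup : Q.ctx.holes.Nodup
  shape : Q.ctx.Shape N (ValueJob Q.pool)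
  term : ∀ j ∈ Q.pool, j.2.holes = []
  bdd : ∀ j ∈ Q.pool, j.2.Bdd N
  bv : Q.bv.Nodup
  fv : ∀ y, Q.ctx.FV (jobFV Q.pool) y → y ∉ Q.bv

theorem State.mem_vars_cons {C : Ctx} {a : ℕ} {t : Ctx} {P : Pool} {y : Var} :
    y ∈ State.vars ⟨C, (a, t) :: P⟩ ↔ y ∈ C.vars ∨ y ∈ t.vars ∨ ∃ j ∈ P, y ∈ j.2.vars := by
  simp [State.vars]

theorem State.mem_bv_cons {C : Ctx} {a : ℕ} {t : Ctx} {P : Pool} {y : Var} :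
    y ∈ State.bv ⟨C, (a, t) :: P⟩ ↔ y ∈ C.bv ∨ y ∈ t.bv ∨ ∃ j ∈ P, y ∈ j.2.bv := by
  simp [State.bv]

theorem State.mem_bv {Q : State} {y : Var} :
    y ∈ Q.bv ↔ y ∈ Q.ctx.bv ∨ ∃ j ∈ Q.pool, y ∈ j.2.bv := by
  simp [State.bv]

theorem State.mem_vars {Q : State} {y : Var} :
    y ∈ Q.vars ↔ y ∈ Q.ctx.vars ∨ ∃ j ∈ Q.pool, y ∈ j.2.vars := by
  simp [State.vars]

theorem State.bv_subset_vars {Q : State} {y : Var} (h : y ∈ Q.bv) : y ∈ Q.vars := by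
  rw [State.mem_bv] at h
  rw [State.mem_vars]
  exact h.imp (fun h => Ctx.mem_vars_iff.2 (.inr h))
    fun ⟨j, hj, h⟩ => ⟨j, hj, Ctx.mem_vars_iff.2 (.inr h)⟩

theorem State.count_bv_cons (C : Ctx) (a : ℕ) (t : Ctx) (P : Pool) (y : Var) :
    (State.bv ⟨C, (a, t) :: P⟩).count y =
      C.bv.count y + t.bv.count y + (P.flatMap fun j => j.2.bv).count y := by
  simp [State.bv]; omega

section

variable {N : ℕ} {C : Ctx} {a : ℕ} {t : Ctx} {P : Pool}

theorem AInv.not_mem_pool (h : AInv N ⟨C, (a, t) :: P⟩) {u : Ctx} : (a, u) ∉ P := by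
  have h1 := h.nodup
  rw [h.holes] at h1
  simp at h1
  exact h1.1 u

theorem AInv.mem_holes (h : AInv N ⟨C, (a, t) :: P⟩) : a ∈ C.holes := by simp [h.holes]

theorem AInv.jobFV_self (h : AInv N ⟨C, (a, t) :: P⟩) {y : Var} :
    jobFV ((a, t) :: P) a y ↔ y ∈ t.fv := by
  constructor
  · rintro ⟨u, hu, hy⟩
    rcases List.mem_cons.1 hu with e | e
    · cases e; exact hy
    · exact absurd e h.not_mem_pool
  · exact fun hy => ⟨t, by simp, hy⟩

theorem jobFV_cons_of_ne {b : ℕ} (hb : b ≠ a) {y : Var} :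
    jobFV ((a, t) :: P) b y ↔ jobFV P b y := by
  simp [jobFV, hb]

/-- Replacing a job by a multi-context and jobs for its holes. -/
theorem AInv.plug (h : AInv N ⟨C, (a, t) :: P⟩) {D : Ctx} {js : Pool}
    (hD : D.holes = js.map Prod.fst) (hn : D.holes.Nodup)
    (hf : ∀ b ∈ D.holes, b ≠ a → b ∉ State.names ⟨C, (a, t) :: P⟩)
    (hbv : ∀ y, D.bv.count y + (js.flatMap fun j => j.2.bv).count y = t.bv.count y)
    (hfv : ∀ y, D.FV (jobFV js) y ↔ y ∈ t.fv) (hs : D.Shape N (ValueJob js))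
    (ht : ∀ j ∈ js, j.2.holes = []) (hb : ∀ j ∈ js, j.2.Bdd N)
    (hv : (∃ w, t = .val w) → ∃ w, (∀ b, w ≠ .hole b) ∧ D = .val w) :
    AInv N ⟨C.plug a D, js ++ P⟩ ∧ Plug a D C (C.plug a D) := by
  have hP : Plug a D C (C.plug a D) := by
    refine Ctx.plug_spec (fun hG => hv (hG t (by simp))) h.shape ?_
    exact List.count_eq_one_of_mem h.nodup h.mem_holes
  have hfP : ∀ b ∈ D.holes, ∀ u, (b, u) ∉ P := by
    intro b hb u hu
    by_cases hba : b = a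
    · subst hba; exact h.not_mem_pool hu
    · apply hf b hb hba
      simp only [State.names, List.mem_append, List.mem_map, List.mem_cons]
      exact .inr ⟨_, .inr hu, rfl⟩
  have hh : (C.plug a D).holes = (js ++ P).map Prod.fst := by
    obtain ⟨l, l', h1, h2⟩ := hP.holes
    have h3 := h.holes
    have h4 := h.nodup
    simp only [h1, List.map_cons] at h3 h4
    cases l with
    | nil => simp_all
    | cons c l =>
      simp only [List.cons_append, List.cons.injEq] at h3
      simp [h3.1] at h4
  refine ⟨⟨hh, ?_, ?_, ?_, ?_, ?_, ?_⟩, hP⟩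
  · simp only [hh, List.map_append, List.nodup_append', ← hD]
    refine ⟨hn, ?_, ?_⟩
    · have := h.nodup
      rw [h.holes] at this
      exact (List.nodup_cons.1 this).2
    · intro b hb hb'
      obtain ⟨⟨b', u⟩, hu, rfl⟩ := List.mem_map.1 hb'
      exact hfP _ hb u hu
  · refine hP.shape h.shape (hs.mono fun b hb hj u hu => ?_) fun b hb hba hj u hu => ?_
    · rcases List.mem_append.1 hu with hu | hu
      · exact hj u hu
      · exact absurd hu (hfP b hb u)
    · rcases List.mem_append.1 hu with hu | hu
      · exfalso
        refine hf b ?_ hba (by simp [State.names, hb])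
        rw [hD]; exact List.mem_map.2 ⟨_, hu, rfl⟩
      · exact hj u (by simp [hu])
  · intro j hj
    rcases List.mem_append.1 hj with hj | hj
    · exact ht j hj
    · exact h.term j (by simp [hj])
  · intro j hj
    rcases List.mem_append.1 hj with hj | hj
    · exact hb j hj
    · exact h.bdd j (by simp [hj])
  · have := h.bv
    rw [List.nodup_iff_count_le_one] at this ⊢
    intro y
    have h1 := this y
    rw [State.count_bv_cons] at h1
    simp only [State.bv, List.flatMap_append, List.count_append, hP.count_bv]
    have := hbv y
    omega
  · intro y hy
    have h1 : C.FV (jobFV ((a, t) :: P)) y := by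
      refine (hP.fv (J' := jobFV (js ++ P)) ?_ ?_).1 hy
      · rw [h.jobFV_self, ← hfv]
        refine Ctx.FV_congr fun b hb => ?_
        constructor
        · rintro ⟨u, hu, hy⟩
          rcases List.mem_append.1 hu with hu | hu
          · exact ⟨u, hu, hy⟩
          · exact absurd hu (hfP b hb u)
        · rintro ⟨u, hu, hy⟩
          exact ⟨u, by simp [hu], hy⟩
      · intro b hb hba
        rw [jobFV_cons_of_ne hba]
        constructor
        · rintro ⟨u, hu, hy⟩
          rcases List.mem_append.1 hu with hu | hu
          · exfalso
            refine hf b ?_ hba (by simp [State.names, hb])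
            rw [hD]; exact List.mem_map.2 ⟨_, hu, rfl⟩
          · exact ⟨u, hu, hy⟩
        · rintro ⟨u, hu, hy⟩
          exact ⟨u, by simp [hu], hy⟩
    have h2 := h.fv y h1
    rw [← List.count_eq_zero] at h2 ⊢
    simp only [State.count_bv_cons] at h2
    simp only [State.bv, List.flatMap_append, List.count_append, hP.count_bv]
    have := hbv y
    omega

/-- Replacing a job by another one. -/
theorem AInv.replace (h : AInv N ⟨C, (a, t) :: P⟩) {D t' : Ctx} (hD : D.holes = C.holes)
    (hs : ∀ G, C.Shape N G → D.Shape N G) (ht : t'.holes = []) (hb : t'.Bdd N)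
    (hv : (∃ w, t = .val w) → ∃ w, t' = .val w)
    (hbv : (State.bv ⟨D, (a, t') :: P⟩).Nodup)
    (hfv : ∀ y, D.FV (jobFV ((a, t') :: P)) y → y ∉ State.bv ⟨D, (a, t') :: P⟩) :
    AInv N ⟨D, (a, t') :: P⟩ := by
  refine ⟨by simpa [hD] using h.holes, by simpa only [hD] using h.nodup, ?_, ?_, ?_, hbv, hfv⟩
  · refine hs _ (h.shape.mono fun b hb hj u hu => ?_)
    rcases List.mem_cons.1 hu with hu | hu
    · cases hu; exact hv (hj t (by simp))
    · exact hj u (by simp [hu])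
  · intro j hj
    rcases List.mem_cons.1 hj with rfl | hj
    · exact ht
    · exact h.term j (by simp [hj])
  · intro j hj
    rcases List.mem_cons.1 hj with rfl | hj
    · exact hb
    · exact h.bdd j (by simp [hj])

/-- The cut on a variable that occurs in the active job is above its hole. -/
theorem AInv.spine (h : AInv N ⟨C, (a, t) :: P⟩) {v : Val} {x : Var} {D : Ctx}
    (hC : CutIn C v x D) (hx : x ∈ t.fv) : ∃ B, Spine v x a B C D := by
  refine hC.cutAt.spine (h.jobFV_self.2 hx) h.shape h.mem_holes (fun h' => ?_) ?_
  · exact h.fv x h' (State.mem_bv_cons.2 (.inl hC.cutAt.mem_bv))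
  · have := h.bv
    simp only [State.bv, List.nodup_append'] at this
    exact this.1

theorem jobFV_replace {t' : Ctx} {S : List Var} {y : Var}
    (ht : y ∈ t'.fv → y ∈ t.fv ∨ y ∈ S) (b : ℕ) :
    jobFV ((a, t') :: P) b y → jobFV ((a, t) :: P) b y ∨ (b = a ∧ y ∈ S) := by
  rintro ⟨u, hu, hy⟩
  rcases List.mem_cons.1 hu with e | hu
  · cases e
    exact (ht hy).imp (fun h' => ⟨t, by simp, h'⟩) fun h' => ⟨rfl, h'⟩
  · exact .inl ⟨u, by simp [hu], hy⟩

/-- Removing a cut and moving material from its value to the active job. -/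
theorem AInv.remove (h : AInv N ⟨C, (a, t) :: P⟩) {v : Val} {x : Var} {B D t' : Ctx}
    (hC : Spine v x a B C D) (ht : t'.holes = []) (hb : t'.Bdd N)
    (hv : (∃ w, t = .val w) → ∃ w, t' = .val w)
    (hbv : ∀ y, t'.bv.count y ≤ t.bv.count y + v.bv.count y)
    (hfv : ∀ y ∈ t'.fv, y ∈ t.fv ∨ y ∈ v.fv) : AInv N ⟨D, (a, t') :: P⟩ := by
  have hc : ∀ y, (State.bv ⟨D, (a, t') :: P⟩).count y + [x].count y ≤
      (State.bv ⟨C, (a, t) :: P⟩).count y := by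
    intro y
    have h1 := hbv y
    have h2 := hC.count_bv y
    simp only [State.count_bv_cons, List.count_cons, List.count_nil] at h1 h2 ⊢
    omega
  have hn := List.nodup_iff_count_le_one.1 h.bv
  refine h.replace hC.holes_eq (fun G => hC.shape) ht hb hv ?_ ?_
  · rw [List.nodup_iff_count_le_one]
    intro y
    have := hc y
    have := hn y
    omega
  · intro y hy
    rw [← List.count_eq_zero]
    rcases hC.fv_remove h.nodup (fun b _ => jobFV_replace (hfv y) b) hy with h1 | rfl
    · have h2 := List.count_eq_zero.2 (h.fv y h1)
      have := hc y
      omega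
    · have h1 := hc y
      have := hn y
      simp at h1
      omega

mutual
theorem Val.FV_cases {J : ℕ → Var → Prop} {y : Var} :
    ∀ {v : Val}, v.FV J y → y ∈ v.fv ∨ ∃ a ∈ v.holes, J a y
  | .hole a, h => .inr ⟨a, by simp [Val.holes], h⟩
  | .var _, h => .inl (by simpa [Val.fv, Val.FV] using h)
  | .lam _ C, h => by
      have := Ctx.FV_cases (v := C) h.1
      have := h.2
      simp only [Val.fv, Val.holes, List.mem_filter, decide_eq_true_eq]; tauto
  | .bang C, h => Ctx.FV_cases (v := C) h
theorem Ctx.FV_cases {J : ℕ → Var → Prop} {y : Var} :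
    ∀ {v : Ctx}, v.FV J y → y ∈ v.fv ∨ ∃ a ∈ v.holes, J a y
  | .val v, h => Val.FV_cases (v := v) h
  | .cut v _ C, h => by
      have h1 := Val.FV_cases (J := J) (y := y) (v := v)
      have h2 := Ctx.FV_cases (J := J) (y := y) (v := C)
      simp only [Ctx.FV, Ctx.fv, Ctx.holes, List.mem_append, List.mem_filter,
        decide_eq_true_eq] at *
      grind
  | .sub _ v _ C, h => by
      have h1 := Val.FV_cases (J := J) (y := y) (v := v)
      have h2 := Ctx.FV_cases (J := J) (y := y) (v := C)
      simp only [Ctx.FV, Ctx.fv, Ctx.holes, List.mem_append, List.mem_filter, List.mem_cons,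
        decide_eq_true_eq] at *
      grind
  | .der _ _ C, h => by
      have h2 := Ctx.FV_cases (J := J) (y := y) (v := C)
      simp only [Ctx.FV, Ctx.fv, Ctx.holes, List.mem_filter, List.mem_cons,
        decide_eq_true_eq] at *
      grind
end

theorem State.mem_vars_of_FV {Q : State} {y : Var} (h : Q.ctx.FV (jobFV Q.pool) y) :
    y ∈ Q.vars := by
  rw [State.mem_vars]
  rcases Ctx.FV_cases h with h | ⟨a, _, u, hu, hy⟩
  · exact .inl (Ctx.mem_vars_iff.2 (.inl h))
  · exact .inr ⟨_, hu, Ctx.mem_vars_iff.2 (.inl hy)⟩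

/-- Copying a cut value to the active job, with fresh bound names. -/
theorem AInv.use (h : AInv N ⟨C, (a, t) :: P⟩) {v : Val} {x : Var} {B D t' : Ctx} {l : List Var}
    (hC : Spine v x a B C D) (ht : t'.holes = []) (hb : t'.Bdd N)
    (hv : (∃ w, t = .val w) → ∃ w, t' = .val w) (hl : l.Nodup)
    (hl' : ∀ y ∈ l, y ∉ State.vars ⟨C, (a, t) :: P⟩)
    (hbv : ∀ y, t'.bv.count y ≤ t.bv.count y + l.count y)
    (hfv : ∀ y ∈ t'.fv, y ∈ t.fv ∨ y ∈ v.fv) : AInv N ⟨C, (a, t') :: P⟩ := by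
  have hn := List.nodup_iff_count_le_one.1 h.bv
  have hl := List.nodup_iff_count_le_one.1 hl
  refine h.replace rfl (fun G => id) ht hb hv ?_ ?_
  · rw [List.nodup_iff_count_le_one]
    intro y
    have h1 := hn y
    have h2 := hbv y
    have h3 := hl y
    by_cases hy : y ∈ l
    · have h4 := List.count_eq_zero.2 fun h' => hl' y hy (State.bv_subset_vars h')
      simp only [State.count_bv_cons] at h1 h4 ⊢
      omega
    · rw [List.count_eq_zero.2 hy] at h2
      simp only [State.count_bv_cons] at h1 ⊢
      omega
  · intro y hy
    have h1 := hC.fv_use h.nodup (fun b _ => jobFV_replace (hfv y) b) hy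
    have h2 := List.count_eq_zero.2 (h.fv y h1)
    have h3 := List.count_eq_zero.2 fun h' => hl' y h' (State.mem_vars_of_FV h1)
    have h4 := hbv y
    rw [← List.count_eq_zero]
    simp only [State.count_bv_cons] at h2 ⊢
    omega

end

theorem AInv.init {t : Ctx} {Q : State} (ht : t.IsTerm) (h : Init t Q) : AInv t.size Q := by
  obtain ⟨a, t', ⟨h1, h2, h3⟩, rfl⟩ := h
  refine ⟨by simp [Ctx.holes, Val.holes], by simp [Ctx.holes, Val.holes], .inl trivial, ?_, ?_, ?_,
    ?_⟩
  · simpa using h1.holes_eq.symm.trans ht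
  · simpa using Ctx.Bdd.of_size_le h1.size_eq.ge
  · simpa [State.bv, Ctx.bv, Val.bv] using h2
  · rintro y ⟨u, hu, hy⟩ hy'
    simp at hu; subst hu
    simp [State.bv, Ctx.bv, Val.bv] at hy'
    exact h3 y hy' ((h1.mem_fv_iff y).2 hy)

/-- The invariant is preserved. -/
theorem AInv.step {N : ℕ} {Q Q' : State} {l : Label} (h : AInv N Q) (hs : Step l Q Q') :
    AInv N Q' := by
  cases hs with
  | sea1 C a v x t P =>
    have ht := h.term _ (List.mem_cons_self ..)
    have hb := h.bdd _ (List.mem_cons_self ..)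
    simp only [Ctx.holes, List.append_eq_nil_iff] at ht
    refine (h.plug (D := .cut v x (.hole a)) (js := [(a, t)]) ?_ ?_ ?_ ?_ ?_ ?_ ?_ ?_ ?_).1
    · simp [Ctx.holes, Val.holes, ht.1]
    · simp [Ctx.holes, Val.holes, ht.1]
    · simp [Ctx.holes, Val.holes, ht.1]
    · intro y; simp [Ctx.bv, Val.bv, List.count_cons]; omega
    · intro y; simp [Ctx.FV, Val.FV, Ctx.fv, jobFV, Val.FV_iff_of_term ht.1]
    · exact ⟨ht.1, hb.1, .inl trivial⟩
    · simpa using ht.2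
    · simpa using hb.2
    · simp
  | sea2 C a b m v x t P hm hb' =>
    have ht := h.term _ (List.mem_cons_self ..)
    have hb := h.bdd _ (List.mem_cons_self ..)
    have hab : b ≠ a := by rintro rfl; simp [State.names] at hb'
    simp only [Ctx.holes, List.append_eq_nil_iff] at ht
    refine (h.plug (D := .sub m (.hole b) x (.hole a)) (js := [(b, .val v), (a, t)])
      ?_ ?_ ?_ ?_ ?_ ?_ ?_ ?_ ?_).1
    · simp [Ctx.holes, Val.holes]
    · simpa [Ctx.holes, Val.holes] using hab
    · simp only [Ctx.holes, Val.holes, List.cons_append, List.nil_append, List.mem_cons,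
        List.not_mem_nil, or_false]
      rintro c (rfl | rfl) hc
      · exact hb'
      · exact absurd rfl hc
    · intro y; simp [Ctx.bv, Val.bv, List.count_cons]; omega
    · intro y; simp [Ctx.FV, Val.FV, Ctx.fv, jobFV, hab, hab.symm]
    · refine ⟨.inr fun u hu => ?_, .inl trivial⟩
      simp [hab] at hu
      exact ⟨v, hu⟩
    · simp only [List.forall_mem_cons]; exact ⟨ht.1, ht.2, nofun⟩
    · simp only [List.forall_mem_cons]; exact ⟨hb.1, hb.2, nofun⟩
    · simp
  | sea3 C a e x t P he =>
    have ht := h.term _ (List.mem_cons_self ..)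
    have hb := h.bdd _ (List.mem_cons_self ..)
    refine (h.plug (D := .der e x (.hole a)) (js := [(a, t)]) ?_ ?_ ?_ ?_ ?_ ?_ ?_ ?_ ?_).1
    · simp [Ctx.holes, Val.holes]
    · simp [Ctx.holes, Val.holes]
    · simp [Ctx.holes, Val.holes]
    · intro y; simp [Ctx.bv, Val.bv, List.count_cons]; omega
    · intro y; simp [Ctx.FV, Val.FV, Ctx.fv, jobFV]
    · exact .inl trivial
    · simp only [List.forall_mem_cons]; exact ⟨ht, nofun⟩
    · simp only [List.forall_mem_cons]; exact ⟨hb, nofun⟩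
    · simp
  | sea4 C a x t P =>
    have ht := h.term _ (List.mem_cons_self ..)
    have hb := h.bdd _ (List.mem_cons_self ..)
    simp only [Ctx.Bdd, Val.size] at hb
    refine (h.plug (D := .val (.lam x (.hole a))) (js := [(a, t)]) ?_ ?_ ?_ ?_ ?_ ?_ ?_ ?_ ?_).1
    · simp [Ctx.holes, Val.holes]
    · simp [Ctx.holes, Val.holes]
    · simp [Ctx.holes, Val.holes]
    · intro y; simp [Ctx.bv, Val.bv, List.count_cons]; omega
    · intro y; simp [Ctx.FV, Val.FV, Ctx.fv, Val.fv, jobFV]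
    · exact .inl trivial
    · simp only [List.forall_mem_cons]; exact ⟨ht, nofun⟩
    · simpa using Ctx.Bdd.of_size_le (by omega)
    · exact fun _ => ⟨.lam x (.hole a), by simp, rfl⟩
  | sea5 C a t P =>
    have ht := h.term _ (List.mem_cons_self ..)
    have hb := h.bdd _ (List.mem_cons_self ..)
    simp only [Ctx.Bdd, Val.size] at hb
    refine (h.plug (D := .val (.bang (.hole a))) (js := [(a, t)]) ?_ ?_ ?_ ?_ ?_ ?_ ?_ ?_ ?_).1
    · simp [Ctx.holes, Val.holes]
    · simp [Ctx.holes, Val.holes]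
    · simp [Ctx.holes, Val.holes]
    · intro y; simp [Ctx.bv, Val.bv]
    · intro y; simp [Ctx.FV, Val.FV, Ctx.fv, Val.fv, jobFV]
    · exact .inl trivial
    · simp only [List.forall_mem_cons]; exact ⟨ht, nofun⟩
    · simpa using Ctx.Bdd.of_size_le (by omega)
    · exact fun _ => ⟨.bang (.hole a), by simp, rfl⟩
  | sea6 C a x P hx =>
    refine (h.plug (D := .val (.var x)) (js := []) ?_ ?_ ?_ ?_ ?_ ?_ ?_ ?_ ?_).1
    · simp [Ctx.holes, Val.holes]
    · simp [Ctx.holes, Val.holes]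
    · simp [Ctx.holes, Val.holes]
    · intro y; simp [Ctx.bv, Val.bv]
    · intro y; simp [Ctx.FV, Val.FV, Ctx.fv, Val.fv]
    · exact trivial
    · simp
    · simp
    · exact fun _ => ⟨.var x, by simp, rfl⟩
  | axm2 C D a m n v x t P hC =>
    obtain ⟨B, hB⟩ := h.spine hC (by simp [Ctx.fv])
    refine h.remove hB (h.term _ (List.mem_cons_self ..)) (h.bdd _ (List.mem_cons_self ..))
      (by simp) (fun y => by simp [Ctx.bv]) fun y hy => ?_
    simp [Ctx.fv, Val.fv] at hy ⊢
    tauto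
  | lolli C D a m y s v x t P hC =>
    obtain ⟨B, hB⟩ := h.spine hC (by simp [Ctx.fv])
    have ht := h.term _ (List.mem_cons_self ..)
    have hb := h.bdd _ (List.mem_cons_self ..)
    have hsz := hB.size_le h.shape
    have hvt := hB.value_term
    simp only [Val.size] at hsz
    simp only [Val.holes] at hvt
    simp only [Ctx.holes, List.append_eq_nil_iff] at ht
    refine h.remove hB ?_ ?_ (by simp) (fun z => ?_) fun z hz => ?_
    · simp [Ctx.holes, Ctx.splice_holes, ht, hvt]
    · exact ⟨hb.1, Ctx.Bdd.splice hb.2 (.of_size_le (by omega))⟩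
    · simp [Ctx.bv, Val.bv, Ctx.splice_count_bv, List.count_cons]; omega
    · have := Ctx.splice_fv_subset (x := x) (t := t) (C := s) (y := z)
      simp [Ctx.fv, Val.fv] at hz ⊢
      tauto
  | axe2 C D a e f x t P hC =>
    obtain ⟨B, hB⟩ := h.spine hC (by simp [Ctx.fv])
    refine h.use hB (l := []) (h.term _ (List.mem_cons_self ..)) (h.bdd _ (List.mem_cons_self ..))
      (by simp) (by simp) (by simp) (fun y => by simp [Ctx.bv]) fun y hy => ?_
    simp [Ctx.fv, Val.fv] at hy ⊢
    tauto
  | bang C D a e s s' x t P hC hs =>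
    obtain ⟨B, hB⟩ := h.spine hC (by simp [Ctx.fv])
    have ht := h.term _ (List.mem_cons_self ..)
    have hb := h.bdd _ (List.mem_cons_self ..)
    have hsz := hB.size_le h.shape
    have hvt := hB.value_term
    have he := hs.1.size_eq
    simp only [Val.size] at hsz
    simp only [Val.holes] at hvt
    simp only [Ctx.holes] at ht
    refine h.use hB (l := s'.bv) ?_ ?_ (by simp) hs.2.1 hs.2.2 (fun z => ?_) fun z hz => ?_
    · simp [Ctx.splice_holes, ht, ← hs.1.holes_eq, hvt]
    · exact Ctx.Bdd.splice (t := t) hb (.of_size_le (C := s') (by omega))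
    · simp [Ctx.bv, Ctx.splice_count_bv, List.count_cons]; omega
    · have h1 := Ctx.splice_fv_subset (x := x) (t := t) (C := s') (y := z) hz
      rw [← hs.1.mem_fv_iff] at h1
      simp [Ctx.fv, Val.fv]
      tauto
  | axm1 C D a m v P hv hC =>
    obtain ⟨B, hB⟩ := h.spine hC (by simp [Ctx.fv, Val.fv])
    exact h.remove hB hB.value_term (hB.size_le h.shape) (fun _ => ⟨_, rfl⟩)
      (fun y => by simp [Ctx.bv]) fun y hy => .inr hy
  | axe1 C D a e v v' P hv hC hv' =>
    obtain ⟨B, hB⟩ := h.spine hC (by simp [Ctx.fv, Val.fv])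
    refine h.use hB (l := v'.bv) (hv'.1.holes_eq.symm.trans hB.value_term)
      (hv'.1.size_eq.symm.le.trans (hB.size_le h.shape)) (fun _ => ⟨_, rfl⟩) hv'.2.1 hv'.2.2
      (fun y => by simp [Ctx.bv]) fun y hy => .inr ((hv'.1.mem_fv_iff y).2 hy)

/-! ### The number of search transitions -/

/-- The total size of the jobs. -/
def Pool.size (P : Pool) : ℕ := (P.map fun j => j.2.size).sum

theorem Step.size_search {l : Label} {Q Q' : State} (hs : Step l Q Q')
    (hl : l.isPrincipal = false) : Pool.size Q'.pool + 1 ≤ Pool.size Q.pool := by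
  cases hs <;> simp [Label.isPrincipal, Pool.size, Ctx.size, Val.size] at hl ⊢ <;> omega

theorem Step.size_principal {N : ℕ} {l : Label} {Q Q' : State} (h : AInv N Q)
    (hs : Step l Q Q') : Pool.size Q'.pool ≤ Pool.size Q.pool + N := by
  cases hs with
  | lolli C D a m y s v x t P hC =>
    obtain ⟨B, hB⟩ := h.spine hC (by simp [Ctx.fv])
    have := hB.size_le h.shape
    simp [Pool.size, Ctx.size, Ctx.splice_size, Val.size] at this ⊢
    omega
  | bang C D a e s s' x t P hC hs =>
    obtain ⟨B, hB⟩ := h.spine hC (by simp [Ctx.fv])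
    have := hB.size_le h.shape
    have := hs.1.size_eq
    simp [Pool.size, Ctx.size, Ctx.splice_size, Val.size] at *
    omega
  | axm1 C D a m v P hv hC =>
    obtain ⟨B, hB⟩ := h.spine hC (by simp [Ctx.fv, Val.fv])
    have := hB.size_le h.shape
    simp [Pool.size, Ctx.size, Val.size] at *
    omega
  | axe1 C D a e v v' P hv hC hv' =>
    obtain ⟨B, hB⟩ := h.spine hC (by simp [Ctx.fv, Val.fv])
    have := hB.size_le h.shape
    have := hv'.1.size_eq
    simp [Pool.size, Ctx.size, Val.size] at *
    omega
  | _ => simp [Pool.size, Ctx.size, Val.size]; try omega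

namespace Run

/-- The number of principal transitions among the first `i` ones. -/
def principalTo (r : Run) (i : ℕ) : ℕ :=
  ((Finset.range i).filter fun i => (r.label i).isPrincipal = true).card

/-- The number of search transitions among the first `i` ones. -/
def searchTo (r : Run) (i : ℕ) : ℕ :=
  ((Finset.range i).filter fun i => (r.label i).isPrincipal = false).card

theorem principalTo_succ (r : Run) (i : ℕ) : r.principalTo (i + 1) =
    r.principalTo i + if (r.label i).isPrincipal then 1 else 0 := by
  unfold principalTo
  rw [Finset.range_add_one, Finset.filter_insert]
  split <;> simp

theorem searchTo_succ (r : Run) (i : ℕ) : r.searchTo (i + 1) =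
    r.searchTo i + if (r.label i).isPrincipal then 0 else 1 := by
  unfold searchTo
  rw [Finset.range_add_one, Finset.filter_insert]
  cases h : (r.label i).isPrincipal <;> simp

theorem ainv {t : Ctx} {r : Run} (ht : t.IsTerm) (h : Init t (r.state 0)) :
    ∀ {i : ℕ}, i ≤ r.length → AInv t.size (r.state i)
  | 0, _ => .init ht h
  | i + 1, hi => (ainv ht h (i := i) (by omega)).step (r.step i (by omega))

theorem searchTo_add_size_le {t : Ctx} {r : Run} (ht : t.IsTerm) (h : Init t (r.state 0)) :
    ∀ {i : ℕ}, i ≤ r.length →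
      r.searchTo i + Pool.size (r.state i).pool ≤ t.size * (r.principalTo i + 1)
  | 0, _ => by
    obtain ⟨a, t', ⟨h1, h2, h3⟩, e⟩ := h
    simp [searchTo, principalTo, e, Pool.size, h1.size_eq]
  | i + 1, hi => by
    have h1 := searchTo_add_size_le ht h (i := i) (by omega)
    have hs := r.step i (by omega)
    have h2 := hs.size_principal (ainv ht h (by omega))
    have h3 := hs.size_search
    rw [principalTo_succ, searchTo_succ]
    split
    · rw [Nat.mul_add, Nat.mul_add, Nat.mul_one] at *
      omega
    · have h3 := h3 (by simp_all)
      simp only [Nat.add_zero]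
      omega

theorem search_le {t : Ctx} {r : Run} (ht : t.IsTerm) (h : Init t (r.state 0)) :
    r.search ≤ t.size * (r.principal + 1) :=
  (Nat.le_add_right _ _).trans (searchTo_add_size_le ht h le_rfl)

end Run

end Sesame
namespace Sesame

/-! ### Memory cells and blocks -/

section Defs

variable (M : ℕ → ℕ) (ρ : Var → ℕ)

mutual
/-- The cells that are read to check that a multi-context is stored in the slot `s`. -/
def Val.rd : Val → ℕ → List ℕ
  | .hole _, _ => []
  | .var _, s => [s, M s, M s + 1]
  | .lam x C, s => s :: ([M s, M s + 1, ρ x] ++ ([] ++ C.rd (M s + 3)))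
  | .bang C, s => s :: ([M s] ++ ([] ++ C.rd (M s + 3)))
def Ctx.rd : Ctx → ℕ → List ℕ
  | .val v, s => v.rd s
  | .cut v x C, s => s :: ([M s, M s + 1, ρ x] ++ (v.rd (ρ x + 1) ++ C.rd (M s + 3)))
  | .sub _ v x C, s => s :: ([M s, M s + 1, M s + 4, ρ x] ++ (v.rd (M s + 2) ++ C.rd (M s + 3)))
  | .der _ x C, s => s :: ([M s, M s + 1, M s + 4, ρ x] ++ ([] ++ C.rd (M s + 3)))
end

mutual
/-- The blocks of constructors. -/
def Val.cb : Val → ℕ → List ℕ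
  | .hole _, _ => []
  | .var _, s => [M s]
  | .lam _ C, s => M s :: C.cb (M s + 3)
  | .bang C, s => M s :: C.cb (M s + 3)
def Ctx.cb : Ctx → ℕ → List ℕ
  | .val v, s => v.cb s
  | .cut v x C, s => M s :: (v.cb (ρ x + 1) ++ C.cb (M s + 3))
  | .sub _ v _ C, s => M s :: (v.cb (M s + 2) ++ C.cb (M s + 3))
  | .der _ _ C, s => M s :: C.cb (M s + 3)
end

mutual
/-- The block of a variable bound by a cut, not inside a cut value, refers to the slot of the
cut. -/
def Val.Back : Val → ℕ → Prop
  | .hole _, _ => True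
  | .var _, _ => True
  | .lam _ C, s => C.Back (M s + 3)
  | .bang C, s => C.Back (M s + 3)
def Ctx.Back : Ctx → ℕ → Prop
  | .val v, s => v.Back s
  | .cut _ x C, s => M (ρ x + 3) = s ∧ C.Back (M s + 3)
  | .sub _ v _ C, s => v.Back (M s + 2) ∧ C.Back (M s + 3)
  | .der _ _ C, s => C.Back (M s + 3)
end

/-- The cells read for a pool stored at `p`. -/
def poolRd (η : ℕ → ℕ) : Pool → ℕ → List ℕ
  | [], _ => []
  | (a, t) :: P, p => p :: (p + 1) :: (t.rd M ρ (η a) ++ poolRd η P (M (p + 1)))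

/-- The blocks of cells of the list and of constructors of a pool stored at `p`. -/
def poolCb (η : ℕ → ℕ) : Pool → ℕ → List ℕ
  | [], _ => []
  | (a, t) :: P, p => p :: (t.cb M ρ (η a) ++ poolCb η P (M (p + 1)))

end Defs

section Congr

variable {M M' : ℕ → ℕ} {ρ ρ' : Var → ℕ} {η η' : ℕ → ℕ}

mutual
theorem Val.layout_congr : ∀ {v : Val} {s : ℕ}, (∀ c ∈ v.rd M ρ s, M' c = M c) →
    (∀ x ∈ v.bv, ρ' x = ρ x) → v.rd M' ρ' s = v.rd M ρ s ∧ v.cb M' ρ' s = v.cb M ρ s ∧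
      v.blocks M' ρ' s = v.blocks M ρ s
  | .hole _, _, _, _ => by simp [Val.rd, Val.cb, Val.blocks]
  | .var _, s, h, _ => by
      have h0 : M' s = M s := h s (by simp [Val.rd])
      simp [Val.rd, Val.cb, Val.blocks, h0]
  | .lam x C, s, h, hx => by
      have h0 : M' s = M s := h s (by simp [Val.rd])
      have hx0 : ρ' x = ρ x := hx x (by simp [Val.bv])
      have ih := Ctx.layout_congr (v := C) (s := M s + 3) (fun c hc => h c (by simp [Val.rd, hc]))
        fun y hy => hx y (by simp [Val.bv, hy])
      simp [Val.rd, Val.cb, Val.blocks, h0, ih, hx0]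
  | .bang C, s, h, hx => by
      have h0 : M' s = M s := h s (by simp [Val.rd])
      have ih := Ctx.layout_congr (v := C) (s := M s + 3) (fun c hc => h c (by simp [Val.rd, hc]))
        fun y hy => hx y (by simp [Val.bv, hy])
      simp [Val.rd, Val.cb, Val.blocks, h0, ih]
theorem Ctx.layout_congr : ∀ {v : Ctx} {s : ℕ}, (∀ c ∈ v.rd M ρ s, M' c = M c) →
    (∀ x ∈ v.bv, ρ' x = ρ x) → v.rd M' ρ' s = v.rd M ρ s ∧ v.cb M' ρ' s = v.cb M ρ s ∧
      v.blocks M' ρ' s = v.blocks M ρ s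
  | .val v, s, h, hx => Val.layout_congr (v := v) h hx
  | .cut v x C, s, h, hx => by
      have h0 : M' s = M s := h s (by simp [Ctx.rd])
      have hx0 : ρ' x = ρ x := hx x (by simp [Ctx.bv])
      have ih := Ctx.layout_congr (v := C) (s := M s + 3) (fun c hc => h c (by simp [Ctx.rd, hc]))
        fun y hy => hx y (by simp [Ctx.bv, hy])
      have ih' := Val.layout_congr (v := v) (s := ρ x + 1)
        (fun c hc => h c (by simp [Ctx.rd, hc])) fun y hy => hx y (by simp [Ctx.bv, hy])
      simp [Ctx.rd, Ctx.cb, Ctx.blocks, h0, ih, ih', hx0]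
  | .sub m v x C, s, h, hx => by
      have h0 : M' s = M s := h s (by simp [Ctx.rd])
      have hx0 : ρ' x = ρ x := hx x (by simp [Ctx.bv])
      have ih := Ctx.layout_congr (v := C) (s := M s + 3) (fun c hc => h c (by simp [Ctx.rd, hc]))
        fun y hy => hx y (by simp [Ctx.bv, hy])
      have ih' := Val.layout_congr (v := v) (s := M s + 2)
        (fun c hc => h c (by simp [Ctx.rd, hc])) fun y hy => hx y (by simp [Ctx.bv, hy])
      simp [Ctx.rd, Ctx.cb, Ctx.blocks, h0, ih, ih', hx0]
  | .der m x C, s, h, hx => by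
      have h0 : M' s = M s := h s (by simp [Ctx.rd])
      have hx0 : ρ' x = ρ x := hx x (by simp [Ctx.bv])
      have ih := Ctx.layout_congr (v := C) (s := M s + 3) (fun c hc => h c (by simp [Ctx.rd, hc]))
        fun y hy => hx y (by simp [Ctx.bv, hy])
      simp [Ctx.rd, Ctx.cb, Ctx.blocks, h0, ih, hx0]
end

mutual
theorem Val.At.congr : ∀ {v : Val} {s : ℕ}, v.At M ρ η s → (∀ c ∈ v.rd M ρ s, M' c = M c) →
    (∀ x ∈ v.vars, ρ' x = ρ x) → (∀ a ∈ v.holes, η' a = η a) → v.At M' ρ' η' s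
  | .hole a, _, h, _, _, ha => by simpa [Val.At, ha a (by simp [Val.holes])] using h
  | .var x, s, h, hc, hx, _ => by
      simp only [Val.At, Val.rd, Val.vars, List.mem_cons, List.not_mem_nil, or_false,
        forall_eq_or_imp, forall_eq] at h hc hx ⊢
      simp only [hc, hx, h, and_self]
  | .lam x C, s, h, hc, hx, ha => by
      simp only [Val.At, Val.rd, Val.vars, Val.holes, List.mem_cons, List.mem_append,
        List.not_mem_nil, or_false, false_or, or_imp, forall_and, forall_eq] at h hc hx ha ⊢
      obtain ⟨c1, ⟨c2, c3, c4⟩, c5⟩ := hc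
      simp only [c1, c2, c3, c4, hx.1, h.1, h.2.1, h.2.2.1, true_and]
      exact Ctx.At.congr h.2.2.2 c5 hx.2 ha
  | .bang C, s, h, hc, hx, ha => by
      simp only [Val.At, Val.rd, Val.vars, Val.holes, List.mem_cons, List.mem_append,
        List.not_mem_nil, or_false, false_or, or_imp, forall_and, forall_eq] at h hc hx ha ⊢
      obtain ⟨c1, c2, c5⟩ := hc
      simp only [c1, c2, h.1, true_and]
      exact Ctx.At.congr h.2 c5 hx ha
theorem Ctx.At.congr : ∀ {v : Ctx} {s : ℕ}, v.At M ρ η s → (∀ c ∈ v.rd M ρ s, M' c = M c) →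
    (∀ x ∈ v.vars, ρ' x = ρ x) → (∀ a ∈ v.holes, η' a = η a) → v.At M' ρ' η' s
  | .val v, s, h, hc, hx, ha => Val.At.congr (v := v) h hc hx ha
  | .cut v x C, s, h, hc, hx, ha => by
      simp only [Ctx.At, Ctx.rd, Ctx.vars, Ctx.holes, List.mem_cons, List.mem_append,
        List.not_mem_nil, or_false, or_imp, forall_and, forall_eq] at h hc hx ha ⊢
      obtain ⟨c1, ⟨c2, c3, c4⟩, c5, c6⟩ := hc
      simp only [c1, c2, c3, c4, hx.1, h.1, h.2.1, h.2.2.1, true_and]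
      exact ⟨Val.At.congr h.2.2.2.1 c5 hx.2.1 ha.1, Ctx.At.congr h.2.2.2.2 c6 hx.2.2 ha.2⟩
  | .sub m v x C, s, h, hc, hx, ha => by
      simp only [Ctx.At, Ctx.rd, Ctx.vars, Ctx.holes, List.mem_cons, List.mem_append,
        List.not_mem_nil, or_false, or_imp, forall_and, forall_eq] at h hc hx ha ⊢
      obtain ⟨c1, ⟨c2, c3, c4, c5⟩, c6, c7⟩ := hc
      simp only [c1, c2, c3, c4, c5, hx.1, hx.2.1, h.1, h.2.1, h.2.2.1, h.2.2.2.1, true_and]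
      exact ⟨Val.At.congr h.2.2.2.2.1 c6 hx.2.2.1 ha.1, Ctx.At.congr h.2.2.2.2.2 c7 hx.2.2.2 ha.2⟩
  | .der m x C, s, h, hc, hx, ha => by
      simp only [Ctx.At, Ctx.rd, Ctx.vars, Ctx.holes, List.mem_cons, List.mem_append,
        List.not_mem_nil, or_false, false_or, or_imp, forall_and, forall_eq] at h hc hx ha ⊢
      obtain ⟨c1, ⟨c2, c3, c4, c5⟩, c6⟩ := hc
      simp only [c1, c2, c3, c4, c5, hx.1, hx.2.1, h.1, h.2.1, h.2.2.1, h.2.2.2.1, true_and]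
      exact Ctx.At.congr h.2.2.2.2 c6 hx.2.2 ha
end

theorem PoolAt.congr : ∀ {P : Pool} {p : ℕ}, PoolAt M ρ η P p →
    (∀ c ∈ poolRd M ρ η P p, M' c = M c) → (∀ j ∈ P, ∀ x ∈ j.2.vars, ρ' x = ρ x) →
    (∀ j ∈ P, j.2.holes = []) → (∀ j ∈ P, η' j.1 = η j.1) →
    PoolAt M' ρ' η' P p ∧ poolRd M' ρ' η' P p = poolRd M ρ η P p ∧
      poolCb M' ρ' η' P p = poolCb M ρ η P p
  | [], _, h, _, _, _, _ => ⟨h, rfl, rfl⟩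
  | (a, t) :: P, p, h, hc, hx, ht, he => by
      simp only [poolRd, List.mem_cons, List.mem_append, or_imp, forall_and, forall_eq] at hc hx ht he
      obtain ⟨c1, c2, c3, c4⟩ := hc
      have ih := h.2.2.congr c4 hx.2 ht.2 he.2
      have h2 := Ctx.layout_congr (ρ' := ρ') c3 fun x h => hx.1 x (Ctx.mem_vars_iff.2 (.inr h))
      simp only [PoolAt, poolRd, poolCb, c1, c2, he.1, h2, ih, h.1, true_and, and_true]
      exact h.2.1.congr c3 hx.1 (by simp [ht.1])

end Congr

end Sesame
namespace Sesame

/-- The block of a cell. -/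
def blk (c : ℕ) : ℕ := c / 8 * 8

theorem blk_add {b i : ℕ} (hb : 8 ∣ b) (hi : i < 8) : blk (b + i) = b := by
  unfold blk; omega

theorem blk_self {b : ℕ} (hb : 8 ∣ b) : blk b = b := by
  unfold blk; omega

theorem cells_nodup {s s₁ s₂ : ℕ} {F L₁ L₂ Bs b₁ b₂ : List ℕ} (hF : F.Nodup)
    (hFb : ∀ c ∈ F, blk c ∈ Bs) (h1 : ∀ c ∈ L₁, c = s₁ ∨ blk c ∈ b₁)
    (h2 : ∀ c ∈ L₂, c = s₂ ∨ blk c ∈ b₂) (hs1 : blk s₁ ∈ Bs) (hs2 : blk s₂ ∈ Bs) (hn1 : s₁ ∉ F)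
    (hn2 : s₂ ∉ F) (hn : s₁ ≠ s₂) (nd : (Bs ++ (b₁ ++ b₂)).Nodup)
    (hs : blk s ∉ Bs ++ (b₁ ++ b₂)) (hL1 : L₁.Nodup) (hL2 : L₂.Nodup) :
    (s :: (F ++ (L₁ ++ L₂))).Nodup := by
  simp only [List.nodup_cons, List.nodup_append', List.mem_append, not_or, List.disjoint_left,
    List.mem_append] at *
  grind

section

variable {M : ℕ → ℕ} {ρ : Var → ℕ} {η : ℕ → ℕ}

theorem slots_perm {s : ℕ} {F L₁ L₂ h₁ h₂ : List ℕ} :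
    (s :: (F ++ (L₁ ++ L₂)) ++ (h₁ ++ h₂).map η).Perm
      (s :: (F ++ ((L₁ ++ h₁.map η) ++ (L₂ ++ h₂.map η)))) := by
  rw [List.perm_iff_count]
  intro a
  simp [List.count_cons]
  omega

mutual
theorem Val.slots : ∀ {v : Val} {s : ℕ}, v.At M ρ η s → (∀ b ∈ v.blocks M ρ s, 8 ∣ b) →
    (∀ c ∈ v.rd M ρ s ++ v.holes.map η, c = s ∨ blk c ∈ v.blocks M ρ s) ∧
    ((v.blocks M ρ s).Nodup → blk s ∉ v.blocks M ρ s → (v.rd M ρ s ++ v.holes.map η).Nodup)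
  | .hole a, s, h, _ => by
      simp only [Val.At] at h
      simp [Val.rd, Val.holes, h]
  | .var x, s, h, hb => by
      simp only [Val.blocks, forall_eq, Val.rd, Val.holes, List.map_nil,
        List.append_nil, List.mem_cons, List.not_mem_nil, or_false, forall_eq_or_imp] at hb ⊢
      refine ⟨⟨.inl trivial, .inr (blk_self hb), .inr (blk_add hb (by omega))⟩, fun _ hs => ?_⟩
      exact cells_nodup (s₁ := M s + 6) (s₂ := M s + 7) (F := [M s, M s + 1]) (L₁ := []) (L₂ := [])
        (Bs := [M s]) (b₁ := []) (b₂ := []) (by simp) (by simp [blk_add hb, blk_self hb]) (by simp)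
        (by simp) (by simp [blk_add hb]) (by simp [blk_add hb]) (by simp) (by simp) (by simp)
        (by simp) (by simpa using hs) (by simp) (by simp)
  | .lam x C, s, h, hb => by
      simp only [Val.At, Val.blocks, List.forall_mem_cons] at h hb
      obtain ⟨h1, h2⟩ := Ctx.slots h.2.2.2 hb.2.2
      have p := slots_perm (η := η) (s := s) (F := [M s, M s + 1, ρ x]) (L₁ := [])
        (L₂ := C.rd M ρ (M s + 3)) (h₁ := []) (h₂ := C.holes)
      simp only [Val.rd, Val.holes, Val.blocks]
      refine ⟨fun c hc => ?_, fun hn hs => ?_⟩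
      · rw [← List.nil_append C.holes, p.mem_iff] at hc
        simp only [List.map_nil, List.append_nil, List.nil_append, List.mem_append (s := [_, _, _]),
          List.mem_cons, List.not_mem_nil, or_false] at hc
        rcases hc with rfl | (rfl | rfl | rfl) | hc
        · exact .inl rfl
        · simp [blk_self hb.1]
        · simp [blk_add hb.1]
        · simp [blk_self hb.2.1]
        · rcases h1 c hc with rfl | h1
          · simp [blk_add hb.1]
          · simp [h1]
      · rw [← List.nil_append C.holes, p.nodup_iff]
        simp only [List.nodup_cons, List.mem_cons, not_or] at hn hs
        refine cells_nodup (s₁ := M s + 6) (s₂ := M s + 3) (Bs := [M s, ρ x]) (b₁ := [])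
          (b₂ := C.blocks M ρ (M s + 3)) ?_ ?_ (by simp) h1 (by simp [blk_add hb.1])
          (by simp [blk_add hb.1]) ?_ ?_ (by simp) ?_ ?_ (by simp) (h2 hn.2.2 ?_)
        · simp; omega
        · simp [blk_self hb.1, blk_self hb.2.1, blk_add hb.1]
        · simp; omega
        · simp; omega
        · simp; tauto
        · simp; tauto
        · rw [blk_add hb.1 (by omega)]; tauto
  | .bang C, s, h, hb => by
      simp only [Val.At, Val.blocks, List.forall_mem_cons] at h hb
      obtain ⟨h1, h2⟩ := Ctx.slots h.2 hb.2
      have p := slots_perm (η := η) (s := s) (F := [M s]) (L₁ := [])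
        (L₂ := C.rd M ρ (M s + 3)) (h₁ := []) (h₂ := C.holes)
      simp only [Val.rd, Val.holes, Val.blocks]
      refine ⟨fun c hc => ?_, fun hn hs => ?_⟩
      · rw [← List.nil_append C.holes, p.mem_iff] at hc
        simp only [List.map_nil, List.append_nil, List.nil_append, List.mem_append (s := [_]),
          List.mem_cons, List.not_mem_nil, or_false] at hc
        rcases hc with rfl | rfl | hc
        · exact .inl rfl
        · simp [blk_self hb.1]
        · rcases h1 c hc with rfl | h1
          · simp [blk_add hb.1]
          · simp [h1]
      · rw [← List.nil_append C.holes, p.nodup_iff]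
        simp only [List.nodup_cons, List.mem_cons, not_or] at hn hs
        refine cells_nodup (s₁ := M s + 6) (s₂ := M s + 3) (Bs := [M s]) (b₁ := [])
          (b₂ := C.blocks M ρ (M s + 3)) ?_ ?_ (by simp) h1 (by simp [blk_add hb.1])
          (by simp [blk_add hb.1]) ?_ ?_ (by simp) ?_ ?_ (by simp) (h2 hn.2 ?_)
        · simp
        · simp [blk_self hb.1]
        · simp
        · simp
        · simp; tauto
        · simp; tauto
        · rw [blk_add hb.1 (by omega)]; tauto
theorem Ctx.slots : ∀ {v : Ctx} {s : ℕ}, v.At M ρ η s → (∀ b ∈ v.blocks M ρ s, 8 ∣ b) →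
    (∀ c ∈ v.rd M ρ s ++ v.holes.map η, c = s ∨ blk c ∈ v.blocks M ρ s) ∧
    ((v.blocks M ρ s).Nodup → blk s ∉ v.blocks M ρ s → (v.rd M ρ s ++ v.holes.map η).Nodup)
  | .val v, s, h, hb => Val.slots (v := v) h hb
  | .cut v x C, s, h, hb => by
      simp only [Ctx.At, Ctx.blocks, List.forall_mem_cons, List.forall_mem_append] at h hb
      obtain ⟨h1, h2⟩ := Ctx.slots h.2.2.2.2 hb.2.2.2
      obtain ⟨h3, h4⟩ := Val.slots h.2.2.2.1 hb.2.2.1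
      have p := slots_perm (η := η) (s := s) (F := [M s, M s + 1, ρ x]) (L₁ := v.rd M ρ (ρ x + 1))
        (L₂ := C.rd M ρ (M s + 3)) (h₁ := v.holes) (h₂ := C.holes)
      simp only [Ctx.rd, Ctx.holes, Ctx.blocks]
      refine ⟨fun c hc => ?_, fun hn hs => ?_⟩
      · rw [p.mem_iff, List.mem_cons, List.mem_append, List.mem_append] at hc
        simp only [List.mem_cons, List.not_mem_nil, or_false] at hc
        rcases hc with rfl | (rfl | rfl | rfl) | hc | hc
        · exact .inl rfl
        · simp [blk_self hb.1]
        · simp [blk_add hb.1]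
        · simp [blk_self hb.2.1]
        · rcases h3 c hc with rfl | h1
          · simp [blk_add hb.2.1]
          · simp [h1]
        · rcases h1 c hc with rfl | h1
          · simp [blk_add hb.1]
          · simp [h1]
      · rw [p.nodup_iff]
        simp only [List.nodup_cons, List.mem_cons, not_or, List.nodup_append', List.mem_append] at hn hs
        refine cells_nodup (s₁ := ρ x + 1) (s₂ := M s + 3) (Bs := [M s, ρ x])
          (b₁ := v.blocks M ρ (ρ x + 1)) (b₂ := C.blocks M ρ (M s + 3)) ?_ ?_ h3 h1
          (by simp [blk_add hb.2.1]) (by simp [blk_add hb.1]) ?_ ?_ ?_ ?_ ?_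
          (h4 hn.2.2.1 ?_) (h2 hn.2.2.2.1 ?_)
        · simp; omega
        · simp [blk_self hb.1, blk_self hb.2.1, blk_add hb.1]
        · simp; omega
        · simp; omega
        · omega
        · simp [List.nodup_append']; tauto
        · simp; tauto
        · rw [blk_add hb.2.1 (by omega)]; tauto
        · rw [blk_add hb.1 (by omega)]; tauto
  | .sub m v x C, s, h, hb => by
      simp only [Ctx.At, Ctx.blocks, List.forall_mem_cons, List.forall_mem_append] at h hb
      obtain ⟨h1, h2⟩ := Ctx.slots h.2.2.2.2.2 hb.2.2.2
      obtain ⟨h3, h4⟩ := Val.slots h.2.2.2.2.1 hb.2.2.1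
      have p := slots_perm (η := η) (s := s) (F := [M s, M s + 1, M s + 4, ρ x])
        (L₁ := v.rd M ρ (M s + 2)) (L₂ := C.rd M ρ (M s + 3)) (h₁ := v.holes) (h₂ := C.holes)
      simp only [Ctx.rd, Ctx.holes, Ctx.blocks]
      refine ⟨fun c hc => ?_, fun hn hs => ?_⟩
      · rw [p.mem_iff, List.mem_cons, List.mem_append, List.mem_append] at hc
        simp only [List.mem_cons, List.not_mem_nil, or_false] at hc
        rcases hc with rfl | (rfl | rfl | rfl | rfl) | hc | hc
        · exact .inl rfl
        · simp [blk_self hb.1]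
        · simp [blk_add hb.1]
        · simp [blk_add hb.1]
        · simp [blk_self hb.2.1]
        · rcases h3 c hc with rfl | h1
          · simp [blk_add hb.1]
          · simp [h1]
        · rcases h1 c hc with rfl | h1
          · simp [blk_add hb.1]
          · simp [h1]
      · rw [p.nodup_iff]
        simp only [List.nodup_cons, List.mem_cons, not_or, List.nodup_append', List.mem_append] at hn hs
        refine cells_nodup (s₁ := M s + 2) (s₂ := M s + 3) (Bs := [M s, ρ x])
          (b₁ := v.blocks M ρ (M s + 2)) (b₂ := C.blocks M ρ (M s + 3)) ?_ ?_ h3 h1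
          (by simp [blk_add hb.1]) (by simp [blk_add hb.1]) ?_ ?_ ?_ ?_ ?_
          (h4 hn.2.2.1 ?_) (h2 hn.2.2.2.1 ?_)
        · simp; omega
        · simp [blk_self hb.1, blk_self hb.2.1, blk_add hb.1]
        · simp; omega
        · simp; omega
        · omega
        · simp [List.nodup_append']; tauto
        · simp; tauto
        · rw [blk_add hb.1 (by omega)]; tauto
        · rw [blk_add hb.1 (by omega)]; tauto
  | .der m x C, s, h, hb => by
      simp only [Ctx.At, Ctx.blocks, List.forall_mem_cons] at h hb
      obtain ⟨h1, h2⟩ := Ctx.slots h.2.2.2.2 hb.2.2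
      have p := slots_perm (η := η) (s := s) (F := [M s, M s + 1, M s + 4, ρ x]) (L₁ := [])
        (L₂ := C.rd M ρ (M s + 3)) (h₁ := []) (h₂ := C.holes)
      simp only [Ctx.rd, Ctx.holes, Ctx.blocks]
      refine ⟨fun c hc => ?_, fun hn hs => ?_⟩
      · rw [← List.nil_append C.holes, p.mem_iff] at hc
        simp only [List.map_nil, List.append_nil, List.nil_append,
          List.mem_append (s := [_, _, _, _]), List.mem_cons, List.not_mem_nil, or_false] at hc
        rcases hc with rfl | (rfl | rfl | rfl | rfl) | hc
        · exact .inl rfl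
        · simp [blk_self hb.1]
        · simp [blk_add hb.1]
        · simp [blk_add hb.1]
        · simp [blk_self hb.2.1]
        · rcases h1 c hc with rfl | h1
          · simp [blk_add hb.1]
          · simp [h1]
      · rw [← List.nil_append C.holes, p.nodup_iff]
        simp only [List.nodup_cons, List.mem_cons, not_or] at hn hs
        refine cells_nodup (s₁ := M s + 6) (s₂ := M s + 3) (Bs := [M s, ρ x]) (b₁ := [])
          (b₂ := C.blocks M ρ (M s + 3)) ?_ ?_ (by simp) h1 (by simp [blk_add hb.1])
          (by simp [blk_add hb.1]) ?_ ?_ (by simp) ?_ ?_ (by simp) (h2 hn.2.2 ?_)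
        · simp; omega
        · simp [blk_self hb.1, blk_self hb.2.1, blk_add hb.1]
        · simp; omega
        · simp; omega
        · simp; tauto
        · simp; tauto
        · rw [blk_add hb.1 (by omega)]; tauto
end

mutual
theorem Val.count_blocks (c : ℕ) : ∀ {v : Val} {s : ℕ}, (v.blocks M ρ s).count c =
    (v.cb M ρ s).count c + (v.bv.map ρ).count c
  | .hole _, _ => by simp [Val.blocks, Val.cb, Val.bv]
  | .var _, _ => by simp [Val.blocks, Val.cb, Val.bv]
  | .lam _ C, _ => by
      simp [Val.blocks, Val.cb, Val.bv, Ctx.count_blocks c (v := C), List.count_cons]; omega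
  | .bang C, _ => by
      simp [Val.blocks, Val.cb, Val.bv, Ctx.count_blocks c (v := C), List.count_cons]; omega
theorem Ctx.count_blocks (c : ℕ) : ∀ {v : Ctx} {s : ℕ}, (v.blocks M ρ s).count c =
    (v.cb M ρ s).count c + (v.bv.map ρ).count c
  | .val v, _ => Val.count_blocks c (v := v)
  | .cut v _ C, _ => by
      simp [Ctx.blocks, Ctx.cb, Ctx.bv, Val.count_blocks c (v := v), Ctx.count_blocks c (v := C),
        List.count_cons]; omega
  | .sub _ v _ C, _ => by
      simp [Ctx.blocks, Ctx.cb, Ctx.bv, Val.count_blocks c (v := v), Ctx.count_blocks c (v := C),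
        List.count_cons]; omega
  | .der _ _ C, _ => by
      simp [Ctx.blocks, Ctx.cb, Ctx.bv, Ctx.count_blocks c (v := C), List.count_cons]; omega
end

theorem poolBlocks_count (c : ℕ) : ∀ {P : Pool} {p : ℕ}, (poolBlocks M ρ η P p).count c =
    (poolCb M ρ η P p).count c + ((P.flatMap fun j => j.2.bv).map ρ).count c
  | [], _ => by simp [poolBlocks, poolCb]
  | (a, t) :: P, p => by
      simp [poolBlocks, poolCb, poolBlocks_count c (P := P), Ctx.count_blocks, List.count_cons]
      omega

/-- Off the slot, the cells that are read are in blocks of constructors, or they are one of the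
first two cells of the block of a variable. -/
def Owned (cs : List ℕ) (bs : List Var) (ρ : Var → ℕ) (c : ℕ) : Prop :=
  blk c ∈ cs ∨ ∃ x ∈ bs, c = ρ x ∨ c = ρ x + 1

mutual
theorem Val.rd_owned {c : ℕ} : ∀ {v : Val} {s : ℕ}, (∀ b ∈ v.blocks M ρ s, 8 ∣ b) →
    c ∈ v.rd M ρ s → c = s ∨ Owned (v.cb M ρ s) v.bv ρ c
  | .hole _, _, _, h => by simp [Val.rd] at h
  | .var _, s, hb, h => by
      simp only [Val.blocks, List.forall_mem_cons] at hb
      have h0 := blk_self hb.1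
      have h1 := blk_add hb.1 (i := 1) (by omega)
      simp only [Val.rd, Val.cb, Owned, List.mem_cons, List.not_mem_nil, or_false] at h ⊢
      rcases h with rfl | rfl | rfl <;> simp [*]
  | .lam x C, s, hb, h => by
      simp only [Val.blocks, List.forall_mem_cons] at hb
      have h0 := blk_self hb.1
      have h1 := blk_add hb.1 (i := 1) (by omega)
      have h3 := blk_add hb.1 (i := 3) (by omega)
      have ih := Ctx.rd_owned (c := c) (v := C) (s := M s + 3) hb.2.2
      simp only [Val.rd, Val.cb, Val.bv, Owned, List.mem_append, List.mem_cons, List.not_mem_nil,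
        or_false, false_or, exists_eq_or_imp] at h ih ⊢
      rcases h with rfl | (rfl | rfl | rfl) | h
      · simp
      · simp [h0]
      · simp [h1]
      · simp
      · rcases ih h with rfl | ih | ih
        · simp [h3]
        · simp [ih]
        · exact .inr (.inr (.inr ih))
  | .bang C, s, hb, h => by
      simp only [Val.blocks, List.forall_mem_cons] at hb
      have h0 := blk_self hb.1
      have h3 := blk_add hb.1 (i := 3) (by omega)
      have ih := Ctx.rd_owned (c := c) (v := C) (s := M s + 3) hb.2
      simp only [Val.rd, Val.cb, Val.bv, Owned, List.mem_append, List.mem_cons, List.not_mem_nil,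
        or_false, false_or, exists_eq_or_imp] at h ih ⊢
      rcases h with rfl | rfl | h
      · simp
      · simp [h0]
      · rcases ih h with rfl | ih | ih
        · simp [h3]
        · simp [ih]
        · exact .inr (.inr ih)
theorem Ctx.rd_owned {c : ℕ} : ∀ {v : Ctx} {s : ℕ}, (∀ b ∈ v.blocks M ρ s, 8 ∣ b) →
    c ∈ v.rd M ρ s → c = s ∨ Owned (v.cb M ρ s) v.bv ρ c
  | .val v, _, hb, h => Val.rd_owned (v := v) hb h
  | .cut v x C, s, hb, h => by
      simp only [Ctx.blocks, List.forall_mem_cons, List.forall_mem_append] at hb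
      have h0 := blk_self hb.1
      have h1 := blk_add hb.1 (i := 1) (by omega)
      have h3 := blk_add hb.1 (i := 3) (by omega)
      have ih := Ctx.rd_owned (c := c) (v := C) (s := M s + 3) hb.2.2.2
      have ih' := Val.rd_owned (c := c) (v := v) (s := ρ x + 1) hb.2.2.1
      simp only [Ctx.rd, Ctx.cb, Ctx.bv, Owned, List.mem_append, List.mem_cons, List.not_mem_nil,
        or_false, or_and_right, exists_or] at h ih ih' ⊢
      rcases h with rfl | (rfl | rfl | rfl) | h | h
      · simp
      · simp [h0]
      · simp [h1]
      · simp
      · rcases ih' h with rfl | ih | ih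
        · simp
        · simp [ih]
        · exact .inr (.inr (.inr (.inl ih)))
      · rcases ih h with rfl | ih | ih
        · simp [h3]
        · simp [ih]
        · exact .inr (.inr (.inr (.inr ih)))
  | .sub m v x C, s, hb, h => by
      simp only [Ctx.blocks, List.forall_mem_cons, List.forall_mem_append] at hb
      have h0 := blk_self hb.1
      have h1 := blk_add hb.1 (i := 1) (by omega)
      have h2 := blk_add hb.1 (i := 2) (by omega)
      have h3 := blk_add hb.1 (i := 3) (by omega)
      have h4 := blk_add hb.1 (i := 4) (by omega)
      have ih := Ctx.rd_owned (c := c) (v := C) (s := M s + 3) hb.2.2.2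
      have ih' := Val.rd_owned (c := c) (v := v) (s := M s + 2) hb.2.2.1
      simp only [Ctx.rd, Ctx.cb, Ctx.bv, Owned, List.mem_append, List.mem_cons, List.not_mem_nil,
        or_false, or_and_right, exists_or] at h ih ih' ⊢
      rcases h with rfl | (rfl | rfl | rfl | rfl) | h | h
      · simp
      · simp [h0]
      · simp [h1]
      · simp [h4]
      · simp
      · rcases ih' h with rfl | ih | ih
        · simp [h2]
        · simp [ih]
        · exact .inr (.inr (.inr (.inl ih)))
      · rcases ih h with rfl | ih | ih
        · simp [h3]
        · simp [ih]
        · exact .inr (.inr (.inr (.inr ih)))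
  | .der m x C, s, hb, h => by
      simp only [Ctx.blocks, List.forall_mem_cons] at hb
      have h0 := blk_self hb.1
      have h1 := blk_add hb.1 (i := 1) (by omega)
      have h3 := blk_add hb.1 (i := 3) (by omega)
      have h4 := blk_add hb.1 (i := 4) (by omega)
      have ih := Ctx.rd_owned (c := c) (v := C) (s := M s + 3) hb.2.2
      simp only [Ctx.rd, Ctx.cb, Ctx.bv, Owned, List.mem_append, List.mem_cons, List.not_mem_nil,
        or_false, false_or, exists_eq_or_imp] at h ih ⊢
      rcases h with rfl | (rfl | rfl | rfl | rfl) | h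
      · simp
      · simp [h0]
      · simp [h1]
      · simp [h4]
      · simp
      · rcases ih h with rfl | ih | ih
        · simp [h3]
        · simp [ih]
        · exact .inr (.inr (.inr ih))
end

end

end Sesame
namespace Sesame

section

variable {M M' : ℕ → ℕ} {ρ ρ' : Var → ℕ} {η η' : ℕ → ℕ}

mutual
theorem Val.Back.congr : ∀ {v : Val} {s : ℕ}, v.Back M ρ s → (∀ c ∈ v.rd M ρ s, M' c = M c) →
    (∀ x ∈ v.bv, M' (ρ' x + 3) = M (ρ x + 3)) → v.Back M' ρ' s
  | .hole _, _, _, _, _ => trivial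
  | .var _, _, _, _, _ => trivial
  | .lam x C, s, h, hc, hx => by
      have h0 : M' s = M s := hc s (by simp [Val.rd])
      simp only [Val.Back, h0] at h ⊢
      exact h.congr (fun c h => hc c (by simp [Val.rd, h])) fun c h => hx c (by simp [Val.bv, h])
  | .bang C, s, h, hc, hx => by
      have h0 : M' s = M s := hc s (by simp [Val.rd])
      simp only [Val.Back, h0] at h ⊢
      exact h.congr (fun c h => hc c (by simp [Val.rd, h])) fun c h => hx c (by simp [Val.bv, h])
theorem Ctx.Back.congr : ∀ {v : Ctx} {s : ℕ}, v.Back M ρ s → (∀ c ∈ v.rd M ρ s, M' c = M c) →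
    (∀ x ∈ v.bv, M' (ρ' x + 3) = M (ρ x + 3)) → v.Back M' ρ' s
  | .val v, _, h, hc, hx => Val.Back.congr (v := v) h hc hx
  | .cut v x C, s, h, hc, hx => by
      have h0 : M' s = M s := hc s (by simp [Ctx.rd])
      simp only [Ctx.Back, h0] at h ⊢
      exact ⟨(hx x (by simp [Ctx.bv])).trans h.1, h.2.congr (fun c h => hc c (by simp [Ctx.rd, h]))
        fun c h => hx c (by simp [Ctx.bv, h])⟩
  | .sub _ v x C, s, h, hc, hx => by
      have h0 : M' s = M s := hc s (by simp [Ctx.rd])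
      simp only [Ctx.Back, h0] at h ⊢
      exact ⟨h.1.congr (fun c h => hc c (by simp [Ctx.rd, h]))
        fun c h => hx c (by simp [Ctx.bv, h]), h.2.congr (fun c h => hc c (by simp [Ctx.rd, h]))
        fun c h => hx c (by simp [Ctx.bv, h])⟩
  | .der _ x C, s, h, hc, hx => by
      have h0 : M' s = M s := hc s (by simp [Ctx.rd])
      simp only [Ctx.Back, h0] at h ⊢
      exact h.congr (fun c h => hc c (by simp [Ctx.rd, h])) fun c h => hx c (by simp [Ctx.bv, h])
end

mutual
theorem Val.flag_eq_zero {J : ℕ → Var → Prop} {N : ℕ} {G : ℕ → Prop} {a : ℕ} {x : Var}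
    (hJ : J a x) : ∀ {v : Val} {s : ℕ} {top : Prop}, v.At M ρ η s → v.Shape N G top →
    a ∈ v.holes → ¬ v.FV J x → x ∉ v.dom → M (ρ x) = 0
  | .hole b, _, _, _, _, ha, hv, _ => by
      simp [Val.holes] at ha; subst ha; exact absurd hJ hv
  | .var _, _, _, _, _, ha, _, _ => by simp [Val.holes] at ha
  | .lam y C, s, _, h, hs, ha, hv, hd => by
      by_cases e : x = y
      · subst e; exact h.2.2.1
      · exact Ctx.flag_eq_zero hJ h.2.2.2 hs ha (fun h' => hv ⟨h', e⟩) hd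
  | .bang C, s, _, h, hs, ha, hv, hd => Ctx.flag_eq_zero hJ h.2 hs ha hv hd
theorem Ctx.flag_eq_zero {J : ℕ → Var → Prop} {N : ℕ} {G : ℕ → Prop} {a : ℕ} {x : Var}
    (hJ : J a x) : ∀ {v : Ctx} {s : ℕ}, v.At M ρ η s → v.Shape N G →
    a ∈ v.holes → ¬ v.FV J x → x ∉ v.dom → M (ρ x) = 0
  | .val v, _, h, hs, ha, hv, hd => Val.flag_eq_zero hJ (v := v) h hs ha hv hd
  | .cut v y C, s, h, hs, ha, hv, hd => by
      simp only [Ctx.holes, hs.1, List.nil_append] at ha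
      rw [Ctx.dom, if_neg (List.ne_nil_of_mem ha), List.mem_cons, not_or] at hd
      exact Ctx.flag_eq_zero hJ h.2.2.2.2 hs.2.2 ha (fun h' => hv (.inr ⟨h', hd.1⟩)) hd.2
  | .sub m v y C, s, h, hs, ha, hv, hd => by
      by_cases e : x = y
      · subst e; exact h.2.2.2.1
      · simp only [Ctx.dom, List.mem_append, not_or] at hd
        simp only [Ctx.holes, List.mem_append] at ha
        rcases ha with ha | ha
        · exact Val.flag_eq_zero hJ h.2.2.2.2.1 hs.1 ha (fun h' => hv (.inr (.inl h'))) hd.1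
        · exact Ctx.flag_eq_zero hJ h.2.2.2.2.2 hs.2 ha (fun h' => hv (.inr (.inr ⟨h', e⟩))) hd.2
  | .der m y C, s, h, hs, ha, hv, hd => by
      by_cases e : x = y
      · subst e; exact h.2.2.2.1
      · exact Ctx.flag_eq_zero hJ h.2.2.2.2 hs ha (fun h' => hv (.inr ⟨h', e⟩)) hd
end

theorem Ctx.At.congr_hole {C : Ctx} {s : ℕ} (h : C.At M ρ η s) (hη : ∀ b ∈ C.holes, η' b = η b) :
    C.At M ρ η' s := h.congr (fun _ _ => rfl) (fun _ _ => rfl) hη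

theorem Val.At.congr_hole {C : Val} {s : ℕ} (h : C.At M ρ η s) (hη : ∀ b ∈ C.holes, η' b = η b) :
    C.At M ρ η' s := h.congr (fun _ _ => rfl) (fun _ _ => rfl) hη

namespace Plug

variable {a : ℕ} {D C R : Ctx}

theorem at_ (h : Plug a D C R) {s : ℕ} (hC : C.At M ρ η s) (hD : D.At M ρ η' (η a))
    (hη : ∀ b ∈ C.holes, b ≠ a → η' b = η b) : R.At M ρ η' s := by
  induction h generalizing s with
  | top => simp only [Ctx.At, Val.At] at hC; rwa [← hC]
  | lam x _ ih => exact ⟨hC.1, hC.2.1, hC.2.2.1, ih hC.2.2.2 hη⟩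
  | bang _ ih => exact ⟨hC.1, ih hC.2 hη⟩
  | der _ _ _ ih =>
    exact ⟨hC.1, hC.2.1, hC.2.2.1, hC.2.2.2.1, ih hC.2.2.2.2 hη⟩
  | cut v x hv _ ih =>
    exact ⟨hC.1, hC.2.1, hC.2.2.1, hC.2.2.2.1.congr_hole (by simp [hv]),
      ih hC.2.2.2.2 fun b hb => hη b (by simp [Ctx.holes, hb])⟩
  | sub m v x hv _ ih =>
    exact ⟨hC.1, hC.2.1, hC.2.2.1, hC.2.2.2.1, hC.2.2.2.2.1.congr_hole fun b hb =>
      hη b (by simp [Ctx.holes, hb]) fun e => hv (e ▸ hb),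
      ih hC.2.2.2.2.2 fun b hb => hη b (by simp [Ctx.holes, hb])⟩
  | subHole m x C h1 hw h2 =>
    subst h2
    have h3 := hC.2.2.2.2.1
    simp only [Val.At] at h3
    exact ⟨hC.1, hC.2.1, hC.2.2.1, hC.2.2.2.1, h3 ▸ hD,
      hC.2.2.2.2.2.congr_hole fun b hb =>
      hη b (by simp [Ctx.holes, hb]) fun e => h1 (e ▸ hb)⟩
  | subLam m z x E hE _ ih =>
    exact ⟨hC.1, hC.2.1, hC.2.2.1, hC.2.2.2.1, ⟨hC.2.2.2.2.1.1, hC.2.2.2.2.1.2.1, hC.2.2.2.2.1.2.2.1,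
      ih hC.2.2.2.2.1.2.2.2 fun b hb => hη b (by simp [Ctx.holes, Val.holes, hb])⟩,
      hC.2.2.2.2.2.congr_hole fun b hb =>
      hη b (by simp [Ctx.holes, hb]) fun e => hE (e ▸ hb)⟩
  | subBang m x E hE _ ih =>
    exact ⟨hC.1, hC.2.1, hC.2.2.1, hC.2.2.2.1, ⟨hC.2.2.2.2.1.1,
      ih hC.2.2.2.2.1.2 fun b hb => hη b (by simp [Ctx.holes, Val.holes, hb])⟩,
      hC.2.2.2.2.2.congr_hole fun b hb =>
      hη b (by simp [Ctx.holes, hb]) fun e => hE (e ▸ hb)⟩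

theorem count_cb (h : Plug a D C R) {s : ℕ} (hC : C.At M ρ η s) (c : ℕ) :
    (R.cb M ρ s).count c = (C.cb M ρ s).count c + (D.cb M ρ (η a)).count c := by
  induction h generalizing s with
  | top =>
    simp only [Ctx.At, Val.At] at hC
    simp [Ctx.cb, Val.cb, hC]
  | lam x _ ih => simp [Ctx.cb, Val.cb, List.count_cons, ih hC.2.2.2]; omega
  | bang _ ih => simp [Ctx.cb, Val.cb, List.count_cons, ih hC.2]; omega
  | der _ _ _ ih => simp [Ctx.cb, List.count_cons, ih hC.2.2.2.2]; omega
  | cut v x hv _ ih => simp [Ctx.cb, List.count_cons, ih hC.2.2.2.2]; omega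
  | sub m v x hv _ ih => simp [Ctx.cb, List.count_cons, ih hC.2.2.2.2.2]; omega
  | subHole m x C h1 hw h2 =>
    have h3 := hC.2.2.2.2.1
    simp only [Val.At] at h3
    simp [Ctx.cb, Val.cb, List.count_cons, h2, h3]; omega
  | subLam m z x E hE _ ih =>
    simp [Ctx.cb, Val.cb, List.count_cons, ih hC.2.2.2.2.1.2.2.2]; omega
  | subBang m x E hE _ ih =>
    simp [Ctx.cb, Val.cb, List.count_cons, ih hC.2.2.2.2.1.2]; omega

theorem back (h : Plug a D C R) {s : ℕ} (hA : C.At M ρ η s) (hC : C.Back M ρ s)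
    (hD : D.Back M ρ (η a)) : R.Back M ρ s := by
  induction h generalizing s with
  | top => simp only [Ctx.At, Val.At] at hA; rwa [← hA]
  | lam x _ ih => exact ih hA.2.2.2 hC
  | bang _ ih => exact ih hA.2 hC
  | der _ _ _ ih => exact ih hA.2.2.2.2 hC
  | cut v x hv _ ih => exact ⟨hC.1, ih hA.2.2.2.2 hC.2⟩
  | sub m v x hv _ ih => exact ⟨hC.1, ih hA.2.2.2.2.2 hC.2⟩
  | subHole m x C h1 hw h2 =>
    subst h2
    have h3 := hA.2.2.2.2.1
    simp only [Val.At] at h3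
    exact ⟨h3 ▸ hD, hC.2⟩
  | subLam m z x E hE _ ih => exact ⟨ih hA.2.2.2.2.1.2.2.2 hC.1, hC.2⟩
  | subBang m x E hE _ ih => exact ⟨ih hA.2.2.2.2.1.2 hC.1, hC.2⟩

end Plug

/-- The spine cut that is removed is stored in the slot `sc`. -/
inductive SpineM (M : ℕ → ℕ) (ρ : Var → ℕ) (v : Val) (x : Var) (a : ℕ) (B : Ctx) (sc : ℕ) :
    Ctx → Ctx → ℕ → Prop where
  | here : a ∈ B.holes → SpineM M ρ v x a B sc (.cut v x B) B sc
  | lam {C D : Ctx} {s : ℕ} (y : Var) : SpineM M ρ v x a B sc C D (M s + 3) →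
      SpineM M ρ v x a B sc (.val (.lam y C)) (.val (.lam y D)) s
  | bang {C D : Ctx} {s : ℕ} : SpineM M ρ v x a B sc C D (M s + 3) →
      SpineM M ρ v x a B sc (.val (.bang C)) (.val (.bang D)) s
  | cut {C D : Ctx} {s : ℕ} (w : Val) (y : Var) : SpineM M ρ v x a B sc C D (M s + 3) →
      SpineM M ρ v x a B sc (.cut w y C) (.cut w y D) s
  | sub {C D : Ctx} {s : ℕ} (m : ℕ) (w : Val) (y : Var) : SpineM M ρ v x a B sc C D (M s + 3) →
      SpineM M ρ v x a B sc (.sub m w y C) (.sub m w y D) s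
  | subLam {C D : Ctx} {s : ℕ} (m : ℕ) (z y : Var) (E : Ctx) :
      SpineM M ρ v x a B sc C D (M (M s + 2) + 3) →
      SpineM M ρ v x a B sc (.sub m (.lam z C) y E) (.sub m (.lam z D) y E) s
  | subBang {C D : Ctx} {s : ℕ} (m : ℕ) (y : Var) (E : Ctx) :
      SpineM M ρ v x a B sc C D (M (M s + 2) + 3) →
      SpineM M ρ v x a B sc (.sub m (.bang C) y E) (.sub m (.bang D) y E) s
  | der {C D : Ctx} {s : ℕ} (e : ℕ) (y : Var) : SpineM M ρ v x a B sc C D (M s + 3) →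
      SpineM M ρ v x a B sc (.der e y C) (.der e y D) s

theorem Spine.spineM {v : Val} {x : Var} {a : ℕ} {B C D : Ctx} (h : Spine v x a B C D) (s : ℕ) :
    ∃ sc, SpineM M ρ v x a B sc C D s := by
  induction h generalizing s with
  | here h => exact ⟨s, .here h⟩
  | lam y h ih => exact (ih _).imp fun _ => .lam y
  | bang h ih => exact (ih _).imp fun _ => .bang
  | cut w y h1 h2 h ih => exact (ih _).imp fun _ => .cut w y
  | sub m w y h ih => exact (ih _).imp fun _ => .sub m w y
  | subLam m z y E h ih => exact (ih _).imp fun _ => .subLam m z y E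
  | subBang m y E h ih => exact (ih _).imp fun _ => .subBang m y E
  | der e y h ih => exact (ih _).imp fun _ => .der e y

namespace SpineM

variable {v : Val} {x : Var} {a sc s : ℕ} {B C D : Ctx}

theorem at_cut (h : SpineM M ρ v x a B sc C D s) (hC : C.At M ρ η s) :
    (Ctx.cut v x B).At M ρ η sc := by
  induction h with
  | here => exact hC
  | lam _ _ ih => exact ih hC.2.2.2
  | bang _ ih => exact ih hC.2
  | der _ _ _ ih | cut _ _ _ ih => exact ih hC.2.2.2.2
  | sub _ _ _ _ ih => exact ih hC.2.2.2.2.2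
  | subLam _ _ _ _ _ ih => exact ih hC.2.2.2.2.1.2.2.2
  | subBang _ _ _ _ ih => exact ih hC.2.2.2.2.1.2

theorem back_eq (h : SpineM M ρ v x a B sc C D s) (hC : C.Back M ρ s) : M (ρ x + 3) = sc := by
  induction h with
  | here => exact hC.1
  | lam _ _ ih | bang _ ih | der _ _ _ ih => exact ih hC
  | cut _ _ _ ih | sub _ _ _ _ ih => exact ih hC.2
  | subLam _ _ _ _ _ ih | subBang _ _ _ _ ih => exact ih hC.1

theorem rd_subset (h : SpineM M ρ v x a B sc C D s) {c : ℕ}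
    (hc : c ∈ (Ctx.cut v x B).rd M ρ sc) : c ∈ C.rd M ρ s := by
  induction h with
  | here => exact hc
  | _ => simp_all [Ctx.rd, Val.rd]

theorem mem_holes (h : SpineM M ρ v x a B sc C D s) : a ∈ C.holes := by
  induction h <;> simp_all [Ctx.holes, Val.holes]

theorem body_bv (h : SpineM M ρ v x a B sc C D s) {y : Var} (hy : y ∈ B.bv) : y ∈ C.bv := by
  induction h <;> simp_all [Ctx.bv, Val.bv]

end SpineM

/-- A multi-context may be moved to another slot. -/
theorem Ctx.at_shift {C : Ctx} {s s' : ℕ} (hC : ∀ b, C ≠ .hole b) (h : C.At M ρ η s)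
    (hs : M' s' = M s) (hc : ∀ c ∈ (C.rd M ρ s).tail, M' c = M c)
    (hη : ∀ b ∈ C.holes, η' b = η b) :
    C.At M' ρ η' s' ∧ C.cb M' ρ s' = C.cb M ρ s ∧ C.rd M' ρ s' = s' :: (C.rd M ρ s).tail ∧
      C.rd M ρ s = s :: (C.rd M ρ s).tail := by
  match C with
  | .val (.hole b) => exact absurd rfl (hC b)
  | .val (.var y) =>
    simp only [Ctx.rd, Val.rd, List.tail_cons, List.forall_mem_cons] at hc
    simp only [Ctx.At, Val.At, Ctx.cb, Val.cb, Ctx.rd, Val.rd, hs, hc.1, hc.2.1] at h ⊢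
    exact ⟨h, by simp⟩
  | .val (.lam y E) =>
    simp only [Ctx.rd, Val.rd, List.tail_cons, List.forall_mem_cons, List.forall_mem_append] at hc
    obtain ⟨⟨c1, c2, c3, -⟩, -, c4⟩ := hc
    have h5 := Ctx.layout_congr (ρ' := ρ) c4 fun _ _ => rfl
    simp only [Ctx.At, Val.At, Ctx.cb, Val.cb, Ctx.rd, Val.rd, hs, c1, c2, c3, h5] at h ⊢
    exact ⟨⟨h.1, h.2.1, h.2.2.1, h.2.2.2.congr c4 (fun _ _ => rfl) hη⟩, by simp⟩
  | .val (.bang E) =>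
    simp only [Ctx.rd, Val.rd, List.tail_cons, List.forall_mem_cons, List.forall_mem_append] at hc
    obtain ⟨⟨c1, -⟩, -, c4⟩ := hc
    have h5 := Ctx.layout_congr (ρ' := ρ) c4 fun _ _ => rfl
    simp only [Ctx.At, Val.At, Ctx.cb, Val.cb, Ctx.rd, Val.rd, hs, c1, h5] at h ⊢
    exact ⟨⟨h.1, h.2.congr c4 (fun _ _ => rfl) hη⟩, by simp⟩
  | .cut w y E =>
    simp only [Ctx.rd, List.tail_cons, List.forall_mem_cons, List.forall_mem_append] at hc
    obtain ⟨⟨c1, c2, c3, -⟩, c5, c4⟩ := hc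
    have h5 := Ctx.layout_congr (ρ' := ρ) c4 fun _ _ => rfl
    have h6 := Val.layout_congr (ρ' := ρ) c5 fun _ _ => rfl
    simp only [Ctx.At, Ctx.cb, Ctx.rd, hs, c1, c2, c3, h5, h6] at h ⊢
    exact ⟨⟨h.1, h.2.1, h.2.2.1, h.2.2.2.1.congr c5 (fun _ _ => rfl)
      fun b hb => hη b (by simp [Ctx.holes, hb]), h.2.2.2.2.congr c4 (fun _ _ => rfl)
      fun b hb => hη b (by simp [Ctx.holes, hb])⟩, by simp⟩
  | .sub m w y E =>
    simp only [Ctx.rd, List.tail_cons, List.forall_mem_cons, List.forall_mem_append] at hc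
    obtain ⟨⟨c1, c2, c2', c3, -⟩, c5, c4⟩ := hc
    have h5 := Ctx.layout_congr (ρ' := ρ) c4 fun _ _ => rfl
    have h6 := Val.layout_congr (ρ' := ρ) c5 fun _ _ => rfl
    simp only [Ctx.At, Ctx.cb, Ctx.rd, hs, c1, c2, c2', c3, h5, h6] at h ⊢
    exact ⟨⟨h.1, h.2.1, h.2.2.1, h.2.2.2.1, h.2.2.2.2.1.congr c5 (fun _ _ => rfl)
      fun b hb => hη b (by simp [Ctx.holes, hb]), h.2.2.2.2.2.congr c4 (fun _ _ => rfl)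
      fun b hb => hη b (by simp [Ctx.holes, hb])⟩, by simp⟩
  | .der m y E =>
    simp only [Ctx.rd, List.tail_cons, List.forall_mem_cons, List.forall_mem_append] at hc
    obtain ⟨⟨c1, c2, c2', c3, -⟩, -, c4⟩ := hc
    have h5 := Ctx.layout_congr (ρ' := ρ) c4 fun _ _ => rfl
    simp only [Ctx.At, Ctx.cb, Ctx.rd, hs, c1, c2, c2', c3, h5] at h ⊢
    exact ⟨⟨h.1, h.2.1, h.2.2.1, h.2.2.2.1, h.2.2.2.2.congr c4 (fun _ _ => rfl) hη⟩, by simp⟩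

theorem Ctx.rd_eq_cons {C : Ctx} {s : ℕ} (hC : ∀ b, C ≠ .hole b) :
    C.rd M ρ s = s :: (C.rd M ρ s).tail := by
  match C with
  | .val (.hole b) => exact absurd rfl (hC b)
  | .val (.var _) | .val (.lam _ _) | .val (.bang _) => rfl
  | .cut _ _ _ | .sub _ _ _ _ | .der _ _ _ => rfl

theorem Ctx.at_move {C : Ctx} {s s' : ℕ} (hC : ∀ b, C ≠ .hole b) (h : C.At M ρ η s)
    (hn : (C.rd M ρ s).Nodup) (hs : M' s' = M s)
    (hc : ∀ c ∈ C.rd M ρ s, c ≠ s → M' c = M c) (hη : ∀ b ∈ C.holes, η' b = η b) :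
    C.At M' ρ η' s' ∧ C.cb M' ρ s' = C.cb M ρ s ∧ C.rd M' ρ s' = s' :: (C.rd M ρ s).tail ∧
      C.rd M ρ s = s :: (C.rd M ρ s).tail := by
  refine Ctx.at_shift hC h hs (fun c h' => hc c (List.mem_of_mem_tail h') ?_) hη
  rw [Ctx.rd_eq_cons hC, List.nodup_cons] at hn
  rintro rfl
  exact hn.1 h'


end

end Sesame
namespace Sesame

section

variable {M M' : ℕ → ℕ} {ρ : Var → ℕ} {η η' : ℕ → ℕ}

/-- The cells that are no longer read at their place when the cut `[v→x]` of the slot `sc` is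
removed. -/
def Touched (M : ℕ → ℕ) (ρ : Var → ℕ) (v : Val) (x : Var) (sc : ℕ) (c : ℕ) : Prop :=
  c = sc ∨ c = ρ x ∨ c ∈ v.rd M ρ (ρ x + 1)

namespace SpineM

variable {v : Val} {x : Var} {a sc s : ℕ} {B C D : Ctx}

theorem touched_mem (h : SpineM M ρ v x a B sc C D s) {c : ℕ} (hc : Touched M ρ v x sc c) :
    c ∈ C.rd M ρ s := by
  refine h.rd_subset ?_
  rcases hc with rfl | rfl | h <;> simp [Ctx.rd, *]

/-- The memory after the removal of a cut. -/
theorem remove (h : SpineM M ρ v x a B sc C D s) (hC : C.At M ρ η s)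
    (hn : (C.rd M ρ s).Nodup) (hh : C.holes.Nodup)
    (hM : ∀ c ∈ C.rd M ρ s, ¬ Touched M ρ v x sc c → M' c = M c)
    (hη : ∀ b ∈ C.holes, b ≠ a → η' b = η b)
    (hB : B = .hole a → η' a = sc)
    (hB' : B ≠ .hole a → η' a = η a ∧ M' sc = M (M sc + 3)) :
    D.At M' ρ η' s ∧ ∀ c, (C.cb M ρ s).count c =
      (M sc :: v.cb M ρ (ρ x + 1)).count c + (D.cb M' ρ s).count c := by
  induction h with
  | here hab =>
    simp only [Ctx.rd, List.nodup_cons, List.nodup_append', List.mem_cons, List.mem_append, not_or,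
      List.disjoint_left] at hn
    have hcB : ∀ c ∈ B.rd M ρ (M sc + 3), M' c = M c := fun c hc =>
      hM c (by simp [Ctx.rd, hc]) (by
        rintro (rfl | rfl | h)
        · tauto
        · exact (hn.2.2.2 (.inr (.inr (.inl rfl)))).2 hc
        · exact hn.2.2.1.2.2 h hc)
    by_cases e : B = .hole a
    · subst e
      refine ⟨by simpa [Ctx.At, Val.At] using hB rfl, fun c => ?_⟩
      simp [Ctx.cb, Val.cb, List.count_cons]
    · have e' : ∀ b, B ≠ .hole b := by
        rintro b rfl
        simp [Ctx.holes, Val.holes] at hab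
        exact e (hab ▸ rfl)
      have := Ctx.at_move e' hC.2.2.2.2 hn.2.2.1.2.1 (hB' e).2 (fun c h _ => hcB c h) (η' := η')
        fun b hb => by
          by_cases h : b = a
          · rw [h, (hB' e).1]
          · exact hη b (by simp [Ctx.holes, hb]) h
      refine ⟨this.1, fun c => ?_⟩
      simp [Ctx.cb, this.2.1, List.count_cons]
      omega
  | @lam C D s y h ih =>
    have ht := fun c => h.touched_mem (c := c)
    simp only [Ctx.rd, Val.rd, List.mem_cons, List.mem_append, List.not_mem_nil, or_false,
      false_or] at hM
    simp only [Ctx.rd, Val.rd, List.nodup_cons, List.nodup_append', List.mem_cons, List.mem_append,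
      not_or, List.disjoint_left, List.not_mem_nil, or_false, false_or] at hn
    have m0 : M' s = M s := hM _ (by simp) fun h' => hn.1.2 (ht _ h')
    have m1 : M' (M s) = M (M s) := hM _ (by simp) fun h' => hn.2.2.2 (.inl rfl) (ht _ h')
    have m2 : M' (M s + 1) = M (M s + 1) := hM _ (by simp) fun h' => hn.2.2.2 (by simp) (ht _ h')
    have m3 : M' (ρ y) = M (ρ y) := hM _ (by simp) fun h' => hn.2.2.2 (by simp) (ht _ h')
    obtain ⟨i1, i2⟩ := ih hC.2.2.2 hn.2.2.1.2.1 hh (fun c hc => hM c (by simp [hc])) hη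
    simp only [Ctx.At, Val.At, Ctx.cb, Val.cb, m0, m1, m2, m3, List.count_cons] at hC i2 ⊢
    exact ⟨⟨hC.1, hC.2.1, hC.2.2.1, i1⟩, fun c => by have := i2 c; omega⟩
  | @bang C D s h ih =>
    have ht := fun c => h.touched_mem (c := c)
    simp only [Ctx.rd, Val.rd, List.mem_cons, List.mem_append, List.not_mem_nil, or_false,
      false_or] at hM
    simp only [Ctx.rd, Val.rd, List.nodup_cons, List.nodup_append', List.mem_cons, List.mem_append,
      not_or, List.disjoint_left, List.not_mem_nil, or_false, false_or] at hn
    have m0 : M' s = M s := hM _ (by simp) fun h' => hn.1.2 (ht _ h')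
    have m1 : M' (M s) = M (M s) := hM _ (by simp) fun h' => hn.2.2.2 rfl (ht _ h')
    obtain ⟨i1, i2⟩ := ih hC.2 hn.2.2.1.2.1 hh (fun c hc => hM c (by simp [hc])) hη
    simp only [Ctx.At, Val.At, Ctx.cb, Val.cb, m0, m1, List.count_cons] at hC i2 ⊢
    exact ⟨⟨hC.1, i1⟩, fun c => by have := i2 c; omega⟩
  | @der C D s e y h ih =>
    have ht := fun c => h.touched_mem (c := c)
    simp only [Ctx.rd, List.mem_cons, List.mem_append, List.not_mem_nil, or_false,
      false_or] at hM
    simp only [Ctx.rd, List.nodup_cons, List.nodup_append', List.mem_cons, List.mem_append,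
      not_or, List.disjoint_left, List.not_mem_nil, or_false, false_or] at hn
    have m0 : M' s = M s := hM _ (by simp) fun h' => hn.1.2 (ht _ h')
    have m1 : M' (M s) = M (M s) := hM _ (by simp) fun h' => hn.2.2.2 (.inl rfl) (ht _ h')
    have m2 : M' (M s + 1) = M (M s + 1) := hM _ (by simp) fun h' => hn.2.2.2 (by simp) (ht _ h')
    have m3 : M' (ρ y) = M (ρ y) := hM _ (by simp) fun h' => hn.2.2.2 (by simp) (ht _ h')
    have m4 : M' (M s + 4) = M (M s + 4) := hM _ (by simp) fun h' => hn.2.2.2 (by simp) (ht _ h')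
    obtain ⟨i1, i2⟩ := ih hC.2.2.2.2 hn.2.2.1.2.1 hh (fun c hc => hM c (by simp [hc])) hη
    simp only [Ctx.At, Ctx.cb, m0, m1, m2, m3, m4, List.count_cons] at hC i2 ⊢
    exact ⟨⟨hC.1, hC.2.1, hC.2.2.1, hC.2.2.2.1, i1⟩, fun c => by have := i2 c; omega⟩
  | @cut C D s w y h ih =>
    have ht := fun c => h.touched_mem (c := c)
    have ha := h.mem_holes
    simp only [Ctx.rd, List.mem_cons, List.mem_append, List.not_mem_nil, or_false] at hM
    simp only [Ctx.rd, List.nodup_cons, List.nodup_append', List.mem_cons, List.mem_append,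
      not_or, List.disjoint_left, List.not_mem_nil, or_false] at hn
    simp only [Ctx.holes, List.nodup_append', List.mem_append, List.disjoint_left] at hh hη
    have m0 : M' s = M s := hM _ (by simp) fun h' => hn.1.2.2 (ht _ h')
    have m1 : M' (M s) = M (M s) := hM _ (by simp) fun h' => (hn.2.2.2 (.inl rfl)).2 (ht _ h')
    have m2 : M' (M s + 1) = M (M s + 1) :=
      hM _ (by simp) fun h' => (hn.2.2.2 (by simp)).2 (ht _ h')
    have m3 : M' (ρ y) = M (ρ y) := hM _ (by simp) fun h' => (hn.2.2.2 (by simp)).2 (ht _ h')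
    have mw : ∀ c ∈ w.rd M ρ (ρ y + 1), M' c = M c := fun c hc =>
      hM c (by simp [hc]) fun h' => hn.2.2.1.2.2 hc (ht _ h')
    obtain ⟨i1, i2⟩ := ih hC.2.2.2.2 hn.2.2.1.2.1 hh.2.1 (fun c hc => hM c (by simp [hc]))
      fun b hb => hη b (.inr hb)
    have h5 := Val.layout_congr (ρ' := ρ) mw fun _ _ => rfl
    simp only [Ctx.At, Ctx.cb, m0, m1, m2, m3, List.count_cons, h5, List.count_append] at hC i2 ⊢
    exact ⟨⟨hC.1, hC.2.1, hC.2.2.1, hC.2.2.2.1.congr mw (fun _ _ => rfl)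
      fun b hb => hη b (.inl hb) fun e => hh.2.2 hb (e ▸ ha), i1⟩,
      fun c => by have := i2 c; omega⟩
  | @sub C D s m w y h ih =>
    have ht := fun c => h.touched_mem (c := c)
    have ha := h.mem_holes
    simp only [Ctx.rd, List.mem_cons, List.mem_append, List.not_mem_nil, or_false] at hM
    simp only [Ctx.rd, List.nodup_cons, List.nodup_append', List.mem_cons, List.mem_append,
      not_or, List.disjoint_left, List.not_mem_nil, or_false] at hn
    simp only [Ctx.holes, List.nodup_append', List.mem_append, List.disjoint_left] at hh hη
    have m0 : M' s = M s := hM _ (by simp) fun h' => hn.1.2.2 (ht _ h')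
    have m1 : M' (M s) = M (M s) := hM _ (by simp) fun h' => (hn.2.2.2 (.inl rfl)).2 (ht _ h')
    have m2 : M' (M s + 1) = M (M s + 1) :=
      hM _ (by simp) fun h' => (hn.2.2.2 (by simp)).2 (ht _ h')
    have m3 : M' (ρ y) = M (ρ y) := hM _ (by simp) fun h' => (hn.2.2.2 (by simp)).2 (ht _ h')
    have m4 : M' (M s + 4) = M (M s + 4) :=
      hM _ (by simp) fun h' => (hn.2.2.2 (by simp)).2 (ht _ h')
    have mw : ∀ c ∈ w.rd M ρ (M s + 2), M' c = M c := fun c hc =>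
      hM c (by simp [hc]) fun h' => hn.2.2.1.2.2 hc (ht _ h')
    obtain ⟨i1, i2⟩ := ih hC.2.2.2.2.2 hn.2.2.1.2.1 hh.2.1 (fun c hc => hM c (by simp [hc]))
      fun b hb => hη b (.inr hb)
    have h5 := Val.layout_congr (ρ' := ρ) mw fun _ _ => rfl
    simp only [Ctx.At, Ctx.cb, m0, m1, m2, m3, m4, List.count_cons, h5, List.count_append]
      at hC i2 ⊢
    exact ⟨⟨hC.1, hC.2.1, hC.2.2.1, hC.2.2.2.1, hC.2.2.2.2.1.congr mw (fun _ _ => rfl)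
      fun b hb => hη b (.inl hb) fun e => hh.2.2 hb (e ▸ ha), i1⟩,
      fun c => by have := i2 c; omega⟩
  | @subLam C D s m z y E h ih =>
    have ht := fun c => h.touched_mem (c := c)
    have ha := h.mem_holes
    simp only [Ctx.rd, Val.rd, List.mem_cons, List.mem_append, List.not_mem_nil, or_false,
      false_or] at hM
    simp only [Ctx.rd, Val.rd, List.nodup_cons, List.nodup_append', List.mem_cons, List.mem_append,
      not_or, List.disjoint_left, List.not_mem_nil, or_false, false_or] at hn
    simp only [Ctx.holes, Val.holes, List.nodup_append', List.mem_append, List.disjoint_left]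
      at hh hη
    have m0 : M' s = M s := hM _ (by simp) fun h' => by have := ht _ h'; tauto
    have m1 : M' (M s) = M (M s) := hM _ (by simp) fun h' =>
      (hn.2.2.2 (.inl rfl)).1.2.2 (ht _ h')
    have m2 : M' (M s + 1) = M (M s + 1) :=
      hM _ (by simp) fun h' => (hn.2.2.2 (by simp)).1.2.2 (ht _ h')
    have m3 : M' (ρ y) = M (ρ y) :=
      hM _ (by simp) fun h' => (hn.2.2.2 (by simp)).1.2.2 (ht _ h')
    have m4 : M' (M s + 4) = M (M s + 4) :=
      hM _ (by simp) fun h' => (hn.2.2.2 (by simp)).1.2.2 (ht _ h')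
    have hn' := hn.2.2.1.1
    have k0 : M' (M s + 2) = M (M s + 2) := hM _ (by simp) fun h' => hn'.1.2 (ht _ h')
    have k1 : M' (M (M s + 2)) = M (M (M s + 2)) :=
      hM _ (by simp) fun h' => hn'.2.2.2 (.inl rfl) (ht _ h')
    have k2 : M' (M (M s + 2) + 1) = M (M (M s + 2) + 1) :=
      hM _ (by simp) fun h' => hn'.2.2.2 (by simp) (ht _ h')
    have k3 : M' (ρ z) = M (ρ z) := hM _ (by simp) fun h' => hn'.2.2.2 (by simp) (ht _ h')
    have mE : ∀ c ∈ E.rd M ρ (M s + 3), M' c = M c := fun c hc =>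
      hM c (by simp [hc]) fun h' => hn.2.2.1.2.2 (.inr (.inr (ht _ h'))) hc
    obtain ⟨i1, i2⟩ := ih hC.2.2.2.2.1.2.2.2 hn'.2.2.1.2.1 hh.1 (fun c hc => hM c (by simp [hc]))
      fun b hb => hη b (.inl hb)
    have h5 := Ctx.layout_congr (ρ' := ρ) mE fun _ _ => rfl
    simp only [Ctx.At, Val.At, Ctx.cb, Val.cb, m0, m1, m2, m3, m4, k0, k1, k2, k3, List.count_cons,
      h5, List.count_append] at hC i2 ⊢
    exact ⟨⟨hC.1, hC.2.1, hC.2.2.1, hC.2.2.2.1, ⟨hC.2.2.2.2.1.1, hC.2.2.2.2.1.2.1,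
      hC.2.2.2.2.1.2.2.1, i1⟩, hC.2.2.2.2.2.congr mE (fun _ _ => rfl)
      fun b hb => hη b (.inr hb) fun e => hh.2.2 (e ▸ ha) hb⟩,
      fun c => by have := i2 c; omega⟩
  | @subBang C D s m y E h ih =>
    have ht := fun c => h.touched_mem (c := c)
    have ha := h.mem_holes
    simp only [Ctx.rd, Val.rd, List.mem_cons, List.mem_append, List.not_mem_nil, or_false,
      false_or] at hM
    simp only [Ctx.rd, Val.rd, List.nodup_cons, List.nodup_append', List.mem_cons, List.mem_append,
      not_or, List.disjoint_left, List.not_mem_nil, or_false, false_or] at hn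
    simp only [Ctx.holes, Val.holes, List.nodup_append', List.mem_append, List.disjoint_left]
      at hh hη
    have m0 : M' s = M s := hM _ (by simp) fun h' => by have := ht _ h'; tauto
    have m1 : M' (M s) = M (M s) := hM _ (by simp) fun h' =>
      (hn.2.2.2 (.inl rfl)).1.2.2 (ht _ h')
    have m2 : M' (M s + 1) = M (M s + 1) :=
      hM _ (by simp) fun h' => (hn.2.2.2 (by simp)).1.2.2 (ht _ h')
    have m3 : M' (ρ y) = M (ρ y) :=
      hM _ (by simp) fun h' => (hn.2.2.2 (by simp)).1.2.2 (ht _ h')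
    have m4 : M' (M s + 4) = M (M s + 4) :=
      hM _ (by simp) fun h' => (hn.2.2.2 (by simp)).1.2.2 (ht _ h')
    have hn' := hn.2.2.1.1
    have k0 : M' (M s + 2) = M (M s + 2) := hM _ (by simp) fun h' => hn'.1.2 (ht _ h')
    have k1 : M' (M (M s + 2)) = M (M (M s + 2)) :=
      hM _ (by simp) fun h' => hn'.2.2.2 rfl (ht _ h')
    have mE : ∀ c ∈ E.rd M ρ (M s + 3), M' c = M c := fun c hc =>
      hM c (by simp [hc]) fun h' => hn.2.2.1.2.2 (.inr (.inr (ht _ h'))) hc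
    obtain ⟨i1, i2⟩ := ih hC.2.2.2.2.1.2 hn'.2.2.1.2.1 hh.1 (fun c hc => hM c (by simp [hc]))
      fun b hb => hη b (.inl hb)
    have h5 := Ctx.layout_congr (ρ' := ρ) mE fun _ _ => rfl
    simp only [Ctx.At, Val.At, Ctx.cb, Val.cb, m0, m1, m2, m3, m4, k0, k1, List.count_cons,
      h5, List.count_append] at hC i2 ⊢
    exact ⟨⟨hC.1, hC.2.1, hC.2.2.1, hC.2.2.2.1, ⟨hC.2.2.2.2.1.1, i1⟩,
      hC.2.2.2.2.2.congr mE (fun _ _ => rfl)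
      fun b hb => hη b (.inr hb) fun e => hh.2.2 (e ▸ ha) hb⟩,
      fun c => by have := i2 c; omega⟩

theorem mem_bv (h : SpineM M ρ v x a B sc C D s) : x ∈ C.bv := by
  induction h <;> simp_all [Ctx.bv, Val.bv]

theorem back_remove (h : SpineM M ρ v x a B sc C D s) (hC : C.Back M ρ s)
    (hn : (C.rd M ρ s).Nodup) (hv : C.bv.Nodup)
    (hM : ∀ c ∈ C.rd M ρ s, ¬ Touched M ρ v x sc c → M' c = M c)
    (hB : B ≠ .hole a → M' sc = M (M sc + 3))
    (hb : ∀ y ∈ C.bv, y ≠ x → (∀ w E, B ≠ .cut w y E) → M' (ρ y + 3) = M (ρ y + 3))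
    (hc : ∀ w y E, B = .cut w y E → M' (ρ y + 3) = sc) : D.Back M' ρ s := by
  induction h with
  | here hab =>
    simp only [Ctx.rd, List.nodup_cons, List.nodup_append', List.mem_cons, List.mem_append, not_or,
      List.disjoint_left] at hn
    simp only [Ctx.bv, List.nodup_cons, List.mem_append, not_or, List.nodup_append'] at hv
    have hcB : ∀ c ∈ B.rd M ρ (M sc + 3), M' c = M c := fun c hc =>
      hM c (by simp [Ctx.rd, hc]) (by
        rintro (rfl | rfl | h)
        · tauto
        · exact (hn.2.2.2 (.inr (.inr (.inl rfl)))).2 hc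
        · exact hn.2.2.1.2.2 h hc)
    have hcb : ∀ y ∈ B.bv, (∀ w E, B ≠ .cut w y E) → M' (ρ y + 3) = M (ρ y + 3) := fun y hy =>
      hb y (by simp [Ctx.bv, hy]) fun e => hv.1.2 (e ▸ hy)
    obtain ⟨-, hC⟩ := hC
    have hvB := hv.2.2.1
    clear hM hb hn hv
    match B with
    | .val (.hole _) => trivial
    | .val (.var _) => trivial
    | .val (.lam y E) | .val (.bang E) | .der m y E =>
      simp only [Ctx.Back, Val.Back, hB (by simp)] at hC ⊢
      exact hC.congr (fun c hc => hcB c (by simp [Ctx.rd, Val.rd, hc])) fun y hy => hcb y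
        (by simp [Ctx.bv, Val.bv, hy]) (by simp)
    | .sub m w y E =>
      simp only [Ctx.Back, hB (by simp)] at hC ⊢
      exact ⟨hC.1.congr (fun c hc => hcB c (by simp [Ctx.rd, hc])) fun y hy => hcb y
        (by simp [Ctx.bv, hy]) (by simp), hC.2.congr (fun c hc => hcB c (by simp [Ctx.rd, hc]))
        fun y hy => hcb y (by simp [Ctx.bv, hy]) (by simp)⟩
    | .cut w y E =>
      simp only [Ctx.bv, List.nodup_cons, List.mem_append, not_or] at hvB
      simp only [Ctx.Back, hB (by simp)] at hC ⊢
      exact ⟨hc w y E rfl, hC.2.congr (fun c hc => hcB c (by simp [Ctx.rd, hc]))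
        fun z hz => hcb z (by simp [Ctx.bv, hz]) (by rintro w' E' ⟨⟩; exact hvB.1.2 hz)⟩
  | @lam C D s y h ih | @bang C D s h ih =>
    have ht := fun c => h.touched_mem (c := c)
    simp only [Ctx.rd, Val.rd, List.mem_cons, List.mem_append, List.not_mem_nil, or_false,
      false_or] at hM
    simp only [Ctx.rd, Val.rd, List.nodup_cons, List.nodup_append', List.mem_cons, List.mem_append,
      not_or, List.disjoint_left, List.not_mem_nil, or_false, false_or] at hn
    simp only [Ctx.bv, Val.bv, List.nodup_cons, List.mem_cons] at hv hb
    have m0 : M' s = M s := hM _ (by simp) fun h' => hn.1.2 (ht _ h')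
    simp only [Ctx.Back, Val.Back, m0] at hC ⊢
    exact ih hC hn.2.2.1.2.1 (by tauto) (fun c hc => hM c (by simp [hc])) fun z hz => hb z (by simp [hz])
  | @der C D s e y h ih =>
    have ht := fun c => h.touched_mem (c := c)
    simp only [Ctx.rd, List.mem_cons, List.mem_append, List.not_mem_nil, or_false,
      false_or] at hM
    simp only [Ctx.rd, List.nodup_cons, List.nodup_append', List.mem_cons, List.mem_append,
      not_or, List.disjoint_left, List.not_mem_nil, or_false, false_or] at hn
    simp only [Ctx.bv, List.nodup_cons, List.mem_cons] at hv hb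
    have m0 : M' s = M s := hM _ (by simp) fun h' => hn.1.2 (ht _ h')
    simp only [Ctx.Back, m0] at hC ⊢
    exact ih hC hn.2.2.1.2.1 hv.2 (fun c hc => hM c (by simp [hc])) fun z hz => hb z (by simp [hz])
  | @cut C D s w y h ih =>
    have ht := fun c => h.touched_mem (c := c)
    simp only [Ctx.rd, List.mem_cons, List.mem_append] at hM
    simp only [Ctx.rd, List.nodup_cons, List.nodup_append', List.mem_cons, List.mem_append,
      not_or, List.disjoint_left] at hn
    simp only [Ctx.bv, List.nodup_cons, List.mem_cons, List.mem_append, List.nodup_append',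
      not_or] at hv hb
    have m0 : M' s = M s := hM _ (by simp) fun h' => hn.1.2.2 (ht _ h')
    have m1 : M' (ρ y + 3) = M (ρ y + 3) := hb y (.inl rfl) (fun e => hv.1.2 (e ▸ h.mem_bv)) (by
      rintro w' E' rfl
      exact hv.1.2 (h.body_bv (by simp [Ctx.bv])))
    simp only [Ctx.Back, m0, m1] at hC ⊢
    exact ⟨hC.1, ih hC.2 hn.2.2.1.2.1 hv.2.2.1 (fun c hc => hM c (by simp [hc]))
      fun z hz => hb z (by simp [hz])⟩
  | @sub C D s m w y h ih =>
    have ht := fun c => h.touched_mem (c := c)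
    simp only [Ctx.rd, List.mem_cons, List.mem_append] at hM
    simp only [Ctx.rd, List.nodup_cons, List.nodup_append', List.mem_cons, List.mem_append,
      not_or, List.disjoint_left] at hn
    simp only [Ctx.bv, List.nodup_cons, List.mem_cons, List.mem_append, List.nodup_append',
      not_or, List.disjoint_left] at hv hb
    have m0 : M' s = M s := hM _ (by simp) fun h' => hn.1.2.2 (ht _ h')
    simp only [Ctx.Back, m0] at hC ⊢
    refine ⟨hC.1.congr (fun c hc => hM c (by simp [hc]) fun h' => hn.2.2.1.2.2 hc (ht _ h'))
      fun z hz => hb z (by simp [hz]) (fun e => hv.2.2.2 hz (e ▸ h.mem_bv)) ?_,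
      ih hC.2 hn.2.2.1.2.1 hv.2.2.1 (fun c hc => hM c (by simp [hc]))
      fun z hz => hb z (by simp [hz])⟩
    rintro w' E' rfl
    exact hv.2.2.2 hz (h.body_bv (by simp [Ctx.bv]))
  | @subLam C D s m z y E h ih | @subBang C D s m y E h ih =>
    have ht := fun c => h.touched_mem (c := c)
    simp only [Ctx.rd, Val.rd, List.mem_cons, List.mem_append, List.not_mem_nil, or_false,
      false_or] at hM
    simp only [Ctx.rd, Val.rd, List.nodup_cons, List.nodup_append', List.mem_cons, List.mem_append,
      not_or, List.disjoint_left, List.not_mem_nil, or_false, false_or] at hn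
    simp only [Ctx.bv, Val.bv, List.nodup_cons, List.mem_cons, List.mem_append, List.nodup_append',
      not_or, List.disjoint_left] at hv hb
    have m0 : M' s = M s := hM _ (by simp) fun h' => by have := ht _ h'; tauto
    have k0 : M' (M s + 2) = M (M s + 2) :=
      hM _ (by simp) fun h' => hn.2.2.1.1.1.2 (ht _ h')
    have hxC := h.mem_bv
    simp only [Ctx.Back, Val.Back, m0, k0] at hC ⊢
    refine ⟨ih hC.1 hn.2.2.1.1.2.2.1.2.1 (by tauto) (fun c hc => hM c (by simp [hc]))
      fun z hz => hb z (by simp [hz]), hC.2.congr (fun c hc => hM c (by simp [hc]) fun h' =>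
      hn.2.2.1.2.2 (.inr (.inr (ht _ h'))) hc)
      fun z hz => hb z (by simp [hz]) (fun e => hv.2.2.2 (by simp [e, hxC]) hz) ?_⟩
    rintro w' E' rfl
    exact hv.2.2.2 (by simp [h.body_bv (y := z) (by simp [Ctx.bv])]) hz

end SpineM
end
end Sesame
set_option linter.unusedSimpArgs false
namespace Sesame

/-! ### The program -/

/-- The program. Registers 6 to 14 hold constants, register 3 the slot of the active job, register 4
the block of its topmost constructor. The main entry points are 82 (removal of the cut on the
variable in register 16), 105 (end of a transition), 126 (splicing at the end of a left context),
141 (copying from the slot in register 21 to the slot in register 22) and 203 (continuing the copy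
with the stack of constructors in register 24). -/
def program : Program :=
  [.const 6 1, .const 7 0, .const 8 2, .const 9 3, .const 10 4, .const 11 8, .const 12 5,
   .const 13 6, .const 14 7, .load 3 1, .load 4 3, .load 5 4, .sub 5 5 6, .jz 5 107, .sub 5 5 6,
   .jz 5 41, .sub 5 5 6, .jz 5 41, .sub 5 5 6, .jz 5 44, .sub 5 5 6, .jz 5 49, .add 15 4 10,
   .load 16 15, .load 17 16, .jz 17 41, .add 18 16 6, .load 19 18, .load 20 19, .sub 20 20 6,
   .jz 20 37, .add 21 19 9, .add 22 3 7, .const 23 0, .const 24 0, .const 25 1, .jz 7 141,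
   .add 18 19 6, .load 18 18, .store 15 18, .jz 7 105, .add 15 4 9, .store 1 15, .jz 7 105,
   .add 15 4 6, .load 15 15, .add 15 15 9, .store 15 3, .jz 7 41, .add 15 4 10, .load 16 15,
   .load 17 16, .jz 17 70, .add 18 16 6, .load 19 18, .load 20 19, .sub 20 20 6, .jz 20 79,
   .add 17 19 6, .load 17 17, .add 18 4 8, .load 18 18, .store 17 6, .add 17 17 6, .store 17 18,
   .store 19 10, .store 3 19, .add 21 19 9, .const 23 1, .jz 7 126, .add 15 4 8, .add 16 2 6,
   .add 17 4 9, .store 2 15, .store 16 1, .store 1 17, .add 1 2 7, .add 2 2 11, .jz 7 0,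
   .add 18 19 6, .load 18 18, .store 15 18, .add 17 16 9, .load 17 17, .load 18 17, .add 18 18 9,
   .load 19 18, .store 16 7, .store 17 19, .sub 20 18 3, .sub 21 3 18, .add 20 20 21, .jz 20 104,
   .load 20 19, .sub 20 20 9, .jz 20 105, .sub 20 20 6, .jz 20 99, .jz 7 105, .add 19 19 6,
   .load 19 19, .add 19 19 9, .store 19 17, .jz 7 105, .store 1 17, .jz 1 230, .jz 7 0, .add 15 4 6,
   .load 16 15, .load 17 16, .jz 17 123, .add 18 16 8, .load 18 18, .jz 18 119, .add 21 16 6,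
   .add 22 3 7, .const 24 0, .const 25 0, .jz 7 141, .add 18 16 6, .load 18 18, .store 3 18,
   .jz 7 82, .add 1 1 6, .load 1 1, .jz 7 105, .load 18 21, .load 19 18, .sub 19 19 9, .jz 19 132,
   .add 21 18 9, .jz 7 126, .add 17 4 6, .load 17 17, .store 17 6, .add 17 17 6, .store 17 18,
   .store 4 10, .store 21 4, .jz 23 105, .jz 7 82, .load 15 21, .load 16 15, .add 17 15 6,
   .load 17 17, .load 18 17, .add 19 17 8, .load 19 19, .add 20 15 10, .load 20 20, .add 27 20 8,
   .load 27 27, .sub 28 27 6, .jz 28 155, .add 20 27 7, .add 26 2 7, .add 2 2 11, .store 22 26,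
   .store 26 16, .sub 27 16 6, .jz 27 198, .sub 27 27 6, .jz 27 165, .sub 27 27 6, .jz 27 195,
   .add 27 2 7, .add 2 2 11, .add 28 26 6, .store 28 27, .add 28 26 10, .store 28 20, .add 28 26 12,
   .store 28 24, .add 28 26 13, .add 29 15 9, .store 28 29, .add 28 26 14, .store 28 17,
   .store 27 18, .add 28 27 8, .store 28 19, .add 24 26 7, .sub 28 16 9, .jz 28 203, .sub 28 28 6,
   .jz 28 189, .sub 28 28 6, .jz 28 192, .jz 7 203, .add 21 17 6, .add 22 27 6, .jz 7 141,
   .add 21 15 8, .add 22 26 8, .jz 7 141, .add 21 15 9, .add 22 26 9, .jz 7 141, .sub 28 19 6,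
   .jz 28 201, .add 17 19 7, .add 28 26 6, .store 28 17, .jz 24 227, .add 15 24 13, .load 21 15,
   .jz 21 216, .add 16 24 14, .load 16 16, .add 17 24 6, .load 17 17, .store 15 7, .add 16 16 8,
   .store 16 17, .add 22 24 9, .jz 7 141, .add 16 24 14, .load 16 16, .add 17 24 6, .load 17 17,
   .add 17 17 8, .load 17 17, .add 15 24 12, .load 24 15, .add 16 16 8, .store 16 17, .jz 7 203,
   .jz 25 105, .add 21 3 7, .jz 7 126]

/-- The program goes from a configuration to another one in at most `b` steps. -/
def Reach (b : ℕ) (σ σ' : Config) : Prop := ∃ k ≤ b, program.after k σ = σ'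

namespace Reach

variable {b c i d x y l : ℕ} {R M : ℕ → ℕ} {σ σ' σ'' : Config}

theorem refl : Reach b σ σ := ⟨0, Nat.zero_le _, rfl⟩

theorem trans (h : Reach b σ σ') (h' : Reach c σ' σ'') : Reach (b + c) σ σ'' := by
  obtain ⟨j, hjb, rfl⟩ := h
  obtain ⟨k, hkc, rfl⟩ := h'
  refine ⟨k + j, by omega, ?_⟩
  simp [Program.after, Function.iterate_add_apply]

theorem mono (h : Reach b σ σ') (hb : b ≤ c) : Reach c σ σ' := by
  obtain ⟨j, hjb, h⟩ := h
  exact ⟨j, by omega, h⟩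

theorem next (h : Reach b (program.next σ) σ') : Reach (b + 1) σ σ' := by
  obtain ⟨j, hjb, h⟩ := h
  exact ⟨j + 1, by omega, by rw [← h]; simp [Program.after, Function.iterate_add_apply]⟩

theorem const (hi : program[i]? = some (.const d x))
    (h : Reach b ⟨i + 1, Function.update R d x, M⟩ σ) : Reach (b + 1) ⟨i, R, M⟩ σ :=
  next (by simpa [Program.next, hi, Instr.exec] using h)

theorem add (hi : program[i]? = some (.add d x y))
    (h : Reach b ⟨i + 1, Function.update R d (R x + R y), M⟩ σ) : Reach (b + 1) ⟨i, R, M⟩ σ :=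
  next (by simpa [Program.next, hi, Instr.exec] using h)

theorem sub (hi : program[i]? = some (.sub d x y))
    (h : Reach b ⟨i + 1, Function.update R d (R x - R y), M⟩ σ) : Reach (b + 1) ⟨i, R, M⟩ σ :=
  next (by simpa [Program.next, hi, Instr.exec] using h)

theorem load (hi : program[i]? = some (.load d x))
    (h : Reach b ⟨i + 1, Function.update R d (M (R x)), M⟩ σ) : Reach (b + 1) ⟨i, R, M⟩ σ :=
  next (by simpa [Program.next, hi, Instr.exec] using h)

theorem store (hi : program[i]? = some (.store x y))
    (h : Reach b ⟨i + 1, R, Function.update M (R x) (R y)⟩ σ) : Reach (b + 1) ⟨i, R, M⟩ σ :=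
  next (by simpa [Program.next, hi, Instr.exec] using h)

theorem jz_zero (hi : program[i]? = some (.jz x l)) (hx : R x = 0)
    (h : Reach b ⟨l, R, M⟩ σ) : Reach (b + 1) ⟨i, R, M⟩ σ :=
  next (by simpa [Program.next, hi, Instr.exec, hx] using h)

theorem jz_pos (hi : program[i]? = some (.jz x l)) (hx : R x ≠ 0)
    (h : Reach b ⟨i + 1, R, M⟩ σ) : Reach (b + 1) ⟨i, R, M⟩ σ :=
  next (by simpa [Program.next, hi, Instr.exec, hx] using h)

end Reach

/-- The registers for constants hold their values. -/
structure Consts (R : ℕ → ℕ) : Prop where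
  c6 : R 6 = 1
  c7 : R 7 = 0
  c8 : R 8 = 2
  c9 : R 9 = 3
  c10 : R 10 = 4
  c11 : R 11 = 8
  c12 : R 12 = 5
  c13 : R 13 = 6
  c14 : R 14 = 7

theorem Consts.congr {R R' : ℕ → ℕ} (h : Consts R) (h' : ∀ r, 6 ≤ r → r ≤ 14 → R' r = R r) :
    Consts R' := by
  obtain ⟨h6, h7, h8, h9, h10, h11, h12, h13, h14⟩ := h
  constructor <;> rw [h' _ (by omega) (by omega)] <;> assumption

/-- The block to which a block is forwarded while a value is copied. -/
def fwd (M : ℕ → ℕ) (b : ℕ) : ℕ := if M (b + 2) ≤ 1 then b else M (b + 2)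

/-- The registers that are not modified by the copy of a term. -/
def Kept (R R' : ℕ → ℕ) : Prop := ∀ r, r < 15 ∧ r ≠ 2 ∨ r = 23 ∨ r = 25 → R' r = R r

theorem Kept.trans {R R' R'' : ℕ → ℕ} (h : Kept R R') (h' : Kept R' R'') : Kept R R'' :=
  fun r hr => (h' r hr).trans (h r hr)

theorem Kept.consts {R R' : ℕ → ℕ} (h : Kept R R') (hc : Consts R) : Consts R' :=
  hc.congr fun r _ _ => h r (by omega)

theorem copy_load {R M : ℕ → ℕ} (hc : Consts R) : ∃ R', Reach 14 ⟨141, R, M⟩ ⟨155, R', M⟩ ∧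
    R' 15 = M (R 21) ∧ R' 16 = M (M (R 21)) ∧ R' 17 = M (M (R 21) + 1) ∧
    R' 18 = M (M (M (R 21) + 1)) ∧ R' 19 = M (M (M (R 21) + 1) + 2) ∧
    R' 20 = fwd M (M (M (R 21) + 4)) ∧ ∀ r, r < 15 ∨ 21 ≤ r ∧ r ≤ 26 → R' r = R r := by
  obtain ⟨h6, h7, h8, h9, h10, h11, h12, h13, h14⟩ := hc
  by_cases h : M (M (M (R 21) + 4) + 2) ≤ 1
  · apply Exists.intro
    apply And.intro
    · iterate 12 first | refine .add rfl ?_ | refine .load rfl ?_ | refine .sub rfl ?_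
      refine .jz_zero rfl ?_ .refl
      simp [*]
    simp only [Function.update_apply, reduceIte, Nat.reduceEqDiff, *, true_and, fwd]
    intro r hr
    simp (disch := omega) only [if_neg]
  · apply Exists.intro
    apply And.intro
    · iterate 12 first | refine .add rfl ?_ | refine .load rfl ?_ | refine .sub rfl ?_
      refine .jz_pos rfl ?_ ?_
      · simp [*]; omega
      · exact .add rfl .refl
    simp only [Function.update_apply, reduceIte, Nat.reduceEqDiff, *, true_and, fwd, add_zero]
    intro r hr
    simp (disch := omega) only [if_neg]

theorem copy_alloc {R M : ℕ → ℕ} (hc : Consts R) {N : ℕ} (hN : R 2 = N) (hd : R 22 < N)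
    (ht : 1 ≤ R 16) : ∃ R' M', Reach 10 ⟨155, R, M⟩
      ⟨if R 16 = 1 then 198 else if R 16 = 3 then 195 else 165, R', M'⟩ ∧
    (∀ c < N, c ≠ R 22 → M' c = M c) ∧ M' (R 22) = N ∧ M' N = R 16 ∧ R' 2 = N + 8 ∧ R' 26 = N ∧
    ∀ r, r ≠ 2 → r ≠ 26 → r ≠ 27 → R' r = R r := by
  obtain ⟨h6, h7, h8, h9, h10, h11, h12, h13, h14⟩ := hc
  obtain ⟨R₁, M₁, h1, e1, e2, e3, e4, e5, e6, e7⟩ : ∃ R' M', Reach 5 ⟨155, R, M⟩ ⟨160, R', M'⟩ ∧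
      (∀ c < N, c ≠ R 22 → M' c = M c) ∧ M' (R 22) = N ∧ M' N = R 16 ∧ R' 2 = N + 8 ∧ R' 26 = N ∧
      R' 27 = R 16 - 1 ∧ ∀ r, r ≠ 2 → r ≠ 26 → r ≠ 27 → R' r = R r := by
    apply Exists.intro
    apply Exists.intro
    apply And.intro
    · iterate 5 first | refine .add rfl ?_ | refine .store rfl ?_ | refine .sub rfl ?_
      exact .refl
    simp only [Function.update_apply, reduceIte, Nat.reduceEqDiff, *, true_and, add_zero, hd.ne]
    refine ⟨fun c hc hc' => ?_, fun r h1 h2 h3 => ?_⟩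
    · rw [if_neg hc.ne, if_neg hc']
    · rw [if_neg h3, if_neg h1, if_neg h2]
  have e8 := e7 6 (by decide) (by decide) (by decide)
  by_cases h : R 16 = 1
  · exact ⟨R₁, M₁, by
      simpa [h] using h1.trans (.jz_zero rfl (by simp [e6, h]) (.refl (b := 4))), e1, e2, e3, e4, e5, e7⟩
  rw [if_neg h]
  by_cases h' : R 16 = 2
  · rw [if_neg (by omega)]
    refine ⟨_, M₁, (h1.trans (.jz_pos rfl (by simp only [e6]; omega) (.sub rfl
      (.jz_zero rfl (by simp [e6, h', e8, h6]) (.refl (b := 2)))))), e1, e2, e3, ?_⟩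
    simp +contextual [e4, e5, e7]
  by_cases h'' : R 16 = 3
  · rw [if_pos h'']
    refine ⟨_, M₁, (h1.trans (.jz_pos rfl (by simp only [e6]; omega) (.sub rfl
      (.jz_pos rfl (by simp [e6, h'', e8, h6]) (.sub rfl (.jz_zero rfl
      (by simp [e6, h'', e8, h6]) (.refl (b := 0)))))))), e1, e2, e3, ?_⟩
    simp +contextual [e4, e5, e7]
  · rw [if_neg h'']
    refine ⟨_, M₁, (h1.trans (.jz_pos rfl (by simp only [e6]; omega) (.sub rfl
      (.jz_pos rfl (by simp [e6, e8, h6]; omega) (.sub rfl (.jz_pos rfl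
      (by simp [e6, e8, h6]; omega) (.refl (b := 0)))))))), e1, e2, e3, ?_⟩
    simp +contextual [e4, e5, e7]

theorem copy_frame {R M : ℕ → ℕ} (hc : Consts R) {N : ℕ} (hN : R 26 = N) (hN' : R 2 = N + 8) :
    ∃ R' M', Reach 17 ⟨165, R, M⟩ ⟨182, R', M'⟩ ∧
    (∀ c ≤ N, M' c = M c) ∧ M' (N + 1) = N + 8 ∧ M' (N + 4) = R 20 ∧ M' (N + 5) = R 24 ∧
    M' (N + 6) = R 15 + 3 ∧ M' (N + 7) = R 17 ∧ M' (N + 8) = R 18 ∧ M' (N + 10) = R 19 ∧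
    R' 2 = N + 16 ∧ R' 24 = N ∧ R' 27 = N + 8 ∧
    ∀ r, r ≠ 2 → r ≠ 24 → r ≠ 27 → r ≠ 28 → r ≠ 29 → R' r = R r := by
  obtain ⟨h6, h7, h8, h9, h10, h11, h12, h13, h14⟩ := hc
  apply Exists.intro
  apply Exists.intro
  apply And.intro
  · repeat first
      | with_reducible exact .refl | refine .add rfl ?_ | refine .store rfl ?_ | refine .sub rfl ?_
  simp only [Function.update_apply, reduceIte, Nat.reduceEqDiff, *, true_and, add_zero,
    add_assoc, Nat.reduceAdd, Nat.add_left_cancel_iff]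
  refine ⟨fun c hc => ?_, fun r h1 h2 h3 h4 h5 => ?_⟩
  · simp (disch := omega) only [if_neg]
  · simp (disch := omega) only [if_neg]

theorem copy_bind {R M : ℕ → ℕ} (hc : Consts R) {N O x : ℕ} (hN : R 2 = N) (hO : M (R 21) = O)
    (hx : M (O + 1) = x) (hd : R 22 < N) (ht : M O = 2 ∨ M O = 4 ∨ M O = 5 ∨ M O = 6) :
    ∃ R' M', Reach 50 ⟨141, R, M⟩ ⟨if M O = 4 ∨ M O = 5 then 141 else 203, R', M'⟩ ∧
    (∀ c < N, c ≠ R 22 → M' c = M c) ∧ M' (R 22) = N ∧ M' N = M O ∧ M' (N + 1) = N + 8 ∧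
    M' (N + 4) = fwd M (M (O + 4)) ∧ M' (N + 5) = R 24 ∧ M' (N + 6) = O + 3 ∧ M' (N + 7) = x ∧
    M' (N + 8) = M x ∧ M' (N + 10) = M (x + 2) ∧ R' 2 = N + 16 ∧ R' 24 = N ∧
    (M O = 4 → R' 21 = x + 1 ∧ R' 22 = N + 9) ∧ (M O = 5 → R' 21 = O + 2 ∧ R' 22 = N + 2) ∧
    Kept R R' := by
  obtain ⟨R₁, h1, a1, a2, a3, a4, a5, a6, a7⟩ := copy_load (M := M) hc
  have hc₁ : Consts R₁ := hc.congr fun r _ _ => a7 r (by omega)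
  rw [hO] at a1 a2 a3 a4 a5 a6
  rw [hx] at a3 a4 a5
  obtain ⟨R₂, M₂, h2, b1, b2, b3, b4, b5, b6⟩ := copy_alloc (M := M) hc₁ (N := N)
    (by rw [a7 _ (by omega), hN]) (by rwa [a7 _ (by omega)]) (by omega)
  rw [a7 22 (by omega)] at b1 b2
  rw [if_neg (by omega), if_neg (by omega)] at h2
  have hc₂ : Consts R₂ := hc₁.congr fun r _ _ => b6 r (by omega) (by omega) (by omega)
  obtain ⟨R₃, M₃, h3, c1, c2, c3, c4, c5, c6, c7, c8, c9, c10, c11, c12⟩ :=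
    copy_frame (M := M₂) hc₂ b5 b4
  have hc₃ : Consts R₃ := hc₂.congr fun r _ _ =>
    c12 r (by omega) (by omega) (by omega) (by omega) (by omega)
  have hR : ∀ r, r ≠ 2 → r ≠ 26 → r ≠ 24 → r ≠ 27 → r ≠ 28 → r ≠ 29 → R₃ r = R₁ r :=
    fun r h1 h2 h3 h4 h5 h6 => by rw [c12 r h1 h3 h4 h5 h6, b6 r h1 h2 h4]
  have hR' : ∀ r, r < 15 ∧ r ≠ 2 ∨ r = 23 ∨ r = 25 → R₃ r = R r := fun r hr => by
    rw [hR r, a7 r] <;> omega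
  have h15 : R₃ 15 = O := by rw [hR 15] <;> simp [a1]
  have h16 : R₃ 16 = M O := by rw [hR 16] <;> simp [a2]
  have h17 : R₃ 17 = x := by rw [hR 17] <;> simp [a3]
  have h26 : R₃ 26 = N := by rw [c12 26] <;> simp [b5]
  have h4 : ∃ R', Reach 9 ⟨182, R₃, M₃⟩ ⟨if M O = 4 ∨ M O = 5 then 141 else 203, R', M₃⟩ ∧
      (M O = 4 → R' 21 = x + 1 ∧ R' 22 = N + 9) ∧ (M O = 5 → R' 21 = O + 2 ∧ R' 22 = N + 2) ∧
      ∀ r, r ≠ 21 → r ≠ 22 → r ≠ 28 → R' r = R₃ r := by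
    obtain ⟨k6, k7, k8, k9, k10, k11, k12, k13, k14⟩ := hc₃
    rcases ht with h | h | h | h <;> simp only [h] at h16 ⊢ <;> simp
    · refine ⟨_, .sub rfl (.jz_zero rfl (by simp [h16, k6, k9, k7]) .refl), ?_⟩
      simp +contextual
    · refine ⟨_, .sub rfl (.jz_pos rfl (by simp [h16, k6, k9, k7]) (.sub rfl (.jz_zero rfl (by simp [h16, k6, k9, k7])
        (.add rfl (.add rfl (.jz_zero rfl (by simp [h16, k6, k9, k7]) .refl)))))), ?_⟩
      simp +contextual [h17, h26, h15, b4, c11, k6, k7, k8, k9]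
    · refine ⟨_, .sub rfl (.jz_pos rfl (by simp [h16, k6, k9, k7]) (.sub rfl (.jz_pos rfl (by simp [h16, k6, k9, k7])
        (.sub rfl (.jz_zero rfl (by simp [h16, k6, k9, k7])
        (.add rfl (.add rfl (.jz_zero rfl (by simp [h16, k6, k9, k7]) .refl)))))))), ?_⟩
      simp +contextual [h17, h26, h15, b4, c11, k6, k7, k8, k9]
    · refine ⟨_, .sub rfl (.jz_pos rfl (by simp [h16, k6, k9, k7]) (.sub rfl (.jz_pos rfl (by simp [h16, k6, k9, k7])
        (.sub rfl (.jz_pos rfl (by simp [h16, k6, k9, k7]) (.jz_zero rfl (by simp [h16, k6, k9, k7]) .refl)))))), ?_⟩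
      simp +contextual
  obtain ⟨R₄, h4, d1, d2, d3⟩ := h4
  have e : ∀ r, r ≠ 2 → r ≠ 26 → r ≠ 27 → R₂ r = R₁ r := b6
  refine ⟨R₄, M₃, ((h1.trans h2).trans (h3.trans h4)).mono (by omega), fun c hc hcd => ?_, ?_, ?_,
    c2, ?_, ?_, ?_, ?_, ?_, ?_, ?_, ?_, d1, d2, fun r hr => ?_⟩
  · rw [c1 c hc.le, b1 c hc hcd]
  · rw [c1 _ hd.le, b2]
  · rw [c1 _ le_rfl, b3, a2]
  · rw [c3, e] <;> simp [a6]
  · rw [c4, e] <;> simp [a7]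
  · rw [c5, e] <;> simp [a1]
  · rw [c6, e] <;> simp [a3]
  · rw [c7, e] <;> simp [a4]
  · rw [c8, e] <;> simp [a5]
  · rw [d3] <;> simp [c9]
  · rw [d3] <;> simp [c10]
  · rw [d3 r (by omega) (by omega) (by omega), hR' r hr]

theorem copy_bang {R M : ℕ → ℕ} (hc : Consts R) {N O : ℕ} (hN : R 2 = N) (hO : M (R 21) = O)
    (hd : R 22 < N) (ht : M O = 3) : ∃ R' M', Reach 50 ⟨141, R, M⟩ ⟨141, R', M'⟩ ∧
    (∀ c < N, c ≠ R 22 → M' c = M c) ∧ M' (R 22) = N ∧ M' N = M O ∧ R' 2 = N + 8 ∧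
    R' 24 = R 24 ∧ R' 21 = O + 3 ∧ R' 22 = N + 3 ∧ Kept R R' := by
  obtain ⟨R₁, h1, a1, a2, a3, a4, a5, a6, a7⟩ := copy_load (M := M) hc
  have hc₁ : Consts R₁ := hc.congr fun r _ _ => a7 r (by omega)
  rw [hO] at a1 a2
  obtain ⟨R₂, M₂, h2, b1, b2, b3, b4, b5, b6⟩ := copy_alloc (M := M) hc₁ (N := N)
    (by rw [a7 _ (by omega), hN]) (by rwa [a7 _ (by omega)]) (by omega)
  rw [a7 22 (by omega)] at b1 b2
  rw [if_neg (by omega), if_pos (by omega)] at h2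
  have hc₂ : Consts R₂ := hc₁.congr fun r _ _ => b6 r (by omega) (by omega) (by omega)
  have h15 : R₂ 15 = O := by rw [b6 15] <;> simp [a1]
  refine ⟨_, M₂, ((h1.trans h2).trans (.add rfl (.add rfl (.jz_zero rfl (by simp [hc₂.c7])
    (.refl (b := 20)))))).mono (by omega), b1, b2, by rw [b3, a2], ?_, ?_, ?_, ?_, fun r hr => ?_⟩
  · simpa using b4
  · simp [b6, a7]
  · simp [h15, hc₂.c9]
  · simp [b5, hc₂.c9]
  · rw [Function.update_of_ne (by omega), Function.update_of_ne (by omega),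
      b6 r (by omega) (by omega) (by omega), a7 r (by omega)]

theorem copy_var {R M : ℕ → ℕ} (hc : Consts R) {N O : ℕ} (hN : R 2 = N) (hO : M (R 21) = O)
    (hd : R 22 < N) (ht : M O = 1) : ∃ R' M', Reach 50 ⟨141, R, M⟩ ⟨203, R', M'⟩ ∧
    (∀ c < N, c ≠ R 22 → M' c = M c) ∧ M' (R 22) = N ∧ M' N = 1 ∧
    M' (N + 1) = fwd M (M (O + 1)) ∧ R' 2 = N + 8 ∧ R' 24 = R 24 ∧ Kept R R' := by
  obtain ⟨R₁, h1, a1, a2, a3, a4, a5, a6, a7⟩ := copy_load (M := M) hc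
  have hc₁ : Consts R₁ := hc.congr fun r _ _ => a7 r (by omega)
  rw [hO] at a1 a2 a3 a5
  obtain ⟨R₂, M₂, h2, b1, b2, b3, b4, b5, b6⟩ := copy_alloc (M := M) hc₁ (N := N)
    (by rw [a7 _ (by omega), hN]) (by rwa [a7 _ (by omega)]) (by omega)
  rw [a7 22 (by omega)] at b1 b2
  rw [if_pos (by omega)] at h2
  obtain ⟨k6, k7, k8, k9, k10, k11, k12, k13, k14⟩ : Consts R₂ :=
    hc₁.congr fun r _ _ => b6 r (by omega) (by omega) (by omega)
  have h17 : R₂ 17 = M (O + 1) := by rw [b6 17] <;> simp [a3]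
  have h19 : R₂ 19 = M (M (O + 1) + 2) := by rw [b6 19] <;> simp [a5]
  have h24 : R₂ 24 = R 24 := by rw [b6 24, a7 24] <;> simp
  have h3 : ∃ R' M', Reach 5 ⟨198, R₂, M₂⟩ ⟨203, R', M'⟩ ∧
      M' = Function.update M₂ (N + 1) (fwd M (M (O + 1))) ∧
      ∀ r, r ≠ 17 → r ≠ 28 → R' r = R₂ r := by
    by_cases h : M (M (O + 1) + 2) ≤ 1
    · apply Exists.intro
      apply Exists.intro
      apply And.intro
      · refine .sub rfl (.jz_zero rfl (by simp [h19, k6]; omega) (.add rfl (.store rfl .refl)))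
      simp +contextual [h17, b5, k6, h, fwd]
    · apply Exists.intro
      apply Exists.intro
      apply And.intro
      · refine .sub rfl (.jz_pos rfl (by simp [h19, k6]; omega)
          (.add rfl (.add rfl (.store rfl .refl))))
      simp +contextual [h17, h19, b5, k6, k7, h, fwd]
  obtain ⟨R₃, _, h3, rfl, c1⟩ := h3
  refine ⟨R₃, _, ((h1.trans h2).trans h3).mono (by omega), fun c hc hcd => ?_, ?_, ?_, by simp, ?_,
    ?_, fun r hr => ?_⟩
  · rw [Function.update_of_ne (by omega), b1 c hc hcd]
  · rw [Function.update_of_ne (by omega), b2]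
  · rw [Function.update_of_ne (by omega), b3, a2, ht]
  · rw [c1, b4] <;> simp
  · rw [c1, h24] <;> simp
  · rw [c1 r (by omega) (by omega), b6 r (by omega) (by omega) (by omega), a7 r (by omega)]

theorem pop_body {R M : ℕ → ℕ} (hc : Consts R) {S p : ℕ} (hS : R 24 = S) (hS' : S ≠ 0)
    (hp : M (S + 6) = p) (hp' : p ≠ 0) : ∃ R', Reach 15 ⟨203, R, M⟩ ⟨141, R',
      Function.update (Function.update M (S + 6) 0) (M (S + 7) + 2) (M (S + 1))⟩ ∧
    R' 21 = p ∧ R' 22 = S + 3 ∧ R' 2 = R 2 ∧ R' 24 = S ∧ Kept R R' := by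
  obtain ⟨h6, h7, h8, h9, h10, h11, h12, h13, h14⟩ := hc
  have key : ∃ R' M', Reach 15 ⟨203, R, M⟩ ⟨141, R', M'⟩ ∧ 
      M' = Function.update (Function.update M (S + 6) 0) (M (S + 7) + 2) (M (S + 1)) ∧
    R' 21 = p ∧ R' 22 = S + 3 ∧ R' 2 = R 2 ∧ R' 24 = S ∧ Kept R R' := by
    apply Exists.intro
    apply Exists.intro
    apply And.intro
    · refine .jz_pos rfl (by simp [*]) (.add rfl (.load rfl (.jz_pos rfl (by simp [*]) ?_)))
      iterate 8 first | refine .add rfl ?_ | refine .load rfl ?_ | refine .store rfl ?_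
      refine .jz_zero rfl ?_ .refl
      simp [*]
    simp only [Function.update_apply, reduceIte, Nat.reduceEqDiff, *, true_and, add_zero, Kept]
    intro r hr
    simp (disch := omega) only [if_neg]
  obtain ⟨R', _, h, rfl, h'⟩ := key
  exact ⟨R', h, h'⟩

theorem pop_exit {R M : ℕ → ℕ} (hc : Consts R) {S : ℕ} (hS : R 24 = S) (hS' : S ≠ 0)
    (hp : M (S + 6) = 0) : ∃ R', Reach 15 ⟨203, R, M⟩ ⟨203, R',
      Function.update M (M (S + 7) + 2) (M (M (S + 1) + 2))⟩ ∧
    R' 2 = R 2 ∧ R' 24 = M (S + 5) ∧ Kept R R' := by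
  obtain ⟨h6, h7, h8, h9, h10, h11, h12, h13, h14⟩ := hc
  have key : ∃ R' M', Reach 15 ⟨203, R, M⟩ ⟨203, R', M'⟩ ∧ 
      M' = Function.update M (M (S + 7) + 2) (M (M (S + 1) + 2)) ∧
    R' 2 = R 2 ∧ R' 24 = M (S + 5) ∧ Kept R R' := by
    apply Exists.intro
    apply Exists.intro
    apply And.intro
    · refine .jz_pos rfl (by simp [*]) (.add rfl (.load rfl (.jz_zero rfl (by simp [*]) ?_)))
      iterate 10 first | refine .add rfl ?_ | refine .load rfl ?_ | refine .store rfl ?_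
      refine .jz_zero rfl ?_ .refl
      simp [*]
    simp only [Function.update_apply, reduceIte, Nat.reduceEqDiff, *, true_and, add_zero, Kept]
    intro r hr
    simp (disch := omega) only [if_neg]
  obtain ⟨R', _, h, rfl, h'⟩ := key
  exact ⟨R', h, h'⟩

end Sesame
set_option linter.unusedSimpArgs false
namespace Sesame

/-! ### Transitions of the program -/

/-- The program goes, in at least one and at most `b + 1` steps, from the beginning of its main loop
to the beginning of the main loop again, or to its end if the pool is empty. -/
def Turn (b : ℕ) (R M R' M' : ℕ → ℕ) : Prop :=
  Reach b (program.next ⟨0, R, M⟩) ⟨if R' 1 = 0 then 230 else 0, R', M'⟩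

/-- Registers 0 and 2 are not modified. -/
def Same (R R' : ℕ → ℕ) : Prop := R' 0 = R 0 ∧ R' 1 = R 1 ∧ R' 2 = R 2

theorem Reach.check {R M : ℕ → ℕ} (hc : Consts R) :
    Reach 2 ⟨105, R, M⟩ ⟨if R 1 = 0 then 230 else 0, R, M⟩ := by
  by_cases h : R 1 = 0
  · rw [if_pos h]
    exact .jz_zero rfl h .refl
  · rw [if_neg h]
    exact .jz_pos rfl h (.jz_zero rfl hc.c7 .refl)

theorem main_start (R M : ℕ → ℕ) : ∃ R', Reach 12 (program.next ⟨0, R, M⟩) ⟨13, R', M⟩ ∧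
    Consts R' ∧ Same R R' ∧ R' 3 = M (R 1) ∧ R' 4 = M (M (R 1)) ∧
    R' 5 = M (M (M (R 1))) - 1 := by
  apply Exists.intro
  apply And.intro
  · change Reach 12 ⟨1, Function.update R 6 1, M⟩ _
    iterate 12 first
      | refine .const rfl ?_ | refine .add rfl ?_ | refine .load rfl ?_ | refine .sub rfl ?_
    exact .refl
  refine ⟨⟨?_, ?_, ?_, ?_, ?_, ?_, ?_, ?_, ?_⟩, ⟨?_, ?_, ?_⟩, ?_, ?_, ?_⟩ <;>
    simp only [Function.update_apply, reduceIte, Nat.reduceEqDiff]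

/-- The entry point for a tag. -/
def entry (k : ℕ) : ℕ :=
  if k = 1 then 107 else if k = 2 then 41 else if k = 3 then 41 else if k = 4 then 44
  else if k = 5 then 49 else 22

theorem main_dispatch {R M : ℕ → ℕ} (ht : 1 ≤ M (M (M (R 1)))) (ht' : M (M (M (R 1))) ≤ 6) :
    ∃ R', Reach 24 (program.next ⟨0, R, M⟩) ⟨entry (M (M (M (R 1)))), R', M⟩ ∧
    Consts R' ∧ Same R R' ∧ R' 3 = M (R 1) ∧ R' 4 = M (M (R 1)) := by
  obtain ⟨R₁, h, hc, hs, h3, h4, h5⟩ := main_start R M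
  have h6 := hc.c6
  have key : ∀ n, M (M (M (R 1))) = n → 1 ≤ n → n ≤ 6 → ∃ R', Reach 12 ⟨13, R₁, M⟩
      ⟨entry n, R', M⟩ ∧ ∀ r, r ≠ 5 → R' r = R₁ r := by
    intro n hn h1 h2
    rw [hn] at h5
    have e : n = 1 ∨ n = 2 ∨ n = 3 ∨ n = 4 ∨ n = 5 ∨ n = 6 := by omega
    rcases e with rfl | rfl | rfl | rfl | rfl | rfl
    · exact ⟨_, .jz_zero rfl h5 .refl, fun _ _ => rfl⟩
    · apply Exists.intro
      apply And.intro
      · iterate 1 refine .jz_pos rfl (by simp [h5, h6]) (.sub rfl ?_)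
        exact .jz_zero rfl (by simp [h5, h6]) .refl
      simp +contextual
    · apply Exists.intro
      apply And.intro
      · iterate 2 refine .jz_pos rfl (by simp [h5, h6]) (.sub rfl ?_)
        exact .jz_zero rfl (by simp [h5, h6]) .refl
      simp +contextual
    · apply Exists.intro
      apply And.intro
      · iterate 3 refine .jz_pos rfl (by simp [h5, h6]) (.sub rfl ?_)
        exact .jz_zero rfl (by simp [h5, h6]) .refl
      simp +contextual
    · apply Exists.intro
      apply And.intro
      · iterate 4 refine .jz_pos rfl (by simp [h5, h6]) (.sub rfl ?_)
        exact .jz_zero rfl (by simp [h5, h6]) .refl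
      simp +contextual
    · apply Exists.intro
      apply And.intro
      · iterate 4 refine .jz_pos rfl (by simp [h5, h6]) (.sub rfl ?_)
        exact .jz_pos rfl (by simp [h5, h6]) .refl
      simp +contextual
  obtain ⟨R₂, h', e⟩ := key _ rfl ht ht'
  refine ⟨R₂, h.trans h', hc.congr fun r _ _ => e r (by omega), ?_, ?_, ?_⟩
  · exact ⟨(e 0 (by omega)).trans hs.1, (e 1 (by omega)).trans hs.2.1, (e 2 (by omega)).trans hs.2.2⟩
  · rw [e 3 (by omega), h3]
  · rw [e 4 (by omega), h4]

theorem Same.trans {R R' R'' : ℕ → ℕ} (h : Same R R') (h' : Same R' R'') : Same R R'' :=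
  ⟨h'.1.trans h.1, h'.2.1.trans h.2.1, h'.2.2.trans h.2.2⟩

theorem Same.of {R R' : ℕ → ℕ} (h : ∀ r < 3, R' r = R r) : Same R R' :=
  ⟨h 0 (by omega), h 1 (by omega), h 2 (by omega)⟩

theorem Reach.finish {b : ℕ} {σ : Config} {R M : ℕ → ℕ} (hc : Consts R)
    (h : Reach b σ ⟨105, R, M⟩) : Reach (b + 2) σ ⟨if R 1 = 0 then 230 else 0, R, M⟩ :=
  h.trans (.check hc)

theorem body_block {R M : ℕ → ℕ} (hc : Consts R) : ∃ R', Reach 3 ⟨41, R, M⟩ ⟨105, R',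
    Function.update M (R 1) (R 4 + 3)⟩ ∧ ∀ r < 15, R' r = R r := by
  refine ⟨Function.update R 15 (R 4 + 3), ?_, fun r hr => ?_⟩
  · have h := @Reach.add 2 41 15 4 9 R M ⟨105, Function.update R 15 (R 4 + R 9),
      Function.update M (R 1) (R 4 + R 9)⟩ rfl (.store rfl (.jz_zero rfl (by simp [hc.c7])
        (by simpa using Reach.refl)))
    rwa [hc.c9] at h
  · rw [Function.update_of_ne (by omega)]

theorem turn_body {R M : ℕ → ℕ} {s B : ℕ} (hs : M (R 1) = s) (hB : M s = B)
    (ht : M B = 2 ∨ M B = 3) :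
    ∃ R', Turn 40 R M R' (Function.update M (R 1) (B + 3)) ∧ Same R R' := by
  subst hs hB
  obtain ⟨R₁, h1, hc, h2, h3, h4⟩ := main_dispatch (R := R) (M := M) (by omega) (by omega)
  have e : entry (M (M (M (R 1)))) = 41 := by rcases ht with h | h <;> rw [h] <;> rfl
  obtain ⟨R₂, h5, h6⟩ := body_block (M := M) hc
  rw [h4, h2.2.1] at h5
  rw [e] at h1
  refine ⟨R₂, (Reach.finish (hc.congr fun r _ _ => h6 r (by omega)) (h1.trans h5)).mono (by omega),
    h2.trans (.of fun r hr => h6 r (by omega))⟩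

theorem turn_der_free {R M : ℕ → ℕ} {s B : ℕ} (hs : M (R 1) = s) (hB : M s = B)
    (ht : M B = 6) (hx : M (M (B + 4)) = 0) :
    ∃ R', Turn 40 R M R' (Function.update M (R 1) (B + 3)) ∧ Same R R' := by
  subst hs hB
  obtain ⟨R₁, h1, hc, h2, h3, h4⟩ := main_dispatch (R := R) (M := M) (by omega) (by omega)
  rw [ht] at h1
  have h : ∃ R', Reach 5 ⟨22, R₁, M⟩ ⟨41, R', M⟩ ∧ ∀ r < 15, R' r = R₁ r := by
    apply Exists.intro
    apply And.intro
    · exact .add rfl (.load rfl (.load rfl (.jz_zero rfl (by simp [h4, hc.c10, hx]) .refl)))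
    intro r hr
    simp (disch := omega) only [Function.update_of_ne]
  obtain ⟨R₂, h5, h6⟩ := h
  have hc' := hc.congr fun r _ _ => h6 r (by omega)
  obtain ⟨R₃, h7, h8⟩ := body_block (M := M) hc'
  rw [h6 4 (by omega), h6 1 (by omega), h4, h2.2.1] at h7
  refine ⟨R₃, (Reach.finish (hc'.congr fun r _ _ => h8 r (by omega))
    ((h1.trans h5).trans h7)).mono (by omega), h2.trans (.of fun r hr => ?_)⟩
  rw [h8 r (by omega), h6 r (by omega)]

theorem turn_cut {R M : ℕ → ℕ} {s B : ℕ} (hs : M (R 1) = s) (hB : M s = B) (ht : M B = 4) :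
    ∃ R', Turn 40 R M R' (Function.update (Function.update M (M (B + 1) + 3) s) (R 1) (B + 3)) ∧
      Same R R' := by
  subst hs hB
  obtain ⟨R₁, h1, hc, h2, h3, h4⟩ := main_dispatch (R := R) (M := M) (by omega) (by omega)
  rw [ht] at h1
  have h : ∃ R' M', Reach 5 ⟨44, R₁, M⟩ ⟨41, R', M'⟩ ∧
      M' = Function.update M (M (M (M (R 1)) + 1) + 3) (M (R 1)) ∧ ∀ r < 15, R' r = R₁ r := by
    apply Exists.intro
    apply Exists.intro
    apply And.intro
    · exact .add rfl (.load rfl (.add rfl (.store rfl (.jz_zero rfl (by simp [hc.c7]) .refl))))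
    simp only [Function.update_apply, reduceIte, Nat.reduceEqDiff, h4, h3, hc.c6, hc.c9, true_and]
    intro r hr
    simp (disch := omega) only [if_neg]
  obtain ⟨R₂, _, h5, rfl, h6⟩ := h
  have hc' := hc.congr fun r _ _ => h6 r (by omega)
  obtain ⟨R₃, h7, h8⟩ := body_block (M := Function.update M (M (M (M (R 1)) + 1) + 3) (M (R 1))) hc'
  rw [h6 4 (by omega), h6 1 (by omega), h4, h2.2.1] at h7
  refine ⟨R₃, (Reach.finish (hc'.congr fun r _ _ => h8 r (by omega))
    ((h1.trans h5).trans h7)).mono (by omega), h2.trans (.of fun r hr => ?_)⟩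
  rw [h8 r (by omega), h6 r (by omega)]

theorem turn_sub_free {R M : ℕ → ℕ} {s B : ℕ} (hs : M (R 1) = s) (hB : M s = B)
    (ht : M B = 5) (hx : M (M (B + 4)) = 0) (hN : R 2 ≠ 0) :
    ∃ R', Turn 40 R M R' (Function.update (Function.update (Function.update M (R 2) (B + 2))
      (R 2 + 1) (R 1)) (R 1) (B + 3)) ∧ R' 0 = R 0 ∧ R' 1 = R 2 ∧ R' 2 = R 2 + 8 := by
  subst hs hB
  obtain ⟨R₁, h1, hc, ⟨h2, h2', h2''⟩, h3, h4⟩ :=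
    main_dispatch (R := R) (M := M) (by omega) (by omega)
  rw [ht] at h1
  have h : ∃ R' M', Reach 13 ⟨49, R₁, M⟩ ⟨0, R', M'⟩ ∧
      M' = Function.update (Function.update (Function.update M (R 2) (M (M (R 1)) + 2))
      (R 2 + 1) (R 1)) (R 1) (M (M (R 1)) + 3) ∧ R' 0 = R 0 ∧ R' 1 = R 2 ∧ R' 2 = R 2 + 8 := by
    apply Exists.intro
    apply Exists.intro
    apply And.intro
    · refine .add rfl (.load rfl (.load rfl (.jz_zero rfl (by simp [h4, hc.c10, hx]) ?_)))
      iterate 8 first | refine .add rfl ?_ | refine .store rfl ?_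
      exact .jz_zero rfl (by simp [hc.c7]) .refl
    simp only [Function.update_apply, reduceIte, Nat.reduceEqDiff, h4, h3, h2, h2', h2'', hc.c6,
      hc.c7, hc.c8, hc.c9, hc.c11, true_and, add_zero]
  obtain ⟨R₂, _, h5, rfl, h6, h7, h8⟩ := h
  refine ⟨R₂, ?_, h6, h7, h8⟩
  rw [Turn, if_neg (by omega)]
  exact (h1.trans h5).mono (by omega)

theorem turn_var_free {R M : ℕ → ℕ} {s B : ℕ} (hs : M (R 1) = s) (hB : M s = B)
    (ht : M B = 1) (hx : M (M (B + 1)) = 0) :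
    ∃ R', Turn 40 R M R' M ∧ R' 0 = R 0 ∧ R' 1 = M (R 1 + 1) ∧ R' 2 = R 2 := by
  subst hs hB
  obtain ⟨R₁, h1, hc, ⟨h2, h2', h2''⟩, h3, h4⟩ :=
    main_dispatch (R := R) (M := M) (by omega) (by omega)
  rw [ht] at h1
  have h : ∃ R', Reach 7 ⟨107, R₁, M⟩ ⟨105, R', M⟩ ∧ R' 1 = M (R 1 + 1) ∧
      ∀ r, r < 15 → r ≠ 1 → R' r = R₁ r := by
    apply Exists.intro
    apply And.intro
    · exact .add rfl (.load rfl (.load rfl (.jz_zero rfl (by simp [h4, hc.c6, hx])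
        (.add rfl (.load rfl (.jz_zero rfl (by simp [hc.c7]) .refl))))))
    simp only [Function.update_apply, reduceIte, Nat.reduceEqDiff, h2', hc.c6, true_and]
    intro r hr hr'
    simp (disch := omega) only [if_neg]
  obtain ⟨R₂, h5, h6, h7⟩ := h
  refine ⟨R₂, (Reach.finish (hc.congr fun r _ _ => h7 r (by omega) (by omega))
    (h1.trans h5)).mono (by omega), ?_, h6, ?_⟩
  · rw [h7 0 (by omega) (by omega), h2]
  · rw [h7 2 (by omega) (by omega), h2'']

theorem turn_axe2 {R M : ℕ → ℕ} {s B x V : ℕ} (hs : M (R 1) = s) (hB : M s = B)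
    (ht : M B = 6) (hx : M (B + 4) = x) (hx' : M x ≠ 0) (hV : M (x + 1) = V) (hV' : M V = 1) :
    ∃ R', Turn 40 R M R' (Function.update M (B + 4) (M (V + 1))) ∧ Same R R' := by
  subst hs hB
  obtain ⟨R₁, h1, hc, h2, h3, h4⟩ := main_dispatch (R := R) (M := M) (by omega) (by omega)
  rw [ht] at h1
  have h : ∃ R' M', Reach 13 ⟨22, R₁, M⟩ ⟨105, R', M'⟩ ∧
      M' = Function.update M (M (M (R 1)) + 4) (M (V + 1)) ∧ ∀ r < 15, R' r = R₁ r := by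
    apply Exists.intro
    apply Exists.intro
    apply And.intro
    · refine .add rfl (.load rfl (.load rfl (.jz_pos rfl (by simp [h4, hc.c10, hx, hx']) ?_)))
      refine .add rfl (.load rfl (.load rfl (.sub rfl (.jz_zero rfl ?_ ?_))))
      · simp [h4, hc.c6, hc.c10, hx, hV, hV']
      exact .add rfl (.load rfl (.store rfl (.jz_zero rfl (by simp [hc.c7]) .refl)))
    simp only [Function.update_apply, reduceIte, Nat.reduceEqDiff, h4, hc.c6, hc.c10, true_and, hx,
      hV]
    intro r hr
    simp (disch := omega) only [if_neg]
  obtain ⟨R₂, _, h5, rfl, h6⟩ := h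
  exact ⟨R₂, (Reach.finish (hc.congr fun r _ _ => h6 r (by omega))
    (h1.trans h5)).mono (by omega), h2.trans (.of fun r hr => h6 r (by omega))⟩

/-- The memory after the removal of the cut on the variable at address `b`, where the active job is
in the slot `s` and the pool is at `p`. -/
def removeMem (M : ℕ → ℕ) (s p b : ℕ) : ℕ → ℕ :=
  let sc := M (b + 3)
  let q := M sc + 3
  let M₁ := Function.update (Function.update M b 0) sc (M q)
  if q = s then Function.update M₁ p sc
  else if M₁ (M q) = 4 then Function.update M₁ (M₁ (M q + 1) + 3) sc else M₁

theorem remove_block {R M : ℕ → ℕ} (hc : Consts R) : ∃ R', Reach 22 ⟨82, R, M⟩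
    ⟨105, R', removeMem M (R 3) (R 1) (R 16)⟩ ∧ ∀ r < 15, R' r = R r := by
  have h : ∃ R' M', Reach 10 ⟨82, R, M⟩ ⟨92, R', M'⟩ ∧
      M' = Function.update (Function.update M (R 16) 0) (M (R 16 + 3)) (M (M (M (R 16 + 3)) + 3)) ∧
      R' 17 = M (R 16 + 3) ∧ R' 19 = M (M (M (R 16 + 3)) + 3) ∧
      R' 20 = (M (M (R 16 + 3)) + 3 - R 3) + (R 3 - (M (M (R 16 + 3)) + 3)) ∧
      ∀ r < 15, R' r = R r := by
    apply Exists.intro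
    apply Exists.intro
    apply And.intro
    · iterate 10 first
        | refine .add rfl ?_ | refine .load rfl ?_ | refine .sub rfl ?_ | refine .store rfl ?_
      exact .refl
    simp only [Function.update_apply, reduceIte, Nat.reduceEqDiff, hc.c6, hc.c7, hc.c9, true_and]
    intro r hr
    simp (disch := omega) only [if_neg]
  obtain ⟨R₁, M₁, h1, e, e17, e19, e20, h2⟩ := h
  have h6 := h2 6 (by omega)
  have h7 := h2 7 (by omega)
  have h9 := h2 9 (by omega)
  rw [hc.c6] at h6
  rw [hc.c7] at h7
  rw [hc.c9] at h9
  have key : ∃ R' M', Reach 12 ⟨92, R₁, M₁⟩ ⟨105, R', M'⟩ ∧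
      M' = removeMem M (R 3) (R 1) (R 16) ∧ ∀ r < 15, R' r = R₁ r := by
    by_cases hq : M (M (R 16 + 3)) + 3 = R 3
    · simp only [removeMem, if_pos hq]
      refine ⟨_, _, .jz_zero rfl (by omega) (.store rfl .refl), ?_, fun _ _ => rfl⟩
      rw [e17, h2 1 (by omega), e]
    · simp only [removeMem, if_neg hq, ← e]
      by_cases h3 : M₁ (R₁ 19) ≤ 3
      · rw [if_neg (by rw [← e19]; omega)]
        refine ⟨_, _, .jz_pos rfl (by omega) (.load rfl (.sub rfl (.jz_zero rfl ?_ .refl))), rfl, ?_⟩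
        · simp [h9]; omega
        · intro r hr
          simp (disch := omega) only [Function.update_of_ne]
      by_cases h4 : M₁ (R₁ 19) = 4
      · rw [if_pos (by rw [← e19]; omega)]
        apply Exists.intro
        apply Exists.intro
        apply And.intro
        · refine .jz_pos rfl (by omega) (.load rfl (.sub rfl (.jz_pos rfl (by simp [h9]; omega)
            (.sub rfl (.jz_zero rfl (by simp [h9, h6, h4]) ?_)))))
          exact .add rfl (.load rfl (.add rfl (.store rfl (.jz_zero rfl (by simp [h7]) .refl))))
        simp only [Function.update_apply, reduceIte, Nat.reduceEqDiff, h6, h7, h9, e17, e19, true_and]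
        intro r hr
        simp (disch := omega) only [if_neg]
      · rw [if_neg (by rw [← e19]; omega)]
        refine ⟨_, _, .jz_pos rfl (by omega) (.load rfl (.sub rfl (.jz_pos rfl (by simp [h9]; omega)
            (.sub rfl (.jz_pos rfl (by simp [h9, h6]; omega) (.jz_zero rfl (by simp [h7])
            .refl)))))), rfl, ?_⟩
        intro r hr
        simp (disch := omega) only [Function.update_of_ne]
  obtain ⟨R₂, _, h3, rfl, h4⟩ := key
  exact ⟨R₂, (h1.trans h3), fun r hr => (h4 r hr).trans (h2 r hr)⟩

theorem turn_axm2 {R M : ℕ → ℕ} {s B x V : ℕ} (hs : M (R 1) = s) (hB : M s = B)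
    (ht : M B = 5) (hx : M (B + 4) = x) (hx' : M x ≠ 0) (hV : M (x + 1) = V) (hV' : M V = 1) :
    ∃ R', Turn 70 R M R' (removeMem (Function.update M (B + 4) (M (V + 1))) s (R 1) x) ∧
      Same R R' := by
  subst hs hB
  obtain ⟨R₁, h1, hc, h2, h3, h4⟩ := main_dispatch (R := R) (M := M) (by omega) (by omega)
  rw [ht] at h1
  have h : ∃ R' M', Reach 13 ⟨49, R₁, M⟩ ⟨82, R', M'⟩ ∧
      M' = Function.update M (M (M (R 1)) + 4) (M (V + 1)) ∧ R' 16 = x ∧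
      ∀ r < 15, R' r = R₁ r := by
    apply Exists.intro
    apply Exists.intro
    apply And.intro
    · refine .add rfl (.load rfl (.load rfl (.jz_pos rfl (by simp [h4, hc.c10, hx, hx']) ?_)))
      refine .add rfl (.load rfl (.load rfl (.sub rfl (.jz_zero rfl ?_ ?_))))
      · simp [h4, hc.c6, hc.c10, hx, hV, hV']
      exact .add rfl (.load rfl (.store rfl .refl))
    simp only [Function.update_apply, reduceIte, Nat.reduceEqDiff, h4, hc.c6, hc.c10, true_and, hx,
      hV]
    intro r hr
    simp (disch := omega) only [if_neg]
  obtain ⟨R₂, _, h5, rfl, h6, h7⟩ := h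
  obtain ⟨R₃, h8, h9⟩ := remove_block (M := Function.update M (M (M (R 1)) + 4) (M (V + 1)))
    (hc.congr fun r _ _ => h7 r (by omega))
  have h10 : ∀ r < 15, R₃ r = R₁ r := fun r hr => (h9 r hr).trans (h7 r hr)
  rw [h6, h7 1 (by omega), h7 3 (by omega), h2.2.1, h3] at h8
  exact ⟨R₃, (Reach.finish (hc.congr fun r _ _ => h10 r (by omega))
    ((h1.trans h5).trans h8)).mono (by omega), h2.trans (.of fun r hr => h10 r (by omega))⟩

theorem turn_axm1 {R M : ℕ → ℕ} {s B x : ℕ} (hs : M (R 1) = s) (hB : M s = B)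
    (ht : M B = 1) (hx : M (B + 1) = x) (hx' : M x ≠ 0) (hk : M (x + 2) = 0) :
    ∃ R', Turn 70 R M R' (removeMem (Function.update M s (M (x + 1))) s (R 1) x) ∧
      Same R R' := by
  subst hs hB
  obtain ⟨R₁, h1, hc, h2, h3, h4⟩ := main_dispatch (R := R) (M := M) (by omega) (by omega)
  rw [ht] at h1
  have h : ∃ R' M', Reach 13 ⟨107, R₁, M⟩ ⟨82, R', M'⟩ ∧
      M' = Function.update M (M (R 1)) (M (x + 1)) ∧ R' 16 = x ∧
      ∀ r < 15, R' r = R₁ r := by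
    apply Exists.intro
    apply Exists.intro
    apply And.intro
    · refine .add rfl (.load rfl (.load rfl (.jz_pos rfl (by simp [h4, hc.c6, hx, hx']) ?_)))
      refine .add rfl (.load rfl (.jz_zero rfl ?_ ?_))
      · simp [h4, hc.c6, hc.c8, hx, hk]
      exact .add rfl (.load rfl (.store rfl (.jz_zero rfl (by simp [hc.c7]) .refl)))
    simp only [Function.update_apply, reduceIte, Nat.reduceEqDiff, h4, h3, hc.c6, hc.c10, true_and,
      hx]
    intro r hr
    simp (disch := omega) only [if_neg]
  obtain ⟨R₂, _, h5, rfl, h6, h7⟩ := h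
  obtain ⟨R₃, h8, h9⟩ := remove_block (M := Function.update M (M (R 1)) (M (x + 1)))
    (hc.congr fun r _ _ => h7 r (by omega))
  have h10 : ∀ r < 15, R₃ r = R₁ r := fun r hr => (h9 r hr).trans (h7 r hr)
  rw [h6, h7 1 (by omega), h7 3 (by omega), h2.2.1, h3] at h8
  exact ⟨R₃, (Reach.finish (hc.congr fun r _ _ => h10 r (by omega))
    ((h1.trans h5).trans h8)).mono (by omega), h2.trans (.of fun r hr => h10 r (by omega))⟩

/-- The slot of the value at the end of a multi-context. -/
def Ctx.bottom (M : ℕ → ℕ) : Ctx → ℕ → ℕ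
  | .val _, s => s
  | .cut _ _ C, s => C.bottom M (M s + 3)
  | .sub _ _ _ C, s => C.bottom M (M s + 3)
  | .der _ _ C, s => C.bottom M (M s + 3)

theorem walk_last {R M : ℕ → ℕ} (hc : Consts R) (ht : M (M (R 21)) ≤ 3) :
    ∃ R', Reach 4 ⟨126, R, M⟩ ⟨132, R', M⟩ ∧ R' 18 = M (R 21) ∧ R' 21 = R 21 ∧
      ∀ r, r < 17 ∨ r = 23 → R' r = R r := by
  apply Exists.intro
  apply And.intro
  · exact .load rfl (.load rfl (.sub rfl (.jz_zero rfl (by simp [hc.c9]; omega) .refl)))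
  simp only [Function.update_apply, reduceIte, Nat.reduceEqDiff, true_and]
  intro r hr
  simp (disch := omega) only [if_neg]

theorem walk_next {R M : ℕ → ℕ} (hc : Consts R) (ht : 3 < M (M (R 21))) :
    ∃ R', Reach 6 ⟨126, R, M⟩ ⟨126, R', M⟩ ∧ R' 21 = M (R 21) + 3 ∧
      ∀ r, r < 17 ∨ r = 23 → R' r = R r := by
  apply Exists.intro
  apply And.intro
  · exact .load rfl (.load rfl (.sub rfl (.jz_pos rfl (by simp [hc.c9]; omega)
      (.add rfl (.jz_zero rfl (by simp [hc.c7]) .refl)))))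
  simp only [Function.update_apply, reduceIte, Nat.reduceEqDiff, true_and, hc.c9]
  intro r hr
  simp (disch := omega) only [if_neg]

theorem walk {M : ℕ → ℕ} {ρ : Var → ℕ} {η : ℕ → ℕ} : ∀ {C : Ctx} {R : ℕ → ℕ}, Consts R →
    C.At M ρ η (R 21) → C.holes = [] → ∃ R', Reach (6 * C.size) ⟨126, R, M⟩ ⟨132, R', M⟩ ∧
      R' 18 = M (R' 21) ∧ R' 21 = C.bottom M (R 21) ∧ ∀ r, r < 17 ∨ r = 23 → R' r = R r
  | .val v, R, hc, h, hh => by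
    have ht : M (M (R 21)) ≤ 3 ∧ 1 ≤ (Ctx.val v).size := by
      cases v <;> simp [Ctx.At, Val.At, Ctx.holes, Val.holes, Ctx.size, Val.size] at h hh ⊢ <;> omega
    obtain ⟨R', h1, h2, h3, h4⟩ := walk_last hc ht.1
    exact ⟨R', h1.mono (by omega), by rw [h2, h3], h3, h4⟩
  | .cut v x C, R, hc, h, hh => by
    obtain ⟨R₁, h1, h2, h3⟩ := walk_next (M := M) hc (by rw [h.1]; omega)
    obtain ⟨R₂, h4, h5, h6, h7⟩ := walk (C := C) (R := R₁) (hc.congr fun r _ _ => h3 r (by omega))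
      (h2 ▸ h.2.2.2.2) (by simp_all [Ctx.holes])
    exact ⟨R₂, (h1.trans h4).mono (by simp only [Ctx.size]; omega), h5, by rw [h6, h2]; rfl,
      fun r hr => (h7 r hr).trans (h3 r hr)⟩
  | .sub m v x C, R, hc, h, hh => by
    obtain ⟨R₁, h1, h2, h3⟩ := walk_next (M := M) hc (by rw [h.1]; omega)
    obtain ⟨R₂, h4, h5, h6, h7⟩ := walk (C := C) (R := R₁) (hc.congr fun r _ _ => h3 r (by omega))
      (h2 ▸ h.2.2.2.2.2) (by simp_all [Ctx.holes])
    exact ⟨R₂, (h1.trans h4).mono (by simp only [Ctx.size]; omega), h5, by rw [h6, h2]; rfl,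
      fun r hr => (h7 r hr).trans (h3 r hr)⟩
  | .der e x C, R, hc, h, hh => by
    obtain ⟨R₁, h1, h2, h3⟩ := walk_next (M := M) hc (by rw [h.1]; omega)
    obtain ⟨R₂, h4, h5, h6, h7⟩ := walk (C := C) (R := R₁) (hc.congr fun r _ _ => h3 r (by omega))
      (h2 ▸ h.2.2.2.2) (by simp_all [Ctx.holes])
    exact ⟨R₂, (h1.trans h4).mono (by simp only [Ctx.size]; omega), h5, by rw [h6, h2]; rfl,
      fun r hr => (h7 r hr).trans (h3 r hr)⟩

/-- The memory after inserting a cut, in the block `B`, on the variable at address `x` around the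
value in the slot `q`. -/
def spliceMem (M : ℕ → ℕ) (B q x : ℕ) : ℕ → ℕ :=
  Function.update (Function.update (Function.update (Function.update M x 1) (x + 1) (M q)) B 4) q B

theorem splice_block {R M : ℕ → ℕ} (hc : Consts R) (hq : R 18 = M (R 21)) :
    ∃ R', Reach 9 ⟨132, R, M⟩ ⟨if R 23 = 0 then 105 else 82, R',
      spliceMem M (R 4) (R 21) (M (R 4 + 1))⟩ ∧ ∀ r < 17, R' r = R r := by
  have h : ∃ R' M', Reach 7 ⟨132, R, M⟩ ⟨139, R', M'⟩ ∧
      M' = spliceMem M (R 4) (R 21) (M (R 4 + 1)) ∧ R' 23 = R 23 ∧ ∀ r < 17, R' r = R r := by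
    apply Exists.intro
    apply Exists.intro
    apply And.intro
    · iterate 7 first
        | refine .add rfl ?_ | refine .load rfl ?_ | refine .sub rfl ?_ | refine .store rfl ?_
      exact .refl
    simp only [Function.update_apply, reduceIte, Nat.reduceEqDiff, hc.c6, hc.c7, hc.c9, hc.c10,
      true_and, spliceMem, hq]
    intro r hr
    simp (disch := omega) only [if_neg]
  obtain ⟨R₁, _, h1, rfl, h2, h3⟩ := h
  refine ⟨R₁, ?_, h3⟩
  by_cases h : R 23 = 0
  · rw [if_pos h]
    exact h1.trans (.jz_zero rfl (h2.trans h) (.refl (b := 1)))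
  · rw [if_neg h]
    exact h1.trans (.jz_pos rfl (by rwa [h2]) (.jz_zero rfl ((h3 7 (by omega)).trans hc.c7)
      (.refl (b := 0))))

theorem start_axe1 {R M : ℕ → ℕ} {s B x : ℕ} (hs : M (R 1) = s) (hB : M s = B)
    (ht : M B = 1) (hx : M (B + 1) = x) (hx' : M x ≠ 0) (hk : M (x + 2) ≠ 0) :
    ∃ R', Reach 40 (program.next ⟨0, R, M⟩) ⟨141, R', M⟩ ∧ Consts R' ∧ Same R R' ∧ R' 3 = s ∧
      R' 21 = x + 1 ∧ R' 22 = s ∧ R' 24 = 0 ∧ R' 25 = 0 := by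
  subst hs hB
  obtain ⟨R₁, h1, hc, h2, h3, h4⟩ := main_dispatch (R := R) (M := M) (by omega) (by omega)
  rw [ht] at h1
  have h : ∃ R', Reach 13 ⟨107, R₁, M⟩ ⟨141, R', M⟩ ∧ R' 21 = x + 1 ∧ R' 22 = M (R 1) ∧
      R' 24 = 0 ∧ R' 25 = 0 ∧ ∀ r < 15, R' r = R₁ r := by
    apply Exists.intro
    apply And.intro
    · refine .add rfl (.load rfl (.load rfl (.jz_pos rfl (by simp [h4, hc.c6, hx, hx']) ?_)))
      refine .add rfl (.load rfl (.jz_pos rfl ?_ ?_))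
      · simp [h4, hc.c6, hc.c8, hx, hk]
      exact .add rfl (.add rfl (.const rfl (.const rfl (.jz_zero rfl (by simp [hc.c7]) .refl))))
    simp only [Function.update_apply, reduceIte, Nat.reduceEqDiff, h4, h3, hc.c6, hc.c7, true_and,
      hx, add_zero]
    intro r hr
    simp (disch := omega) only [if_neg]
  obtain ⟨R₂, h5, h6, h7, h8, h9, h10⟩ := h
  exact ⟨R₂, (h1.trans h5).mono (by omega), hc.congr fun r _ _ => h10 r (by omega),
    h2.trans (.of fun r hr => h10 r (by omega)), (h10 3 (by omega)).trans h3, h6, h7, h8, h9⟩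

theorem start_bang {R M : ℕ → ℕ} {s B x V : ℕ} (hs : M (R 1) = s) (hB : M s = B)
    (ht : M B = 6) (hx : M (B + 4) = x) (hx' : M x ≠ 0) (hV : M (x + 1) = V) (hV' : 1 < M V) :
    ∃ R', Reach 40 (program.next ⟨0, R, M⟩) ⟨141, R', M⟩ ∧ Consts R' ∧ Same R R' ∧ R' 3 = s ∧
      R' 4 = B ∧ R' 21 = V + 3 ∧ R' 22 = s ∧ R' 23 = 0 ∧ R' 24 = 0 ∧ R' 25 = 1 := by
  subst hs hB
  obtain ⟨R₁, h1, hc, h2, h3, h4⟩ := main_dispatch (R := R) (M := M) (by omega) (by omega)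
  rw [ht] at h1
  have h : ∃ R', Reach 15 ⟨22, R₁, M⟩ ⟨141, R', M⟩ ∧ R' 21 = V + 3 ∧ R' 22 = M (R 1) ∧
      R' 23 = 0 ∧ R' 24 = 0 ∧ R' 25 = 1 ∧ ∀ r < 15, R' r = R₁ r := by
    apply Exists.intro
    apply And.intro
    · refine .add rfl (.load rfl (.load rfl (.jz_pos rfl (by simp [h4, hc.c10, hx, hx']) ?_)))
      refine .add rfl (.load rfl (.load rfl (.sub rfl (.jz_pos rfl ?_ ?_))))
      · simp [h4, hc.c6, hc.c10, hx, hV]; omega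
      exact .add rfl (.add rfl (.const rfl (.const rfl (.const rfl
        (.jz_zero rfl (by simp [hc.c7]) .refl)))))
    simp only [Function.update_apply, reduceIte, Nat.reduceEqDiff, h4, h3, hc.c6, hc.c7, hc.c9,
      hc.c10, true_and, hx, hV, add_zero]
    intro r hr
    simp (disch := omega) only [if_neg]
  obtain ⟨R₂, h5, h6, h7, h8, h9, h9', h10⟩ := h
  exact ⟨R₂, (h1.trans h5).mono (by omega), hc.congr fun r _ _ => h10 r (by omega),
    h2.trans (.of fun r hr => h10 r (by omega)), (h10 3 (by omega)).trans h3,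
    (h10 4 (by omega)).trans h4, h6, h7, h8, h9, h9'⟩

theorem start_lolli {R M : ℕ → ℕ} {s B x V : ℕ} (hs : M (R 1) = s) (hB : M s = B)
    (ht : M B = 5) (hx : M (B + 4) = x) (hx' : M x ≠ 0) (hV : M (x + 1) = V) (hV' : 1 < M V) :
    ∃ R', Reach 50 (program.next ⟨0, R, M⟩) ⟨126, R', Function.update (Function.update
        (Function.update (Function.update M (M (V + 1)) 1) (M (V + 1) + 1) (M (B + 2))) V 4) s V⟩ ∧
      Consts R' ∧ Same R R' ∧ R' 3 = s ∧ R' 4 = B ∧ R' 16 = x ∧ R' 21 = V + 3 ∧ R' 23 = 1 := by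
  subst hs hB
  obtain ⟨R₁, h1, hc, h2, h3, h4⟩ := main_dispatch (R := R) (M := M) (by omega) (by omega)
  rw [ht] at h1
  have h : ∃ R' M', Reach 22 ⟨49, R₁, M⟩ ⟨126, R', M'⟩ ∧ M' = Function.update (Function.update
        (Function.update (Function.update M (M (V + 1)) 1) (M (V + 1) + 1)
        (M (M (M (R 1)) + 2))) V 4) (M (R 1)) V ∧ R' 16 = x ∧ R' 21 = V + 3 ∧
      R' 23 = 1 ∧ ∀ r < 15, R' r = R₁ r := by
    apply Exists.intro
    apply Exists.intro
    apply And.intro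
    · refine .add rfl (.load rfl (.load rfl (.jz_pos rfl (by simp [h4, hc.c10, hx, hx']) ?_)))
      refine .add rfl (.load rfl (.load rfl (.sub rfl (.jz_pos rfl ?_ ?_))))
      · simp [h4, hc.c6, hc.c10, hx, hV]; omega
      iterate 11 first
        | refine .add rfl ?_ | refine .load rfl ?_ | refine .const rfl ?_ | refine .store rfl ?_
      exact .jz_zero rfl (by simp [hc.c7]) .refl
    simp only [Function.update_apply, reduceIte, Nat.reduceEqDiff, h4, h3, hc.c6, hc.c7, hc.c8,
      hc.c9, hc.c10, true_and, hx, hV, add_zero]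
    intro r hr
    simp (disch := omega) only [if_neg]
  obtain ⟨R₂, _, h5, rfl, h6, h7, h8, h10⟩ := h
  exact ⟨R₂, (h1.trans h5).mono (by omega), hc.congr fun r _ _ => h10 r (by omega),
    h2.trans (.of fun r hr => h10 r (by omega)), (h10 3 (by omega)).trans h3,
    (h10 4 (by omega)).trans h4, h6, h7, h8⟩

end Sesame
set_option linter.unusedSimpArgs false
namespace Sesame

/-! ### The copy of a term -/

mutual
/-- The number of blocks that are occupied by a multi-context. -/
def Val.nb : Val → ℕ
  | .hole _ => 0
  | .var _ => 1
  | .lam _ C => C.nb + 2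
  | .bang C => C.nb + 1
def Ctx.nb : Ctx → ℕ
  | .val v => v.nb
  | .cut v _ C => v.nb + C.nb + 2
  | .sub _ v _ C => v.nb + C.nb + 2
  | .der _ _ C => C.nb + 2
end

mutual
/-- The addresses of the bound variables of a copy that is stored from `b` on. -/
def Val.newVars : Val → ℕ → List ℕ
  | .hole _, _ => []
  | .var _, _ => []
  | .lam _ C, b => (b + 8) :: C.newVars (b + 16)
  | .bang C, b => C.newVars (b + 8)
def Ctx.newVars : Ctx → ℕ → List ℕ
  | .val v, b => v.newVars b
  | .cut v _ C, b => (b + 8) :: (v.newVars (b + 16) ++ C.newVars (b + 16 + 8 * v.nb))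
  | .sub _ v _ C, b => (b + 8) :: (v.newVars (b + 16) ++ C.newVars (b + 16 + 8 * v.nb))
  | .der _ _ C, b => (b + 8) :: C.newVars (b + 16)
end

mutual
theorem Val.newVars_length : ∀ {v : Val} {b : ℕ}, (v.newVars b).length = v.bv.length
  | .hole _, _ => rfl
  | .var _, _ => rfl
  | .lam _ C, _ => by simp [Val.newVars, Val.bv, Ctx.newVars_length (v := C)]
  | .bang C, _ => by simp [Val.newVars, Val.bv, Ctx.newVars_length (v := C)]
theorem Ctx.newVars_length : ∀ {v : Ctx} {b : ℕ}, (v.newVars b).length = v.bv.length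
  | .val v, _ => Val.newVars_length (v := v)
  | .cut v _ C, _ => by
    simp [Ctx.newVars, Ctx.bv, Ctx.newVars_length (v := C), Val.newVars_length (v := v)]
  | .sub _ v _ C, _ => by
    simp [Ctx.newVars, Ctx.bv, Ctx.newVars_length (v := C), Val.newVars_length (v := v)]
  | .der _ _ C, _ => by simp [Ctx.newVars, Ctx.bv, Ctx.newVars_length (v := C)]
end

theorem Ctx.mem_blocks_of_bv {M : ℕ → ℕ} {ρ : Var → ℕ} {C : Ctx} {s : ℕ} {x : Var}
    (hx : x ∈ C.bv) : ρ x ∈ C.blocks M ρ s := by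
  rw [← List.one_le_count_iff, Ctx.count_blocks]
  have := List.one_le_count_iff.2 (List.mem_map_of_mem (f := ρ) hx)
  omega

/-- The conditions for a copy into the slot `dst`, with new blocks from `lim` on, of a multi-context
stored in the given cells, with the given variables. -/
structure CopyPre (M : ℕ → ℕ) (ρ ρ' : Var → ℕ) (l : List (Var × Var)) (rd : List ℕ)
    (vars bv fv : List Var) (dst lim : ℕ) : Prop where
  lt : ∀ c ∈ rd, c < lim ∧ c ≠ dst
  cell : ∀ x ∈ vars, ρ x + 2 < lim ∧ ρ x + 2 ≠ dst ∧ ρ x + 2 ∉ rd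
  inj : ∀ x ∈ vars, ∀ y ∈ vars, ρ x = ρ y → x = y
  kind : ∀ x ∈ bv, M (ρ x + 2) = x.kind
  nodup : bv.Nodup
  fwds : ∀ y ∈ fv, ∀ y', AlphaVar l y y' → fwd M (ρ y) = ρ' y'
  dst_lt : dst < lim

/-- The outcome of a copy. -/
structure CopyPost (M' : ℕ → ℕ) (ρ' : Var → ℕ) (η : ℕ → ℕ) (C' : Ctx) (dst lim : ℕ) : Prop where
  at_ : C'.At M' ρ' η dst
  rd : ∀ c ∈ C'.rd M' ρ' dst, c = dst ∨ lim ≤ c ∧ c < lim + 8 * C'.nb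
  blocks : C'.blocks M' ρ' dst = List.range' lim C'.nb 8
  kind : ∀ x ∈ C'.bv, M' (ρ' x + 2) = x.kind

section

variable {M M₁ M₂ : ℕ → ℕ} {ρ ρ' : Var → ℕ} {l : List (Var × Var)} {rd rd₁ : List ℕ}
  {vars bv fv vars₁ bv₁ fv₁ : List Var} {dst lim dst₁ lim₁ : ℕ} {η : ℕ → ℕ}

theorem CopyPre.value (P : CopyPre M ρ ρ' l rd vars bv fv dst lim)
    (hM : ∀ c < lim, c ≠ dst → M₁ c = M c) (hrd : ∀ c ∈ rd₁, c ∈ rd) (hv : ∀ y ∈ vars₁, y ∈ vars)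
    (hb : bv₁.Nodup) (hb' : ∀ y ∈ bv₁, y ∈ bv) (hbv : ∀ y ∈ bv₁, y ∈ vars₁)
    (hf : ∀ y ∈ fv₁, y ∈ fv) (hfv : ∀ y ∈ fv₁, y ∈ vars₁)
    (hd : lim ≤ dst₁) (hl : dst₁ < lim₁) : CopyPre M₁ ρ ρ' l rd₁ vars₁ bv₁ fv₁ dst₁ lim₁ where
  lt c hc := by have := P.lt c (hrd c hc); omega
  cell x hx := by
    have := P.cell x (hv x hx)
    exact ⟨by omega, by omega, fun h => this.2.2 (hrd _ h)⟩
  inj x hx y hy := P.inj x (hv x hx) y (hv y hy)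
  kind x hx := by
    have := P.cell x (hv x (hbv x hx))
    rw [hM _ this.1 this.2.1, P.kind x (hb' x hx)]
  nodup := hb
  fwds y hy y' h := by
    have := P.cell y (hv y (hfv y hy))
    rw [← P.fwds y (hf y hy) y' h]
    simp only [Sesame.fwd, hM _ this.1 this.2.1]
  dst_lt := hl

theorem CopyPre.body (P : CopyPre M ρ ρ' l rd vars bv fv dst lim) {x x' : Var}
    (hM : ∀ c < lim, c ≠ dst → c ≠ ρ x + 2 → M₁ c = M c) (hx : M₁ (ρ x + 2) = ρ' x')
    (hx' : 1 < ρ' x') (hxv : x ∈ vars) (hrd : ∀ c ∈ rd₁, c ∈ rd) (hv : ∀ y ∈ vars₁, y ∈ vars)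
    (hb : bv₁.Nodup) (hxb : x ∉ bv₁) (hb' : ∀ y ∈ bv₁, y ∈ bv) (hbv : ∀ y ∈ bv₁, y ∈ vars₁)
    (hf : ∀ y ∈ fv₁, y ≠ x → y ∈ fv) (hfv : ∀ y ∈ fv₁, y ∈ vars₁)
    (hd : lim ≤ dst₁) (hl : dst₁ < lim₁) :
    CopyPre M₁ ρ ρ' ((x, x') :: l) rd₁ vars₁ bv₁ fv₁ dst₁ lim₁ where
  lt c hc := by have := P.lt c (hrd c hc); omega
  cell x hx := by
    have := P.cell x (hv x hx)
    exact ⟨by omega, by omega, fun h => this.2.2 (hrd _ h)⟩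
  inj x hx y hy := P.inj x (hv x hx) y (hv y hy)
  kind y hy := by
    have := P.cell y (hv y (hbv y hy))
    rw [hM _ this.1 this.2.1, P.kind y (hb' y hy)]
    intro e
    have := P.inj y (hv y (hbv y hy)) x hxv (by omega)
    exact hxb (this ▸ hy)
  nodup := hb
  fwds y hy y' h := by
    rcases h with ⟨rfl, rfl⟩ | ⟨h1, h2, h⟩
    · rw [Sesame.fwd, if_neg (by omega), hx]
    · have := P.cell y (hv y (hfv y hy))
      rw [← P.fwds y (hf y hy h1) y' h]
      have h3 : ρ y + 2 ≠ ρ x + 2 := fun e =>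
        h1 (P.inj y (hv y (hfv y hy)) x hxv (by omega))
      simp only [Sesame.fwd, hM _ this.1 this.2.1 h3]
  dst_lt := hl

/-- The program copies `C` to `C'`. -/
def Copies (ρ ρ' : Var → ℕ) (η : ℕ → ℕ) (l : List (Var × Var)) (C C' : Ctx) : Prop :=
  ∀ (R M : ℕ → ℕ), Consts R → C.At M ρ η (R 21) →
    CopyPre M ρ ρ' l (C.rd M ρ (R 21)) C.vars C.bv C.fv (R 22) (R 2) →
    C'.bv.map ρ' = C'.newVars (R 2) →
    ∃ R' M', Reach (100 * C.size) ⟨141, R, M⟩ ⟨203, R', M'⟩ ∧ Kept R R' ∧ R' 24 = R 24 ∧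
      R' 2 = R 2 + 8 * C'.nb ∧ (∀ c < R 2, c ≠ R 22 → M' c = M c) ∧
      CopyPost M' ρ' η C' (R 22) (R 2)

/-- An outcome does not depend on other cells. -/
theorem CopyPost.congr {C' : Ctx} (P : CopyPost M ρ' η C' dst lim)
    (hM : ∀ c, c = dst ∨ lim ≤ c ∧ c < lim + 8 * C'.nb → M' c = M c) :
    CopyPost M' ρ' η C' dst lim := by
  have h : ∀ c ∈ C'.rd M ρ' dst, M' c = M c := fun c hc => hM c (P.rd c hc)
  obtain ⟨h1, h2, h3⟩ := Ctx.layout_congr (ρ' := ρ') h fun _ _ => rfl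
  refine ⟨P.at_.congr h (fun _ _ => rfl) fun _ _ => rfl, h1 ▸ P.rd, h3 ▸ P.blocks, fun x hx => ?_⟩
  have hb := Ctx.mem_blocks_of_bv (M := M) (ρ := ρ') (s := dst) hx
  rw [P.blocks, List.mem_range'] at hb
  obtain ⟨i, hi, hb⟩ := hb
  rw [hM _ (by omega), P.kind x hx]

theorem copy_body {C C' : Ctx} {x x' : Var} (ih : Copies ρ ρ' η ((x, x') :: l) C C')
    {R : ℕ → ℕ} (hc : Consts R) {N O : ℕ} (hN : R 24 = N) (hN' : 0 < N) (h2 : N + 16 ≤ R 2)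
    (m1 : M (N + 1) = N + 8) (m6 : M (N + 6) = O + 3) (m7 : M (N + 7) = ρ x)
    (m10 : M (N + 10) = x.kind) (hx : ρ x + 2 < N) (hk : M (ρ x + 2) = x.kind)
    (hC : C.At M ρ η (O + 3)) (hrd : ∀ c ∈ C.rd M ρ (O + 3), c < N ∧ c ≠ ρ x + 2)
    (hP : ∀ M₁, (∀ c, c ≠ N + 6 → c ≠ ρ x + 2 → M₁ c = M c) → M₁ (ρ x + 2) = N + 8 →
      CopyPre M₁ ρ ρ' ((x, x') :: l) (C.rd M ρ (O + 3)) C.vars C.bv C.fv (N + 3) (R 2))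
    (hn : C'.bv.map ρ' = C'.newVars (R 2)) :
    ∃ R' M', Reach (100 * C.size + 30) ⟨203, R, M⟩ ⟨203, R', M'⟩ ∧ Kept R R' ∧
      R' 24 = M (N + 5) ∧ R' 2 = R 2 + 8 * C'.nb ∧
      (∀ c < R 2, c ≠ N + 3 → c ≠ N + 6 → M' c = M c) ∧ CopyPost M' ρ' η C' (N + 3) (R 2) := by
  obtain ⟨R₁, h1, a1, a2, a3, a4, a5⟩ := pop_body hc hN (by omega) m6 (by omega)
  rw [m7, m1] at h1
  set M₁ := Function.update (Function.update M (N + 6) 0) (ρ x + 2) (N + 8) with hM₁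
  have e1 : ∀ c, c ≠ N + 6 → c ≠ ρ x + 2 → M₁ c = M c := fun c h h' => by
    rw [hM₁, Function.update_of_ne h', Function.update_of_ne h]
  have e2 : M₁ (ρ x + 2) = N + 8 := by rw [hM₁, Function.update_self]
  have e3 : M₁ (N + 6) = 0 := by
    rw [hM₁, Function.update_of_ne (by omega), Function.update_self]
  have e4 : ∀ c ∈ C.rd M ρ (O + 3), M₁ c = M c := fun c hc =>
    e1 c (by have := hrd c hc; omega) (hrd c hc).2
  obtain ⟨e5, -⟩ := Ctx.layout_congr (ρ' := ρ) e4 fun _ _ => rfl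
  obtain ⟨R₂, M₂, h2', b1, b2, b3, b4, b5⟩ := ih R₁ M₁ (a5.consts hc)
    (by rw [a1]; exact hC.congr e4 (fun _ _ => rfl) fun _ _ => rfl)
    (by rw [a1, a2, a3, e5]; exact hP M₁ e1 e2) (by rwa [a3])
  rw [a2, a3] at b4 b5
  obtain ⟨R₃, h3, c1, c2, c3⟩ := pop_exit (M := M₂) (b1.consts (a5.consts hc))
    (b2.trans a4) (by omega) (by rw [b4 _ (by omega) (by omega), e3])
  rw [b4 (N + 7) (by omega) (by omega), b4 (N + 1) (by omega) (by omega),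
    b4 (N + 5) (by omega) (by omega), e1 (N + 7) (by omega) (by omega),
    e1 (N + 1) (by omega) (by omega), e1 (N + 5) (by omega) (by omega), m7, m1,
    b4 (N + 8 + 2) (by omega) (by omega), e1 (N + 8 + 2) (by omega) (by omega), m10] at *
  refine ⟨R₃, _, ((h1.trans h2').trans h3).mono (by omega), (a5.trans b1).trans c3, c2, ?_, ?_,
    b5.congr fun c hc => Function.update_of_ne (by omega) _ _⟩
  · rw [c1, b3, a3]
  · intro c h h' h''
    by_cases hcx : c = ρ x + 2
    · rw [hcx, Function.update_self, hk]
    · rw [Function.update_of_ne hcx, b4 c h h', e1 c h'' hcx]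

theorem copy_scope {C C' : Ctx} {x x' : Var} (ih : Copies ρ ρ' η ((x, x') :: l) C C')
    {R : ℕ → ℕ} (hc : Consts R) {N O : ℕ} (P : CopyPre M ρ ρ' l rd vars bv fv dst N)
    (hN : R 24 = N) (h2 : N + 16 ≤ R 2) (hM : ∀ c < N, c ≠ dst → M₁ c = M c)
    (m1 : M₁ (N + 1) = N + 8) (m6 : M₁ (N + 6) = O + 3) (m7 : M₁ (N + 7) = ρ x)
    (m10 : M₁ (N + 10) = M (ρ x + 2)) (hx' : ρ' x' = N + 8) (hxv : x ∈ vars) (hxb : x ∈ bv)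
    (hC : C.At M ρ η (O + 3)) (hrd : ∀ c ∈ C.rd M ρ (O + 3), c ∈ rd) (hv : ∀ y ∈ C.vars, y ∈ vars)
    (hb : (x :: C.bv).Nodup) (hb' : ∀ y ∈ C.bv, y ∈ bv) (hf : ∀ y ∈ C.fv, y ≠ x → y ∈ fv)
    (hn : C'.bv.map ρ' = C'.newVars (R 2)) :
    ∃ R' M', Reach (100 * C.size + 30) ⟨203, R, M₁⟩ ⟨203, R', M'⟩ ∧ Kept R R' ∧
      R' 24 = M₁ (N + 5) ∧ R' 2 = R 2 + 8 * C'.nb ∧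
      (∀ c < R 2, c ≠ N + 3 → c ≠ N + 6 → M' c = M₁ c) ∧ CopyPost M' ρ' η C' (N + 3) (R 2) := by
  obtain ⟨hx1, hx2, hx3⟩ := P.cell x hxv
  have hd := P.dst_lt
  have e : ∀ c ∈ C.rd M ρ (O + 3), M₁ c = M c := fun c hc =>
    hM c (P.lt c (hrd c hc)).1 (P.lt c (hrd c hc)).2
  obtain ⟨e', -⟩ := Ctx.layout_congr (ρ' := ρ) e fun _ _ => rfl
  refine copy_body ih hc hN (by omega) h2 m1 m6 m7 (m10.trans (P.kind x hxb)) hx1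
    ((hM _ hx1 hx2).trans (P.kind x hxb)) (hC.congr e (fun _ _ => rfl) fun _ _ => rfl) ?_ ?_ hn
  · rw [e']
    exact fun c hc => ⟨(P.lt c (hrd c hc)).1, fun h => hx3 (h ▸ hrd c hc)⟩
  · intro M₂ h1 h2
    rw [e']
    rw [List.nodup_cons] at hb
    exact P.body (fun c hc hcd hcx => by rw [h1 c (by omega) hcx, hM c hc hcd]) (by rw [h2, hx'])
      (by omega) hxv hrd hv hb.2 hb.1 hb' (fun y hy => Ctx.mem_vars_iff.2 (.inr hy)) hf
      (fun y hy => Ctx.mem_vars_iff.2 (.inl hy)) (by omega) (by omega)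

end

section

variable {ρ ρ' : Var → ℕ} {η : ℕ → ℕ}

set_option maxHeartbeats 1000000 in
mutual
theorem Val.copies : ∀ {l : List (Var × Var)} {v w : Val}, v.Alpha l w → v.holes = [] →
    Copies ρ ρ' η l (.val v) (.val w)
  | l, .hole _, w, _, hh => by simp [Val.holes] at hh
  | l, .var x, .var y, h, _ => by
    intro R M hc hA P hn
    simp only [Ctx.At, Val.At] at hA
    obtain ⟨R', M', h1, h2, h3, h4, h5, h6, h7, h8⟩ := copy_var hc rfl rfl P.dst_lt hA.1
    rw [hA.2, P.fwds x (by simp [Ctx.fv, Val.fv]) y h] at h5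
    refine ⟨R', M', h1.mono (by simp [Ctx.size, Val.size]), h8, h7, by simp [h6, Ctx.nb, Val.nb],
      h2, ?_, ?_, ?_, ?_⟩
    · simp [Ctx.At, Val.At, h3, h4, h5]
    · simp [Ctx.rd, Val.rd, h3, Ctx.nb, Val.nb]
    · simp [Ctx.blocks, Val.blocks, h3, Ctx.nb, Val.nb]
    · simp [Ctx.bv, Val.bv]
  | l, .lam x C, .lam y D, h, hh => by
    intro R M hc hA P hn
    simp only [Ctx.At, Val.At] at hA
    obtain ⟨hA1, hA2, hA3, hA4⟩ := hA
    simp only [Ctx.bv, Val.bv, List.map_cons, Ctx.newVars, Val.newVars, List.cons.injEq] at hn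
    obtain ⟨R₁, M₁, h1, a0, a1, a2, a3, a4, a5, a6, a7, a8, a9, a10, a11, -, -, a12⟩ :=
      copy_bind hc rfl rfl hA2 P.dst_lt (.inl hA1)
    rw [if_neg (by omega)] at h1
    have hd := P.dst_lt
    obtain ⟨R₂, M₂, h2, b1, b2, b3, b4, b5⟩ := copy_scope (Ctx.copies h.2 hh) (a12.consts hc) P a11
      (by omega) a0 a3 a6 a7 a9 hn.1 (by simp [Ctx.vars, Val.vars]) (by simp [Ctx.bv, Val.bv]) hA4
      (by simp +contextual [Ctx.rd, Val.rd]) (by simp +contextual [Ctx.vars, Val.vars])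
      P.nodup (by simp +contextual [Ctx.bv, Val.bv]) (by simp +contextual [Ctx.fv, Val.fv])
      (by rw [a10]; exact hn.2)
    rw [a10] at b3 b4 b5
    have e : ∀ c, c < R 2 + 16 → c ≠ R 2 + 3 → c ≠ R 2 + 6 → M₂ c = M₁ c := b4
    have m0 : M₂ (R 22) = R 2 := by rw [e _ (by omega) (by omega) (by omega), a1]
    refine ⟨R₂, M₂, (h1.trans h2).mono (by simp only [Ctx.size, Val.size]; omega), a12.trans b1,
      b2.trans a5, by simp only [b3, Ctx.nb, Val.nb]; omega, fun c hc hcd => ?_, ?_, ?_, ?_, ?_⟩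
    · rw [e c (by omega) (by omega) (by omega), a0 c hc hcd]
    · simp only [Ctx.At, Val.At, m0, hn.1]
      refine ⟨?_, ?_, ?_, b5.at_⟩
      · rw [e _ (by omega) (by omega) (by omega), a2, hA1]
      · rw [e _ (by omega) (by omega) (by omega), a3]
      · rw [e _ (by omega) (by omega) (by omega), a8, hA3]
    · intro c hc
      simp only [Ctx.rd, Val.rd, m0, hn.1, List.mem_cons, List.mem_append, List.not_mem_nil,
        or_false, false_or] at hc
      simp only [Ctx.nb, Val.nb]
      rcases Classical.em (c ∈ D.rd M₂ ρ' (R 2 + 3)) with h | h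
      · have := b5.rd c h
        omega
      · simp only [h, or_false] at hc
        omega
    · simp only [Ctx.blocks, Val.blocks, m0, hn.1, b5.blocks, Ctx.nb, Val.nb, List.range'_succ]
    · simp only [Ctx.bv, Val.bv, List.mem_cons, forall_eq_or_imp, hn.1]
      refine ⟨?_, b5.kind⟩
      rw [e _ (by omega) (by omega) (by omega), a9, P.kind x (by simp [Ctx.bv, Val.bv]), h.1]
  | l, .bang C, .bang D, h, hh => by
    intro R M hc hA P hn
    simp only [Ctx.At, Val.At] at hA
    obtain ⟨R₁, M₁, h1, a0, a1, a2, a3, a4, a5, a6, a7⟩ :=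
      copy_bang hc rfl rfl P.dst_lt hA.1
    have hd := P.dst_lt
    have hrd : ∀ c ∈ C.rd M ρ (M (R 21) + 3), c ∈ (Ctx.val (.bang C)).rd M ρ (R 21) := by
      simp +contextual [Ctx.rd, Val.rd]
    have e : ∀ c ∈ C.rd M ρ (M (R 21) + 3), M₁ c = M c := fun c hc =>
      a0 c (P.lt c (hrd c hc)).1 (P.lt c (hrd c hc)).2
    obtain ⟨e', -⟩ := Ctx.layout_congr (ρ' := ρ) e fun _ _ => rfl
    obtain ⟨R₂, M₂, h2, b1, b2, b3, b4, b5⟩ := Ctx.copies h hh R₁ M₁ (a7.consts hc)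
      (by rw [a5]; exact hA.2.congr e (fun _ _ => rfl) fun _ _ => rfl)
      (by
        rw [a5, a6, a3, e']
        exact P.value a0 hrd (fun _ h => h) P.nodup (fun _ h => h)
          (fun y hy => Ctx.mem_vars_iff.2 (.inr hy)) (fun _ h => h)
          (fun y hy => Ctx.mem_vars_iff.2 (.inl hy)) (by omega) (by omega)) (by rw [a3]; exact hn)
    rw [a3] at b3 b4 b5
    rw [a6] at b4 b5
    have m0 : M₂ (R 22) = R 2 := by rw [b4 _ (by omega) (by omega), a1]
    refine ⟨R₂, M₂, (h1.trans h2).mono (by simp only [Ctx.size, Val.size]; omega), a7.trans b1,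
      b2.trans a4, by simp only [b3, Ctx.nb, Val.nb]; omega, fun c hc hcd => ?_, ?_, ?_, ?_, b5.kind⟩
    · rw [b4 c (by omega) (by omega), a0 c hc hcd]
    · simp only [Ctx.At, Val.At, m0]
      exact ⟨by rw [b4 _ (by omega) (by omega), a2, hA.1], b5.at_⟩
    · intro c hc
      simp only [Ctx.rd, Val.rd, m0, List.mem_cons, List.mem_append, List.not_mem_nil,
        or_false, false_or] at hc
      simp only [Ctx.nb, Val.nb]
      rcases Classical.em (c ∈ D.rd M₂ ρ' (R 2 + 3)) with h | h
      · have := b5.rd c h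
        omega
      · simp only [h, or_false] at hc
        omega
    · simp only [Ctx.blocks, Val.blocks, m0, b5.blocks, Ctx.nb, Val.nb, List.range'_succ]
  | _, .var _, .hole _, h, _ | _, .var _, .lam _ _, h, _ | _, .var _, .bang _, h, _
  | _, .lam _ _, .hole _, h, _ | _, .lam _ _, .var _, h, _ | _, .lam _ _, .bang _, h, _
  | _, .bang _, .hole _, h, _ | _, .bang _, .var _, h, _ | _, .bang _, .lam _ _, h, _ => by
    simp [Val.Alpha] at h
theorem Ctx.copies : ∀ {l : List (Var × Var)} {v w : Ctx}, v.Alpha l w → v.holes = [] →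
    Copies ρ ρ' η l v w
  | l, .val v, .val w, h, hh => Val.copies h hh
  | l, .cut v x C, .cut w y D, h, hh => by
    simp only [Ctx.holes, List.append_eq_nil_iff] at hh
    intro R M hc hA P hn
    simp only [Ctx.At] at hA
    obtain ⟨hA1, hA2, hA3, hA4, hA5⟩ := hA
    simp only [Ctx.bv, List.map_cons, Ctx.newVars, List.cons.injEq, List.map_append] at hn
    obtain ⟨hn1, hn2⟩ := hn
    obtain ⟨hn2, hn3⟩ := List.append_inj hn2 (by rw [List.length_map, Val.newVars_length])
    obtain ⟨R₁, M₁, h1, a0, a1, a2, a3, a4, a5, a6, a7, a8, a9, a10, a11, a12, -, a13⟩ :=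
      copy_bind hc rfl rfl hA2 P.dst_lt (.inr (.inl hA1))
    rw [if_pos (.inl hA1)] at h1
    obtain ⟨a12, a12'⟩ := a12 hA1
    have hd := P.dst_lt
    have hnd := P.nodup
    simp only [Ctx.bv, List.nodup_cons, List.nodup_append', List.mem_append, not_or] at hnd
    have hrd : ∀ c ∈ v.rd M ρ (ρ x + 1), c ∈ (Ctx.cut v x C).rd M ρ (R 21) := by
      simp +contextual [Ctx.rd]
    have e : ∀ c ∈ v.rd M ρ (ρ x + 1), M₁ c = M c := fun c hc =>
      a0 c (P.lt c (hrd c hc)).1 (P.lt c (hrd c hc)).2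
    obtain ⟨e', -⟩ := Val.layout_congr (ρ' := ρ) e fun _ _ => rfl
    obtain ⟨R₂, M₂, h2, b1, b2, b3, b4, b5⟩ := Val.copies h.1 hh.1 R₁ M₁ (a13.consts hc)
      (by rw [a12]; exact hA4.congr e (fun _ _ => rfl) fun _ _ => rfl)
      (by
        rw [a12, a12', a10, Ctx.rd, e']
        exact P.value a0 hrd (by simp +contextual [Ctx.vars]) hnd.2.1
          (by simp +contextual [Ctx.bv]) (fun y hy => Ctx.mem_vars_iff.2 (.inr hy))
          (by simp +contextual [Ctx.fv]) (fun y hy => Ctx.mem_vars_iff.2 (.inl hy)) (by omega)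
          (by omega)) (by rw [a10]; exact hn2)
    rw [a10] at b3 b4 b5
    rw [a12'] at b4 b5
    simp only [Ctx.nb] at b3
    obtain ⟨R₃, M₃, h3, c1, c2, c3, c4, c5⟩ := copy_scope (M₁ := M₂) (Ctx.copies h.2.2 hh.2)
      ((a13.trans b1).consts hc) P (b2.trans a11) (by omega)
      (fun c hc hcd => by rw [b4 c (by omega) (by omega), a0 c hc hcd])
      (by rw [b4 _ (by omega) (by omega), a3]) (by rw [b4 _ (by omega) (by omega), a6])
      (by rw [b4 _ (by omega) (by omega), a7]) (by rw [b4 _ (by omega) (by omega), a9])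
      hn1 (by simp [Ctx.vars]) (by simp [Ctx.bv]) hA5
      (by simp +contextual [Ctx.rd]) (by simp +contextual [Ctx.vars])
      (by simp [hnd]) (by simp +contextual [Ctx.bv]) (by simp +contextual [Ctx.fv])
      (by rw [b3]; exact hn3)
    rw [b3] at c3 c4 c5
    rw [b4 _ (by omega) (by omega)] at c2
    have e : ∀ c, c < R 2 + 16 → c ≠ R 2 + 3 → c ≠ R 2 + 6 → c ≠ R 2 + 9 → M₃ c = M₁ c :=
      fun c _ _ _ _ => by rw [c4 c (by omega) (by omega) (by omega), b4 c (by omega) (by omega)]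
    have b6 := b5.congr (M' := M₃) fun c hc => c4 c (by simp only [Ctx.nb] at hc; omega)
      (by omega) (by omega)
    have m0 : M₃ (R 22) = R 2 := by rw [e _ (by omega) (by omega) (by omega) (by omega), a1]
    refine ⟨R₃, M₃, ((h1.trans h2).trans h3).mono (by simp only [Ctx.size]; omega),
      (a13.trans b1).trans c1, c2.trans a5, by simp only [c3, Ctx.nb]; omega,
      fun c hc hcd => ?_, ?_, ?_, ?_, ?_⟩
    · rw [e c (by omega) (by omega) (by omega) (by omega), a0 c hc hcd]
    · simp only [Ctx.At, m0, hn1]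
      refine ⟨?_, ?_, ?_, b6.at_, c5.at_⟩
      · rw [e _ (by omega) (by omega) (by omega) (by omega), a2, hA1]
      · rw [e _ (by omega) (by omega) (by omega) (by omega), a3]
      · rw [e _ (by omega) (by omega) (by omega) (by omega), a8, hA3]
    · intro c hc
      simp only [Ctx.rd, m0, hn1, List.mem_cons, List.mem_append, List.not_mem_nil,
        or_false, false_or] at hc
      simp only [Ctx.nb]
      have h5 := b6.rd c
      simp only [Ctx.rd, Ctx.nb] at h5
      rcases hc with rfl | (rfl | rfl | rfl) | hc | hc
      · exact .inl rfl
      · omega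
      · omega
      · omega
      · have := h5 hc
        omega
      · have := c5.rd c hc
        omega
    · have h5 := b6.blocks
      simp only [Ctx.blocks, Ctx.nb] at h5
      simp only [Ctx.blocks, m0, hn1, h5, c5.blocks, Ctx.nb, List.range'_succ]
      rw [← List.range'_append]
    · have h5 := b6.kind
      simp only [Ctx.bv] at h5
      simp only [Ctx.bv, List.mem_cons, hn1, List.mem_append, or_imp, forall_and, forall_eq]
      refine ⟨?_, h5, c5.kind⟩
      rw [e _ (by omega) (by omega) (by omega) (by omega), a9, P.kind x (by simp [Ctx.bv]), h.2.1]
  | l, .sub m v x C, .sub n w y D, h, hh => by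
    simp only [Ctx.holes, List.append_eq_nil_iff] at hh
    intro R M hc hA P hn
    simp only [Ctx.At] at hA
    obtain ⟨hA1, hA2, hA6, hA3, hA4, hA5⟩ := hA
    simp only [Ctx.bv, List.map_cons, Ctx.newVars, List.cons.injEq, List.map_append] at hn
    obtain ⟨hn1, hn2⟩ := hn
    obtain ⟨hn2, hn3⟩ := List.append_inj hn2 (by rw [List.length_map, Val.newVars_length])
    obtain ⟨R₁, M₁, h1, a0, a1, a2, a3, a4, a5, a6, a7, a8, a9, a10, a11, -, a12, a13⟩ :=
      copy_bind hc rfl rfl hA2 P.dst_lt (.inr (.inr (.inl hA1)))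
    rw [if_pos (.inr hA1)] at h1
    obtain ⟨a12, a12'⟩ := a12 hA1
    have hd := P.dst_lt
    have hnd := P.nodup
    simp only [Ctx.bv, List.nodup_cons, List.nodup_append', List.mem_append, not_or] at hnd
    have hrd : ∀ c ∈ v.rd M ρ (M (R 21) + 2), c ∈ (Ctx.sub m v x C).rd M ρ (R 21) := by
      simp +contextual [Ctx.rd]
    have e : ∀ c ∈ v.rd M ρ (M (R 21) + 2), M₁ c = M c := fun c hc =>
      a0 c (P.lt c (hrd c hc)).1 (P.lt c (hrd c hc)).2
    obtain ⟨e', -⟩ := Val.layout_congr (ρ' := ρ) e fun _ _ => rfl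
    obtain ⟨R₂, M₂, h2, b1, b2, b3, b4, b5⟩ := Val.copies h.2.1 hh.1 R₁ M₁ (a13.consts hc)
      (by rw [a12]; exact hA4.congr e (fun _ _ => rfl) fun _ _ => rfl)
      (by
        rw [a12, a12', a10, Ctx.rd, e']
        exact P.value a0 hrd (by simp +contextual [Ctx.vars]) hnd.2.1
          (by simp +contextual [Ctx.bv]) (fun y hy => Ctx.mem_vars_iff.2 (.inr hy))
          (by simp +contextual [Ctx.fv]) (fun y hy => Ctx.mem_vars_iff.2 (.inl hy)) (by omega)
          (by omega)) (by rw [a10]; exact hn2)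
    rw [a10] at b3 b4 b5
    rw [a12'] at b4 b5
    simp only [Ctx.nb] at b3
    obtain ⟨R₃, M₃, h3, c1, c2, c3, c4, c5⟩ := copy_scope (M₁ := M₂) (Ctx.copies h.2.2.2 hh.2)
      ((a13.trans b1).consts hc) P (b2.trans a11) (by omega)
      (fun c hc hcd => by rw [b4 c (by omega) (by omega), a0 c hc hcd])
      (by rw [b4 _ (by omega) (by omega), a3]) (by rw [b4 _ (by omega) (by omega), a6])
      (by rw [b4 _ (by omega) (by omega), a7]) (by rw [b4 _ (by omega) (by omega), a9])
      hn1 (by simp [Ctx.vars]) (by simp [Ctx.bv]) hA5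
      (by simp +contextual [Ctx.rd]) (by simp +contextual [Ctx.vars])
      (by simp [hnd]) (by simp +contextual [Ctx.bv]) (by simp +contextual [Ctx.fv])
      (by rw [b3]; exact hn3)
    rw [b3] at c3 c4 c5
    rw [b4 _ (by omega) (by omega)] at c2
    have e : ∀ c, c < R 2 + 16 → c ≠ R 2 + 3 → c ≠ R 2 + 6 → c ≠ R 2 + 2 → M₃ c = M₁ c :=
      fun c _ _ _ _ => by rw [c4 c (by omega) (by omega) (by omega), b4 c (by omega) (by omega)]
    have b6 := b5.congr (M' := M₃) fun c hc => c4 c (by simp only [Ctx.nb] at hc; omega)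
      (by omega) (by omega)
    have m0 : M₃ (R 22) = R 2 := by rw [e _ (by omega) (by omega) (by omega) (by omega), a1]
    refine ⟨R₃, M₃, ((h1.trans h2).trans h3).mono (by simp only [Ctx.size]; omega),
      (a13.trans b1).trans c1, c2.trans a5, by simp only [c3, Ctx.nb]; omega,
      fun c hc hcd => ?_, ?_, ?_, ?_, ?_⟩
    · rw [e c (by omega) (by omega) (by omega) (by omega), a0 c hc hcd]
    · simp only [Ctx.At, m0, hn1]
      refine ⟨?_, ?_, ?_, ?_, b6.at_, c5.at_⟩
      · rw [e _ (by omega) (by omega) (by omega) (by omega), a2, hA1]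
      · rw [e _ (by omega) (by omega) (by omega) (by omega), a3]
      · rw [e _ (by omega) (by omega) (by omega) (by omega), a4, hA6,
          P.fwds (.m m) (by simp [Ctx.fv]) _ h.1]
      · rw [e _ (by omega) (by omega) (by omega) (by omega), a8, hA3]
    · intro c hc
      simp only [Ctx.rd, m0, hn1, List.mem_cons, List.mem_append, List.not_mem_nil,
        or_false, false_or] at hc
      simp only [Ctx.nb]
      have h5 := b6.rd c
      simp only [Ctx.rd, Ctx.nb] at h5
      rcases hc with rfl | (rfl | rfl | rfl | rfl) | hc | hc
      · exact .inl rfl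
      · omega
      · omega
      · omega
      · omega
      · have := h5 hc
        omega
      · have := c5.rd c hc
        omega
    · have h5 := b6.blocks
      simp only [Ctx.blocks, Ctx.nb] at h5
      simp only [Ctx.blocks, m0, hn1, h5, c5.blocks, Ctx.nb, List.range'_succ]
      rw [← List.range'_append]
    · have h5 := b6.kind
      simp only [Ctx.bv] at h5
      simp only [Ctx.bv, List.mem_cons, hn1, List.mem_append, or_imp, forall_and, forall_eq]
      refine ⟨?_, h5, c5.kind⟩
      rw [e _ (by omega) (by omega) (by omega) (by omega), a9, P.kind x (by simp [Ctx.bv]), h.2.2.1]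
  | l, .der m x C, .der n y D, h, hh => by
    intro R M hc hA P hn
    simp only [Ctx.At] at hA
    obtain ⟨hA1, hA2, hA6, hA3, hA4⟩ := hA
    simp only [Ctx.bv, List.map_cons, Ctx.newVars, List.cons.injEq] at hn
    obtain ⟨R₁, M₁, h1, a0, a1, a2, a3, a4, a5, a6, a7, a8, a9, a10, a11, -, -, a12⟩ :=
      copy_bind hc rfl rfl hA2 P.dst_lt (.inr (.inr (.inr hA1)))
    rw [if_neg (by omega)] at h1
    have hd := P.dst_lt
    obtain ⟨R₂, M₂, h2, b1, b2, b3, b4, b5⟩ := copy_scope (Ctx.copies h.2.2 hh) (a12.consts hc) P a11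
      (by omega) a0 a3 a6 a7 a9 hn.1 (by simp [Ctx.vars]) (by simp [Ctx.bv]) hA4
      (by simp +contextual [Ctx.rd]) (by simp +contextual [Ctx.vars])
      P.nodup (by simp +contextual [Ctx.bv]) (by simp +contextual [Ctx.fv])
      (by rw [a10]; exact hn.2)
    rw [a10] at b3 b4 b5
    have e : ∀ c, c < R 2 + 16 → c ≠ R 2 + 3 → c ≠ R 2 + 6 → M₂ c = M₁ c := b4
    have m0 : M₂ (R 22) = R 2 := by rw [e _ (by omega) (by omega) (by omega), a1]
    refine ⟨R₂, M₂, (h1.trans h2).mono (by simp only [Ctx.size]; omega), a12.trans b1,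
      b2.trans a5, by simp only [b3, Ctx.nb]; omega, fun c hc hcd => ?_, ?_, ?_, ?_, ?_⟩
    · rw [e c (by omega) (by omega) (by omega), a0 c hc hcd]
    · simp only [Ctx.At, m0, hn.1]
      refine ⟨?_, ?_, ?_, ?_, b5.at_⟩
      · rw [e _ (by omega) (by omega) (by omega), a2, hA1]
      · rw [e _ (by omega) (by omega) (by omega), a3]
      · rw [e _ (by omega) (by omega) (by omega), a4, hA6,
          P.fwds (.e m) (by simp [Ctx.fv]) _ h.1]
      · rw [e _ (by omega) (by omega) (by omega), a8, hA3]
    · intro c hc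
      simp only [Ctx.rd, m0, hn.1, List.mem_cons, List.mem_append, List.not_mem_nil,
        or_false, false_or] at hc
      simp only [Ctx.nb]
      rcases Classical.em (c ∈ D.rd M₂ ρ' (R 2 + 3)) with h | h
      · have := b5.rd c h
        omega
      · simp only [h, or_false] at hc
        omega
    · simp only [Ctx.blocks, m0, hn.1, b5.blocks, Ctx.nb, List.range'_succ]
    · simp only [Ctx.bv, List.mem_cons, forall_eq_or_imp, hn.1]
      refine ⟨?_, b5.kind⟩
      rw [e _ (by omega) (by omega) (by omega), a9, P.kind x (by simp [Ctx.bv]), h.2.1]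
  | _, .val _, .cut _ _ _, h, _ | _, .val _, .sub _ _ _ _, h, _ | _, .val _, .der _ _ _, h, _
  | _, .cut _ _ _, .val _, h, _ | _, .cut _ _ _, .sub _ _ _ _, h, _
  | _, .cut _ _ _, .der _ _ _, h, _
  | _, .sub _ _ _ _, .val _, h, _ | _, .sub _ _ _ _, .cut _ _ _, h, _
  | _, .sub _ _ _ _, .der _ _ _, h, _
  | _, .der _ _ _, .val _, h, _ | _, .der _ _ _, .cut _ _ _, h, _
  | _, .der _ _ _, .sub _ _ _ _, h, _ => by
    simp [Ctx.Alpha] at h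
end

end

end Sesame
set_option linter.unusedSimpArgs false
namespace Sesame

/-! ### The invariant of the memory -/

/-- The given blocks of constructors and blocks of variables are disjoint and in the used part of
the memory. -/
structure Layout (cs : List ℕ) (vars : List Var) (ρ : Var → ℕ) (lim : ℕ) : Prop where
  nodup : cs.Nodup
  inj : ∀ x ∈ vars, ∀ y ∈ vars, ρ x = ρ y → x = y
  sep : ∀ x ∈ vars, ρ x ∉ cs
  con : ∀ b ∈ cs, 8 ∣ b ∧ 0 < b ∧ b < lim
  var : ∀ x ∈ vars, 8 ∣ ρ x ∧ 0 < ρ x ∧ ρ x < lim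
  lim : 8 ∣ lim

/-- Going to another layout: the new blocks and variables are old ones or fresh ones. -/
theorem Layout.extend {cs cs' F : List ℕ} {vars vars' S : List Var} {ρ ρ' : Var → ℕ} {lim lim' : ℕ}
    (h : Layout cs vars ρ lim) (hc : ∀ c, cs'.count c ≤ cs.count c + F.count c)
    (hv : ∀ x ∈ vars', x ∈ vars ∨ x ∈ S) (hρ : ∀ x ∈ vars, ρ' x = ρ x)
    (hn : (F ++ S.map ρ').Nodup)
    (hF : ∀ b ∈ F ++ S.map ρ', 8 ∣ b ∧ lim ≤ b ∧ b < lim') (hl : lim ≤ lim') (hl' : 8 ∣ lim')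
    (h0 : 0 < lim) : Layout cs' vars' ρ' lim' := by
  have hm : ∀ b ∈ cs', b ∈ cs ∨ b ∈ F := by
    intro b hb
    have := hc b
    rw [← List.count_pos_iff] at hb ⊢
    rw [← List.count_pos_iff]
    omega
  simp only [List.mem_append, List.mem_map, or_imp, forall_and, forall_exists_index, and_imp,
    forall_apply_eq_imp_iff₂] at hF
  rw [List.nodup_append'] at hn
  obtain ⟨⟨hF1, hF2⟩, ⟨hF3, hF4⟩, hF5, hF6⟩ := hF
  obtain ⟨hn1, hn2, hn3⟩ := hn
  refine ⟨?_, ?_, ?_, ?_, ?_, hl'⟩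
  · rw [List.nodup_iff_count_le_one]
    intro b
    have h1 := hc b
    have h2 := List.nodup_iff_count_le_one.1 h.nodup b
    have h3 := List.nodup_iff_count_le_one.1 hn1 b
    by_cases hb : b ∈ F
    · have : b ∉ cs := fun h' => by
        have := (h.con b h').2.2
        have := hF3 b hb
        omega
      rw [List.count_eq_zero.2 this] at h1
      omega
    · rw [List.count_eq_zero.2 hb] at h1
      omega
  · intro x hx y hy e
    rcases hv x hx with hx | hx <;> rcases hv y hy with hy | hy
    · exact h.inj x hx y hy (by rw [← hρ x hx, ← hρ y hy, e])
    · have := (h.var x hx).2.2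
      have := hF4 y hy
      rw [← e, hρ x hx] at this
      omega
    · have := (h.var y hy).2.2
      have := hF4 x hx
      rw [e, hρ y hy] at this
      omega
    · exact List.inj_on_of_nodup_map hn2 hx hy e
  · intro x hx hb
    rcases hv x hx with hx | hx <;> rcases hm _ hb with hb | hb
    · rw [hρ x hx] at hb
      exact h.sep x hx hb
    · have := (h.var x hx).2.2
      have := hF3 _ hb
      rw [hρ x hx] at this
      omega
    · have := (h.con _ hb).2.2
      have := hF4 x hx
      omega
    · exact hn3 hb (List.mem_map_of_mem hx)
  · intro b hb
    rcases hm b hb with hb | hb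
    · have := h.con b hb
      exact ⟨this.1, this.2.1, by omega⟩
    · have := hF3 b hb
      exact ⟨hF1 b hb, by omega, hF5 b hb⟩
  · intro x hx
    rcases hv x hx with hx | hx
    · have := h.var x hx
      rw [hρ x hx]
      exact ⟨this.1, this.2.1, by omega⟩
    · have := hF4 x hx
      exact ⟨hF2 x hx, by omega, hF6 x hx⟩

/-- The invariant of the memory, with the multi-context in the slot `r`, the pool at `p`, and the
unused part of the memory from `lim` on. -/
structure MInv (M : ℕ → ℕ) (ρ : Var → ℕ) (η : ℕ → ℕ) (r p lim : ℕ) (Q : State) : Prop where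
  at_ : Q.ctx.At M ρ η r
  back : Q.ctx.Back M ρ r
  pool : PoolAt M ρ η Q.pool p
  flag : ∀ x ∈ Q.vars, x ∉ Q.bv → M (ρ x) = 0
  kind : ∀ x ∈ Q.vars, M (ρ x + 2) = x.kind
  layout : Layout (r :: (Q.ctx.cb M ρ r ++ poolCb M ρ η Q.pool p)) Q.vars ρ lim

section

variable {M : ℕ → ℕ} {ρ : Var → ℕ} {η : ℕ → ℕ}

/-- The slot of a hole is in the block of a constructor. -/
theorem Ctx.slot_mem {N : ℕ} {G : ℕ → Prop} {a : ℕ} : ∀ {C : Ctx} {s : ℕ}, C.At M ρ η s →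
    C.Shape N G → a ∈ C.holes → η a = s ∨ ∃ b ∈ C.cb M ρ s, η a = b + 2 ∨ η a = b + 3
  | .val (.hole b), s, h, _, ha => by
    simp [Ctx.holes, Val.holes] at ha
    subst ha
    exact .inl h
  | .val (.var x), s, h, _, ha => by simp [Ctx.holes, Val.holes] at ha
  | .val (.lam x C), s, h, hs, ha => by
    rcases Ctx.slot_mem (C := C) h.2.2.2 hs ha with e | ⟨b, hb, e⟩
    · exact .inr ⟨M s, by simp [Ctx.cb, Val.cb], .inr e⟩
    · exact .inr ⟨b, by simp [Ctx.cb, Val.cb, hb], e⟩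
  | .val (.bang C), s, h, hs, ha => by
    rcases Ctx.slot_mem (C := C) h.2 hs ha with e | ⟨b, hb, e⟩
    · exact .inr ⟨M s, by simp [Ctx.cb, Val.cb], .inr e⟩
    · exact .inr ⟨b, by simp [Ctx.cb, Val.cb, hb], e⟩
  | .cut v x C, s, h, hs, ha => by
    simp only [Ctx.holes, hs.1, List.nil_append] at ha
    rcases Ctx.slot_mem (C := C) h.2.2.2.2 hs.2.2 ha with e | ⟨b, hb, e⟩
    · exact .inr ⟨M s, by simp [Ctx.cb], .inr e⟩
    · exact .inr ⟨b, by simp [Ctx.cb, hb], e⟩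
  | .der m x C, s, h, hs, ha => by
    rcases Ctx.slot_mem (C := C) h.2.2.2.2 hs ha with e | ⟨b, hb, e⟩
    · exact .inr ⟨M s, by simp [Ctx.cb], .inr e⟩
    · exact .inr ⟨b, by simp [Ctx.cb, hb], e⟩
  | .sub m v x C, s, h, hs, ha => by
    simp only [Ctx.holes, List.mem_append] at ha
    rcases ha with ha | ha
    · match v with
      | .hole b =>
        simp [Val.holes] at ha
        subst ha
        exact .inr ⟨M s, by simp [Ctx.cb], .inl h.2.2.2.2.1⟩
      | .var _ => simp [Val.holes] at ha
      | .lam y E =>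
        rcases Ctx.slot_mem (C := E) h.2.2.2.2.1.2.2.2 hs.1 ha with e | ⟨b, hb, e⟩
        · exact .inr ⟨M (M s + 2), by simp [Ctx.cb, Val.cb], .inr e⟩
        · exact .inr ⟨b, by simp [Ctx.cb, Val.cb, hb], e⟩
      | .bang E =>
        rcases Ctx.slot_mem (C := E) h.2.2.2.2.1.2 hs.1 ha with e | ⟨b, hb, e⟩
        · exact .inr ⟨M (M s + 2), by simp [Ctx.cb, Val.cb], .inr e⟩
        · exact .inr ⟨b, by simp [Ctx.cb, Val.cb, hb], e⟩
    · rcases Ctx.slot_mem (C := C) h.2.2.2.2.2 hs.2 ha with e | ⟨b, hb, e⟩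
      · exact .inr ⟨M s, by simp [Ctx.cb], .inr e⟩
      · exact .inr ⟨b, by simp [Ctx.cb, hb], e⟩

theorem Ctx.mem_rd_self {C : Ctx} {s : ℕ} (h : C.holes = []) : s ∈ C.rd M ρ s := by
  match C with
  | .val (.hole _) => simp [Ctx.holes, Val.holes] at h
  | .val (.var _) | .val (.lam _ _) | .val (.bang _) => simp [Ctx.rd, Val.rd]
  | .cut _ _ _ | .sub _ _ _ _ | .der _ _ _ => simp [Ctx.rd]

theorem pool_cells {Bs : List ℕ} : ∀ {P : Pool} {p : ℕ}, PoolAt M ρ η P p →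
    (∀ b ∈ poolBlocks M ρ η P p, 8 ∣ b) → (poolBlocks M ρ η P p).Nodup →
    (P.map fun j => η j.1).Nodup → (∀ j ∈ P, blk (η j.1) ∈ Bs) →
    (∀ b ∈ Bs, b ∉ poolBlocks M ρ η P p) → (∀ j ∈ P, j.2.holes = []) →
    (∀ c ∈ poolRd M ρ η P p, c ∈ P.map (fun j => η j.1) ∨ blk c ∈ poolBlocks M ρ η P p) ∧
    (poolRd M ρ η P p).Nodup
  | [], _, _, _, _, _, _, _, _ => by simp [poolRd]
  | (a, t) :: P, p, h, hb, hn, hs, hB, hd, ht => by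
    simp only [poolBlocks, List.nodup_cons, List.nodup_append', List.mem_append, List.map_cons,
      List.mem_cons, not_or, or_imp, forall_and, forall_eq] at hb hn hs hB hd ht
    obtain ⟨hb1, hb2, hb3⟩ := hb
    obtain ⟨⟨hn1, hn2⟩, hn3, hn4, hn5⟩ := hn
    obtain ⟨hd1, hd2, hd3⟩ := hd
    obtain ⟨h1, h2⟩ := pool_cells (Bs := Bs) h.2.2 hb3 hn4 hs.2 hB.2 hd3 ht.2
    obtain ⟨h3, h4⟩ := Ctx.slots h.2.1 hb2
    simp only [ht.1, List.map_nil, List.append_nil] at h3 h4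
    have h5 := h4 hn3 (hd2 _ hB.1)
    have e0 := blk_self hb1
    have e1 := blk_add hb1 (i := 1) (by omega)
    have h6 : ∀ c ∈ P.map (fun j => η j.1), blk c ∈ Bs := by
      intro c hc
      obtain ⟨j, hj, rfl⟩ := List.mem_map.1 hc
      exact hB.2 j hj
    have h7 : ∀ c ∈ t.rd M ρ (η a), blk c ∈ Bs ∨ blk c ∈ t.blocks M ρ (η a) := fun c hc =>
      (h3 c hc).imp (fun e => by rw [e]; exact hB.1) id
    have h8 : ∀ c ∈ poolRd M ρ η P (M (p + 1)), blk c ∈ Bs ∨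
        blk c ∈ poolBlocks M ρ η P (M (p + 1)) := fun c hc => (h1 c hc).imp (h6 c) id
    constructor
    · simp only [poolRd, List.mem_cons, List.mem_append, List.map_cons, poolBlocks]
      rintro c (rfl | rfl | hc | hc)
      · exact .inr (.inl e0)
      · exact .inr (.inl e1)
      · rcases h3 c hc with h | h
        · exact .inl (.inl h)
        · exact .inr (.inr (.inl h))
      · rcases h1 c hc with h | h
        · exact .inl (.inr h)
        · exact .inr (.inr (.inr h))
    · simp only [poolRd, List.nodup_cons, List.mem_cons, List.mem_append, List.nodup_append',
        List.disjoint_left, not_or]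
      refine ⟨⟨by omega, fun hc => ?_, fun hc => ?_⟩, ⟨fun hc => ?_, fun hc => ?_⟩, h5, h2,
        fun c hc hc' => ?_⟩
      · rcases h7 _ hc with h | h <;> rw [e0] at h
        exacts [hd1 _ h rfl, hn1 h]
      · rcases h8 _ hc with h | h <;> rw [e0] at h
        exacts [hd1 _ h rfl, hn2 h]
      · rcases h7 _ hc with h | h <;> rw [e1] at h
        exacts [hd1 _ h rfl, hn1 h]
      · rcases h8 _ hc with h | h <;> rw [e1] at h
        exacts [hd1 _ h rfl, hn2 h]
      · rcases h3 c hc with h | h <;> rcases h1 c hc' with h' | h'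
        · exact hs.1 (h ▸ h')
        · exact hd3 _ hB.1 (h ▸ h')
        · exact hd2 _ (h6 c h') h
        · exact hn5 h h'

theorem MInv.nodup_blocks {r p lim N : ℕ} {Q : State} (h : MInv M ρ η r p lim Q) (hA : AInv N Q) :
    (r :: (Q.ctx.blocks M ρ r ++ poolBlocks M ρ η Q.pool p)).Nodup := by
  rw [List.nodup_iff_count_le_one]
  intro c
  have h1 := List.nodup_iff_count_le_one.1 h.layout.nodup c
  have h2 : (Q.bv.map ρ).Nodup := hA.bv.map_on fun x hx y hy =>
    h.layout.inj x (State.bv_subset_vars hx) y (State.bv_subset_vars hy)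
  have h2 := List.nodup_iff_count_le_one.1 h2 c
  have h3 : c ∈ Q.bv.map ρ → c ∉ r :: (Q.ctx.cb M ρ r ++ poolCb M ρ η Q.pool p) := by
    rintro hc
    obtain ⟨x, hx, rfl⟩ := List.mem_map.1 hc
    exact h.layout.sep x (State.bv_subset_vars hx)
  simp only [State.bv, List.map_append] at h2 h3
  rw [← List.count_pos_iff, ← List.count_eq_zero] at h3
  simp only [List.count_cons, List.count_append, Ctx.count_blocks, poolBlocks_count] at *
  omega

theorem MInv.mem_blocks {r p lim : ℕ} {Q : State} (h : MInv M ρ η r p lim Q) {b : ℕ}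
    (hb : b ∈ r :: (Q.ctx.blocks M ρ r ++ poolBlocks M ρ η Q.pool p)) :
    8 ∣ b ∧ 0 < b ∧ b < lim := by
  have : b ∈ r :: (Q.ctx.cb M ρ r ++ poolCb M ρ η Q.pool p) ∨ b ∈ Q.bv.map ρ := by
    rw [← List.count_pos_iff] at hb
    rw [← List.count_pos_iff, ← List.count_pos_iff (l := Q.bv.map ρ)]
    simp only [State.bv, List.map_append, List.count_cons, List.count_append, Ctx.count_blocks,
      poolBlocks_count] at *
    omega
  rcases this with hb | hb
  · exact h.layout.con b hb
  · obtain ⟨x, hx, rfl⟩ := List.mem_map.1 hb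
    exact h.layout.var x (State.bv_subset_vars hx)

/-- The cells that are read are distinct, and so are the slots of the holes. -/
theorem MInv.cells {r p lim N : ℕ} {Q : State} (h : MInv M ρ η r p lim Q) (hA : AInv N Q) :
    (Q.ctx.rd M ρ r ++ poolRd M ρ η Q.pool p).Nodup ∧ (Q.ctx.holes.map η).Nodup ∧
      ∀ c ∈ Q.ctx.rd M ρ r, c ∉ Q.ctx.holes.map η := by
  have hb := fun b hb => h.mem_blocks (b := b) hb
  have hn := h.nodup_blocks hA
  simp only [List.mem_cons, List.mem_append, or_imp, forall_and, forall_eq, List.nodup_cons,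
    not_or, List.nodup_append'] at hb hn
  obtain ⟨⟨hb1, hb2, hb3⟩, -⟩ := hb
  obtain ⟨⟨hn1, hn2⟩, hn3, hn4, hn5⟩ := hn
  obtain ⟨h1, h2⟩ := Ctx.slots h.at_ hb2
  have e := blk_self hb1
  have h3 := h2 hn3 (by rwa [e])
  rw [List.nodup_append'] at h3
  have hm : Q.ctx.holes.map η = Q.pool.map fun j => η j.1 := by simp [hA.holes]
  have h4 : ∀ c ∈ Q.ctx.rd M ρ r ++ Q.ctx.holes.map η, blk c ∈ r :: Q.ctx.blocks M ρ r := by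
    intro c hc
    rcases h1 c hc with rfl | h
    · simp [e]
    · simp [h]
  have h5 : ∀ b ∈ r :: Q.ctx.blocks M ρ r, b ∉ poolBlocks M ρ η Q.pool p := by
    intro b hb
    rcases List.mem_cons.1 hb with rfl | hb
    · exact hn2
    · exact hn5 hb
  obtain ⟨h6, h7⟩ := pool_cells (Bs := r :: Q.ctx.blocks M ρ r) h.pool hb3 hn4 (hm ▸ h3.2.1)
    (fun j hj => h4 _ (List.mem_append_right _ (hm ▸ List.mem_map_of_mem hj))) h5 hA.term
  refine ⟨?_, h3.2.1, fun c hc hc' => h3.2.2 hc hc'⟩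
  rw [List.nodup_append']
  refine ⟨h3.1, h7, fun c hc hc' => ?_⟩
  rcases h6 c hc' with h | h
  · exact h3.2.2 hc (hm ▸ h)
  · exact h5 _ (h4 c (List.mem_append_left _ hc)) h

theorem poolRd_owned {c : ℕ} : ∀ {P : Pool} {p : ℕ}, (∀ b ∈ poolBlocks M ρ η P p, 8 ∣ b) →
    c ∈ poolRd M ρ η P p → c ∈ P.map (fun j => η j.1) ∨
      Owned (poolCb M ρ η P p) (P.flatMap fun j => j.2.bv) ρ c
  | [], _, _, h => by simp [poolRd] at h
  | (a, t) :: P, p, hb, h => by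
    simp only [poolBlocks, List.forall_mem_cons, List.forall_mem_append] at hb
    have e0 := blk_self hb.1
    have e1 := blk_add hb.1 (i := 1) (by omega)
    have ih := poolRd_owned (c := c) (P := P) (p := M (p + 1)) hb.2.2
    have ih' := Ctx.rd_owned (c := c) (v := t) (s := η a) hb.2.1
    simp only [poolRd, Owned, poolCb, List.mem_cons, List.mem_append, List.map_cons,
      List.flatMap_cons, or_and_right, exists_or] at h ih ih' ⊢
    rcases h with rfl | rfl | h | h
    · simp [e0]
    · simp [e1]
    · rcases ih' h with h | h | h
      · exact .inl (.inl h)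
      · exact .inr (.inl (.inr (.inl h)))
      · exact .inr (.inr (.inl h))
    · rcases ih h with h | h | h
      · exact .inl (.inr h)
      · exact .inr (.inl (.inr (.inr h)))
      · exact .inr (.inr (.inr h))

theorem MInv.owned {r p lim N : ℕ} {Q : State} (h : MInv M ρ η r p lim Q) (hA : AInv N Q) {c : ℕ}
    (hc : c ∈ Q.ctx.rd M ρ r ++ poolRd M ρ η Q.pool p) :
    Owned (r :: (Q.ctx.cb M ρ r ++ poolCb M ρ η Q.pool p)) Q.bv ρ c := by
  have hb := fun b hb => h.mem_blocks (b := b) hb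
  simp only [List.mem_cons, List.mem_append, or_imp, forall_and, forall_eq] at hb
  obtain ⟨⟨hb1, hb2, hb3⟩, -⟩ := hb
  have e := blk_self hb1
  have key : c = r ∨ (∃ b ∈ Q.ctx.cb M ρ r, c = b + 2 ∨ c = b + 3) ∨
      Owned (Q.ctx.cb M ρ r ++ poolCb M ρ η Q.pool p) Q.bv ρ c := by
    simp only [Owned, State.bv, List.mem_append, or_and_right, exists_or]
    rcases List.mem_append.1 hc with hc | hc
    · rcases Ctx.rd_owned hb2 hc with h | h | h
      · exact .inl h
      · exact .inr (.inr (.inl (.inl h)))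
      · exact .inr (.inr (.inr (.inl h)))
    · rcases poolRd_owned hb3 hc with h' | h | h
      · obtain ⟨j, hj, rfl⟩ := List.mem_map.1 h'
        rcases Ctx.slot_mem h.at_ hA.shape (a := j.1)
          (by rw [hA.holes]; exact List.mem_map_of_mem hj) with h | h
        · exact .inl h
        · exact .inr (.inl h)
      · exact .inr (.inr (.inl (.inr h)))
      · exact .inr (.inr (.inr (.inr h)))
  rcases key with rfl | ⟨b, hb, hb'⟩ | h | h
  · exact .inl (by simp [e])
  · have hb8 := (h.layout.con b (by simp [hb])).1
    refine .inl ?_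
    have : blk c = b := by
      rcases hb' with rfl | rfl <;> exact blk_add hb8 (by omega)
    simp [this, hb]
  · exact .inl (List.mem_cons_of_mem _ h)
  · exact .inr h

theorem MInv.cell_lt {r p lim N : ℕ} {Q : State} (h : MInv M ρ η r p lim Q) (hA : AInv N Q) {c : ℕ}
    (hc : c ∈ Q.ctx.rd M ρ r ++ poolRd M ρ η Q.pool p) : c < lim := by
  have hl := h.layout.lim
  rcases h.owned hA hc with h' | ⟨x, hx, h'⟩
  · have := h.layout.con _ h'
    unfold blk at this
    omega
  · have := h.layout.var x (State.bv_subset_vars hx)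
    omega

theorem MInv.cell_ne {r p lim N : ℕ} {Q : State} (h : MInv M ρ η r p lim Q) (hA : AInv N Q) {c i : ℕ}
    (hc : c ∈ Q.ctx.rd M ρ r ++ poolRd M ρ η Q.pool p) {x : Var} (hx : x ∈ Q.vars) (hi : i < 8)
    (hx' : 2 ≤ i ∨ x ∉ Q.bv) : c ≠ ρ x + i := by
  rintro rfl
  have hx8 := (h.layout.var x hx).1
  rcases h.owned hA hc with h' | ⟨y, hy, h'⟩
  · rw [blk_add hx8 hi] at h'
    exact h.layout.sep x hx h'
  · have hy' := h.layout.var y (State.bv_subset_vars hy)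
    have := h.layout.inj x hx y (State.bv_subset_vars hy) (by omega)
    subst this
    rcases hx' with h | h
    · omega
    · exact h hy

end

end Sesame
set_option linter.unusedSimpArgs false
namespace Sesame

/-! ### Simulation of the search transitions -/

section

variable {M M' : ℕ → ℕ} {ρ : Var → ℕ} {η η' : ℕ → ℕ} {r p lim N a : ℕ} {C D R t : Ctx} {P : Pool}

/-- What the invariant says of the active job. -/
structure Head (M : ℕ → ℕ) (ρ : Var → ℕ) (η : ℕ → ℕ) (r p lim : ℕ) (C : Ctx) (a : ℕ) (t : Ctx)
    (P : Pool) : Prop where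
  job : M p = η a
  at_ : t.At M ρ η (η a)
  tail : PoolAt M ρ η P (M (p + 1))
  nodup : (C.rd M ρ r).Nodup
  nodup' : (t.rd M ρ (η a)).Nodup
  ctx : ∀ c ∈ C.rd M ρ r, c ≠ p ∧ c ≠ p + 1 ∧ c ∉ t.rd M ρ (η a) ∧
    c ∉ poolRd M ρ η P (M (p + 1))
  term : ∀ c ∈ t.rd M ρ (η a), c ≠ p ∧ c ≠ p + 1 ∧ c ∉ poolRd M ρ η P (M (p + 1))
  pool : ∀ c ∈ poolRd M ρ η P (M (p + 1)), c ≠ p ∧ c ≠ p + 1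
  slot : η a ∈ t.rd M ρ (η a)
  slots : ∀ b ∈ C.holes, b ≠ a → η b ≠ η a
  lt : ∀ c, c ∈ C.rd M ρ r ∨ c = p ∨ c = p + 1 ∨ c ∈ t.rd M ρ (η a) ∨
    c ∈ poolRd M ρ η P (M (p + 1)) → c < lim
  ne : ∀ c, c ∈ C.rd M ρ r ∨ c = p ∨ c = p + 1 ∨ c ∈ t.rd M ρ (η a) ∨
    c ∈ poolRd M ρ η P (M (p + 1)) → ∀ x ∈ State.vars ⟨C, (a, t) :: P⟩, ∀ i < 8,
      2 ≤ i ∨ x ∉ State.bv ⟨C, (a, t) :: P⟩ → c ≠ ρ x + i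
  con : ∀ b, b = p ∨ b ∈ C.cb M ρ r ∨ b ∈ t.cb M ρ (η a) → 8 ∣ b ∧ 0 < b ∧ b < lim ∧
    ∀ x ∈ State.vars ⟨C, (a, t) :: P⟩, ∀ i < 8, ∀ j < 8, b + i ≠ ρ x + j
  names : ∀ j ∈ P, j.1 ≠ a ∧ j.1 ∈ C.holes

theorem MInv.head (h : MInv M ρ η r p lim ⟨C, (a, t) :: P⟩) (hA : AInv N ⟨C, (a, t) :: P⟩) :
    Head M ρ η r p lim C a t P := by
  obtain ⟨h1, h2, h3⟩ := h.cells hA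
  have hl := fun c hc => h.cell_lt hA (c := c) hc
  have hx := fun c i hc x hx => h.cell_ne hA (c := c) (i := i) hc (x := x) hx
  simp only [poolRd, List.nodup_append', List.nodup_cons, List.mem_cons, List.mem_append, not_or,
    List.disjoint_left] at h1 hl hx
  have hh := hA.holes
  simp only [List.map_cons] at hh
  have hn := hA.nodup
  simp only [hh, List.nodup_cons] at hn
  have ht : t.holes = [] := hA.term (a, t) (by simp)
  refine ⟨h.pool.1, h.pool.2.1, h.pool.2.2, h1.1, h1.2.1.2.2.1, fun c hc => h1.2.2 hc,
    fun c hc => ⟨?_, ?_, h1.2.1.2.2.2.2 hc⟩, fun c hc => ⟨?_, ?_⟩, Ctx.mem_rd_self ht, ?_,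
    hl, fun c hc x hx' i hi => hx c i hc x hx' hi, fun b hb => ?_, fun j hj => ⟨?_, ?_⟩⟩
  · rintro rfl
    exact h1.2.1.1.2.1 hc
  · rintro rfl
    exact h1.2.1.2.1.1 hc
  · rintro rfl
    exact h1.2.1.1.2.2 hc
  · rintro rfl
    exact h1.2.1.2.1.2 hc
  · intro b hb hba e
    exact hba (List.inj_on_of_nodup_map h2 hb (by simp [hh]) e)
  · have hb' : b ∈ r :: (C.cb M ρ r ++ poolCb M ρ η ((a, t) :: P) p) := by
      simp only [poolCb, List.mem_cons, List.mem_append]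
      tauto
    have := h.layout.con b hb'
    refine ⟨this.1, this.2.1, this.2.2, fun x hx i hi j hj e => ?_⟩
    have h4 := h.layout.sep x hx
    have h5 := (h.layout.var x hx).1
    have : b = ρ x := by omega
    exact h4 (this ▸ hb')
  · rintro rfl
    exact hn.1 (List.mem_map_of_mem hj)
  · rw [hh]
    exact List.mem_cons_of_mem _ (List.mem_map_of_mem hj)

theorem MInv.flag_dom (h : MInv M ρ η r p lim ⟨C, (a, t) :: P⟩) (hA : AInv N ⟨C, (a, t) :: P⟩)
    {x : Var} (hx : x ∈ t.fv) (hd : x ∉ C.dom) : M (ρ x) = 0 := by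
  by_cases hF : C.FV (jobFV ((a, t) :: P)) x
  · refine h.flag x ?_ (hA.fv x hF)
    exact State.mem_vars_cons.2 (.inr (.inl (Ctx.mem_vars_iff.2 (.inl hx))))
  · exact Ctx.flag_eq_zero (hA.jobFV_self.2 hx) h.at_ hA.shape hA.mem_holes hF hd

theorem Head.tail_congr (h : Head M ρ η r p lim C a t P) (hA : AInv N ⟨C, (a, t) :: P⟩)
    {ρ' : Var → ℕ} (hρ : ∀ j ∈ P, ∀ x ∈ j.2.vars, ρ' x = ρ x)
    (hM : ∀ c ∈ poolRd M ρ η P (M (p + 1)), M' c = M c) (hη : ∀ b ∈ C.holes, b ≠ a → η' b = η b) :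
    PoolAt M' ρ' η' P (M (p + 1)) ∧
      poolCb M' ρ' η' P (M (p + 1)) = poolCb M ρ η P (M (p + 1)) := by
  obtain ⟨h1, -, h2⟩ := h.tail.congr hM hρ
    (fun j hj => hA.term j (by simp [hj])) fun j hj => hη _ (h.names j hj).2 (h.names j hj).1
  exact ⟨h1, h2⟩

/-- The invariant after a search transition. -/
theorem MInv.search (h : MInv M ρ η r p lim ⟨C, (a, t) :: P⟩) {js : Pool} {p₁ lim₁ : ℕ} {F : List ℕ}
    (hP : Plug a D C R) (hη : ∀ b ∈ C.holes, b ≠ a → η' b = η b)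
    (hC : ∀ c ∈ C.rd M ρ r, M' c = M c) (hD : D.At M' ρ η' (η a)) (hB : D.Back M' ρ (η a))
    (hb : ∀ x ∈ C.bv, M' (ρ x + 3) = M (ρ x + 3)) (hpool : PoolAt M' ρ η' (js ++ P) p₁)
    (hc : ∀ c, (D.cb M' ρ (η a)).count c + (poolCb M' ρ η' (js ++ P) p₁).count c ≤
      (p :: (t.cb M ρ (η a) ++ poolCb M ρ η P (M (p + 1)))).count c + F.count c)
    (hv : ∀ x, x ∈ D.vars ∨ (∃ j ∈ js, x ∈ j.2.vars) → x ∈ t.vars)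
    (hbv : ∀ x ∈ t.bv, x ∈ D.bv ∨ ∃ j ∈ js, x ∈ j.2.bv)
    (hf : ∀ x ∈ State.vars ⟨C, (a, t) :: P⟩, x ∉ State.bv ⟨C, (a, t) :: P⟩ → M' (ρ x) = M (ρ x))
    (hk : ∀ x ∈ State.vars ⟨C, (a, t) :: P⟩, M' (ρ x + 2) = M (ρ x + 2))
    (hF : F.Nodup) (hF' : ∀ b ∈ F, 8 ∣ b ∧ lim ≤ b ∧ b < lim₁) (hl : lim ≤ lim₁) (hl' : 8 ∣ lim₁) :
    MInv M' ρ η' r p₁ lim₁ ⟨R, js ++ P⟩ := by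
  have hA' : C.At M' ρ η r := h.at_.congr hC (fun _ _ => rfl) fun _ _ => rfl
  obtain ⟨e1, e2, -⟩ := Ctx.layout_congr (ρ' := ρ) hC fun _ _ => rfl
  have hvars : ∀ x ∈ State.vars ⟨R, js ++ P⟩, x ∈ State.vars ⟨C, (a, t) :: P⟩ := by
    intro x hx
    rw [State.mem_vars] at hx
    rw [State.mem_vars_cons]
    rcases hx with hx | ⟨j, hj, hx⟩
    · rcases (hP.mem_vars x).1 hx with hx | hx
      · exact .inl hx
      · exact .inr (.inl (hv x (.inl hx)))
    · rcases List.mem_append.1 hj with hj | hj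
      · exact .inr (.inl (hv x (.inr ⟨j, hj, hx⟩)))
      · exact .inr (.inr ⟨j, hj, hx⟩)
  refine ⟨hP.at_ hA' hD hη, hP.back hA' (h.back.congr hC hb) hB, hpool, fun x hx hx' => ?_,
    fun x hx => ?_, ?_⟩
  · have h1 : x ∉ State.bv ⟨C, (a, t) :: P⟩ := by
      rw [State.mem_bv_cons]
      rw [State.mem_bv] at hx'
      rintro (hx | hx | ⟨j, hj, hx⟩)
      · exact hx' (.inl ((hP.mem_bv x).2 (.inl hx)))
      · rcases hbv x hx with hx | ⟨j, hj, hx⟩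
        · exact hx' (.inl ((hP.mem_bv x).2 (.inr hx)))
        · exact hx' (.inr ⟨j, List.mem_append_left _ hj, hx⟩)
      · exact hx' (.inr ⟨j, List.mem_append_right _ hj, hx⟩)
    rw [hf x (hvars x hx) h1, h.flag x (hvars x hx) h1]
  · rw [hk x (hvars x hx), h.kind x (hvars x hx)]
  · refine h.layout.extend (F := F) (S := []) (fun c => ?_) (fun x hx => .inl (hvars x hx))
      (fun _ _ => rfl) (by simpa using hF) (by simpa using hF') hl hl' ?_
    · have := hc c
      simp only [List.count_cons, List.count_append, hP.count_cb hA', e2, poolCb] at this ⊢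
      omega
    · have := h.layout.con r (by simp)
      omega

/-- The invariant after a search transition with one remaining job. -/
theorem MInv.search_one (h : MInv M ρ η r p lim ⟨C, (a, t) :: P⟩) (hA : AInv N ⟨C, (a, t) :: P⟩)
    {t₁ : Ctx} {q : ℕ} (hP : Plug a D C R)
    (hη : η' = Function.update η a q) (hM : M' p = q)
    (hM' : ∀ c, c ∈ C.rd M ρ r ∨ c = p + 1 ∨ c ∈ t.rd M ρ (η a) ∨
      c ∈ poolRd M ρ η P (M (p + 1)) → M' c = M c)
    (hD : D.At M' ρ η' (η a)) (hB : D.Back M' ρ (η a))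
    (hb : ∀ x ∈ C.bv, M' (ρ x + 3) = M (ρ x + 3))
    (ht : t₁.At M ρ η q) (ht' : t₁.holes = []) (hrd : ∀ c ∈ t₁.rd M ρ q, c ∈ t.rd M ρ (η a))
    (hc : ∀ c, (D.cb M' ρ (η a)).count c + (t₁.cb M ρ q).count c ≤ (t.cb M ρ (η a)).count c)
    (hv : ∀ x, x ∈ D.vars ∨ x ∈ t₁.vars → x ∈ t.vars)
    (hbv : ∀ x ∈ t.bv, x ∈ D.bv ∨ x ∈ t₁.bv)
    (hf : ∀ x ∈ State.vars ⟨C, (a, t) :: P⟩, x ∉ State.bv ⟨C, (a, t) :: P⟩ → M' (ρ x) = M (ρ x))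
    (hk : ∀ x ∈ State.vars ⟨C, (a, t) :: P⟩, M' (ρ x + 2) = M (ρ x + 2)) :
    MInv M' ρ η' r p lim ⟨R, (a, t₁) :: P⟩ := by
  have H := h.head hA
  have e : ∀ c ∈ t₁.rd M ρ q, M' c = M c := fun c hc => hM' c (by have := hrd c hc; tauto)
  obtain ⟨-, e1, -⟩ := Ctx.layout_congr (ρ' := ρ) e fun _ _ => rfl
  have hη' : ∀ b ∈ C.holes, b ≠ a → η' b = η b := fun b _ hb => by
    rw [hη, Function.update_of_ne hb]
  have hq : η' a = q := by rw [hη, Function.update_self]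
  obtain ⟨e2, e3⟩ := H.tail_congr hA (M' := M') (ρ' := ρ) (fun _ _ _ _ => rfl)
    (fun c hc => hM' c (by tauto)) hη'
  have e4 := hM' (p + 1) (by tauto)
  refine h.search (js := [(a, t₁)]) (F := []) hP hη' (fun c hc => hM' c (by tauto)) hD hB hb ?_ ?_
    (by simpa using hv) (by simpa using hbv) hf hk (by simp) (by simp) le_rfl h.layout.lim
  · simp only [List.singleton_append, PoolAt, hq, e4]
    exact ⟨hM, ht.congr e (fun _ _ => rfl) (by simp [ht']), e2⟩
  · intro c
    have := hc c
    simp only [List.singleton_append, poolCb, hq, e4, e1, e3, List.count_cons, List.count_append,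
      List.count_nil] at this ⊢
    omega

theorem AInv.plug_spec (h : AInv N ⟨C, (a, t) :: P⟩)
    (hv : (∃ w, t = .val w) → ∃ w, (∀ b, w ≠ .hole b) ∧ D = .val w) : Plug a D C (C.plug a D) := by
  refine Ctx.plug_spec (fun hG => hv (hG t (by simp))) h.shape ?_
  exact List.count_eq_one_of_mem h.nodup h.mem_holes

end

/-- The program simulates a transition within `b + 1` steps. -/
def Sim (b : ℕ) (R M : ℕ → ℕ) (ρ : Var → ℕ) (Q Q' : State) : Prop :=
  ∃ R' M' ρ' η', Turn b R M R' M' ∧ (∀ x ∈ Q.vars, ρ' x = ρ x) ∧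
    MInv M' ρ' η' (R' 0) (R' 1) (R' 2) Q'

section

variable {R M : ℕ → ℕ} {ρ : Var → ℕ} {η : ℕ → ℕ} {N a : ℕ} {C t : Ctx} {P : Pool} {x : Var}

/-- A search transition that goes to the body of the topmost constructor and does nothing else. -/
theorem sim_body {t₁ D : Ctx} (h : MInv M ρ η (R 0) (R 1) (R 2) ⟨C, (a, t) :: P⟩)
    (hA : AInv N ⟨C, (a, t) :: P⟩) (hP : Plug a D C (C.plug a D))
    (hT : ∃ R', Turn 40 R M R' (Function.update M (R 1) (M (η a) + 3)) ∧ Same R R')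
    (hD : ∀ M' η', (∀ c ∈ t.rd M ρ (η a), M' c = M c) → η' a = M (η a) + 3 →
      D.At M' ρ η' (η a) ∧ D.Back M' ρ (η a) ∧ D.cb M' ρ (η a) = [M (η a)])
    (ht : t₁.At M ρ η (M (η a) + 3))
    (hrd : ∀ c ∈ t₁.rd M ρ (M (η a) + 3), c ∈ t.rd M ρ (η a))
    (hc : t.cb M ρ (η a) = M (η a) :: t₁.cb M ρ (M (η a) + 3)) (ht' : t₁.holes = [])
    (hv : ∀ x, x ∈ D.vars ∨ x ∈ t₁.vars → x ∈ t.vars) (hbv : ∀ x ∈ t.bv, x ∈ D.bv ∨ x ∈ t₁.bv) :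
    Sim 40 R M ρ ⟨C, (a, t) :: P⟩ ⟨C.plug a D, (a, t₁) :: P⟩ := by
  have H := h.head hA
  obtain ⟨R', hT, hs1, hs2, hs3⟩ := hT
  have hM : ∀ c, c ≠ R 1 → Function.update M (R 1) (M (η a) + 3) c = M c := fun c hc =>
    Function.update_of_ne hc _ _
  have hp : ∀ x ∈ State.vars ⟨C, (a, t) :: P⟩, ∀ i < 8, ρ x + i ≠ R 1 := fun x hx i hi e =>
    (H.con (R 1) (.inl rfl)).2.2.2 x hx 0 (by omega) i hi (by omega)
  obtain ⟨d1, d2, d3⟩ := hD (Function.update M (R 1) (M (η a) + 3))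
    (Function.update η a (M (η a) + 3)) (fun c hc => hM c (H.term c hc).1)
    (Function.update_self ..)
  refine ⟨R', _, ρ, Function.update η a (M (η a) + 3), hT, fun _ _ => rfl, ?_⟩
  rw [hs1, hs2, hs3]
  refine h.search_one hA hP rfl (Function.update_self ..) (fun c hc => hM c ?_) d1 d2
    (fun x hx => hM _ (hp x (State.mem_vars_cons.2 (.inl (Ctx.mem_vars_iff.2 (.inr hx)))) 3
      (by omega))) ht ht' hrd (fun c => ?_) hv hbv (fun x hx _ => hM _ (hp x hx 0 (by omega)))
    fun x hx => hM _ (hp x hx 2 (by omega))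
  · rcases hc with hc | rfl | hc | hc
    · exact (H.ctx c hc).1
    · omega
    · exact (H.term c hc).1
    · exact (H.pool c hc).1
  · rw [d3, hc]
    simp only [List.count_cons, List.count_nil]
    omega

theorem sim_sea3 {e : ℕ} (h : MInv M ρ η (R 0) (R 1) (R 2) ⟨C, (a, .der e x t) :: P⟩)
    (hA : AInv N ⟨C, (a, .der e x t) :: P⟩) (he : Var.e e ∉ C.dom) :
    Sim 40 R M ρ ⟨C, (a, .der e x t) :: P⟩ ⟨C.plug a (.der e x (.hole a)), (a, t) :: P⟩ := by
  have H := h.head hA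
  obtain ⟨h1, h2, h3, h4, h5⟩ := H.at_
  refine sim_body h hA (hA.plug_spec (by simp)) (turn_der_free H.job rfl h1 ?_) ?_ h5 ?_ rfl ?_ ?_ ?_
  · rw [h3]
    exact h.flag_dom hA (by simp [Ctx.fv]) he
  · intro M' η' hM hη
    have e1 := hM (η a) (by simp [Ctx.rd])
    simp only [Ctx.At, Val.At, Ctx.Back, Val.Back, Ctx.cb, Val.cb, e1, hη, and_true,
      hM (M (η a)) (by simp [Ctx.rd]), hM (M (η a) + 1) (by simp [Ctx.rd]),
      hM (M (η a) + 4) (by simp [Ctx.rd]), hM (ρ x) (by simp [Ctx.rd]), h1, h2, h3, h4]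
  · intro c hc
    simp [Ctx.rd, hc]
  · simpa [Ctx.holes] using hA.term _ (List.mem_cons_self ..)
  · simp only [Ctx.vars, Val.vars, List.mem_cons, List.not_mem_nil]
    tauto
  · simp [Ctx.bv, Val.bv]

theorem sim_sea4 (h : MInv M ρ η (R 0) (R 1) (R 2) ⟨C, (a, .val (.lam x t)) :: P⟩)
    (hA : AInv N ⟨C, (a, .val (.lam x t)) :: P⟩) : Sim 40 R M ρ ⟨C, (a, .val (.lam x t)) :: P⟩
      ⟨C.plug a (.val (.lam x (.hole a))), (a, t) :: P⟩ := by
  have H := h.head hA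
  obtain ⟨h1, h2, h4, h5⟩ := H.at_
  refine sim_body h hA (hA.plug_spec fun _ => ⟨.lam x (.hole a), by simp, rfl⟩)
    (turn_body H.job rfl (.inl h1)) ?_ h5 ?_ rfl ?_ ?_ ?_
  · intro M' η' hM hη
    have e1 := hM (η a) (by simp [Ctx.rd, Val.rd])
    simp only [Ctx.At, Val.At, Ctx.Back, Val.Back, Ctx.cb, Val.cb, e1, hη, and_true,
      hM (M (η a)) (by simp [Ctx.rd, Val.rd]), hM (M (η a) + 1) (by simp [Ctx.rd, Val.rd]),
      hM (ρ x) (by simp [Ctx.rd, Val.rd]), h1, h2, h4]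
  · intro c hc
    simp [Ctx.rd, Val.rd, hc]
  · simpa [Ctx.holes, Val.holes] using hA.term _ (List.mem_cons_self ..)
  · simp [Ctx.vars, Val.vars]
  · simp [Ctx.bv, Val.bv]

theorem sim_sea5 (h : MInv M ρ η (R 0) (R 1) (R 2) ⟨C, (a, .val (.bang t)) :: P⟩)
    (hA : AInv N ⟨C, (a, .val (.bang t)) :: P⟩) : Sim 40 R M ρ ⟨C, (a, .val (.bang t)) :: P⟩
      ⟨C.plug a (.val (.bang (.hole a))), (a, t) :: P⟩ := by
  have H := h.head hA
  obtain ⟨h1, h5⟩ := H.at_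
  refine sim_body h hA (hA.plug_spec fun _ => ⟨.bang (.hole a), by simp, rfl⟩)
    (turn_body H.job rfl (.inr h1)) ?_ h5 ?_ rfl ?_ ?_ ?_
  · intro M' η' hM hη
    have e1 := hM (η a) (by simp [Ctx.rd, Val.rd])
    simp only [Ctx.At, Val.At, Ctx.Back, Val.Back, Ctx.cb, Val.cb, e1, hη, and_true,
      hM (M (η a)) (by simp [Ctx.rd, Val.rd]), h1]
  · intro c hc
    simp [Ctx.rd, Val.rd, hc]
  · simpa [Ctx.holes, Val.holes] using hA.term _ (List.mem_cons_self ..)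
  · simp [Ctx.vars, Val.vars]
  · simp [Ctx.bv, Val.bv]

theorem sim_sea1 {v : Val} (h : MInv M ρ η (R 0) (R 1) (R 2) ⟨C, (a, .cut v x t) :: P⟩)
    (hA : AInv N ⟨C, (a, .cut v x t) :: P⟩) : Sim 40 R M ρ ⟨C, (a, .cut v x t) :: P⟩
      ⟨C.plug a (.cut v x (.hole a)), (a, t) :: P⟩ := by
  have H := h.head hA
  obtain ⟨h1, h2, h3, h4, h5⟩ := H.at_
  obtain ⟨R', hT, hs1, hs2, hs3⟩ := turn_cut H.job rfl h1
  have ht := hA.term _ (List.mem_cons_self ..)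
  simp only [Ctx.holes, List.append_eq_nil_iff] at ht
  have hxv : x ∈ State.vars ⟨C, (a, .cut v x t) :: P⟩ :=
    State.mem_vars_cons.2 (.inr (.inl (by simp [Ctx.vars])))
  rw [h2] at hT
  set M' := Function.update (Function.update M (ρ x + 3) (η a)) (R 1) (M (η a) + 3) with hM'
  have hM : ∀ c, c ≠ R 1 → c ≠ ρ x + 3 → M' c = M c := fun c hc hc' => by
    rw [hM', Function.update_of_ne hc, Function.update_of_ne hc']
  have hp : ∀ y ∈ State.vars ⟨C, (a, .cut v x t) :: P⟩, ∀ i < 8, ρ y + i ≠ R 1 := fun x hx i hi e =>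
    (H.con (R 1) (.inl rfl)).2.2.2 x hx 0 (by omega) i hi (by omega)
  have hx3 : ∀ y ∈ State.vars ⟨C, (a, .cut v x t) :: P⟩, ∀ i < 8, i ≠ 3 ∨ y ≠ x → 
      ρ y + i ≠ ρ x + 3 := by
    intro y hy i hi hyx e
    have h1 := (h.layout.var y hy).1
    have h2 := (h.layout.var x hxv).1
    have := h.layout.inj y hy x hxv (by omega)
    rcases hyx with h | h
    · omega
    · exact h this
  have hcell : ∀ c, c ∈ C.rd M ρ (R 0) ∨ c = R 1 + 1 ∨ c ∈ (Ctx.cut v x t).rd M ρ (η a) ∨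
      c ∈ poolRd M ρ η P (M (R 1 + 1)) → M' c = M c := fun c hc => by
    refine hM c ?_ (H.ne c (by tauto) x hxv 3 (by omega) (by omega))
    rcases hc with hc | rfl | hc | hc
    · exact (H.ctx c hc).1
    · omega
    · exact (H.term c hc).1
    · exact (H.pool c hc).1
  have hxC : ∀ y ∈ C.bv, y ≠ x := by
    rintro y hy rfl
    have := hA.bv
    simp only [State.bv, List.nodup_append', List.disjoint_left] at this
    exact this.2.2 hy (by simp [Ctx.bv])
  have e1 := hcell (η a) (by simp [Ctx.rd])
  have e2 : ∀ c ∈ v.rd M ρ (ρ x + 1), M' c = M c := fun c hc => hcell c (by simp [Ctx.rd, hc])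
  refine ⟨R', M', ρ, Function.update η a (M (η a) + 3), hT, fun _ _ => rfl, ?_⟩
  rw [hs1, hs2, hs3]
  refine h.search_one hA (hA.plug_spec (by simp)) rfl (Function.update_self ..) hcell ?_ ?_
    (fun y hy => hM _ (hp y ?_ 3 (by omega)) (hx3 y ?_ 3 (by omega) (.inr (hxC y hy))))
    h5 ht.2 ?_ (fun c => ?_) ?_ ?_ (fun y hy _ => hM _ (hp y hy 0 (by omega))
      (hx3 y hy 0 (by omega) (by omega)))
    fun y hy => hM _ (hp y hy 2 (by omega)) (hx3 y hy 2 (by omega) (by omega))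
  · simp only [Ctx.At, Val.At, e1, Function.update_self, and_true,
      hcell (M (η a)) (by simp [Ctx.rd]), hcell (M (η a) + 1) (by simp [Ctx.rd]),
      hcell (ρ x) (by simp [Ctx.rd]), h1, h2, h3, true_and]
    exact h4.congr e2 (fun _ _ => rfl) (by simp [ht.1])
  · simp only [Ctx.Back, Val.Back, and_true]
    rw [hM', Function.update_of_ne (hp x hxv 3 (by omega)), Function.update_self]
  · exact State.mem_vars_cons.2 (.inl (Ctx.mem_vars_iff.2 (.inr hy)))
  · exact State.mem_vars_cons.2 (.inl (Ctx.mem_vars_iff.2 (.inr hy)))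
  · intro c hc
    simp [Ctx.rd, hc]
  · have := (Val.layout_congr (ρ' := ρ) e2 fun _ _ => rfl).2.1
    simp only [Ctx.cb, Val.cb, e1, this, List.append_nil, List.count_cons, List.count_append]
    omega
  · simp only [Ctx.vars, Val.vars, List.mem_cons, List.mem_append, List.not_mem_nil]
    tauto
  · simp only [Ctx.bv, Val.bv, List.mem_cons, List.mem_append, List.not_mem_nil]
    tauto

theorem sim_sea6 (h : MInv M ρ η (R 0) (R 1) (R 2) ⟨C, (a, .val (.var x)) :: P⟩)
    (hA : AInv N ⟨C, (a, .val (.var x)) :: P⟩) (hx : x ∉ C.dom) :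
    Sim 40 R M ρ ⟨C, (a, .val (.var x)) :: P⟩ ⟨C.plug a (.val (.var x)), P⟩ := by
  have H := h.head hA
  obtain ⟨h1, h2⟩ := H.at_
  obtain ⟨R', hT, hs1, hs2, hs3⟩ := turn_var_free H.job rfl h1
    (by rw [h2]; exact h.flag_dom hA (by simp [Ctx.fv, Val.fv]) hx)
  refine ⟨R', M, ρ, η, hT, fun _ _ => rfl, ?_⟩
  rw [hs1, hs2, hs3]
  refine h.search (js := []) (F := []) (hA.plug_spec fun _ => ⟨.var x, by simp, rfl⟩)
    (fun _ _ _ => rfl) (fun _ _ => rfl) ⟨h1, h2⟩ trivial (fun _ _ => rfl) H.tail (fun c => ?_)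
    (by simp) (by simp [Ctx.bv, Val.bv]) (fun _ _ _ => rfl) (fun _ _ => rfl) (by simp) (by simp)
    le_rfl h.layout.lim
  simp only [List.nil_append, List.count_cons, List.count_append]
  omega

theorem sim_sea2 {m b : ℕ} {v : Val}
    (h : MInv M ρ η (R 0) (R 1) (R 2) ⟨C, (a, .sub m v x t) :: P⟩)
    (hA : AInv N ⟨C, (a, .sub m v x t) :: P⟩) (hm : Var.m m ∉ C.dom)
    (hb : b ∉ State.names ⟨C, (a, .sub m v x t) :: P⟩) : Sim 40 R M ρ ⟨C, (a, .sub m v x t) :: P⟩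
      ⟨C.plug a (.sub m (.hole b) x (.hole a)), (b, .val v) :: (a, t) :: P⟩ := by
  have H := h.head hA
  obtain ⟨h1, h2, h3, h4, h5, h6⟩ := H.at_
  have hp0 := h.layout.con (R 0) (by simp)
  obtain ⟨R', hT, hs1, hs2, hs3⟩ := turn_sub_free H.job rfl h1
    (by rw [h3]; exact h.flag_dom hA (by simp [Ctx.fv]) hm) (by omega)
  have ht := hA.term _ (List.mem_cons_self ..)
  simp only [Ctx.holes, List.append_eq_nil_iff] at ht
  simp only [State.names, List.mem_append, List.map_cons, List.mem_cons, not_or] at hb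
  obtain ⟨hbC, hba, hbP⟩ := hb
  set M' := Function.update (Function.update (Function.update M (R 2) (M (η a) + 2)) (R 2 + 1) (R 1))
    (R 1) (M (η a) + 3) with hM'
  have hM : ∀ c < R 2, c ≠ R 1 → M' c = M c := fun c hc hc' => by
    rw [hM', Function.update_of_ne hc', Function.update_of_ne (by omega),
      Function.update_of_ne (by omega)]
  have hp := H.con (R 1) (.inl rfl)
  have hN : M' (R 2) = M (η a) + 2 := by
    rw [hM', Function.update_of_ne (by omega), Function.update_of_ne (by omega),
      Function.update_self]
  have hN1 : M' (R 2 + 1) = R 1 := by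
    rw [hM', Function.update_of_ne (by omega), Function.update_self]
  have hp' : M' (R 1) = M (η a) + 3 := by rw [hM', Function.update_self]
  have hcell : ∀ c, c ∈ C.rd M ρ (R 0) ∨ c = R 1 + 1 ∨ c ∈ (Ctx.sub m v x t).rd M ρ (η a) ∨
      c ∈ poolRd M ρ η P (M (R 1 + 1)) → M' c = M c := fun c hc => by
    refine hM c (H.lt c (by tauto)) ?_
    rcases hc with hc | rfl | hc | hc
    · exact (H.ctx c hc).1
    · omega
    · exact (H.term c hc).1
    · exact (H.pool c hc).1
  have hvar : ∀ y ∈ State.vars ⟨C, (a, .sub m v x t) :: P⟩, ∀ i < 8, M' (ρ y + i) = M (ρ y + i) := by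
    intro y hy i hi
    have h1 := h.layout.var y hy
    have h2 := h.layout.lim
    exact hM _ (by omega) fun e => hp.2.2.2 y hy 0 (by omega) i hi (by omega)
  set η' := Function.update (Function.update η a (M (η a) + 3)) b (M (η a) + 2) with hη'
  have ηb : η' b = M (η a) + 2 := by rw [hη', Function.update_self]
  have ηa : η' a = M (η a) + 3 := by
    rw [hη', Function.update_of_ne (Ne.symm hba), Function.update_self]
  have hηC : ∀ c ∈ C.holes, c ≠ a → η' c = η c := fun c hc hca => by
    rw [hη', Function.update_of_ne (fun e => hbC (by rwa [← e])), Function.update_of_ne hca]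
  have e1 := hcell (η a) (by simp [Ctx.rd])
  have e2 : ∀ c ∈ v.rd M ρ (M (η a) + 2), M' c = M c := fun c hc => hcell c (by simp [Ctx.rd, hc])
  have e3 : ∀ c ∈ t.rd M ρ (M (η a) + 3), M' c = M c := fun c hc => hcell c (by simp [Ctx.rd, hc])
  obtain ⟨e4, e5⟩ := H.tail_congr hA (M' := M') (ρ' := ρ) (fun _ _ _ _ => rfl)
    (fun c hc => hcell c (by tauto)) hηC
  have e6 := hcell (R 1 + 1) (by tauto)
  refine ⟨R', M', ρ, η', hT, fun _ _ => rfl, ?_⟩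
  rw [hs1, hs2, hs3]
  refine h.search (js := [(b, .val v), (a, t)]) (F := [R 2]) (hA.plug_spec (by simp)) hηC
    (fun c hc => hcell c (.inl hc)) ?_ ⟨trivial, trivial⟩ (fun y hy => hvar y ?_ 3 (by omega)) ?_
    (fun c => ?_) ?_ ?_ (fun y hy _ => hvar y hy 0 (by omega))
    (fun y hy => hvar y hy 2 (by omega)) (by simp) ?_ (by omega) ?_
  · simp only [Ctx.At, Val.At, e1, hcell (M (η a)) (by simp [Ctx.rd]),
      hcell (M (η a) + 1) (by simp [Ctx.rd]), hcell (M (η a) + 4) (by simp [Ctx.rd]),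
      hcell (ρ x) (by simp [Ctx.rd]), h1, h2, h3, h4, ηa, ηb, true_and]
  · exact State.mem_vars_cons.2 (.inl (Ctx.mem_vars_iff.2 (.inr hy)))
  · simp only [List.cons_append, List.nil_append, PoolAt, hN, hN1, hp', ηa, ηb, e6, true_and]
    exact ⟨h5.congr e2 (fun _ _ => rfl) (by simp [ht.1]),
      h6.congr e3 (fun _ _ => rfl) (by simp [ht.2]), e4⟩
  · have e7 := (Val.layout_congr (ρ' := ρ) e2 fun _ _ => rfl).2.1
    have e8 := (Ctx.layout_congr (ρ' := ρ) e3 fun _ _ => rfl).2.1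
    simp only [Ctx.cb, Val.cb, e1, e5, e6, e7, e8, ηa, ηb, hN1, poolCb, List.cons_append,
      List.nil_append, List.append_nil, List.count_cons, List.count_append, List.count_nil]
    omega
  · simp only [Ctx.vars, Val.vars, List.mem_cons, List.mem_append, List.not_mem_nil,
      exists_eq_or_imp, exists_eq_left]
    grind
  · simp only [Ctx.bv, Val.bv, List.mem_cons, List.mem_append, List.not_mem_nil,
      exists_eq_or_imp, exists_eq_left]
    grind
  · simp [h.layout.lim]
  · have := h.layout.lim
    omega

end

end Sesame
set_option linter.unusedSimpArgs false
namespace Sesame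

/-! ### Tools for the principal transitions -/

theorem Owned.mono {cs cs' : List ℕ} {bs bs' : List Var} {ρ : Var → ℕ} {c : ℕ}
    (h : Owned cs bs ρ c) (hc : ∀ b ∈ cs, b ∈ cs') (hb : ∀ x ∈ bs, x ∈ bs') : Owned cs' bs' ρ c :=
  h.imp (hc _) fun ⟨x, hx, h⟩ => ⟨x, hb x hx, h⟩

theorem Owned.block {cs : List ℕ} {bs : List Var} {ρ : Var → ℕ} {b i : ℕ} (hb : b ∈ cs)
    (h8 : 8 ∣ b) (hi : i < 8) : Owned cs bs ρ (b + i) :=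
  .inl (by rwa [blk_add h8 hi])

/-- The cells of the block of a variable that is not one of the owners. -/
theorem Layout.ne {cs cs' : List ℕ} {vars bs : List Var} {ρ : Var → ℕ} {lim c : ℕ}
    (L : Layout cs vars ρ lim) (h : Owned cs' bs ρ c) (hc : ∀ b ∈ cs', b ∈ cs)
    (hb : ∀ z ∈ bs, z ∈ vars) {x : Var} (hx : x ∈ vars) (hxb : x ∉ bs) {i : ℕ} (hi : i < 8) :
    c ≠ ρ x + i := by
  rintro rfl
  have hx8 := (L.var x hx).1
  rcases h with h | ⟨z, hz, h⟩
  · rw [blk_add hx8 hi] at h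
    exact L.sep x hx (hc _ h)
  · have := (L.var z (hb z hz)).1
    have := L.inj x hx z (hb z hz) (by omega)
    exact hxb (this ▸ hz)

section

variable {M M' : ℕ → ℕ} {ρ : Var → ℕ} {η : ℕ → ℕ}

namespace SpineM

variable {v : Val} {x : Var} {a sc s : ℕ} {B C D : Ctx}

theorem slot (h : SpineM M ρ v x a B sc C D s) : sc = s ∨ ∃ b ∈ C.cb M ρ s, sc = b + 3 := by
  induction h with
  | here => exact .inl rfl
  | lam y h ih | bang h ih | cut w y h ih | sub m w y h ih | der e y h ih =>
    right
    rcases ih with rfl | ⟨b, hb, rfl⟩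
    · exact ⟨_, by simp [Ctx.cb, Val.cb], rfl⟩
    · exact ⟨b, by simp [Ctx.cb, Val.cb, hb], rfl⟩
  | subLam m z y E h ih | subBang m y E h ih =>
    right
    rcases ih with rfl | ⟨b, hb, rfl⟩
    · exact ⟨_, by simp [Ctx.cb, Val.cb], rfl⟩
    · exact ⟨b, by simp [Ctx.cb, Val.cb, hb], rfl⟩

/-- The cells that are read at the same place after the removal of a cut. -/
theorem owned (h : SpineM M ρ v x a B sc C D s) (hb : ∀ b ∈ C.blocks M ρ s, 8 ∣ b) {c : ℕ}
    (hc : c ∈ C.rd M ρ s) : Touched M ρ v x sc c ∨ c = s ∨ Owned (C.cb M ρ s) D.bv ρ c := by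
  induction h with
  | here =>
    simp only [Ctx.blocks, List.forall_mem_cons, List.forall_mem_append] at hb
    obtain ⟨b1, b2, b3, b4⟩ := hb
    simp only [Ctx.rd, List.mem_cons, List.mem_append, List.not_mem_nil, or_false] at hc
    have e := fun i (hi : i < 8) => Owned.block (ρ := ρ) (cs := (Ctx.cut v x B).cb M ρ sc)
      (bs := B.bv) (b := M sc) (i := i) (by simp [Ctx.cb]) b1 hi
    rcases hc with rfl | (rfl | rfl | rfl) | hc | hc
    · exact .inl (.inl rfl)
    · exact .inr (.inr (e 0 (by omega)))
    · exact .inr (.inr (e 1 (by omega)))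
    · exact .inl (.inr (.inl rfl))
    · exact .inl (.inr (.inr hc))
    · rcases Ctx.rd_owned b4 hc with rfl | h
      · exact .inr (.inr (e 3 (by omega)))
      · exact .inr (.inr (h.mono (by simp +contextual [Ctx.cb]) fun _ => id))
  | @lam C D s y h ih =>
    simp only [Ctx.blocks, Val.blocks, List.forall_mem_cons] at hb
    obtain ⟨b1, b2, b4⟩ := hb
    simp only [Ctx.rd, Val.rd, List.mem_cons, List.mem_append, List.not_mem_nil, or_false,
      false_or] at hc
    have e := fun i (hi : i < 8) => Owned.block (ρ := ρ) (cs := (Ctx.val (.lam y C)).cb M ρ s)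
      (bs := (Ctx.val (.lam y D)).bv) (b := M s) (i := i) (by simp [Ctx.cb, Val.cb]) b1 hi
    rcases hc with rfl | (rfl | rfl | rfl) | hc
    · exact .inr (.inl rfl)
    · exact .inr (.inr (e 0 (by omega)))
    · exact .inr (.inr (e 1 (by omega)))
    · exact .inr (.inr (.inr ⟨y, by simp [Ctx.bv, Val.bv], .inl rfl⟩))
    · rcases ih b4 hc with h | rfl | h
      · exact .inl h
      · exact .inr (.inr (e 3 (by omega)))
      · exact .inr (.inr (h.mono (by simp +contextual [Ctx.cb, Val.cb])
          (by simp +contextual [Ctx.bv, Val.bv])))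
  | @bang C D s h ih =>
    simp only [Ctx.blocks, Val.blocks, List.forall_mem_cons] at hb
    obtain ⟨b1, b4⟩ := hb
    simp only [Ctx.rd, Val.rd, List.mem_cons, List.mem_append, List.not_mem_nil, or_false,
      false_or] at hc
    have e := fun i (hi : i < 8) => Owned.block (ρ := ρ) (cs := (Ctx.val (.bang C)).cb M ρ s)
      (bs := (Ctx.val (.bang D)).bv) (b := M s) (i := i) (by simp [Ctx.cb, Val.cb]) b1 hi
    rcases hc with rfl | rfl | hc
    · exact .inr (.inl rfl)
    · exact .inr (.inr (e 0 (by omega)))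
    · rcases ih b4 hc with h | rfl | h
      · exact .inl h
      · exact .inr (.inr (e 3 (by omega)))
      · exact .inr (.inr (h.mono (by simp +contextual [Ctx.cb, Val.cb])
          (by simp +contextual [Ctx.bv, Val.bv])))
  | @cut C D s w y h ih =>
    simp only [Ctx.blocks, List.forall_mem_cons, List.forall_mem_append] at hb
    obtain ⟨b1, b2, b3, b4⟩ := hb
    simp only [Ctx.rd, List.mem_cons, List.mem_append, List.not_mem_nil, or_false] at hc
    have e := fun i (hi : i < 8) => Owned.block (ρ := ρ) (cs := (Ctx.cut w y C).cb M ρ s)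
      (bs := (Ctx.cut w y D).bv) (b := M s) (i := i) (by simp [Ctx.cb]) b1 hi
    rcases hc with rfl | (rfl | rfl | rfl) | hc | hc
    · exact .inr (.inl rfl)
    · exact .inr (.inr (e 0 (by omega)))
    · exact .inr (.inr (e 1 (by omega)))
    · exact .inr (.inr (.inr ⟨y, by simp [Ctx.bv], .inl rfl⟩))
    · rcases Val.rd_owned b3 hc with rfl | h
      · exact .inr (.inr (.inr ⟨y, by simp [Ctx.bv], .inr rfl⟩))
      · exact .inr (.inr (h.mono (by simp +contextual [Ctx.cb]) (by simp +contextual [Ctx.bv])))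
    · rcases ih b4 hc with h | rfl | h
      · exact .inl h
      · exact .inr (.inr (e 3 (by omega)))
      · exact .inr (.inr (h.mono (by simp +contextual [Ctx.cb]) (by simp +contextual [Ctx.bv])))
  | @sub C D s m w y h ih =>
    simp only [Ctx.blocks, List.forall_mem_cons, List.forall_mem_append] at hb
    obtain ⟨b1, b2, b3, b4⟩ := hb
    simp only [Ctx.rd, List.mem_cons, List.mem_append, List.not_mem_nil, or_false] at hc
    have e := fun i (hi : i < 8) => Owned.block (ρ := ρ) (cs := (Ctx.sub m w y C).cb M ρ s)
      (bs := (Ctx.sub m w y D).bv) (b := M s) (i := i) (by simp [Ctx.cb]) b1 hi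
    rcases hc with rfl | (rfl | rfl | rfl | rfl) | hc | hc
    · exact .inr (.inl rfl)
    · exact .inr (.inr (e 0 (by omega)))
    · exact .inr (.inr (e 1 (by omega)))
    · exact .inr (.inr (e 4 (by omega)))
    · exact .inr (.inr (.inr ⟨y, by simp [Ctx.bv], .inl rfl⟩))
    · rcases Val.rd_owned b3 hc with rfl | h
      · exact .inr (.inr (e 2 (by omega)))
      · exact .inr (.inr (h.mono (by simp +contextual [Ctx.cb]) (by simp +contextual [Ctx.bv])))
    · rcases ih b4 hc with h | rfl | h
      · exact .inl h
      · exact .inr (.inr (e 3 (by omega)))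
      · exact .inr (.inr (h.mono (by simp +contextual [Ctx.cb]) (by simp +contextual [Ctx.bv])))
  | @subLam C D s m z y E h ih =>
    simp only [Ctx.blocks, Val.blocks, List.forall_mem_cons, List.forall_mem_append] at hb
    obtain ⟨b1, b2, ⟨b3, b5, b6⟩, b4⟩ := hb
    simp only [Ctx.rd, Val.rd, List.mem_cons, List.mem_append, List.not_mem_nil, or_false,
      false_or] at hc
    have e := fun i (hi : i < 8) => Owned.block (ρ := ρ)
      (cs := (Ctx.sub m (.lam z C) y E).cb M ρ s)
      (bs := (Ctx.sub m (.lam z D) y E).bv) (b := M s) (i := i) (by simp [Ctx.cb]) b1 hi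
    have e' := fun i (hi : i < 8) => Owned.block (ρ := ρ)
      (cs := (Ctx.sub m (.lam z C) y E).cb M ρ s)
      (bs := (Ctx.sub m (.lam z D) y E).bv) (b := M (M s + 2)) (i := i)
      (by simp [Ctx.cb, Val.cb]) b3 hi
    rcases hc with rfl | (rfl | rfl | rfl | rfl) | (rfl | (rfl | rfl | rfl) | hc) | hc
    · exact .inr (.inl rfl)
    · exact .inr (.inr (e 0 (by omega)))
    · exact .inr (.inr (e 1 (by omega)))
    · exact .inr (.inr (e 4 (by omega)))
    · exact .inr (.inr (.inr ⟨y, by simp [Ctx.bv], .inl rfl⟩))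
    · exact .inr (.inr (e 2 (by omega)))
    · exact .inr (.inr (e' 0 (by omega)))
    · exact .inr (.inr (e' 1 (by omega)))
    · exact .inr (.inr (.inr ⟨z, by simp [Ctx.bv, Val.bv], .inl rfl⟩))
    · rcases ih b6 hc with h | rfl | h
      · exact .inl h
      · exact .inr (.inr (e' 3 (by omega)))
      · exact .inr (.inr (h.mono (by simp +contextual [Ctx.cb, Val.cb])
          (by simp +contextual [Ctx.bv, Val.bv])))
    · rcases Ctx.rd_owned b4 hc with rfl | h
      · exact .inr (.inr (e 3 (by omega)))
      · exact .inr (.inr (h.mono (by simp +contextual [Ctx.cb]) (by simp +contextual [Ctx.bv])))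
  | @subBang C D s m y E h ih =>
    simp only [Ctx.blocks, Val.blocks, List.forall_mem_cons, List.forall_mem_append] at hb
    obtain ⟨b1, b2, ⟨b3, b6⟩, b4⟩ := hb
    simp only [Ctx.rd, Val.rd, List.mem_cons, List.mem_append, List.not_mem_nil, or_false,
      false_or] at hc
    have e := fun i (hi : i < 8) => Owned.block (ρ := ρ)
      (cs := (Ctx.sub m (.bang C) y E).cb M ρ s)
      (bs := (Ctx.sub m (.bang D) y E).bv) (b := M s) (i := i) (by simp [Ctx.cb]) b1 hi
    have e' := fun i (hi : i < 8) => Owned.block (ρ := ρ)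
      (cs := (Ctx.sub m (.bang C) y E).cb M ρ s)
      (bs := (Ctx.sub m (.bang D) y E).bv) (b := M (M s + 2)) (i := i)
      (by simp [Ctx.cb, Val.cb]) b3 hi
    rcases hc with rfl | (rfl | rfl | rfl | rfl) | (rfl | rfl | hc) | hc
    · exact .inr (.inl rfl)
    · exact .inr (.inr (e 0 (by omega)))
    · exact .inr (.inr (e 1 (by omega)))
    · exact .inr (.inr (e 4 (by omega)))
    · exact .inr (.inr (.inr ⟨y, by simp [Ctx.bv], .inl rfl⟩))
    · exact .inr (.inr (e 2 (by omega)))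
    · exact .inr (.inr (e' 0 (by omega)))
    · rcases ih b6 hc with h | rfl | h
      · exact .inl h
      · exact .inr (.inr (e' 3 (by omega)))
      · exact .inr (.inr (h.mono (by simp +contextual [Ctx.cb, Val.cb])
          (by simp +contextual [Ctx.bv, Val.bv])))
    · rcases Ctx.rd_owned b4 hc with rfl | h
      · exact .inr (.inr (e 3 (by omega)))
      · exact .inr (.inr (h.mono (by simp +contextual [Ctx.cb]) (by simp +contextual [Ctx.bv])))
  | @der C D s m y h ih =>
    simp only [Ctx.blocks, List.forall_mem_cons] at hb
    obtain ⟨b1, b2, b4⟩ := hb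
    simp only [Ctx.rd, List.mem_cons, List.mem_append, List.not_mem_nil, or_false,
      false_or] at hc
    have e := fun i (hi : i < 8) => Owned.block (ρ := ρ) (cs := (Ctx.der m y C).cb M ρ s)
      (bs := (Ctx.der m y D).bv) (b := M s) (i := i) (by simp [Ctx.cb]) b1 hi
    rcases hc with rfl | (rfl | rfl | rfl | rfl) | hc
    · exact .inr (.inl rfl)
    · exact .inr (.inr (e 0 (by omega)))
    · exact .inr (.inr (e 1 (by omega)))
    · exact .inr (.inr (e 4 (by omega)))
    · exact .inr (.inr (.inr ⟨y, by simp [Ctx.bv], .inl rfl⟩))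
    · rcases ih b4 hc with h | rfl | h
      · exact .inl h
      · exact .inr (.inr (e 3 (by omega)))
      · exact .inr (.inr (h.mono (by simp +contextual [Ctx.cb]) (by simp +contextual [Ctx.bv])))

end SpineM

theorem Ctx.bottom_mem : ∀ {C : Ctx} {s : ℕ}, C.holes = [] → C.bottom M s ∈ C.rd M ρ s
  | .val v, s, h => by simpa [Ctx.bottom] using Ctx.mem_rd_self (C := .val v) h
  | .cut v x C, s, h => by
    simp only [Ctx.holes, List.append_eq_nil_iff] at h
    simp [Ctx.bottom, Ctx.rd, Ctx.bottom_mem (s := M s + 3) h.2]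
  | .sub m v x C, s, h => by
    simp only [Ctx.holes, List.append_eq_nil_iff] at h
    simp [Ctx.bottom, Ctx.rd, Ctx.bottom_mem (s := M s + 3) h.2]
  | .der e x C, s, h => by
    simp only [Ctx.holes] at h
    simp [Ctx.bottom, Ctx.rd, Ctx.bottom_mem (s := M s + 3) h]

/-- A cut, with a body that is already in place, is inserted around the value of a term. -/
theorem Ctx.splice_at {t : Ctx} {x : Var} {B : ℕ} (h1 : M' B = 4) (h2 : M' (B + 1) = ρ x)
    (h3 : M' (ρ x) = 1) (ht : t.At M' ρ η (B + 3)) : ∀ {C : Ctx} {s : ℕ}, C.At M ρ η s →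
    C.holes = [] → (C.rd M ρ s).Nodup → (∀ c ∈ C.rd M ρ s, c ≠ C.bottom M s → M' c = M c) →
    M' (C.bottom M s) = B → M' (ρ x + 1) = M (C.bottom M s) →
    (C.splice fun v => .cut v x t).At M' ρ η s ∧
    (∀ c, ((C.splice fun v => .cut v x t).cb M' ρ s).count c =
      (C.cb M ρ s).count c + (B :: t.cb M' ρ (B + 3)).count c) ∧
    ∀ c ∈ (C.splice fun v => .cut v x t).rd M' ρ s, c ∈ C.rd M ρ s ∨ c = B ∨ c = B + 1 ∨
      c = ρ x ∨ c = ρ x + 1 ∨ c ∈ t.rd M' ρ (B + 3)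
  | .val v, s, h, hh, hn, hM, hq, hx => by
    simp only [Ctx.bottom] at hM hq hx
    have hv : ∀ b, Ctx.val v ≠ .hole b := by
      rintro b ⟨⟩
      simp [Ctx.holes, Val.holes] at hh
    obtain ⟨e1, e2, e3, e4⟩ := Ctx.at_move (η' := η) hv h hn hx hM fun _ _ => rfl
    simp only [Ctx.At, Ctx.cb, Ctx.rd] at e1 e2 e3 e4
    have hs : s ∈ v.rd M ρ s := e4 ▸ List.mem_cons_self ..
    simp only [Ctx.splice, Ctx.At, Ctx.cb, Ctx.rd, hq, h1, h2, h3, e2, e3, true_and]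
    refine ⟨⟨e1, ht⟩, fun c => ?_, fun c hc => ?_⟩
    · simp only [List.count_cons, List.count_append]
      omega
    · simp only [List.mem_cons, List.mem_append, List.not_mem_nil] at hc
      rcases hc with rfl | hc | (rfl | hc) | hc
      · exact .inl hs
      · grind
      · simp
      · exact .inl (List.mem_of_mem_tail hc)
      · simp [hc]
  | .cut w y E, s, h, hh, hn, hM, hq, hx => by
    simp only [Ctx.holes, List.append_eq_nil_iff] at hh
    have hb := Ctx.bottom_mem (M := M) (ρ := ρ) (s := M s + 3) hh.2
    simp only [Ctx.bottom] at hM hq hx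
    simp only [Ctx.rd, List.mem_cons, List.mem_append, List.not_mem_nil, or_false] at hM
    simp only [Ctx.rd, List.nodup_cons, List.nodup_append', List.mem_cons, List.mem_append, not_or,
      List.disjoint_left, List.not_mem_nil, or_false] at hn
    obtain ⟨⟨n1, n2, n3⟩, n4, ⟨n5, n6, n7⟩, n8⟩ := hn
    have nb : ∀ {c}, c ∉ E.rd M ρ (M s + 3) → c ≠ E.bottom M (M s + 3) := by
      rintro c hc rfl
      exact hc hb
    have m0 : M' s = M s := hM _ (by simp) (nb n3)
    have m1 : M' (M s) = M (M s) := hM _ (by simp) (nb (n8 (.inl rfl)).2)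
    have m2 : M' (M s + 1) = M (M s + 1) := hM _ (by simp) (nb (n8 (by simp)).2)
    have m3 : M' (ρ y) = M (ρ y) := hM _ (by simp) (nb (n8 (by simp)).2)
    have mw : ∀ c ∈ w.rd M ρ (ρ y + 1), M' c = M c := fun c hc =>
      hM c (by simp [hc]) (nb (n7 hc))
    obtain ⟨i1, i2, i3⟩ := Ctx.splice_at h1 h2 h3 ht (C := E) (s := M s + 3) h.2.2.2.2 hh.2 n6
      (fun c hc => hM c (by simp [hc])) hq hx
    have h5 := Val.layout_congr (ρ' := ρ) mw fun _ _ => rfl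
    simp only [Ctx.splice, Ctx.At, Ctx.cb, Ctx.rd, m0, m1, m2, m3, List.count_cons, h5,
      List.count_append] at h i2 ⊢
    refine ⟨⟨h.1, h.2.1, h.2.2.1, h.2.2.2.1.congr mw (fun _ _ => rfl) (by simp [hh.1]), i1⟩,
      fun c => by have := i2 c; omega, fun c hc => ?_⟩
    simp only [List.mem_cons, List.mem_append, List.not_mem_nil, or_false] at hc ⊢
    have := i3 c
    grind
  | .sub m w y E, s, h, hh, hn, hM, hq, hx => by
    simp only [Ctx.holes, List.append_eq_nil_iff] at hh
    have hb := Ctx.bottom_mem (M := M) (ρ := ρ) (s := M s + 3) hh.2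
    simp only [Ctx.bottom] at hM hq hx
    simp only [Ctx.rd, List.mem_cons, List.mem_append, List.not_mem_nil, or_false] at hM
    simp only [Ctx.rd, List.nodup_cons, List.nodup_append', List.mem_cons, List.mem_append, not_or,
      List.disjoint_left, List.not_mem_nil, or_false] at hn
    obtain ⟨⟨n1, n2, n3⟩, n4, ⟨n5, n6, n7⟩, n8⟩ := hn
    have nb : ∀ {c}, c ∉ E.rd M ρ (M s + 3) → c ≠ E.bottom M (M s + 3) := by
      rintro c hc rfl
      exact hc hb
    have m0 : M' s = M s := hM _ (by simp) (nb n3)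
    have m1 : M' (M s) = M (M s) := hM _ (by simp) (nb (n8 (.inl rfl)).2)
    have m2 : M' (M s + 1) = M (M s + 1) := hM _ (by simp) (nb (n8 (by simp)).2)
    have m4 : M' (M s + 4) = M (M s + 4) := hM _ (by simp) (nb (n8 (by simp)).2)
    have m3 : M' (ρ y) = M (ρ y) := hM _ (by simp) (nb (n8 (by simp)).2)
    have mw : ∀ c ∈ w.rd M ρ (M s + 2), M' c = M c := fun c hc =>
      hM c (by simp [hc]) (nb (n7 hc))
    obtain ⟨i1, i2, i3⟩ := Ctx.splice_at h1 h2 h3 ht (C := E) (s := M s + 3) h.2.2.2.2.2 hh.2 n6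
      (fun c hc => hM c (by simp [hc])) hq hx
    have h5 := Val.layout_congr (ρ' := ρ) mw fun _ _ => rfl
    simp only [Ctx.splice, Ctx.At, Ctx.cb, Ctx.rd, m0, m1, m2, m3, m4, List.count_cons, h5,
      List.count_append] at h i2 ⊢
    refine ⟨⟨h.1, h.2.1, h.2.2.1, h.2.2.2.1, h.2.2.2.2.1.congr mw (fun _ _ => rfl)
      (by simp [hh.1]), i1⟩, fun c => by have := i2 c; omega, fun c hc => ?_⟩
    simp only [List.mem_cons, List.mem_append, List.not_mem_nil, or_false] at hc ⊢
    have := i3 c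
    grind
  | .der e y E, s, h, hh, hn, hM, hq, hx => by
    simp only [Ctx.holes] at hh
    have hb := Ctx.bottom_mem (M := M) (ρ := ρ) (s := M s + 3) hh
    simp only [Ctx.bottom] at hM hq hx
    simp only [Ctx.rd, List.mem_cons, List.mem_append, List.not_mem_nil, or_false, false_or] at hM
    simp only [Ctx.rd, List.nodup_cons, List.nodup_append', List.mem_cons, List.mem_append, not_or,
      List.disjoint_left, List.not_mem_nil, or_false, false_or] at hn
    obtain ⟨⟨n1, n3⟩, n4, ⟨n5, n6, n7⟩, n8⟩ := hn
    have nb : ∀ {c}, c ∉ E.rd M ρ (M s + 3) → c ≠ E.bottom M (M s + 3) := by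
      rintro c hc rfl
      exact hc hb
    have m0 : M' s = M s := hM _ (by simp) (nb n3)
    have m1 : M' (M s) = M (M s) := hM _ (by simp) (nb (n8 (.inl rfl)))
    have m2 : M' (M s + 1) = M (M s + 1) := hM _ (by simp) (nb (n8 (by simp)))
    have m4 : M' (M s + 4) = M (M s + 4) := hM _ (by simp) (nb (n8 (by simp)))
    have m3 : M' (ρ y) = M (ρ y) := hM _ (by simp) (nb (n8 (by simp)))
    obtain ⟨i1, i2, i3⟩ := Ctx.splice_at h1 h2 h3 ht (C := E) (s := M s + 3) h.2.2.2.2 hh n6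
      (fun c hc => hM c (by simp [hc])) hq hx
    simp only [Ctx.splice, Ctx.At, Ctx.cb, Ctx.rd, m0, m1, m2, m3, m4, List.count_cons,
      List.count_append] at h i2 ⊢
    refine ⟨⟨h.1, h.2.1, h.2.2.1, h.2.2.2.1, i1⟩, fun c => by have := i2 c; omega,
      fun c hc => ?_⟩
    simp only [List.mem_cons, List.mem_append, List.not_mem_nil, or_false, false_or] at hc ⊢
    have := i3 c
    grind

end

end Sesame
set_option linter.unusedSimpArgs false
namespace Sesame

/-! ### Simulation of the principal transitions on variables -/

section

variable {M M' M₁ : ℕ → ℕ} {ρ ρ' : Var → ℕ} {η η' : ℕ → ℕ} {r p lim lim' N a sc : ℕ}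
  {B C D t t' : Ctx} {P : Pool} {v : Val} {x : Var}

/-- The cells outside of the active job are not in the blocks of its bound variables. -/
theorem MInv.ne_bv (h : MInv M ρ η r p lim ⟨C, (a, t) :: P⟩) (hA : AInv N ⟨C, (a, t) :: P⟩) {c : ℕ}
    (hc : c ∈ C.rd M ρ r ∨ c = p ∨ c = p + 1 ∨ c ∈ poolRd M ρ η P (M (p + 1))) (hx : x ∈ t.bv)
    {i : ℕ} (hi : i < 8) : c ≠ ρ x + i := by
  have hb := fun b hb => h.mem_blocks (b := b) hb
  simp only [poolBlocks, List.mem_cons, List.mem_append, or_imp, forall_and, forall_eq] at hb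
  obtain ⟨⟨hb1, hb2, hb3, hb4, hb5⟩, -⟩ := hb
  have hbv := hA.bv
  simp only [State.bv, List.flatMap_cons, List.nodup_append', List.disjoint_left,
    List.mem_append] at hbv
  have hxv : x ∈ State.vars ⟨C, (a, t) :: P⟩ :=
    State.mem_vars_cons.2 (.inr (.inl (Ctx.mem_vars_iff.2 (.inr hx))))
  have key : Owned (r :: (C.cb M ρ r ++ poolCb M ρ η ((a, t) :: P) p))
      (C.bv ++ P.flatMap fun j => j.2.bv) ρ c := by
    simp only [poolCb]
    rcases hc with hc | rfl | rfl | hc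
    · rcases Ctx.rd_owned hb2 hc with rfl | h'
      · exact .block (i := 0) (by simp) hb1 (by omega)
      · exact h'.mono (by simp +contextual) (by simp +contextual)
    · exact .block (i := 0) (by simp) hb3 (by omega)
    · exact .block (i := 1) (by simp) hb3 (by omega)
    · rcases poolRd_owned hb5 hc with h' | h'
      · obtain ⟨j, hj, rfl⟩ := List.mem_map.1 h'
        rcases Ctx.slot_mem h.at_ hA.shape (a := j.1)
          (by rw [hA.holes]; exact List.mem_map_of_mem (List.mem_cons_of_mem _ hj)) with e | ⟨b, hb, e⟩
        · rw [e]
          exact .block (i := 0) (by simp) hb1 (by omega)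
        · have hb8 := (h.layout.con b (by simp [hb])).1
          rcases e with e | e <;> rw [e] <;> exact .block (by simp [hb]) hb8 (by omega)
      · exact h'.mono (by simp +contextual) (by simp +contextual)
  refine h.layout.ne key (fun _ => id) (fun z hz => ?_) hxv ?_ hi
  · rcases List.mem_append.1 hz with hz | hz
    · exact State.bv_subset_vars (by simp [State.bv, hz])
    · exact State.bv_subset_vars (by simp only [State.bv, List.flatMap_cons, List.mem_append, hz, or_true])
  · rw [List.mem_append, not_or]
    exact ⟨fun h => hbv.2.2 h (.inl hx), fun h => hbv.2.1.2.2 hx h⟩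

/-- The invariant after a principal transition that does not modify the multi-context. -/
theorem MInv.use (h : MInv M ρ η r p lim ⟨C, (a, t) :: P⟩) (hA : AInv N ⟨C, (a, t) :: P⟩)
    {F : List ℕ} {S : List Var}
    (hM : ∀ c, c < lim → c ∉ t.rd M ρ (η a) → (∀ z ∈ t.bv, c ≠ ρ z + 1) → M' c = M c)
    (hρ : ∀ y ∈ State.vars ⟨C, (a, t) :: P⟩, ρ' y = ρ y) (ht : t'.At M' ρ' η (η a))
    (hc : ∀ c, (t'.cb M' ρ' (η a)).count c ≤ (t.cb M ρ (η a)).count c + F.count c)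
    (hv : ∀ y ∈ t'.vars, y ∈ State.vars ⟨C, (a, t) :: P⟩ ∨ y ∈ S)
    (hS : ∀ y ∈ S, y ∈ t'.bv ∧ M' (ρ' y + 2) = y.kind) (hbv : ∀ y ∈ t.bv, y ∈ t'.bv)
    (hn : (F ++ S.map ρ').Nodup) (hF : ∀ b ∈ F ++ S.map ρ', 8 ∣ b ∧ lim ≤ b ∧ b < lim')
    (hl : lim ≤ lim') (hl' : 8 ∣ lim') : MInv M' ρ' η r p lim' ⟨C, (a, t') :: P⟩ := by
  have H := h.head hA
  have hcell : ∀ c, c ∈ C.rd M ρ r ∨ c = p ∨ c = p + 1 ∨ c ∈ poolRd M ρ η P (M (p + 1)) →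
      M' c = M c := fun c hc => by
    refine hM c (H.lt c (by tauto)) (fun h' => ?_) fun z hz => h.ne_bv hA hc hz (by omega)
    have := H.term c h'
    rcases hc with hc | hc | hc | hc
    · exact (H.ctx c hc).2.2.1 h'
    all_goals tauto
  have hvar : ∀ y ∈ State.vars ⟨C, (a, t) :: P⟩, ∀ i < 8,
      2 ≤ i ∨ y ∉ State.bv ⟨C, (a, t) :: P⟩ → M' (ρ y + i) = M (ρ y + i) := by
    intro y hy i hi hi'
    have h1 := h.layout.var y hy
    have h2 := h.layout.lim
    refine hM _ (by omega) (fun h' => H.ne _ (by tauto) y hy i hi hi' rfl) fun z hz e => ?_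
    have hz' : z ∈ State.bv ⟨C, (a, t) :: P⟩ := State.mem_bv_cons.2 (.inr (.inl hz))
    have h3 := h.layout.var z (State.bv_subset_vars hz')
    have := h.layout.inj y hy z (State.bv_subset_vars hz') (by omega)
    subst this
    rcases hi' with h | h
    · omega
    · exact h hz'
  have hCb : ∀ y ∈ C.bv, y ∈ State.vars ⟨C, (a, t) :: P⟩ := fun y hy =>
    State.bv_subset_vars (State.mem_bv_cons.2 (.inl hy))
  have hCv : ∀ y ∈ C.vars, y ∈ State.vars ⟨C, (a, t) :: P⟩ := fun y hy =>
    State.mem_vars_cons.2 (.inl hy)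
  obtain ⟨-, e1, -⟩ := Ctx.layout_congr (M' := M') (ρ' := ρ') (v := C) (s := r)
    (fun c hc => hcell c (.inl hc)) fun y hy => hρ y (hCb y hy)
  have hB : C.Back M' ρ' r := h.back.congr (fun c hc => hcell c (.inl hc)) fun y hy => by
    rw [hρ y (hCb y hy)]
    exact hvar y (hCb y hy) 3 (by omega) (.inl (by omega))
  obtain ⟨e2, e3⟩ := H.tail_congr hA (M' := M') (ρ' := ρ') (η' := η)
    (fun j hj y hy => hρ y (State.mem_vars_cons.2 (.inr (.inr ⟨j, hj, hy⟩))))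
    (fun c hc => hcell c (by tauto)) fun _ _ _ => rfl
  have e4 := hcell (p + 1) (by tauto)
  have e5 := hcell p (by tauto)
  have hold : ∀ y ∈ State.vars ⟨C, (a, t') :: P⟩, y ∈ State.vars ⟨C, (a, t) :: P⟩ ∨ y ∈ S := by
    intro y hy
    rcases State.mem_vars_cons.1 hy with hy | hy | hy
    · exact .inl (hCv y hy)
    · exact hv y hy
    · exact .inl (State.mem_vars_cons.2 (.inr (.inr hy)))
  refine ⟨h.at_.congr (fun c hc => hcell c (.inl hc)) (fun y hy => hρ y (hCv y hy)) fun _ _ => rfl,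
    hB, ?_, fun y hy hy' => ?_, fun y hy => ?_, ?_⟩
  · simp only [PoolAt, e4, e5]
    exact ⟨H.job, ht, e2⟩
  · have h1 : y ∉ S := fun h1 => hy' (State.mem_bv_cons.2 (.inr (.inl (hS y h1).1)))
    have h2 := (hold y hy).resolve_right h1
    have h3 : y ∉ State.bv ⟨C, (a, t) :: P⟩ := by
      rw [State.mem_bv_cons] at hy' ⊢
      rintro (h | h | h)
      exacts [hy' (.inl h), hy' (.inr (.inl (hbv y h))), hy' (.inr (.inr h))]
    have := hvar y h2 0 (by omega) (.inr h3)
    rw [hρ y h2]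
    exact this.trans (h.flag y h2 h3)
  · rcases hold y hy with hy | hy
    · rw [hρ y hy, hvar y hy 2 (by omega) (.inl le_rfl), h.kind y hy]
    · exact (hS y hy).2
  · refine h.layout.extend (F := F) (S := S) (fun c => ?_) hold hρ hn hF hl hl' ?_
    · have := hc c
      simp only [List.count_cons, List.count_append, e1, poolCb, e3, e4] at this ⊢
      omega
    · have := h.layout.con r (by simp)
      omega

theorem SpineM.rd_sublist {s : ℕ} (h : SpineM M ρ v x a B sc C D s) :
    ((Ctx.cut v x B).rd M ρ sc).Sublist (C.rd M ρ s) := by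
  induction h with
  | here => exact .refl _
  | lam y h ih | bang h ih | cut w y h ih | sub m w y h ih | der e y h ih =>
    exact ih.trans (((List.sublist_append_right ..).trans (List.sublist_append_right ..)).cons _)
  | subLam m z y E h ih | subBang m y E h ih =>
    refine ih.trans (((List.Sublist.trans ?_ (List.sublist_append_left ..)).trans
      (List.sublist_append_right ..)).cons _)
    exact ((List.sublist_append_right ..).trans (List.sublist_append_right ..)).cons _

/-- The effect of the removal of a cut on the memory. -/
theorem removeMem_spec {s b q : ℕ} (h1 : M (b + 3) = sc) (h2 : M sc + 3 = q) (hbs : b ≠ sc)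
    (hb : s = q → b ≠ p) (hs : s = q → sc ≠ p) (hm : s ≠ q → M q ≠ b ∧ M q ≠ sc)
    (hm' : s ≠ q → M (M q) = 4 → M q + 1 ≠ b ∧ M q + 1 ≠ sc ∧ M (M q + 1) + 3 ≠ b ∧
      M (M q + 1) + 3 ≠ sc) :
    (∀ c, c ≠ b → c ≠ sc → (s = q → c ≠ p) → (s ≠ q → M (M q) = 4 → c ≠ M (M q + 1) + 3) →
      removeMem M s p b c = M c) ∧
    removeMem M s p b b = 0 ∧ removeMem M s p b sc = M q ∧ (s = q → removeMem M s p b p = sc) ∧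
    (s ≠ q → M (M q) = 4 → removeMem M s p b (M (M q + 1) + 3) = sc) := by
  have e : removeMem M s p b = if q = s then Function.update (Function.update
      (Function.update M b 0) sc (M q)) p sc else if Function.update (Function.update M b 0) sc
      (M q) (M q) = 4 then Function.update (Function.update (Function.update M b 0) sc (M q))
      (Function.update (Function.update M b 0) sc (M q) (M q + 1) + 3) sc else
      Function.update (Function.update M b 0) sc (M q) := by
    simp only [removeMem, h1, h2]
  rw [e]
  by_cases hq : s = q
  · subst hq
    simp only [if_true, ne_eq, not_true_eq_false, false_implies, true_implies, implies_true] at hb hs ⊢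
    refine ⟨fun c h1 h2 h3 => ?_, ?_, ?_, Function.update_self .., trivial⟩
    · rw [Function.update_of_ne h3, Function.update_of_ne h2, Function.update_of_ne h1]
    · rw [Function.update_of_ne hb, Function.update_of_ne hbs, Function.update_self]
    · rw [Function.update_of_ne hs, Function.update_self]
  · obtain ⟨g1, g2⟩ := hm hq
    rw [if_neg (Ne.symm hq), Function.update_of_ne g2, Function.update_of_ne g1]
    simp only [hq, ne_eq, not_false_eq_true, false_implies, true_implies, true_and]
    by_cases h4 : M (M q) = 4
    · obtain ⟨g3, g4, g5, g6⟩ := hm' hq h4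
      simp only [h4, if_true, Function.update_of_ne g4, Function.update_of_ne g3, true_implies]
      refine ⟨fun c h1 h2 h3 => ?_, ?_, ?_, Function.update_self ..⟩
      · rw [Function.update_of_ne h3, Function.update_of_ne h2, Function.update_of_ne h1]
      · rw [Function.update_of_ne (Ne.symm g5), Function.update_of_ne hbs, Function.update_self]
      · rw [Function.update_of_ne (Ne.symm g6), Function.update_self]
    · simp only [h4, if_false, false_implies, true_implies, and_true]
      refine ⟨fun c h1 h2 => ?_, ?_, ?_⟩
      · rw [Function.update_of_ne h2, Function.update_of_ne h1]
      · rw [Function.update_of_ne hbs, Function.update_self]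
      · rw [Function.update_self]

set_option maxHeartbeats 400000 in
/-- The invariant after a principal transition that removes a cut. -/
theorem MInv.remove (h : MInv M ρ η r p lim ⟨C, (a, t) :: P⟩) (hA : AInv N ⟨C, (a, t) :: P⟩)
    (hS : Spine v x a B C D) (hM : SpineM M ρ v x a B sc C D r)
    (h1 : ∀ c, (c ∈ C.rd M ρ r ∧ ¬ Touched M ρ v x sc c) ∨ c = sc ∨ c = p + 1 ∨ c = p ∨ 
      c ∈ poolRd M ρ η P (M (p + 1)) → M₁ c = M c)
    (h2 : ∀ y ∈ State.vars ⟨C, (a, t) :: P⟩, ∀ i < 8,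
      2 ≤ i ∨ y ∉ State.bv ⟨C, (a, t) :: P⟩ → M₁ (ρ y + i) = M (ρ y + i))
    (ht : t'.At M₁ ρ η (η a)) (ht' : t'.holes = [])
    (hrd : ∀ c ∈ t'.rd M₁ ρ (η a), c ∈ t.rd M ρ (η a) ∨ c ∈ v.rd M ρ (ρ x + 1) ∨
      ∃ z, (z ∈ t.bv ∨ z ∈ v.bv) ∧ c = ρ z + 1)
    (hc : ∀ c, (t'.cb M₁ ρ (η a)).count c ≤
      (t.cb M ρ (η a)).count c + (v.cb M ρ (ρ x + 1)).count c)
    (hv : ∀ y ∈ t'.vars, y ∈ t.vars ∨ y ∈ v.vars)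
    (hbv : ∀ y, y ∈ t.bv ∨ y ∈ v.bv → y ∈ t'.bv) :
    ∃ η', MInv (removeMem M₁ (η a) p (ρ x)) ρ η' r p lim ⟨D, (a, t') :: P⟩ := by
  have H := h.head hA
  have hcut := hM.at_cut h.at_
  have hsub := fun c => hM.rd_subset (c := c)
  have hnd := hM.rd_sublist.nodup H.nodup
  have hx := hM.mem_bv
  simp only [Ctx.rd, List.nodup_cons, List.nodup_append', List.mem_cons, List.mem_append, not_or,
    List.disjoint_left, List.not_mem_nil, or_false] at hnd hsub
  obtain ⟨⟨⟨n1, n1', n1''⟩, n2, n3⟩, n4, ⟨n5, n6, n7⟩, n8⟩ := hnd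
  have n9 := n8 (.inr (.inr rfl))
  have hxsc : ρ x ≠ sc := Ne.symm n1''
  have hscC : sc ∈ C.rd M ρ r := hsub sc (by simp)
  have hxC : ρ x ∈ C.rd M ρ r := hsub _ (by simp)
  have hCv : ∀ y ∈ C.bv, y ∈ State.vars ⟨C, (a, t) :: P⟩ := fun y hy =>
    State.bv_subset_vars (State.mem_bv_cons.2 (.inl hy))
  have hx3 : M₁ (ρ x + 3) = sc :=
    (h2 x (hCv x hx) 3 (by omega) (.inl (by omega))).trans (hM.back_eq h.back)
  have hsc1 : M₁ sc = M sc := h1 sc (.inr (.inl rfl))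
  have hhole : η a = M sc + 3 ↔ B = .hole a := by
    constructor
    · intro e
      by_contra hB
      have hB' : ∀ b, B ≠ .hole b := by
        rintro b rfl
        have := hS.mem_body
        simp only [Ctx.holes, Val.holes, List.mem_singleton] at this
        exact hB (this ▸ rfl)
      have : M sc + 3 ∈ B.rd M ρ (M sc + 3) := by
        rw [Ctx.rd_eq_cons hB']
        exact List.mem_cons_self ..
      exact (H.ctx _ (hsub _ (.inr (.inr (.inr this))))).2.2.1 (e ▸ H.slot)
    · rintro rfl
      exact hcut.2.2.2.2
  have hB' : B ≠ .hole a → ∀ b, B ≠ .hole b := by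
    rintro hB b rfl
    have := hS.mem_body
    simp only [Ctx.holes, Val.holes, List.mem_singleton] at this
    exact hB (this ▸ rfl)
  have hcB : ∀ c ∈ B.rd M ρ (M sc + 3), c ≠ ρ x ∧ c ≠ sc ∧ M₁ c = M c := fun c hc => by
    have e1 : c ≠ ρ x := by
      rintro rfl
      exact n9.2 hc
    have e2 : c ≠ sc := by
      rintro rfl
      exact n3 hc
    refine ⟨e1, e2, h1 c (.inl ⟨hsub c (.inr (.inr (.inr hc))), ?_⟩)⟩
    rintro (h | h | h)
    exacts [e2 h, e1 h, n7 h hc]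
  have hal : ∀ y ∈ State.vars ⟨C, (a, t) :: P⟩, 8 ∣ ρ y := fun y hy => (h.layout.var y hy).1
  have hne : ∀ c, c ∈ C.rd M ρ r ∨ c = p ∨ c = p + 1 ∨ c ∈ t.rd M ρ (η a) ∨
      c ∈ poolRd M ρ η P (M (p + 1)) → ∀ y ∈ C.bv, c ≠ ρ y + 3 := fun c hc y hy =>
    H.ne c hc y (hCv y hy) 3 (by omega) (.inl (by omega))
  have hcutB : ∀ w y E, B = .cut w y E → y ∈ C.bv ∧ M₁ (M₁ (M sc + 3)) = 4 ∧
      M₁ (M₁ (M sc + 3) + 1) = ρ y := by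
    rintro w y E rfl
    obtain ⟨-, -, -, -, g1, g2, -⟩ := hcut
    rw [(hcB (M sc + 3) (by simp [Ctx.rd])).2.2, (hcB (M (M sc + 3)) (by simp [Ctx.rd])).2.2,
      (hcB (M (M sc + 3) + 1) (by simp [Ctx.rd])).2.2]
    exact ⟨hM.body_bv (by simp [Ctx.bv]), g1, g2⟩
  have hcutB' : η a ≠ M sc + 3 → M₁ (M₁ (M sc + 3)) = 4 → ∃ w y E, B = .cut w y E := by
    intro e h4
    have hB := hB' fun e' => e (hhole.2 e')
    have g := hcut.2.2.2.2
    match B with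
    | .val (.hole b) => exact absurd rfl (hB b)
    | .cut w y E => exact ⟨w, y, E, rfl⟩
    | .val (.var y) | .val (.lam y E) | .val (.bang E) | .sub m w y E | .der m y E =>
      rw [(hcB (M sc + 3) (by simp [Ctx.rd, Val.rd])).2.2,
        (hcB (M (M sc + 3)) (by simp [Ctx.rd, Val.rd])).2.2] at h4
      simp only [Ctx.At, Val.At, h4] at g
      omega
  have hβ : η a ≠ M sc + 3 → ∃ l, B.rd M ρ (M sc + 3) = (M sc + 3) :: M (M sc + 3) :: l := by
    intro e
    have hB := hB' fun e' => e (hhole.2 e')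
    match B with
    | .val (.hole b) => exact absurd rfl (hB b)
    | .val (.var y) | .val (.lam y E) | .val (.bang E) | .cut w y E | .sub m w y E | .der m y E =>
      exact ⟨_, rfl⟩
  obtain ⟨m1, m2, m3, m4, m5⟩ := removeMem_spec (M := M₁) (s := η a) (p := p) (b := ρ x)
    (q := M sc + 3) hx3 (by rw [hsc1]) hxsc (fun _ => (H.ctx _ hxC).1) (fun _ => (H.ctx _ hscC).1)
    (fun e => by
      obtain ⟨l, hl⟩ := hβ e
      rw [(hcB (M sc + 3) (by simp [hl])).2.2]
      have := hcB (M (M sc + 3)) (by simp [hl])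
      exact ⟨this.1, this.2.1⟩)
    (fun e h4 => by
      obtain ⟨w, y, E, hB⟩ := hcutB' e h4
      obtain ⟨g1, g2, g3⟩ := hcutB w y E hB
      rw [g3]
      have := hcB (M (M sc + 3) + 1) (by simp [hB, Ctx.rd])
      have e1 := (hcB (M sc + 3) (by simp [hB, Ctx.rd])).2.2
      have e2 := hal y (hCv y g1)
      have e3 := hal x (hCv x hx)
      exact ⟨by rw [e1]; exact this.1, by rw [e1]; exact this.2.1, by omega,
        Ne.symm (hne sc (.inl hscC) y g1)⟩)
  set M' := removeMem M₁ (η a) p (ρ x) with hM'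
  have m1' : ∀ c, c ≠ ρ x → c ≠ sc → (B = .hole a → c ≠ p) →
      (∀ w y E, B = .cut w y E → c ≠ ρ y + 3) → M' c = M₁ c := by
    intro c e1 e2 e3 e4
    refine m1 c e1 e2 (fun e => e3 (hhole.1 e)) fun e e' => ?_
    obtain ⟨w, y, E, hB⟩ := hcutB' e e'
    rw [(hcutB w y E hB).2.2]
    exact e4 w y E hB
  have hne' : ∀ c, c ∈ C.rd M ρ r ∨ c = p ∨ c = p + 1 ∨ c ∈ t.rd M ρ (η a) ∨
      c ∈ poolRd M ρ η P (M (p + 1)) → ∀ w y E, B = .cut w y E → c ≠ ρ y + 3 :=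
    fun c hc w y E hB => hne c hc y (hcutB w y E hB).1
  have hkeep : ∀ c ∈ C.rd M ρ r, ¬ Touched M ρ v x sc c → M' c = M c := fun c hc hT => by
    rw [m1' c (fun e => hT (.inr (.inl e))) (fun e => hT (.inl e)) (fun _ => (H.ctx c hc).1)
      (hne' c (.inl hc)), h1 c (.inl ⟨hc, hT⟩)]
  have htail : ∀ c, c = p + 1 ∨ c ∈ poolRd M ρ η P (M (p + 1)) → M' c = M c := by
    intro c hc
    rw [m1' c ?_ ?_ ?_ (hne' c (by rcases hc with hc | hc <;> simp [hc])), h1 c (by rcases hc with hc | hc <;> simp [hc])]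
    · rintro rfl
      exact hc.elim (H.ctx _ hxC).2.1 (H.ctx _ hxC).2.2.2
    · rintro rfl
      exact hc.elim (H.ctx _ hscC).2.1 (H.ctx _ hscC).2.2.2
    · rintro - rfl
      rcases hc with hc | hc
      · omega
      · exact (H.pool c hc).1 rfl
  have hvar : ∀ y ∈ State.vars ⟨C, (a, t) :: P⟩, ∀ i < 8, i ≠ 3 →
      2 ≤ i ∨ y ∉ State.bv ⟨C, (a, t) :: P⟩ → M' (ρ y + i) = M (ρ y + i) := by
    intro y hy i hi hi3 hi'
    have e1 := hal y hy
    rw [m1' (ρ y + i) ?_ (fun e => H.ne sc (.inl hscC) y hy i hi hi' e.symm)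
      (fun _ e => H.ne p (.inr (.inl rfl)) y hy i hi hi' e.symm) ?_, h2 y hy i hi hi']
    · intro e
      have e2 := hal x (hCv x hx)
      have := h.layout.inj y hy x (hCv x hx) (by omega)
      subst this
      rcases hi' with h | h
      · omega
      · exact h (State.mem_bv_cons.2 (.inl hx))
    · intro w z E hB
      have e2 := hal z (hCv z (hcutB w z E hB).1)
      omega
  have hjob : ∀ c ∈ t'.rd M₁ ρ (η a), M' c = M₁ c := by
    intro c hc
    have key : c ≠ ρ x ∧ c ≠ sc ∧ c ≠ p ∧ ∀ w y E, B = .cut w y E → c ≠ ρ y + 3 := by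
      rcases hrd c hc with hc | hc | ⟨z, hz, rfl⟩
      · refine ⟨?_, ?_, (H.term c hc).1, hne' c (.inr (.inr (.inr (.inl hc))))⟩
        · rintro rfl
          exact (H.ctx _ hxC).2.2.1 hc
        · rintro rfl
          exact (H.ctx _ hscC).2.2.1 hc
      · have hcC := hsub c (.inr (.inr (.inl hc)))
        refine ⟨?_, ?_, (H.ctx c hcC).1, hne' c (.inl hcC)⟩
        · rintro rfl
          exact n9.1 hc
        · rintro rfl
          exact n2 hc
      · have hz' : z ∈ State.vars ⟨C, (a, t) :: P⟩ := by
          refine State.bv_subset_vars (State.mem_bv_cons.2 ?_)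
          rcases hz with hz | hz
          · exact .inr (.inl hz)
          · exact .inl ((hS.mem_bv z).2 (.inr (.inl hz)))
        have e1 := hal z hz'
        have e2 := hal x (hCv x hx)
        have e4 := h.layout.con r (by simp)
        have e5 := h.layout.con p (by simp [poolCb])
        refine ⟨by omega, ?_, by omega, fun w y E hB => ?_⟩
        · rcases hM.slot with e | ⟨b, hb, e⟩
          · omega
          · have := h.layout.con b (by simp [hb])
            omega
        · have e3 := hal y (hCv y (hcutB w y E hB).1)
          omega
    exact m1' c key.1 key.2.1 (fun _ => key.2.2.1) key.2.2.2
  have hη : ∃ η' : ℕ → ℕ, (∀ b, b ≠ a → η' b = η b) ∧ (B = .hole a → η' a = sc) ∧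
      (B ≠ .hole a → η' a = η a) := by
    by_cases hB : B = .hole a
    · exact ⟨Function.update η a sc, fun b hb => Function.update_of_ne hb _ _,
        fun _ => Function.update_self .., fun h => absurd hB h⟩
    · exact ⟨η, fun _ _ => rfl, fun h => absurd h hB, fun _ => rfl⟩
  obtain ⟨η', hη1, hη2, hη3⟩ := hη
  have hm3 : B ≠ .hole a → M' sc = M (M sc + 3) := fun hB => by
    rw [m3, (hcB _ _).2.2]
    rw [Ctx.rd_eq_cons (hB' hB)]
    exact List.mem_cons_self ..
  have hjob' : M' p = η' a ∧ t'.At M' ρ η' (η' a) ∧ t'.cb M' ρ (η' a) = t'.cb M₁ ρ (η a) := by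
    by_cases hB : B = .hole a
    · have ht0 : ∀ b, t' ≠ .hole b := by
        rintro b rfl
        simp [Ctx.holes, Val.holes] at ht'
      have := Ctx.at_shift (M' := M') (s' := sc) (η' := η') ht0 ht
        (by rw [m3, hhole.2 hB]) (fun c hc => hjob c (List.mem_of_mem_tail hc)) (by simp [ht'])
      rw [hη2 hB]
      exact ⟨m4 (hhole.2 hB), this.1, this.2.1⟩
    · rw [hη3 hB]
      refine ⟨?_, ht.congr hjob (fun _ _ => rfl) (by simp [ht']),
        (Ctx.layout_congr (ρ' := ρ) hjob fun _ _ => rfl).2.1⟩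
      rw [m1' p (fun e => (H.ctx _ hxC).1 e.symm) (fun e => (H.ctx _ hscC).1 e.symm)
        (fun e => absurd e hB) (hne' p (.inr (.inl rfl))), h1 p (.inr (.inr (.inr (.inl rfl)))), H.job]
  obtain ⟨e2, e3⟩ := H.tail_congr hA (M' := M') (ρ' := ρ) (η' := η') (fun _ _ _ _ => rfl)
    (fun c hc => htail c (.inr hc)) fun b _ hb => hη1 b hb
  have e4 := htail (p + 1) (.inl rfl)
  obtain ⟨e5, e6⟩ := hM.remove (M' := M') (η' := η') h.at_ H.nodup hA.nodup hkeep
    (fun b _ hb => hη1 b hb) hη2 fun hB => ⟨hη3 hB, hm3 hB⟩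
  have hold : ∀ y ∈ State.vars ⟨D, (a, t') :: P⟩, y ∈ State.vars ⟨C, (a, t) :: P⟩ := by
    intro y hy
    rw [State.mem_vars_cons] at hy ⊢
    rcases hy with hy | hy | hy
    · exact .inl ((hS.mem_vars y).2 (.inr (.inr hy)))
    · rcases hv y hy with hy | hy
      · exact .inr (.inl hy)
      · exact .inl ((hS.mem_vars y).2 (.inr (.inl hy)))
    · exact .inr (.inr hy)
  refine ⟨η', e5, ?_, ?_, fun y hy hy' => ?_, fun y hy => ?_, ?_⟩
  · have hbv := hA.bv
    simp only [State.bv, List.nodup_append'] at hbv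
    refine hM.back_remove h.back H.nodup hbv.1 hkeep hm3 (fun y hy hyx hyB => ?_) ?_
    · rw [m1' (ρ y + 3) ?_ (Ne.symm (hne sc (.inl hscC) y hy)) (fun _ => Ne.symm (hne p (.inr (.inl rfl)) y hy))
        ?_, h2 y (hCv y hy) 3 (by omega) (.inl (by omega))]
      · have e1 := hal y (hCv y hy)
        have e2 := hal x (hCv x hx)
        omega
      · intro w z E hB e
        have := h.layout.inj y (hCv y hy) z (hCv z (hcutB w z E hB).1) (by omega)
        subst this
        exact hyB w E hB
    · intro w y E hB
      have e := m5 (fun e => by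
        have := hhole.1 e
        rw [hB] at this
        cases this) (hcutB w y E hB).2.1
      rwa [(hcutB w y E hB).2.2] at e
  · simp only [PoolAt, e4]
    exact ⟨hjob'.1, hjob'.2.1, e2⟩
  · by_cases hy2 : y ∈ State.bv ⟨C, (a, t) :: P⟩
    · have : y = x := by
        rw [State.mem_bv_cons] at hy2 hy'
        rcases hy2 with hy2 | hy2 | hy2
        · rcases (hS.mem_bv y).1 hy2 with h | h | h
          · exact h
          · exact absurd (.inr (.inl (hbv y (.inr h)))) hy'
          · exact absurd (.inl h) hy'
        · exact absurd (.inr (.inl (hbv y (.inl hy2)))) hy'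
        · exact absurd (.inr (.inr hy2)) hy'
      rw [this]
      exact m2
    · exact (hvar y (hold y hy) 0 (by omega) (by omega) (.inr hy2)).trans
        (h.flag y (hold y hy) hy2)
  · rw [hvar y (hold y hy) 2 (by omega) (by omega) (.inl le_rfl), h.kind y (hold y hy)]
  · refine h.layout.extend (F := []) (S := []) (fun c => ?_) (fun y hy => .inl (hold y hy))
      (fun _ _ => rfl) (by simp) (by simp) le_rfl h.layout.lim ?_
    · have i1 := hc c
      have i2 := e6 c
      simp only [List.count_cons, List.count_append, poolCb, e3, e4, hjob'.2.2, List.count_nil]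
        at i1 i2 ⊢
      omega
    · have := h.layout.con r (by simp)
      omega

end

end Sesame
set_option linter.unusedSimpArgs false
namespace Sesame

theorem Sim.mono {b b' : ℕ} {R M : ℕ → ℕ} {ρ : Var → ℕ} {Q Q' : State} (h : Sim b R M ρ Q Q')
    (hb : b ≤ b') : Sim b' R M ρ Q Q' := by
  obtain ⟨R', M', ρ', η', h1, h2, h3⟩ := h
  exact ⟨R', M', ρ', η', h1.mono hb, h2, h3⟩

section

variable {R M : ℕ → ℕ} {ρ : Var → ℕ} {η : ℕ → ℕ} {N a : ℕ} {C D t : Ctx} {P : Pool} {x : Var}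
  {v : Val}

/-- What the invariants say of a cut on a variable of the active job. -/
theorem MInv.cut {y : Var} (h : MInv M ρ η (R 0) (R 1) (R 2) ⟨C, (a, t) :: P⟩)
    (hA : AInv N ⟨C, (a, t) :: P⟩) (hC : CutIn C v y D) (hy : y ∈ t.fv) :
    ∃ B sc, Spine v y a B C D ∧ SpineM M ρ v y a B sc C D (R 0) ∧ M (ρ y) = 1 ∧
      v.At M ρ η (ρ y + 1) ∧ v.holes = [] ∧ v.size ≤ N ∧
      (∀ c ∈ v.rd M ρ (ρ y + 1), c ∈ C.rd M ρ (R 0) ∧ c ≠ sc ∧ c ≠ ρ y) ∧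
      (v.rd M ρ (ρ y + 1)).Nodup ∧ ρ y ∈ C.rd M ρ (R 0) ∧ sc ∈ C.rd M ρ (R 0) ∧
      ∀ z ∈ v.vars, z ∈ State.vars ⟨C, (a, t) :: P⟩ := by
  obtain ⟨B, hS⟩ := hA.spine hC hy
  obtain ⟨sc, hM⟩ := hS.spineM (M := M) (ρ := ρ) (R 0)
  have hcut := hM.at_cut h.at_
  have hsub := fun c => hM.rd_subset (c := c)
  have hnd := hM.rd_sublist.nodup (h.head hA).nodup
  simp only [Ctx.rd, List.nodup_cons, List.nodup_append', List.mem_cons, List.mem_append, not_or,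
    List.disjoint_left, List.not_mem_nil, or_false] at hnd hsub
  refine ⟨B, sc, hS, hM, hcut.2.2.1, hcut.2.2.2.1, hS.value_term, hS.size_le hA.shape,
    fun c hc => ⟨hsub c (.inr (.inr (.inl hc))), ?_, ?_⟩, hnd.2.2.1.1, hsub _ (by simp),
    hsub _ (by simp), fun z hz => ?_⟩
  · rintro rfl
    exact hnd.1.2.1 hc
  · rintro rfl
    exact (hnd.2.2.2 (.inr (.inr rfl))).1 hc
  · exact State.mem_vars_cons.2 (.inl ((hS.mem_vars z).2 (.inr (.inl hz))))

theorem sim_axe2 {e f : ℕ} (h : MInv M ρ η (R 0) (R 1) (R 2) ⟨C, (a, .der e x t) :: P⟩)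
    (hA : AInv N ⟨C, (a, .der e x t) :: P⟩) (hC : CutIn C (.var (.e f)) (.e e) D) :
    Sim 40 R M ρ ⟨C, (a, .der e x t) :: P⟩ ⟨C, (a, .der f x t) :: P⟩ := by
  have H := h.head hA
  obtain ⟨h1, h2, h3, h4, h5⟩ := H.at_
  obtain ⟨B, sc, hS, hM, g1, ⟨g2, g2'⟩, g3, g4, g5, g6, g7, g8, g9⟩ := h.cut hA hC
    (by simp [Ctx.fv])
  obtain ⟨R', hT, hs1, hs2, hs3⟩ := turn_axe2 H.job rfl h1 h3 (by omega) rfl g2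
  have ht := hA.term _ (List.mem_cons_self ..)
  simp only [Ctx.holes] at ht
  rw [g2'] at hT
  have hn := H.nodup'
  simp only [Ctx.rd, List.nodup_cons, List.nodup_append', List.mem_cons, List.mem_append, not_or,
    List.disjoint_left, List.not_mem_nil, or_false, false_or] at hn
  set M' := Function.update M (M (η a) + 4) (ρ (.e f)) with hM'
  have hM1 : ∀ c, c ≠ M (η a) + 4 → M' c = M c := fun c hc => Function.update_of_ne hc _ _
  have m4 : M' (M (η a) + 4) = ρ (.e f) := Function.update_self ..
  have m0 := hM1 (η a) (by omega)
  have m1 := hM1 (M (η a)) (by omega)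
  have m2 := hM1 (M (η a) + 1) (by omega)
  have m3 := hM1 (ρ x) (by omega)
  have mt : ∀ c ∈ t.rd M ρ (M (η a) + 3), M' c = M c := fun c hc => hM1 c (by
    rintro rfl
    exact hn.2.2.2 (by simp) hc)
  have e1 := (Ctx.layout_congr (ρ' := ρ) mt fun _ _ => rfl).2.1
  refine ⟨R', M', ρ, η, hT, fun _ _ => rfl, ?_⟩
  rw [hs1, hs2, hs3]
  refine h.use hA (F := []) (S := []) (fun c _ hc _ => hM1 c ?_) (fun _ _ => rfl) ?_ (fun c => ?_)
    (fun y hy => .inl ?_) (by simp) ?_ (by simp) (by simp) le_rfl h.layout.lim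
  · rintro rfl
    exact hc (by simp [Ctx.rd])
  · simp only [Ctx.At, m0, m1, m2, m3, m4]
    exact ⟨h1, h2, trivial, h4, h5.congr mt (fun _ _ => rfl) (by simp [ht])⟩
  · simp only [Ctx.cb, m0, e1, List.count_nil, add_zero, le_refl]
  · simp only [Ctx.vars, List.mem_cons] at hy
    rcases hy with rfl | hy
    · exact g9 _ (by simp [Val.vars])
    · exact State.mem_vars_cons.2 (.inr (.inl (by simp [Ctx.vars, hy])))
  · simp [Ctx.bv]

theorem sim_axm2 {m n : ℕ} (h : MInv M ρ η (R 0) (R 1) (R 2) ⟨C, (a, .sub m v x t) :: P⟩)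
    (hA : AInv N ⟨C, (a, .sub m v x t) :: P⟩) (hC : CutIn C (.var (.m n)) (.m m) D) :
    Sim 70 R M ρ ⟨C, (a, .sub m v x t) :: P⟩ ⟨D, (a, .sub n v x t) :: P⟩ := by
  have H := h.head hA
  obtain ⟨h1, h2, h3, h4, h6, h5⟩ := H.at_
  obtain ⟨B, sc, hS, hM, g1, ⟨g2, g2'⟩, g3, g4, g5, g6, g7, g8, g9⟩ := h.cut hA hC
    (by simp [Ctx.fv])
  obtain ⟨R', hT, hs1, hs2, hs3⟩ := turn_axm2 H.job rfl h1 h3 (by omega) rfl g2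
  have ht := hA.term _ (List.mem_cons_self ..)
  simp only [Ctx.holes, List.append_eq_nil_iff] at ht
  rw [g2'] at hT
  have hn := H.nodup'
  simp only [Ctx.rd, List.nodup_cons, List.nodup_append', List.mem_cons, List.mem_append, not_or,
    List.disjoint_left, List.not_mem_nil, or_false, false_or] at hn
  set M' := Function.update M (M (η a) + 4) (ρ (.m n)) with hM'
  have hM1 : ∀ c, c ≠ M (η a) + 4 → M' c = M c := fun c hc => Function.update_of_ne hc _ _
  have m4 : M' (M (η a) + 4) = ρ (.m n) := Function.update_self ..
  have m0 := hM1 (η a) (by omega)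
  have m1 := hM1 (M (η a)) (by omega)
  have m2 := hM1 (M (η a) + 1) (by omega)
  have m3 := hM1 (ρ x) (by omega)
  have mt : ∀ c ∈ t.rd M ρ (M (η a) + 3), M' c = M c := fun c hc => hM1 c (by
    rintro rfl
    exact (hn.2.2.2 (by simp)).2 hc)
  have mv : ∀ c ∈ v.rd M ρ (M (η a) + 2), M' c = M c := fun c hc => hM1 c (by
    rintro rfl
    exact (hn.2.2.2 (by simp)).1 hc)
  have hB4 : M (η a) + 4 ∈ (Ctx.sub m v x t).rd M ρ (η a) := by simp [Ctx.rd]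
  have e1 := Ctx.layout_congr (ρ' := ρ) mt fun _ _ => rfl
  have e2 := Val.layout_congr (ρ' := ρ) mv fun _ _ => rfl
  suffices hI : ∃ η', MInv (removeMem M' (η a) (R 1) (ρ (.m m))) ρ η' (R 0) (R 1) (R 2)
      ⟨D, (a, .sub n v x t) :: P⟩ by
    obtain ⟨η', hI⟩ := hI
    refine ⟨R', _, ρ, η', hT, fun _ _ => rfl, ?_⟩
    rw [hs1, hs2, hs3]
    exact hI
  refine h.remove hA hS hM (fun c hc => hM1 c ?_)
    (fun y hy i hi hi' => hM1 _ (Ne.symm (H.ne _ (.inr (.inr (.inr (.inl hB4)))) y hy i hi hi')))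
    ?_ (by simpa [Ctx.holes] using ht) (fun c hc => .inl ?_) (fun c => ?_) (fun y hy => ?_) ?_
  · rintro rfl
    have := H.term _ hB4
    rcases hc with hc | hc | hc | hc | hc
    · exact (H.ctx _ hc.1).2.2.1 hB4
    · exact (H.ctx _ g8).2.2.1 (hc ▸ hB4)
    · exact this.2.1 hc
    · exact this.1 hc
    · exact this.2.2 hc
  · simp only [Ctx.At, m0, m1, m2, m3, m4]
    exact ⟨h1, h2, trivial, h4, h6.congr mv (fun _ _ => rfl) (by simp [ht]),
      h5.congr mt (fun _ _ => rfl) (by simp [ht])⟩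
  · simpa only [Ctx.rd, m0, e1, e2] using hc
  · simp only [Ctx.cb, m0, e1, e2]
    omega
  · simp only [Ctx.vars, Val.vars, List.mem_cons, List.mem_singleton] at hy ⊢
    tauto
  · simp [Ctx.bv, Val.bv]

theorem sim_axm1 {m : ℕ} (h : MInv M ρ η (R 0) (R 1) (R 2) ⟨C, (a, .val (.var (.m m))) :: P⟩)
    (hA : AInv N ⟨C, (a, .val (.var (.m m))) :: P⟩) (hC : CutIn C v (.m m) D) :
    Sim 70 R M ρ ⟨C, (a, .val (.var (.m m))) :: P⟩ ⟨D, (a, .val v) :: P⟩ := by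
  have H := h.head hA
  obtain ⟨h1, h2⟩ := H.at_
  obtain ⟨B, sc, hS, hM, g1, g2, g3, g4, g5, g6, g7, g8, g9⟩ := h.cut hA hC
    (by simp [Ctx.fv, Val.fv])
  have hmv : Var.m m ∈ State.vars ⟨C, (a, .val (.var (.m m))) :: P⟩ :=
    State.mem_vars_cons.2 (.inr (.inl (by simp [Ctx.vars, Val.vars])))
  obtain ⟨R', hT, hs1, hs2, hs3⟩ := turn_axm1 H.job rfl h1 h2 (by omega) (h.kind _ hmv)
  set M' := Function.update M (η a) (M (ρ (.m m) + 1)) with hM'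
  have hM1 : ∀ c, c ≠ η a → M' c = M c := fun c hc => Function.update_of_ne hc _ _
  have hv0 : ∀ b, Ctx.val v ≠ .hole b := by
    rintro b ⟨⟩
    simp [Val.holes] at g3
  have hs := H.slot
  obtain ⟨e1, e2, e3, e4⟩ := Ctx.at_shift (M := M) (M' := M') (s' := η a) (η' := η) hv0 g2
    (Function.update_self ..) (fun c hc => hM1 c (by
      rintro rfl
      exact (H.ctx _ (g5 _ (List.mem_of_mem_tail hc)).1).2.2.1 hs)) fun _ _ => rfl
  suffices hI : ∃ η', MInv (removeMem M' (η a) (R 1) (ρ (.m m))) ρ η' (R 0) (R 1) (R 2)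
      ⟨D, (a, .val v) :: P⟩ by
    obtain ⟨η', hI⟩ := hI
    refine ⟨R', _, ρ, η', hT, fun _ _ => rfl, ?_⟩
    rw [hs1, hs2, hs3]
    exact hI
  refine h.remove hA hS hM (fun c hc => hM1 c ?_)
    (fun y hy i hi hi' => hM1 _ (Ne.symm (H.ne _ (.inr (.inr (.inr (.inl hs)))) y hy i hi hi')))
    e1 g3 (fun c hc => ?_) (fun c => ?_) (fun y hy => .inr hy) ?_
  · rintro rfl
    have := H.term _ hs
    rcases hc with hc | hc | hc | hc | hc
    · exact (H.ctx _ hc.1).2.2.1 hs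
    · exact (H.ctx _ g8).2.2.1 (hc ▸ hs)
    · exact this.2.1 hc
    · exact this.1 hc
    · exact this.2.2 hc
  · rw [e3, List.mem_cons] at hc
    rcases hc with rfl | hc
    · exact .inl hs
    · exact .inr (.inl (List.mem_of_mem_tail hc))
  · rw [e2]
    simp only [Ctx.cb]
    omega
  · simp [Ctx.bv, Val.bv]

end

end Sesame
set_option linter.unusedSimpArgs false
namespace Sesame

section

variable {M : ℕ → ℕ} {ρ : Var → ℕ}

theorem Val.mem_blocks {v : Val} {s b : ℕ} :
    b ∈ v.blocks M ρ s ↔ b ∈ v.cb M ρ s ∨ ∃ x ∈ v.bv, ρ x = b := by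
  rw [← List.mem_map, ← List.count_pos_iff, Val.count_blocks, ← List.count_pos_iff,
    ← List.count_pos_iff]
  omega

theorem Ctx.mem_blocks {v : Ctx} {s b : ℕ} :
    b ∈ v.blocks M ρ s ↔ b ∈ v.cb M ρ s ∨ ∃ x ∈ v.bv, ρ x = b := by
  rw [← List.mem_map, ← List.count_pos_iff, Ctx.count_blocks, ← List.count_pos_iff,
    ← List.count_pos_iff]
  omega

theorem SpineM.cb_subset {v : Val} {x : Var} {a sc s b : ℕ} {B C D : Ctx}
    (h : SpineM M ρ v x a B sc C D s) (hb : b ∈ v.cb M ρ (ρ x + 1)) : b ∈ C.cb M ρ s := by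
  induction h <;> simp_all [Ctx.cb, Val.cb]

end

section

variable {R M : ℕ → ℕ} {ρ : Var → ℕ} {η : ℕ → ℕ} {r p lim N a : ℕ} {C D t s : Ctx} {P : Pool}
  {x y : Var} {v : Val}

/-- The slots of the holes are in the blocks of constructors. -/
theorem MInv.slot_owned (h : MInv M ρ η r p lim ⟨C, P⟩) (hA : AInv N ⟨C, P⟩) (ha : a ∈ C.holes)
    (bs : List Var) : Owned (r :: (C.cb M ρ r ++ poolCb M ρ η P p)) bs ρ (η a) := by
  have h8 := fun b hb => (h.layout.con b hb).1
  rcases Ctx.slot_mem h.at_ hA.shape ha with e | ⟨b, hb, e⟩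
  · rw [e]
    exact .block (i := 0) (by simp) (h8 _ (by simp)) (by omega)
  · have hb8 := h8 b (by simp [hb])
    rcases e with e | e <;> rw [e] <;> exact .block (by simp [hb]) hb8 (by omega)

/-- The cells that are used by the rest of the state are not in the block of the binder of the value
of a removed cut. -/
theorem MInv.ne_lam {m : Var} {B : Ctx} {sc : ℕ} (h : MInv M ρ η r p lim ⟨C, (a, t) :: P⟩)
    (hA : AInv N ⟨C, (a, t) :: P⟩) (hS : Spine v m a B C D) (hM : SpineM M ρ v m a B sc C D r)
    (hy : y ∈ v.bv) {c : ℕ} (hc : (c ∈ C.rd M ρ r ∧ ¬ Touched M ρ v m sc c) ∨ c = sc ∨ c = p + 1 ∨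
      c = p ∨ c ∈ poolRd M ρ η P (M (p + 1)) ∨ c ∈ t.rd M ρ (η a)) {i : ℕ} (hi : i < 8) :
    c ≠ ρ y + i := by
  have hb := fun b hb => (h.mem_blocks (b := b) hb).1
  have h8 := fun b hb => (h.layout.con b hb).1
  simp only [poolBlocks, List.mem_cons, List.mem_append, or_imp, forall_and, forall_eq] at hb
  obtain ⟨hb1, hb2, hb3, hb4, hb5⟩ := hb
  have hbv := fun z => List.nodup_iff_count_le_one.1 hA.bv z
  simp only [State.count_bv_cons, hS.count_bv, List.count_cons] at hbv
  have key : Owned (r :: (C.cb M ρ r ++ poolCb M ρ η ((a, t) :: P) p))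
      (D.bv ++ (t.bv ++ P.flatMap fun j => j.2.bv)) ρ c := by
    rcases hc with ⟨hc, hT⟩ | rfl | rfl | rfl | hc | hc
    · rcases (hM.owned hb2 hc).resolve_left hT with rfl | h'
      · exact .block (i := 0) (by simp) hb1 (by omega)
      · exact h'.mono (by simp +contextual) (by simp +contextual)
    · rcases hM.slot with e | ⟨b, hb, e⟩ <;> rw [e]
      · exact .block (i := 0) (by simp) hb1 (by omega)
      · exact .block (by simp [hb]) (h8 b (by simp [hb])) (by omega)
    · exact .block (i := 1) (by simp [poolCb]) hb3 (by omega)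
    · exact .block (i := 0) (by simp [poolCb]) hb3 (by omega)
    · rcases poolRd_owned hb5 hc with h' | h'
      · obtain ⟨j, hj, rfl⟩ := List.mem_map.1 h'
        exact h.slot_owned hA (by rw [hA.holes]; exact List.mem_map_of_mem (List.mem_cons_of_mem _ hj)) _
      · exact h'.mono (by simp +contextual [poolCb]) (by simp +contextual)
    · rcases Ctx.rd_owned hb4 hc with rfl | h'
      · exact h.slot_owned hA hA.mem_holes _
      · exact h'.mono (by simp +contextual [poolCb]) (by simp +contextual)
  have hyC : y ∈ C.bv := (hS.mem_bv y).2 (.inr (.inl hy))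
  refine h.layout.ne key (fun _ => id) (fun z hz => ?_)
    (State.bv_subset_vars (State.mem_bv_cons.2 (.inl hyC))) ?_ hi
  · refine State.bv_subset_vars (State.mem_bv_cons.2 ?_)
    simp only [List.mem_append, List.mem_flatMap] at hz
    rcases hz with hz | hz | hz
    · exact .inl ((hS.mem_bv z).2 (.inr (.inr hz)))
    · exact .inr (.inl hz)
    · exact .inr (.inr hz)
  · have := hbv y
    have := List.count_pos_iff.2 hy
    rw [← List.count_pos_iff, List.count_append, List.count_append]
    omega

set_option maxHeartbeats 800000 in
theorem sim_lolli {m : ℕ} (h : MInv M ρ η (R 0) (R 1) (R 2) ⟨C, (a, .sub m v x t) :: P⟩)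
    (hA : AInv N ⟨C, (a, .sub m v x t) :: P⟩) (hC : CutIn C (.lam y s) (.m m) D) :
    Sim (100 + 6 * N) R M ρ ⟨C, (a, .sub m v x t) :: P⟩
      ⟨D, (a, .cut v y (s.splice fun v' => .cut v' x t)) :: P⟩ := by
  have H := h.head hA
  obtain ⟨h1, h2, h3, h4, h6, h5⟩ := H.at_
  obtain ⟨B, sc, hS, hM, g1, ⟨g2, g2', -, g2''⟩, g3, g4, g5, g6, g7, g8, g9⟩ := h.cut hA hC
    (by simp [Ctx.fv])
  have ht := hA.term _ (List.mem_cons_self ..)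
  simp only [Ctx.holes, List.append_eq_nil_iff] at ht
  simp only [Val.holes] at g3
  obtain ⟨R₁, k1, k2, k3, k4, k5, k6, k7, k8⟩ := start_lolli H.job rfl h1 h3 (by omega) rfl
    (by omega)
  rw [g2'] at k1
  have hmC := hM.mem_bv
  have hyC : y ∈ C.bv := (hS.mem_bv y).2 (.inr (.inl (by simp [Val.bv])))
  have hCv : ∀ y ∈ C.bv, y ∈ State.vars ⟨C, (a, .sub m v x t) :: P⟩ := fun y hy =>
    State.bv_subset_vars (State.mem_bv_cons.2 (.inl hy))
  have hmv := hCv _ hmC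
  have hyv := hCv y hyC
  have hxv : x ∈ State.vars ⟨C, (a, .sub m v x t) :: P⟩ :=
    State.mem_vars_cons.2 (.inr (.inl (by simp [Ctx.vars])))
  have ay := (h.layout.var y hyv).1
  have ax := (h.layout.var x hxv).1
  have am := (h.layout.var _ hmv).1
  have hbvn := fun z => List.nodup_iff_count_le_one.1 hA.bv z
  simp only [State.count_bv_cons, hS.count_bv, List.count_cons] at hbvn
  have hxb : x ∈ (Ctx.sub m v x t).bv := by simp [Ctx.bv]
  have hxC : x ∉ C.bv := fun hx => by
    have h1 := hbvn x
    have h2 := List.count_pos_iff.2 hx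
    have h3 := List.count_pos_iff.2 hxb
    rw [hS.count_bv, List.count_cons] at h2
    omega
  have hxvt : x ∉ v.bv ∧ x ∉ t.bv := by
    have h1 := hbvn x
    simp only [Ctx.bv, List.count_cons, List.count_append, beq_self_eq_true, if_true] at h1
    rw [← List.count_eq_zero, ← List.count_eq_zero]
    omega
  have hys : y ∉ s.bv := by
    have h1 := hbvn y
    simp only [Val.bv, List.count_cons, beq_self_eq_true, if_true] at h1
    rw [← List.count_eq_zero]
    omega
  have hxy : ρ x ≠ ρ y := fun e => hxC (h.layout.inj x hxv y hyv e ▸ hyC)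
  set b := M (η a) with hb
  set V := M (ρ (.m m) + 1) with hV
  have hn := H.nodup'
  have hrd := H.term
  have hCt := fun c hc => (H.ctx c hc).2.2.1
  simp only [Ctx.rd, ← hb, List.nodup_cons, List.nodup_append', List.mem_cons, List.mem_append,
    not_or, List.disjoint_left, List.not_mem_nil, or_false, false_or] at hn hrd hCt
  obtain ⟨⟨⟨n1, n2, n3, n4⟩, n5, n6⟩, ⟨⟨n7, n8, n9⟩, ⟨n10, n11⟩, n12, -⟩, ⟨n13, n14, n15⟩, n16⟩ := hn
  simp only [Val.rd, ← hV, List.nodup_cons, List.nodup_append', List.mem_cons, List.mem_append,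
    not_or, List.disjoint_left, List.not_mem_nil, or_false, false_or] at g5 g6
  obtain ⟨⟨⟨l1, l2, l3⟩, l4⟩, ⟨⟨l5, l6⟩, l7, -⟩, ⟨-, l8, -⟩, l9⟩ := g6
  have hbl : 8 ∣ b := (H.con b (.inr (.inr (by simp [Ctx.cb, hb])))).1
  have hVl : 8 ∣ V := (H.con V (.inr (.inl (hM.cb_subset (by simp [Val.cb, hV]))))).1
  have hsb : ∀ c ∈ s.blocks M ρ (V + 3), 8 ∣ c := by
    intro c hc
    rcases Ctx.mem_blocks.1 hc with hc | ⟨z, hz, rfl⟩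
    · exact (H.con c (.inr (.inl (hM.cb_subset (by simp [Val.cb, ← hV, hc]))))).1
    · exact (h.layout.var z (hCv z ((hS.mem_bv z).2 (.inr (.inl (by simp [Val.bv, hz])))))).1
  have htb : ∀ c, c ∈ v.blocks M ρ (b + 2) ∨ c ∈ t.blocks M ρ (b + 3) → 8 ∣ c := by
    intro c hc
    refine (h.mem_blocks (b := c) ?_).1
    rcases hc with hc | hc <;> simp [poolBlocks, Ctx.blocks, ← hb, hc]
  have hsy : ∀ c ∈ s.rd M ρ (V + 3), c ≠ ρ y + 1 := by
    intro c hc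
    rcases Ctx.rd_owned hsb hc with rfl | h'
    · clear * - ay hVl
      omega
    · refine h.layout.ne h' (fun b hb => ?_) (fun z hz => hCv z
        ((hS.mem_bv z).2 (.inr (.inl (by simp [Val.bv, hz]))))) hyv hys (by decide)
      simp [hM.cb_subset (b := b) (by simp [Val.cb, ← hV, hb])]
  have hvx : ∀ c ∈ v.rd M ρ (b + 2), c ≠ ρ x + 1 := by
    intro c hc
    rcases Val.rd_owned (fun c hc => htb c (.inl hc)) hc with rfl | h'
    · clear * - ax hbl
      omega
    · refine h.layout.ne h' (fun c hc => ?_) (fun z hz => State.bv_subset_vars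
        (State.mem_bv_cons.2 (.inr (.inl (by simp [Ctx.bv, hz]))))) hxv hxvt.1 (by decide)
      simp [poolCb, Ctx.cb, ← hb, hc]
  have htx : ∀ c ∈ t.rd M ρ (b + 3), c ≠ ρ x + 1 := by
    intro c hc
    rcases Ctx.rd_owned (fun c hc => htb c (.inr hc)) hc with rfl | h'
    · clear * - ax hbl
      omega
    · refine h.layout.ne h' (fun c hc => ?_) (fun z hz => State.bv_subset_vars
        (State.mem_bv_cons.2 (.inr (.inl (by simp [Ctx.bv, hz]))))) hxv hxvt.2 (by decide)
      simp [poolCb, Ctx.cb, ← hb, hc]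
  have hxC1 : ∀ c, c ∈ C.rd M ρ (R 0) ∨ c = R 1 ∨ c = R 1 + 1 ∨
      c ∈ poolRd M ρ η P (M (R 1 + 1)) → c ≠ ρ x + 1 := fun c hc => h.ne_bv hA hc hxb (by decide)
  have hya1 : ∀ c, (c ∈ C.rd M ρ (R 0) ∧ ¬ Touched M ρ (.lam y s) (.m m) sc c) ∨ c = sc ∨
      c = R 1 + 1 ∨ c = R 1 ∨ c ∈ poolRd M ρ η P (M (R 1 + 1)) ∨
      c ∈ (Ctx.sub m v x t).rd M ρ (η a) → c ≠ ρ y + 1 := fun c hc =>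
    h.ne_lam hA hS hM (by simp [Val.bv]) hc (by decide)
  have hsx : η a ≠ ρ x + 1 := h.layout.ne (h.slot_owned hA hA.mem_holes []) (fun _ => id) (by simp)
    hxv (by simp) (by decide)
  have hsy' : η a ≠ ρ y + 1 := hya1 _ (by simp [Ctx.rd])
  have hyC' := (g5 (ρ y) (by simp)).1
  have hVC := (g5 V (by simp)).1
  have hy0 : ρ y ≠ η a ∧ ρ y ≠ b := ⟨(hCt _ hyC').1, (hCt _ hyC').2.1.1⟩
  have hV0 : V ≠ η a ∧ V ≠ b ∧ V ≠ ρ x := ⟨(hCt _ hVC).1, (hCt _ hVC).2.1.1, (hCt _ hVC).2.1.2.2.2⟩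
  have hqC : ∀ c ∈ s.rd M ρ (V + 3), c ∈ C.rd M ρ (R 0) := fun c hc => (g5 c (by simp [hc])).1
  set M0 := Function.update (Function.update (Function.update (Function.update M (ρ y) 1)
    (ρ y + 1) (M (b + 2))) V 4) (η a) V with hM0
  have hM0' : ∀ c, c ≠ ρ y → c ≠ ρ y + 1 → c ≠ V → c ≠ η a → M0 c = M c := by
    intro c e1 e2 e3 e4
    rw [hM0, Function.update_of_ne e4, Function.update_of_ne e3, Function.update_of_ne e2,
      Function.update_of_ne e1]
  have hsM0 : ∀ c ∈ s.rd M ρ (V + 3), M0 c = M c := by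
    intro c hc
    refine hM0' c ?_ (hsy c hc) ?_ (hCt c (hqC c hc)).1
    · rintro rfl
      exact l9 (by simp) hc
    · rintro rfl
      exact l9 (by simp) hc
  have hs0 : s.At M0 ρ η (V + 3) := g2''.congr hsM0 (fun _ _ => rfl) (by simp [g3])
  obtain ⟨z1, z2, -⟩ := Ctx.layout_congr (ρ' := ρ) hsM0 fun _ _ => rfl
  obtain ⟨R₂, w1, w2, w3, w4⟩ := walk (R := R₁) k2 (by rw [k7]; exact hs0) g3
  rw [k7] at w3
  set q := s.bottom M0 (V + 3) with hq
  have hqs : q ∈ s.rd M ρ (V + 3) := z1 ▸ Ctx.bottom_mem g3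
  have hc2 : Consts R₂ := k2.congr fun r h h' => w4 r (by clear * - h h'; omega)
  obtain ⟨R₃, s1, s2⟩ := splice_block (M := M0) hc2 w2
  have mb1 : M0 (b + 1) = M (b + 1) := hM0' _ (fun e => (hCt _ hyC').2.1.2.1 e.symm)
    (fun e => hya1 (b + 1) (by simp [Ctx.rd, ← hb]) e) (fun e => (hCt _ hVC).2.1.2.1 e.symm)
    (Ne.symm n2)
  rw [w4 23 (by decide), k8, w4 4 (by decide), k5, mb1, h2, w3, if_neg (by decide)] at s1
  set M₁ := spliceMem M0 b q (ρ x) with hM₁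
  have hc3 : Consts R₃ := hc2.congr fun r h h' => s2 r (by clear * - h h'; omega)
  obtain ⟨R₄, r1, r2⟩ := remove_block (M := M₁) hc3
  rw [s2 3 (by decide), w4 3 (by decide), k4, s2 1 (by decide), w4 1 (by decide), k3.2.1,
    s2 16 (by decide), w4 16 (by decide), k6] at r1
  have hR : ∀ r < 3, R₄ r = R r := by
    intro r hr
    rw [r2 r (hr.trans (by decide)), s2 r (hr.trans (by decide)),
      w4 r (.inl (hr.trans (by decide)))]
    interval_cases r
    exacts [k3.1, k3.2.1, k3.2.2]
  have hT : Turn (100 + 6 * N) R M R₄ (removeMem M₁ (η a) (R 1) (ρ (.m m))) := by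
    refine (Reach.finish (hc3.congr fun r h h' => r2 r (by clear * - h h'; omega))
      (((k1.trans w1).trans s1).trans r1)).mono ?_
    simp only [Val.size] at g4
    clear * - g4
    omega
  suffices hI : ∃ η', MInv (removeMem M₁ (η a) (R 1) (ρ (.m m))) ρ η' (R 0) (R 1) (R 2)
      ⟨D, (a, .cut v y (s.splice fun v' => .cut v' x t)) :: P⟩ by
    obtain ⟨η', hI⟩ := hI
    refine ⟨R₄, _, ρ, η', hT, fun _ _ => rfl, ?_⟩
    rwa [hR 0 (by decide), hR 1 (by decide), hR 2 (by decide)]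
  clear hT hR r1 r2 s1 s2 w1 w2 w3 w4 k1 k2 k3 k4 k5 k6 k7 k8 hc2 hc3
  have hqt := hCt q (hqC q hqs)
  have hqy : q ≠ ρ y := by
    rintro e
    exact l9 (.inr (.inr rfl)) (e ▸ hqs)
  have hqV : q ≠ V := by
    rintro e
    exact l9 (.inl rfl) (e ▸ hqs)
  have hqy1 := hsy q hqs
  have hqx1 := hxC1 q (.inl (hqC q hqs))
  have hVx1 := hxC1 V (.inl hVC)
  have hyx1 := hxC1 (ρ y) (.inl hyC')
  have hdist : ∀ c, c ≠ ρ y → c ≠ ρ y + 1 → c ≠ V → c ≠ η a → c ≠ ρ x → c ≠ ρ x + 1 → c ≠ b →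
      c ≠ q → M₁ c = M c := by
    intro c e1 e2 e3 e4 e5 e6 e7 e8
    rw [hM₁, spliceMem, Function.update_of_ne e8, Function.update_of_ne e7,
      Function.update_of_ne e6, Function.update_of_ne e5, hM0' c e1 e2 e3 e4]
  have hM1' : ∀ c, c ≠ ρ x → c ≠ ρ x + 1 → c ≠ b → c ≠ q → M₁ c = M0 c := by
    intro c e5 e6 e7 e8
    rw [hM₁, spliceMem, Function.update_of_ne e8, Function.update_of_ne e7,
      Function.update_of_ne e6, Function.update_of_ne e5]
  have vq : M₁ q = b := by rw [hM₁, spliceMem, Function.update_self]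
  have vb : M₁ b = 4 := by
    rw [hM₁, spliceMem, Function.update_of_ne (Ne.symm hqt.2.1.1), Function.update_self]
  have vx1 : M₁ (ρ x + 1) = M0 q := by
    rw [hM₁, spliceMem, Function.update_of_ne (Ne.symm hqx1),
      Function.update_of_ne (by clear * - ax hbl; omega),
      Function.update_self]
  have vx : M₁ (ρ x) = 1 := by
    rw [hM₁, spliceMem, Function.update_of_ne (Ne.symm hqt.2.1.2.2.2),
      Function.update_of_ne (Ne.symm n9),
      Function.update_of_ne (Nat.succ_ne_self _).symm, Function.update_self]
  have va : M₁ (η a) = V := by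
    rw [hM1' _ n4 hsx n1 (Ne.symm hqt.1), hM0, Function.update_self]
  have vV : M₁ V = 4 := by
    rw [hM1' _ hV0.2.2 hVx1 hV0.2.1 (Ne.symm hqV), hM0, Function.update_of_ne hV0.1,
      Function.update_self]
  have vy1 : M₁ (ρ y + 1) = M (b + 2) := by
    rw [hM1' _ (by clear * - ax ay; omega) (fun e => hxy (Nat.succ_injective e).symm)
      (by clear * - ay hbl; omega) (Ne.symm hqy1), hM0, Function.update_of_ne (Ne.symm hsy'),
      Function.update_of_ne (by clear * - ay hVl; omega), Function.update_self]
  have vy : M₁ (ρ y) = 1 := by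
    rw [hM1' _ (Ne.symm hxy) hyx1 hy0.2 (Ne.symm hqy), hM0, Function.update_of_ne hy0.1,
      Function.update_of_ne (Ne.symm l6), Function.update_of_ne (Nat.succ_ne_self _).symm, Function.update_self]
  have vV1 : M₁ (V + 1) = M (V + 1) := by
    have hV1 := g5 (V + 1) (by simp)
    refine hdist _ l7 (fun e => l6 (Nat.succ_injective e)) (Nat.succ_ne_self _) (hCt _ hV1.1).1 (hCt _ hV1.1).2.1.2.2.2
      (hxC1 _ (.inl hV1.1)) (hCt _ hV1.1).2.1.1 ?_
    rintro e
    exact l9 (.inr (.inl rfl)) (e ▸ hqs)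
  have vb1 : M₁ (b + 1) = M (b + 1) := by
    rw [hM1' _ n11 (fun e => n9 (Nat.succ_injective e)) (Nat.succ_ne_self _)
      (Ne.symm hqt.2.1.2.1), mb1]
  have hvt : ∀ c, c ∈ v.rd M ρ (b + 2) ∨ c ∈ t.rd M ρ (b + 3) → M₁ c = M c := by
    intro c hc
    have hcT : c ∈ (Ctx.sub m v x t).rd M ρ (η a) := by
      rcases hc with hc | hc <;> simp [Ctx.rd, ← hb, hc]
    have e : ∀ d, d ∈ C.rd M ρ (R 0) → c ≠ d := by
      rintro d hd rfl
      exact (H.ctx _ hd).2.2.1 hcT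
    refine hdist c (e _ hyC') (hya1 c (.inr (.inr (.inr (.inr (.inr hcT)))))) (e _ hVC) ?_ ?_ ?_ ?_
      (e _ (hqC q hqs))
    · rintro rfl
      exact hc.elim n5 n6
    · rintro rfl
      exact hc.elim (n16 (by simp)).1 (n16 (by simp)).2
    · exact hc.elim (hvx c) (htx c)
    · rintro rfl
      exact hc.elim (n16 (by simp)).1 (n16 (by simp)).2
  have htM := fun c hc => hvt c (.inr hc)
  have htA : t.At M₁ ρ η (b + 3) := h5.congr htM (fun _ _ => rfl) (by simp [ht])
  obtain ⟨t1, t2, -⟩ := Ctx.layout_congr (ρ' := ρ) htM fun _ _ => rfl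
  obtain ⟨p1, p2, p3⟩ := Ctx.splice_at vb (vb1.trans h2) vx htA hs0 g3 (z1 ▸ l8) (fun c hc hcq => by
    rw [z1] at hc
    have := hCt c (hqC c hc)
    exact hM1' c this.2.1.2.2.2 (hxC1 c (.inl (hqC c hc))) this.2.1.1 hcq) vq vx1
  rw [z1, t1] at p3
  rw [z2, t2] at p2
  have hv0 : ∀ b, Ctx.val v ≠ .hole b := by
    rintro b ⟨⟩
    simp [Val.holes] at ht
  obtain ⟨q1, q2, q3, q4⟩ := Ctx.at_shift (M := M) (M' := M₁) (s' := ρ y + 1) (η' := η) hv0 h6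
    vy1 (fun c hc => hvt c (.inl (List.mem_of_mem_tail hc))) fun _ _ => rfl
  simp only [Ctx.At, Ctx.cb, Ctx.rd] at q1 q2 q3
  refine h.remove hA hS hM (fun c hc => ?_) (fun z hz i hi hi' => ?_) ?_ ?_ (fun c hc => ?_)
    (fun c => ?_) (fun z hz => ?_) (fun z hz => ?_)
  · have e : ∀ d, d ∈ (Ctx.sub m v x t).rd M ρ (η a) → c ≠ d := by
      rintro d hd rfl
      rcases hc with hc | hc | hc | hc | hc
      · exact (H.ctx _ hc.1).2.2.1 hd
      · exact (H.ctx _ g8).2.2.1 (hc ▸ hd)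
      · exact (H.term _ hd).2.1 hc
      · exact (H.term _ hd).1 hc
      · exact (H.term _ hd).2.2 hc
    have e' : ∀ d, d ∈ (Val.lam y s).rd M ρ (ρ (.m m) + 1) → d ∈ C.rd M ρ (R 0) → d ≠ sc →
        c ≠ d := by
      rintro d hd hd' hds rfl
      rcases hc with hc | hc | hc | hc | hc
      · exact hc.2 (.inr (.inr hd))
      · exact hds hc
      · exact (H.ctx _ hd').2.1 hc
      · exact (H.ctx _ hd').1 hc
      · exact (H.ctx _ hd').2.2.2 hc
    have e'' : ∀ d, d = V ∨ d = ρ y ∨ d ∈ s.rd M ρ (V + 3) → c ≠ d := by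
      intro d hd
      have := g5 d (by rcases hd with hd | hd | hd <;> simp [hd])
      exact e' d (by rcases hd with hd | hd | hd <;> simp [Val.rd, ← hV, hd]) this.1 this.2.1
    refine hdist c (e'' _ (by simp)) (hya1 c ?_) (e'' _ (by simp)) (e _ (by simp [Ctx.rd]))
      (e _ (by simp [Ctx.rd])) (hxC1 c ?_) (e _ (by simp [Ctx.rd, hb])) (e'' _ (by simp [hqs]))
    · rcases hc with hc | hc | hc | hc | hc <;> simp [hc]
    · rcases hc with hc | hc | hc | hc | hc
      · exact .inl hc.1
      · exact .inl (hc ▸ g8)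
      all_goals simp [hc]
  · have e : ∀ d, d ∈ C.rd M ρ (R 0) ∨ d ∈ (Ctx.sub m v x t).rd M ρ (η a) → ρ z + i ≠ d :=
      fun d hd e => H.ne d (by rcases hd with hd | hd <;> simp [hd]) z hz i hi hi' e.symm
    have az := (h.layout.var z hz).1
    have e1 : ∀ u ∈ State.bv ⟨C, (a, .sub m v x t) :: P⟩, 8 ∣ ρ u → ∀ j < 2, ρ z + i ≠ ρ u + j := by
      intro u hu hu8 j hj e
      have := h.layout.inj z hz u (State.bv_subset_vars hu) (by clear * - e az hu8 hi hj; omega)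
      subst this
      rcases hi' with h | h
      · clear * - e h hj
        omega
      · exact h hu
    have hyb : y ∈ State.bv ⟨C, (a, .sub m v x t) :: P⟩ := State.mem_bv_cons.2 (.inl hyC)
    have hxb' : x ∈ State.bv ⟨C, (a, .sub m v x t) :: P⟩ := State.mem_bv_cons.2 (.inr (.inl hxb))
    exact hdist _ (e1 y hyb ay 0 (by decide)) (e1 y hyb ay 1 (by decide)) (e _ (.inl hVC))
      (e _ (.inr H.slot)) (e1 x hxb' ax 0 (by decide)) (e1 x hxb' ax 1 (by decide))
      (e _ (.inr (by simp [Ctx.rd, hb]))) (e _ (.inl (hqC q hqs)))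
  · simp only [Ctx.At, va, vV, vV1, vy, g2', true_and]
    exact ⟨q1, p1⟩
  · simp [Ctx.holes, Ctx.splice_holes, ht, g3]
  · simp only [Ctx.rd, va, q3, List.mem_cons, List.mem_append, List.not_mem_nil, or_false] at hc
    simp only [Ctx.rd, Val.rd, ← hb, ← hV, List.mem_cons, List.mem_append, List.not_mem_nil,
      or_false]
    rcases hc with rfl | (rfl | rfl | rfl) | (rfl | hc) | hc
    · simp
    · simp
    · simp
    · simp
    · exact .inr (.inr ⟨y, by simp [Val.bv], rfl⟩)
    · have := List.mem_of_mem_tail hc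
      exact .inl (by simp [this])
    · rcases p3 c hc with h | rfl | rfl | rfl | rfl | h
      · simp [h]
      · simp
      · simp
      · simp
      · exact .inr (.inr ⟨x, by simp [Ctx.bv], rfl⟩)
      · simp [h]
  · have := p2 c
    simp only [Ctx.cb, Val.cb, va, q2, ← hb, ← hV, List.count_cons, List.count_append] at this ⊢
    clear * - this
    omega
  · simp only [Ctx.vars, Val.vars, List.mem_cons, List.mem_append, Ctx.splice_mem_vars] at hz ⊢
    clear * - hz
    tauto
  · simp only [Ctx.bv, Val.bv, List.mem_cons, List.mem_append, Ctx.splice_mem_bv] at hz ⊢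
    clear * - hz
    tauto

end

end Sesame
set_option linter.unusedSimpArgs false
namespace Sesame

/-! ### Simulation of the principal transitions that copy -/

theorem copy_end {R M : ℕ → ℕ} (h24 : R 24 = 0) (h25 : R 25 = 0) :
    Reach 2 ⟨203, R, M⟩ ⟨105, R, M⟩ :=
  .jz_zero rfl h24 (.jz_zero rfl h25 .refl)

theorem copy_end_splice {R M : ℕ → ℕ} (hc : Consts R) (h24 : R 24 = 0) (h25 : R 25 ≠ 0) :
    ∃ R', Reach 4 ⟨203, R, M⟩ ⟨126, R', M⟩ ∧ R' 21 = R 3 ∧ ∀ r, r ≠ 21 → R' r = R r := by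
  refine ⟨Function.update R 21 (R 3 + R 7), .jz_zero rfl h24 (.jz_pos rfl h25 (.add rfl
    (.jz_zero rfl (by simp [hc.c7]) .refl))), by simp [hc.c7],
    fun r hr => Function.update_of_ne hr _ _⟩

/-- Fresh names are assigned to given locations. -/
theorem exists_update {bs : List Var} {ns : List ℕ} (hl : ns.length = bs.length) (hn : bs.Nodup)
    (ρ : Var → ℕ) : ∃ ρ' : Var → ℕ, bs.map ρ' = ns ∧ ∀ y, y ∉ bs → ρ' y = ρ y := by
  refine ⟨fun y => if y ∈ bs then ns.getD (bs.idxOf y) 0 else ρ y, ?_, fun y hy => if_neg hy⟩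
  refine List.ext_getElem (by simp [hl]) fun i h1 h2 => ?_
  have h3 : i < bs.length := by simpa using h1
  simp [hn.idxOf_getElem i h3, List.getElem?_eq_getElem h2]

section

variable {R M : ℕ → ℕ} {ρ : Var → ℕ} {η : ℕ → ℕ} {r p lim N a : ℕ} {C D t s s' : Ctx} {P : Pool}
  {x y : Var} {v : Val}

theorem MInv.copy {src : ℕ} (h : MInv M ρ η r p lim ⟨C, (a, t) :: P⟩)
    (hA : AInv N ⟨C, (a, t) :: P⟩) (hc : Consts R) (h21 : R 21 = src) (h22 : R 22 = η a)
    (h2 : R 2 = lim) (hs : s.At M ρ η src) (hs0 : s.holes = [])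
    (hrd : ∀ c ∈ s.rd M ρ src, c ∈ C.rd M ρ r)
    (hv : ∀ z ∈ s.vars, z ∈ State.vars ⟨C, (a, t) :: P⟩) (hbn : s.bv.Nodup)
    (hr : s.Renaming s' (State.vars ⟨C, (a, t) :: P⟩)) :
    ∃ ρ' R' M', Reach (100 * s.size) ⟨141, R, M⟩ ⟨203, R', M'⟩ ∧ Kept R R' ∧ R' 24 = R 24 ∧
      R' 2 = lim + 8 * s'.nb ∧ (∀ c < lim, c ≠ η a → M' c = M c) ∧
      (∀ y ∈ State.vars ⟨C, (a, t) :: P⟩, ρ' y = ρ y) ∧ CopyPost M' ρ' η s' (η a) lim ∧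
      (∀ y ∈ s'.vars, y ∈ State.vars ⟨C, (a, t) :: P⟩ ∨ y ∈ s'.bv) ∧
      (s'.cb M' ρ' (η a) ++ s'.bv.map ρ').Nodup ∧
      (∀ b ∈ s'.cb M' ρ' (η a) ++ s'.bv.map ρ', 8 ∣ b ∧ lim ≤ b ∧ b < lim + 8 * s'.nb) ∧
      (s'.rd M' ρ' (η a)).Nodup := by
  have H := h.head hA
  obtain ⟨hα, hn', hf'⟩ := hr
  obtain ⟨ρ', e1, e2⟩ := exists_update (Ctx.newVars_length (v := s') (b := lim)) hn' ρ
  have hρ : ∀ y ∈ State.vars ⟨C, (a, t) :: P⟩, ρ' y = ρ y := fun y hy => e2 y fun h => hf' y h hy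
  have hpre : CopyPre M ρ ρ' [] (s.rd M ρ src) s.vars s.bv s.fv (η a) lim := by
    have hbv : ∀ z ∈ s.bv, z ∈ s.vars := fun z hz => Ctx.mem_vars_iff.2 (.inr hz)
    have hd := H.lt _ (.inr (.inr (.inr (.inl H.slot))))
    refine ⟨fun c hc => ⟨H.lt c (.inl (hrd c hc)), ?_⟩, fun z hz => ⟨?_, ?_, ?_⟩,
      fun z hz w hw => h.layout.inj z (hv z hz) w (hv w hw), fun z hz => h.kind z (hv z (hbv z hz)),
      hbn, ?_, hd⟩
    · rintro rfl
      exact (H.ctx _ (hrd _ hc)).2.2.1 H.slot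
    · have := h.layout.var z (hv z hz)
      have := h.layout.lim
      omega
    · exact Ne.symm (H.ne _ (.inr (.inr (.inr (.inl H.slot)))) z (hv z hz) 2 (by omega) (by omega))
    · intro hc
      exact H.ne _ (.inl (hrd _ hc)) z (hv z hz) 2 (by omega) (by omega) rfl
    · intro z hz z' hzz'
      have hzv := hv z (Ctx.mem_vars_iff.2 (.inl hz))
      rw [← AlphaVar.eq_of_nil hzz', hρ z hzv, fwd, if_pos]
      rw [h.kind z hzv]
      cases z <;> simp [Var.kind]
  subst h21 h2
  rw [← h22] at hpre
  obtain ⟨R', M', k1, k2, k3, k4, k5, k6⟩ := Ctx.copies hα hs0 R M hc hs hpre e1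
  rw [h22] at k5 k6
  have hcount : ∀ b, (s'.cb M' ρ' (η a) ++ s'.bv.map ρ').count b =
      (List.range' (R 2) s'.nb 8).count b := fun b => by
    rw [← k6.blocks, Ctx.count_blocks, List.count_append]
  have hnd : (List.range' (R 2) s'.nb 8).Nodup := List.nodup_range' (step := 8) (h := by decide)
  have hmem : ∀ b, b ∈ List.range' (R 2) s'.nb 8 → 8 ∣ b ∧ R 2 ≤ b ∧ b < R 2 + 8 * s'.nb := by
    intro b hb
    obtain ⟨i, hi, rfl⟩ := List.mem_range'.1 hb
    have := h.layout.lim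
    omega
  refine ⟨ρ', R', M', k1, k2, k3, k4, k5, hρ, k6, fun z hz => ?_, ?_, fun b hb => hmem b ?_, ?_⟩
  · rcases Ctx.mem_vars_iff.1 hz with hz | hz
    · exact .inl (hv z (Ctx.mem_vars_iff.2 (.inl ((hα.mem_fv_iff z).2 hz))))
    · exact .inr hz
  · rw [List.nodup_iff_count_le_one] at hnd ⊢
    intro b
    rw [hcount]
    exact hnd b
  · rw [← List.count_pos_iff] at hb ⊢
    rwa [← hcount]
  · have h1 := Ctx.slots k6.at_ fun b hb => (hmem b (k6.blocks ▸ hb)).1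
    have h2 := h1.2 (k6.blocks ▸ hnd) (fun hb => by
      have h3 := (hmem _ (k6.blocks ▸ hb)).2.1
      have h4 := H.lt _ (.inr (.inr (.inr (.inl H.slot))))
      unfold blk at h3
      omega)
    exact (List.nodup_append'.1 h2).1

theorem sim_axe1 {e : ℕ} {v' : Val}
    (h : MInv M ρ η (R 0) (R 1) (R 2) ⟨C, (a, .val (.var (.e e))) :: P⟩)
    (hA : AInv N ⟨C, (a, .val (.var (.e e))) :: P⟩) (hC : CutIn C v (.e e) D)
    (hr : (Ctx.val v).Renaming (.val v') (State.vars ⟨C, (a, .val (.var (.e e))) :: P⟩)) :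
    Sim (100 + 106 * N) R M ρ ⟨C, (a, .val (.var (.e e))) :: P⟩ ⟨C, (a, .val v') :: P⟩ := by
  have H := h.head hA
  obtain ⟨h1, h2⟩ := H.at_
  obtain ⟨B, sc, hS, hM, g1, g2, g3, g4, g5, g6, g7, g8, g9⟩ := h.cut hA hC
    (by simp [Ctx.fv, Val.fv])
  have hev : Var.e e ∈ State.vars ⟨C, (a, .val (.var (.e e))) :: P⟩ :=
    State.mem_vars_cons.2 (.inr (.inl (by simp [Ctx.vars, Val.vars])))
  have hk := h.kind _ hev
  obtain ⟨R₁, k1, k2, k3, k4, k5, k6, k7, k8⟩ := start_axe1 H.job rfl h1 h2 (by omega)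
    (by rw [hk]; simp [Var.kind])
  have hbn : v.bv.Nodup := by
    have hbvn := fun z => List.nodup_iff_count_le_one.1 hA.bv z
    simp only [State.count_bv_cons, hS.count_bv, List.count_cons] at hbvn
    rw [List.nodup_iff_count_le_one]
    intro z
    have := hbvn z
    omega
  obtain ⟨ρ', R₂, M', c1, c2, c3, c4, c5, c6, c7, c8, c9, c10, c11⟩ := h.copy hA k2 k5 k6 k3.2.2
    (s := .val v) g2 g3 (fun c hc => (g5 c hc).1) g9 hbn hr
  have hR : ∀ r < 2, R₂ r = R r := by
    intro r hr
    rw [c2 r (by omega)]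
    interval_cases r
    exacts [k3.1, k3.2.1]
  refine ⟨R₂, M', ρ', η, ?_, c6, ?_⟩
  · refine (Reach.finish (k2.congr fun r h h' => c2 r (by omega)) ((k1.trans c1).trans
      (copy_end (by omega) ?_))).mono ?_
    · rw [c2 25 (by omega), k8]
    · simp only [Ctx.size] at *
      omega
  · rw [hR 0 (by omega), hR 1 (by omega), c4]
    have hl := h.layout.lim
    refine h.use hA (fun c hc hc' _ => c5 c hc fun e => hc' (e ▸ H.slot)) c6 c7.at_
      (fun c => Nat.le_add_left _ _) c8 (fun y hy => ⟨hy, c7.kind y hy⟩) (by simp [Ctx.bv, Val.bv])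
      c9 c10 (by omega) (by omega)

theorem sim_bang {e : ℕ}
    (h : MInv M ρ η (R 0) (R 1) (R 2) ⟨C, (a, .der e x t) :: P⟩)
    (hA : AInv N ⟨C, (a, .der e x t) :: P⟩) (hC : CutIn C (.bang s) (.e e) D)
    (hr : s.Renaming s' (State.vars ⟨C, (a, .der e x t) :: P⟩)) :
    Sim (100 + 106 * N) R M ρ ⟨C, (a, .der e x t) :: P⟩
      ⟨C, (a, s'.splice fun v' => .cut v' x t) :: P⟩ := by
  have H := h.head hA
  obtain ⟨h1, h2, h3, h4, h5⟩ := H.at_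
  obtain ⟨B, sc, hS, hM, g1, ⟨g2, g2'⟩, g3, g4, g5, g6, g7, g8, g9⟩ := h.cut hA hC
    (by simp [Ctx.fv])
  have ht := hA.term _ (List.mem_cons_self ..)
  simp only [Ctx.holes] at ht
  simp only [Val.holes] at g3
  simp only [Val.size] at g4
  obtain ⟨R₁, k1, k2, k3, k4, k5, k6, k7, k8, k9, k10⟩ := start_bang H.job rfl h1 h3 (by omega) rfl
    (by omega)
  have hbvn := fun z => List.nodup_iff_count_le_one.1 hA.bv z
  simp only [State.count_bv_cons, hS.count_bv, List.count_cons, Val.bv] at hbvn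
  have hbn : s.bv.Nodup := by
    rw [List.nodup_iff_count_le_one]
    intro z
    have := hbvn z
    omega
  have hxt : x ∉ t.bv := by
    have := hbvn x
    simp only [Ctx.bv, List.count_cons, beq_self_eq_true, if_true] at this
    rw [← List.count_eq_zero]
    omega
  clear hbvn
  have hs'0 : s'.holes = [] := by rw [← hr.1.holes_eq, g3]
  have hs's : s'.size = s.size := hr.1.size_eq.symm
  obtain ⟨ρ', R₂, M', c1, c2, c3, c4, c5, c6, c7, c8, c9, c10, c11⟩ := h.copy hA k2 k6 k7 k3.2.2
    g2' g3 (fun c hc => (g5 c (by simp [Val.rd, hc])).1) g9 hbn hr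
  have hc2 : Consts R₂ := k2.congr fun r h h' => c2 r (by omega)
  obtain ⟨R₃, p1, p2, p3⟩ := copy_end_splice (M := M') hc2 (by omega) (by rw [c2 25 (by omega)]; omega)
  rw [c2 3 (by omega), k4] at p2
  have hc3 : Consts R₃ := hc2.congr fun r h h' => p3 r (by omega)
  obtain ⟨R₄, w1, w2, w3, w4⟩ := walk (R := R₃) hc3 (by rw [p2]; exact c7.at_) hs'0
  rw [p2] at w3
  have hc4 : Consts R₄ := hc3.congr fun r h h' => w4 r (by omega)
  obtain ⟨R₅, s1, s2⟩ := splice_block (M := M') hc4 w2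
  have hn := H.nodup'
  set b := M (η a) with hb
  set q := s'.bottom M' (η a) with hq
  have hlt := fun c hc => H.lt c (.inr (.inr (.inr (.inl hc))))
  simp only [Ctx.rd, ← hb, List.nodup_cons, List.nodup_append', List.mem_cons, List.mem_append,
    not_or, List.disjoint_left, List.not_mem_nil, or_false, false_or] at hn hlt
  obtain ⟨⟨⟨n1, n2, n3, n4⟩, n5⟩, ⟨⟨n7, n8, n9⟩, ⟨n10, n11⟩, n12, -⟩, -, n16⟩ := hn
  have hxv : x ∈ State.vars ⟨C, (a, .der e x t) :: P⟩ :=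
    State.mem_vars_cons.2 (.inr (.inl (by simp [Ctx.vars])))
  have hxb : x ∈ State.bv ⟨C, (a, .der e x t) :: P⟩ :=
    State.mem_bv_cons.2 (.inr (.inl (by simp [Ctx.bv])))
  have hl := h.layout.lim
  have hx8 := h.layout.var x hxv
  have hbl := H.con b (.inr (.inr (by simp [Ctx.cb, hb])))
  have hqlt : q = η a ∨ R 2 ≤ q := (c7.rd q (Ctx.bottom_mem hs'0)).imp id And.left
  have hb1 : b + 1 < R 2 := hlt _ (by simp)
  rw [w4 23 (by decide), p3 23 (by decide), c2 23 (by decide), k8, w4 4 (by decide),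
    p3 4 (by decide), c2 4 (by decide), k5, w3, if_pos rfl, c5 _ hb1 (Ne.symm n2), h2] at s1
  have hR : ∀ r < 2, R₅ r = R r := by
    intro r hr
    rw [s2 r (by omega), w4 r (by omega), p3 r (by omega), c2 r (by omega)]
    interval_cases r
    exacts [k3.1, k3.2.1]
  have hT : Turn (100 + 106 * N) R M R₅ (spliceMem M' b q (ρ x)) := by
    refine (Reach.finish (hc4.congr fun r h h' => s2 r (by omega))
      ((((k1.trans c1).trans p1).trans w1).trans s1)).mono ?_
    clear * - g4 hs's
    omega
  refine ⟨R₅, _, ρ', η, hT, c6, ?_⟩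
  rw [hR 0 (by decide), hR 1 (by decide), s2 2 (by decide), w4 2 (by decide), p3 2 (by decide), c4]
  clear hT hR s1 s2 w1 w2 w3 w4 p1 p2 p3 c1 c2 c3 c4 hc2 hc3 hc4 k1 k2 k3 k4 k5 k6 k7 k8 k9 k10
  set M₁ := spliceMem M' b q (ρ x) with hM₁
  have hbx : b ≠ ρ x + 1 := by
    clear * - hbl hx8
    omega
  have ha := hlt (η a) (.inl rfl)
  have hqn : ∀ c < R 2, c ≠ η a → c ≠ q := by
    rintro c hc hca rfl
    clear * - hqlt hc hca
    omega
  have hdist : ∀ c, c ≠ ρ x → c ≠ ρ x + 1 → c ≠ b → c ≠ q → M₁ c = M' c := by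
    intro c e1 e2 e3 e4
    rw [hM₁, spliceMem, Function.update_of_ne e4, Function.update_of_ne e3,
      Function.update_of_ne e2, Function.update_of_ne e1]
  have hbq := hqn b hbl.2.2.1 (Ne.symm n1)
  have hxq := hqn (ρ x) hx8.2.2 (Ne.symm n4)
  have hax : η a ≠ ρ x + 1 := h.layout.ne (h.slot_owned hA hA.mem_holes []) (fun _ => id) (by simp)
    hxv (by simp) (by decide)
  have hx1l : ρ x + 1 < R 2 := by
    clear * - hx8 hl
    omega
  have hx1q := hqn (ρ x + 1) hx1l (Ne.symm hax)
  have vq : M₁ q = b := by rw [hM₁, spliceMem, Function.update_self]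
  have vb : M₁ b = 4 := by
    rw [hM₁, spliceMem, Function.update_of_ne hbq, Function.update_self]
  have vx1 : M₁ (ρ' x + 1) = M' q := by
    rw [c6 x hxv, hM₁, spliceMem, Function.update_of_ne hx1q,
      Function.update_of_ne (Ne.symm hbx), Function.update_self]
  have vx : M₁ (ρ' x) = 1 := by
    rw [c6 x hxv, hM₁, spliceMem, Function.update_of_ne hxq, Function.update_of_ne (Ne.symm n9),
      Function.update_of_ne (Nat.succ_ne_self _).symm, Function.update_self]
  have vb1 : M₁ (b + 1) = ρ' x := by
    rw [hdist _ n11 (fun e => n9 (Nat.succ_injective e)) (Nat.succ_ne_self _)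
      (hqn _ hb1 (Ne.symm n2)), c5 _ hb1 (Ne.symm n2), h2, c6 x hxv]
  have htb : ∀ c ∈ t.blocks M ρ (b + 3), 8 ∣ c := by
    intro c hc
    refine (h.mem_blocks (b := c) ?_).1
    simp [poolBlocks, Ctx.blocks, ← hb, hc]
  have htx : ∀ c ∈ t.rd M ρ (b + 3), c ≠ ρ x + 1 := by
    intro c hc
    rcases Ctx.rd_owned htb hc with rfl | h'
    · clear * - hbl hx8
      omega
    · refine h.layout.ne h' (fun c hc => ?_) (fun z hz => State.bv_subset_vars
        (State.mem_bv_cons.2 (.inr (.inl (by simp [Ctx.bv, hz]))))) hxv hxt (by decide)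
      simp [poolCb, Ctx.cb, ← hb, hc]
  have htM : ∀ c ∈ t.rd M ρ (b + 3), M₁ c = M c := by
    intro c hc
    have hcl := hlt c (.inr (.inr hc))
    have hca : c ≠ η a := by
      rintro rfl
      exact n5 hc
    rw [hdist c ?_ (htx c hc) ?_ (hqn c hcl hca), c5 c hcl hca]
    · rintro rfl
      exact n16 (by simp) hc
    · rintro rfl
      exact n16 (by simp) hc
  have htv : ∀ y ∈ t.vars, ρ' y = ρ y := fun y hy =>
    c6 y (State.mem_vars_cons.2 (.inr (.inl (by simp [Ctx.vars, hy]))))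
  have htA : t.At M₁ ρ' η (b + 3) := h5.congr htM htv (by simp [ht])
  have t2 := (Ctx.layout_congr (ρ' := ρ') htM
    fun y hy => htv y (Ctx.mem_vars_iff.2 (.inr hy))).2.1
  obtain ⟨q1, q2, -⟩ := Ctx.splice_at vb vb1 vx htA c7.at_ hs'0 c11 (fun c hc hcq => by
    refine hdist c ?_ ?_ ?_ hcq
    · rintro rfl
      rcases c7.rd _ hc with e | e
      · exact n4 e.symm
      · exact absurd hx8.2.2 (not_lt.2 e.1)
    · rintro rfl
      rcases c7.rd _ hc with e | e
      · exact hax e.symm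
      · exact absurd hx1l (not_lt.2 e.1)
    · rintro rfl
      rcases c7.rd _ hc with e | e
      · exact n1 e.symm
      · exact absurd hbl.2.2.1 (not_lt.2 e.1)) vq vx1
  have hold : ∀ y ∈ s'.bv, M₁ (ρ' y + 2) = y.kind := by
    intro y hy
    have hyl := c10 (ρ' y) (List.mem_append_right _ (List.mem_map_of_mem hy))
    have hyr : ρ' y + 2 ∉ s'.rd M' ρ' (η a) := by
      intro hc
      rcases Ctx.rd_owned (fun c hc => (c10 c (by
        rw [← List.count_pos_iff, List.count_append, ← Ctx.count_blocks]
        exact List.count_pos_iff.2 hc)).1) hc with e | e | ⟨z, hz, e⟩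
      · clear * - e ha hyl
        omega
      · rw [blk_add hyl.1 (by decide)] at e
        exact (List.disjoint_of_nodup_append c9) e (List.mem_map_of_mem hy)
      · have hzl := c10 (ρ' z) (List.mem_append_right _ (List.mem_map_of_mem hz))
        clear * - e hyl hzl
        omega
    rw [hdist _ ?_ ?_ ?_ ?_, c7.kind y hy]
    · clear * - hyl hx8 hl
      omega
    · clear * - hyl hx8 hl
      omega
    · clear * - hyl hbl hl
      omega
    · intro e
      exact hyr (e ▸ Ctx.bottom_mem hs'0)
  refine h.use hA (F := s'.cb M' ρ' (η a)) (S := s'.bv) (fun c hc hc' hc'' => ?_) c6 q1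
    (fun c => ?_) (fun y hy => ?_) (fun y hy => ⟨Ctx.splice_mem_bv.2 (.inl hy), hold y hy⟩)
    (fun y hy => ?_) c9 c10 (Nat.le_add_right _ _) ?_
  · simp only [Ctx.rd, ← hb, List.mem_cons, List.mem_append, not_or] at hc'
    rw [hdist c hc'.2.1.2.2.2.1 (hc'' x (by simp [Ctx.bv])) hc'.2.1.1 (hqn c hc hc'.1),
      c5 c hc hc'.1]
  · have := q2 c
    simp only [Ctx.cb, ← hb, t2, List.count_cons] at this ⊢
    clear * - this
    omega
  · rcases Ctx.splice_mem_vars.1 hy with hy | rfl | hy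
    · exact c8 y hy
    · exact .inl hxv
    · exact .inl (State.mem_vars_cons.2 (.inr (.inl (by simp [Ctx.vars, hy]))))
  · simp only [Ctx.splice_mem_bv, Ctx.bv, List.mem_cons] at hy ⊢
    clear * - hy
    tauto
  · clear * - hl
    omega

end

end Sesame
set_option linter.unusedSimpArgs false
namespace Sesame

/-! ### All transitions -/

/-- The program implements every transition. -/
theorem Step.sim {R M : ℕ → ℕ} {ρ : Var → ℕ} {η : ℕ → ℕ} {N : ℕ} {l : Label} {Q Q' : State}
    (hs : Step l Q Q') (h : MInv M ρ η (R 0) (R 1) (R 2) Q) (hA : AInv N Q) :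
    Sim (if l.isPrincipal then 100 + 106 * N else 40) R M ρ Q Q' := by
  cases hs with
  | sea1 => exact sim_sea1 h hA
  | sea2 C a b m v x t P hm hb => exact sim_sea2 h hA hm hb
  | sea3 C a e x t P he => exact sim_sea3 h hA he
  | sea4 => exact sim_sea4 h hA
  | sea5 => exact sim_sea5 h hA
  | sea6 C a x P hx => exact sim_sea6 h hA hx
  | axm2 C D a m n v x t P hC => exact (sim_axm2 h hA hC).mono (by simp [Label.isPrincipal]; omega)
  | lolli C D a m y s v x t P hC =>
    exact (sim_lolli h hA hC).mono (by simp [Label.isPrincipal]; omega)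
  | axe2 C D a e f x t P hC => exact (sim_axe2 h hA hC).mono (by simp [Label.isPrincipal]; omega)
  | bang C D a e s s' x t P hC hr => exact sim_bang h hA hC hr
  | axm1 C D a m v P hv hC => exact (sim_axm1 h hA hC).mono (by simp [Label.isPrincipal]; omega)
  | axe1 C D a e v v' P hv hC hr => exact sim_axe1 h hA hC hr

/-- Variables that are not bound remain so. -/
theorem Step.not_bound {N : ℕ} {l : Label} {Q Q' : State} {y : Var} (hs : Step l Q Q')
    (hA : AInv N Q) (h : y ∈ Q.vars) (h' : y ∉ Q.bv) : y ∈ Q'.vars ∧ y ∉ Q'.bv := by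
  cases hs with
  | sea1 C a v x t P =>
    have hP := hA.plug_spec (D := .cut v x (.hole a)) (by simp)
    simp [State.mem_vars, State.mem_bv, hP.mem_vars, hP.mem_bv, Ctx.vars, Ctx.bv, Val.vars,
      Val.bv] at h h' ⊢
    tauto
  | sea2 C a b m v x t P hm hb =>
    have hP := hA.plug_spec (D := .sub m (.hole b) x (.hole a)) (by simp)
    simp [State.mem_vars, State.mem_bv, hP.mem_vars, hP.mem_bv, Ctx.vars, Ctx.bv, Val.vars,
      Val.bv] at h h' ⊢
    tauto
  | sea3 C a e x t P he =>
    have hP := hA.plug_spec (D := .der e x (.hole a)) (by simp)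
    simp [State.mem_vars, State.mem_bv, hP.mem_vars, hP.mem_bv, Ctx.vars, Ctx.bv, Val.vars,
      Val.bv] at h h' ⊢
    tauto
  | sea4 C a x t P =>
    have hP := hA.plug_spec (D := .val (.lam x (.hole a))) fun _ => ⟨_, by simp, rfl⟩
    simp [State.mem_vars, State.mem_bv, hP.mem_vars, hP.mem_bv, Ctx.vars, Ctx.bv, Val.vars,
      Val.bv] at h h' ⊢
    tauto
  | sea5 C a t P =>
    have hP := hA.plug_spec (D := .val (.bang (.hole a))) fun _ => ⟨_, by simp, rfl⟩
    simp [State.mem_vars, State.mem_bv, hP.mem_vars, hP.mem_bv, Ctx.vars, Ctx.bv, Val.vars,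
      Val.bv] at h h' ⊢
    tauto
  | sea6 C a x P hx =>
    have hP := hA.plug_spec (D := .val (.var x)) fun _ => ⟨_, by simp, rfl⟩
    simp [State.mem_vars, State.mem_bv, hP.mem_vars, hP.mem_bv, Ctx.vars, Ctx.bv, Val.vars,
      Val.bv] at h h' ⊢
    tauto
  | axm2 C D a m n v x t P hC =>
    obtain ⟨B, hB⟩ := hA.spine hC (by simp [Ctx.fv])
    simp [State.mem_vars, State.mem_bv, hB.mem_vars, hB.mem_bv, Ctx.vars, Ctx.bv, Val.vars,
      Val.bv] at h h' ⊢
    tauto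
  | lolli C D a m z s v x t P hC =>
    obtain ⟨B, hB⟩ := hA.spine hC (by simp [Ctx.fv])
    simp [State.mem_vars, State.mem_bv, hB.mem_vars, hB.mem_bv, Ctx.vars, Ctx.bv, Val.vars,
      Val.bv, Ctx.splice_mem_vars, Ctx.splice_mem_bv] at h h' ⊢
    tauto
  | axe2 C D a e f x t P hC =>
    obtain ⟨B, hB⟩ := hA.spine hC (by simp [Ctx.fv])
    simp [State.mem_vars, State.mem_bv, hB.mem_vars, hB.mem_bv, Ctx.vars, Ctx.bv, Val.vars,
      Val.bv] at h h' ⊢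
    tauto
  | bang C D a e s s' x t P hC hr =>
    obtain ⟨B, hB⟩ := hA.spine hC (by simp [Ctx.fv])
    have hy := fun hy => hr.2.2 y hy h
    clear hr hC
    simp [State.mem_vars, State.mem_bv, hB.mem_vars, hB.mem_bv, Ctx.vars, Ctx.bv, Val.vars,
      Val.bv, Ctx.splice_mem_vars, Ctx.splice_mem_bv] at h h' hy ⊢
    tauto
  | axm1 C D a m v P hv hC =>
    obtain ⟨B, hB⟩ := hA.spine hC (by simp [Ctx.fv, Val.fv])
    simp [State.mem_vars, State.mem_bv, hB.mem_vars, hB.mem_bv, Ctx.vars, Ctx.bv, Val.vars,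
      Val.bv] at h h' ⊢
    tauto
  | axe1 C D a e v v' P hv hC hr =>
    obtain ⟨B, hB⟩ := hA.spine hC (by simp [Ctx.fv, Val.fv])
    have hy := fun hy => hr.2.2 y hy h
    clear hr hC
    simp [State.mem_vars, State.mem_bv, hB.mem_vars, hB.mem_bv, Ctx.vars, Ctx.bv, Val.vars,
      Val.bv] at h h' hy ⊢
    tauto

end Sesame
set_option linter.unusedSimpArgs false
namespace Sesame

/-! ### Representations and the invariant -/

section

variable {M : ℕ → ℕ} {ρ : Var → ℕ} {η : ℕ → ℕ} {r p : ℕ} {Q : State}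

theorem State.mem_free {x : Var} : x ∈ Q.free ↔ x ∈ Q.vars ∧ x ∉ Q.bv := by
  simp [State.free]

theorem State.blocks_perm : (r :: (Q.ctx.blocks M ρ r ++ poolBlocks M ρ η Q.pool p ++
    Q.free.map ρ)).Perm (r :: (Q.ctx.cb M ρ r ++ poolCb M ρ η Q.pool p) ++
      (Q.bv ++ Q.free).map ρ) := by
  refine List.perm_iff_count.2 fun c => ?_
  simp only [State.bv, List.map_append, List.count_cons, List.count_append, List.cons_append,
    Ctx.count_blocks, poolBlocks_count]
  omega

theorem MInv.represents {N pc : ℕ} {R : ℕ → ℕ} (h : MInv M ρ η (R 0) (R 1) (R 2) Q)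
    (hA : AInv N Q) : Represents ⟨pc, R, M⟩ ρ Q := by
  have hv : ∀ x ∈ Q.bv ++ Q.free, x ∈ Q.vars := by
    simp only [List.mem_append, State.mem_free]
    rintro x (hx | hx)
    exacts [State.bv_subset_vars hx, hx.1]
  refine ⟨η, h.at_, h.pool, fun x hx => ?_, h.kind, ?_, fun b hb => ?_, h.layout.lim⟩
  · rw [State.mem_free] at hx
    exact h.flag x hx.1 hx.2
  · rw [State.blocks_perm.nodup_iff, List.nodup_append']
    refine ⟨h.layout.nodup, List.Nodup.map_on (fun x hx y hy =>
      h.layout.inj x (hv x hx) y (hv y hy)) ?_, fun b hb hb' => ?_⟩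
    · exact hA.bv.append (List.nodup_dedup _) fun x hx hx' => (State.mem_free.1 hx').2 hx
    · obtain ⟨x, hx, rfl⟩ := List.mem_map.1 hb'
      exact h.layout.sep x (hv x hx) hb
  · rcases List.mem_append.1 (State.blocks_perm.mem_iff.1 hb) with hb | hb
    · exact h.layout.con b hb
    · obtain ⟨x, hx, rfl⟩ := List.mem_map.1 hb
      exact h.layout.var x (hv x hx)

theorem Represents.inv {σ : Config} (h : Represents σ ρ Q)
    (hQ : Q.ctx.Back σ.mem ρ (σ.reg 0)) :
    ∃ η, MInv σ.mem ρ η (σ.reg 0) (σ.reg 1) (σ.reg 2) Q := by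
  obtain ⟨η, h1, h2, h3, h4, h5, h6, h7⟩ := h
  have hv : ∀ x ∈ Q.vars, x ∈ Q.bv ++ Q.free := fun x hx => by
    rw [List.mem_append, State.mem_free]
    tauto
  rw [State.blocks_perm.nodup_iff, List.nodup_append'] at h5
  have h6 := fun b hb => h6 b (State.blocks_perm.mem_iff.2 hb)
  refine ⟨η, h1, hQ, h2, fun x hx hx' => h3 x (State.mem_free.2 ⟨hx, hx'⟩), h4, h5.1,
    fun x hx y hy => List.inj_on_of_nodup_map h5.2.1 (hv x hx) (hv y hy), fun x hx hx' =>
    h5.2.2 hx' (List.mem_map_of_mem (hv x hx)), fun b hb => h6 b (List.mem_append_left _ hb),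
    fun x hx => h6 _ (List.mem_append_right _ (List.mem_map_of_mem (hv x hx))), h7⟩

theorem MInv.pool_eq_nil {lim : ℕ} (h : MInv M ρ η r p lim Q) : p = 0 ↔ Q.pool = [] := by
  obtain ⟨C, P⟩ := Q
  cases P with
  | nil => simpa [PoolAt] using h.pool
  | cons j P =>
    have := h.layout.con p (by simp [poolCb])
    simp
    omega

end

/-! ### Runs -/

theorem Step.pool_ne_nil {l : Label} {Q Q' : State} (hs : Step l Q Q') : Q.pool ≠ [] := by
  cases hs <;> simp

theorem Ctx.one_le_size {t : Ctx} (ht : t.IsTerm) : 1 ≤ t.size := by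
  rcases t with (_ | _ | _ | _) | _ | _ | _ <;>
    simp_all [Ctx.IsTerm, Ctx.holes, Val.holes, Ctx.size, Val.size]

section

variable {t : Ctx} {r : Run} {σ : Config} {ρ₀ : Var → ℕ}

/-- After `k` steps, the program is about to execute the transition `i` of the run. -/
def Reaches (t : Ctx) (r : Run) (σ : Config) (ρ₀ : Var → ℕ) (i k : ℕ) : Prop :=
  ∃ R M ρ η, program.after k σ = ⟨if R 1 = 0 then 230 else 0, R, M⟩ ∧
    MInv M ρ η (R 0) (R 1) (R 2) (r.state i) ∧
    ∀ x ∈ t.fv, ρ x = ρ₀ x ∧ x ∈ (r.state i).vars ∧ x ∉ (r.state i).bv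

theorem Reaches.zero (h : Init t (r.state 0)) (hσ : σ.pc = 0)
    (hR : Represents σ ρ₀ (r.state 0)) : Reaches t r σ ρ₀ 0 0 := by
  obtain ⟨a, t', ⟨h1, h2, h3⟩, hQ⟩ := h
  rw [hQ] at hR
  obtain ⟨η, hM⟩ := hR.inv (by simp [Ctx.Back, Val.Back])
  refine ⟨σ.reg, σ.mem, ρ₀, η, ?_, hQ ▸ hM, fun x hx => ⟨rfl, ?_, ?_⟩⟩
  · rw [if_neg fun e => by simpa using hM.pool_eq_nil.1 e, show program.after 0 σ = σ from rfl,
      ← hσ]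
  · rw [hQ, State.mem_vars_cons]
    exact .inr (.inl (Ctx.mem_vars_iff.2 (.inl ((h1.mem_fv_iff x).1 hx))))
  · rw [hQ, State.mem_bv_cons]
    rintro (h | h | h)
    · simp [Ctx.bv, Val.bv] at h
    · exact h3 x h hx
    · simp at h

theorem Reaches.succ (ht : t.IsTerm) (h : Init t (r.state 0)) {i k : ℕ} (hi : i < r.length)
    (hk : Reaches t r σ ρ₀ i k) : ∃ k', Reaches t r σ ρ₀ (i + 1) k' ∧ k < k' ∧
      k' ≤ k + if (r.label i).isPrincipal then 101 + 106 * t.size else 41 := by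
  obtain ⟨R, M, ρ, η, h1, h2, h3⟩ := hk
  have hA := Run.ainv ht h hi.le
  obtain ⟨R', M', ρ', η', ⟨n, hn, h4⟩, h5, h6⟩ := (r.step i hi).sim h2 hA
  have hp : R 1 ≠ 0 := by
    rw [Ne, h2.pool_eq_nil]
    exact (r.step i hi).pool_ne_nil
  rw [if_neg hp] at h1
  refine ⟨k + 1 + n, ⟨R', M', ρ', η', ?_, h6, fun x hx => ?_⟩, by omega, ?_⟩
  · rw [← h4, ← h1]
    simp only [Program.after]
    rw [← Function.iterate_succ_apply' program.next, add_comm, Function.iterate_add_apply]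
  · obtain ⟨e1, e2, e3⟩ := h3 x hx
    exact ⟨(h5 x e2).trans e1, (r.step i hi).not_bound hA e2 e3⟩
  · split_ifs at hn ⊢ <;> omega

theorem implements_program (ht : t.IsTerm) (h : Init t (r.state 0)) (hσ : σ.pc = 0)
    (hR : Represents σ ρ₀ (r.state 0)) : Implements program 300 t r σ ρ₀ := by
  have hs : ∀ i k, i < r.length → Reaches t r σ ρ₀ i k → _ := fun i k hi hk =>
    hk.succ ht h hi
  choose! f hf using hs
  let τ : ℕ → ℕ := fun n => Nat.rec 0 f n
  have hτ : ∀ i ≤ r.length, Reaches t r σ ρ₀ i (τ i) := by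
    intro i
    induction i with
    | zero => exact fun _ => .zero h hσ hR
    | succ i ih => exact fun hi => (hf i _ hi (ih (by omega))).1
  have hstep := fun i hi => (hf i (τ i) hi (hτ i hi.le)).2
  have ht1 : 1 ≤ t.size := Ctx.one_le_size ht
  have hsum : ∀ i ≤ r.length, τ i ≤
      41 * r.searchTo i + 207 * (t.size * r.principalTo i) := by
    intro i
    induction i with
    | zero => simp [τ]
    | succ i ih =>
      intro hi
      have e1 := ih (by omega)
      have e2 : τ (i + 1) ≤ _ := (hstep i hi).2
      rw [Run.principalTo_succ, Run.searchTo_succ]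
      split_ifs at e2 ⊢ <;> simp only [mul_add, mul_one, mul_zero] <;> omega
  refine ⟨τ, fun i hi => ?_, fun i hi => ⟨(hstep i hi).1, (hstep i hi).2.trans ?_⟩, ?_, fun hp => ?_⟩
  · obtain ⟨R, M, ρ, η, e1, e2, e3⟩ := hτ i hi
    exact ⟨ρ, fun x hx => (e3 x hx).1, e1 ▸ e2.represents (Run.ainv ht h hi)⟩
  · split_ifs <;> omega
  · have e1 := hsum _ le_rfl
    have e2 : r.searchTo r.length ≤ _ := Run.search_le ht h
    have e3 : r.principalTo r.length = r.principal := rfl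
    rw [e3] at e1
    rw [mul_add] at e2 ⊢
    omega
  · obtain ⟨R, M, ρ, η, e1, e2, e3⟩ := hτ _ le_rfl
    rw [e1, if_pos (e2.pool_eq_nil.2 hp)]
    exact le_rfl

end

end Sesame
set_option linter.unusedSimpArgs false
namespace Sesame

/-! ### Initial memories -/

section

variable {ρ : Var → ℕ} {η : ℕ → ℕ}

/-- The blocks of a constructor and of the variable that it binds can be written. -/
theorem exists_block (M : ℕ → ℕ) {s lim : ℕ} (hs : s < lim) (k f o κ : ℕ) : ∃ M' : ℕ → ℕ,
    (∀ c < lim, c ≠ s → M' c = M c) ∧ M' s = lim ∧ M' lim = k ∧ M' (lim + 1) = lim + 8 ∧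
      M' (lim + 4) = o ∧ M' (lim + 8) = f ∧ M' (lim + 10) = κ := by
  refine ⟨fun c => if c = s then lim else if c = lim then k else if c = lim + 1 then lim + 8 else
    if c = lim + 4 then o else if c = lim + 8 then f else if c = lim + 10 then κ else M c,
    fun c h h' => ?_, ?_, ?_, ?_, ?_, ?_, ?_⟩
  · simp only [h', show c ≠ lim by omega, show c ≠ lim + 1 by omega, show c ≠ lim + 4 by omega,
      show c ≠ lim + 8 by omega, show c ≠ lim + 10 by omega, if_false]
  · simp
  all_goals simp [show lim ≠ s by omega, show lim + 1 ≠ s by omega, show lim + 4 ≠ s by omega,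
      show lim + 8 ≠ s by omega, show lim + 10 ≠ s by omega]

/-- The multi-context can be stored in any slot, with new blocks from any address on. -/
def Storable (ρ : Var → ℕ) (η : ℕ → ℕ) (C : Ctx) : Prop :=
  ∀ (M : ℕ → ℕ) (s lim : ℕ), s < lim → C.bv.map ρ = C.newVars lim →
    ∃ M' : ℕ → ℕ, (∀ c < lim, c ≠ s → M' c = M c) ∧ CopyPost M' ρ η C s lim

mutual
theorem Val.storable : ∀ {v : Val}, v.holes = [] → Storable ρ η (.val v)
  | .hole _, h => by simp [Val.holes] at h
  | .var x, _ => fun M s lim hs _ => by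
    obtain ⟨M', h0, h1, h2, h3, -⟩ := exists_block M hs 1 0 0 0
    refine ⟨Function.update M' (lim + 1) (ρ x), fun c hc hc' => ?_, ?_, ?_, ?_, ?_⟩
    · rw [Function.update_of_ne (by omega), h0 c hc hc']
    all_goals simp [Ctx.At, Val.At, Ctx.rd, Val.rd, Ctx.nb, Val.nb, Ctx.blocks, Val.blocks, Ctx.bv,
      Val.bv, Function.update_apply, show s ≠ lim + 1 by omega, h1, h2]
  | .lam x C, h => fun M s lim hs hn => by
    simp only [Ctx.bv, Val.bv, List.map_cons, Ctx.newVars, Val.newVars, List.cons.injEq] at hn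
    obtain ⟨M₁, h0, h1, h2, h3, -, h5, h6⟩ := exists_block M hs 2 0 0 x.kind
    obtain ⟨M₂, e0, e⟩ := Ctx.storable (C := C) h M₁ (lim + 3) (lim + 16) (by omega) hn.2
    have m0 : M₂ s = lim := by rw [e0 _ (by omega) (by omega), h1]
    refine ⟨M₂, fun c hc hc' => by rw [e0 _ (by omega) (by omega), h0 c hc hc'], ?_, ?_, ?_, ?_⟩
    · simp only [Ctx.At, Val.At, m0, hn.1]
      exact ⟨by rw [e0 _ (by omega) (by omega), h2], by rw [e0 _ (by omega) (by omega), h3],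
        by rw [e0 _ (by omega) (by omega), h5], e.at_⟩
    · intro c hc
      simp only [Ctx.rd, Val.rd, m0, hn.1, List.mem_cons, List.mem_append, List.not_mem_nil,
        or_false, false_or] at hc
      simp only [Ctx.nb, Val.nb]
      rcases hc with hc | hc | hc
      · omega
      · omega
      · have := e.rd c hc
        omega
    · simp only [Ctx.blocks, Val.blocks, m0, hn.1, e.blocks, Ctx.nb, Val.nb, List.range'_succ]
    · simp only [Ctx.bv, Val.bv, List.mem_cons, forall_eq_or_imp, hn.1]
      exact ⟨by rw [e0 _ (by omega) (by omega), h6], e.kind⟩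
  | .bang C, h => fun M s lim hs hn => by
    obtain ⟨M₁, h0, h1, h2, -⟩ := exists_block M hs 3 0 0 0
    obtain ⟨M₂, e0, e⟩ := Ctx.storable (C := C) h M₁ (lim + 3) (lim + 8) (by omega) hn
    have m0 : M₂ s = lim := by rw [e0 _ (by omega) (by omega), h1]
    refine ⟨M₂, fun c hc hc' => by rw [e0 _ (by omega) (by omega), h0 c hc hc'], ?_, ?_, ?_, e.kind⟩
    · simp only [Ctx.At, Val.At, m0]
      exact ⟨by rw [e0 _ (by omega) (by omega), h2], e.at_⟩
    · intro c hc
      simp only [Ctx.rd, Val.rd, m0, List.mem_cons, List.mem_append, List.not_mem_nil,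
        or_false, false_or] at hc
      simp only [Ctx.nb, Val.nb]
      rcases hc with hc | hc | hc
      · omega
      · omega
      · have := e.rd c hc
        omega
    · simp only [Ctx.blocks, Val.blocks, m0, e.blocks, Ctx.nb, Val.nb, List.range'_succ]
theorem Ctx.storable : ∀ {C : Ctx}, C.holes = [] → Storable ρ η C
  | .val v, h => Val.storable (v := v) h
  | .cut v x C, h => fun M s lim hs hn => by
    simp only [Ctx.holes, List.append_eq_nil_iff] at h
    simp only [Ctx.bv, List.map_cons, Ctx.newVars, List.cons.injEq, List.map_append] at hn
    obtain ⟨hn1, hn2⟩ := hn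
    obtain ⟨hn2, hn3⟩ := List.append_inj hn2 (by rw [List.length_map, Val.newVars_length])
    obtain ⟨M₁, h0, h1, h2, h3, -, h5, h6⟩ := exists_block M hs 4 1 0 x.kind
    obtain ⟨M₂, e0, e⟩ := Val.storable (v := v) h.1 M₁ (lim + 9) (lim + 16) (by omega) hn2
    obtain ⟨M₃, f0, f⟩ := Ctx.storable (C := C) h.2 M₂ (lim + 3) (lim + 16 + 8 * v.nb) (by omega) hn3
    have g : ∀ c < lim + 16, c ≠ lim + 9 → c ≠ lim + 3 → M₃ c = M₁ c := fun c hc hc' hc'' => by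
      rw [f0 c (by omega) hc'', e0 c hc hc']
    have e := e.congr fun c hc => f0 c (by simp only [Ctx.nb] at hc; omega) (by omega)
    have m0 : M₃ s = lim := by rw [g _ (by omega) (by omega) (by omega), h1]
    refine ⟨M₃, fun c hc hc' => by rw [g _ (by omega) (by omega) (by omega), h0 c hc hc'],
      ?_, ?_, ?_, ?_⟩
    · simp only [Ctx.At, m0, hn1]
      exact ⟨by rw [g _ (by omega) (by omega) (by omega), h2],
        by rw [g _ (by omega) (by omega) (by omega), h3],
        by rw [g _ (by omega) (by omega) (by omega), h5], e.at_, f.at_⟩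
    · intro c hc
      simp only [Ctx.rd, m0, hn1, List.mem_cons, List.mem_append, List.not_mem_nil,
        or_false, false_or] at hc
      simp only [Ctx.nb]
      rcases hc with hc | hc | hc | hc
      · omega
      · omega
      · have : _ ∨ lim + 16 ≤ c ∧ c < lim + 16 + 8 * v.nb := e.rd c hc
        omega
      · have := f.rd c hc
        omega
    · have h5 : v.blocks M₃ ρ (lim + 9) = _ := e.blocks
      simp only [Ctx.nb] at h5
      simp only [Ctx.blocks, m0, hn1, h5, f.blocks, Ctx.nb, List.range'_succ]
      rw [← List.range'_append]
    · simp only [Ctx.bv, List.mem_cons, hn1, List.mem_append, or_imp, forall_and, forall_eq]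
      exact ⟨by rw [g _ (by omega) (by omega) (by omega), h6], e.kind, f.kind⟩
  | .sub m v x C, h => fun M s lim hs hn => by
    simp only [Ctx.holes, List.append_eq_nil_iff] at h
    simp only [Ctx.bv, List.map_cons, Ctx.newVars, List.cons.injEq, List.map_append] at hn
    obtain ⟨hn1, hn2⟩ := hn
    obtain ⟨hn2, hn3⟩ := List.append_inj hn2 (by rw [List.length_map, Val.newVars_length])
    obtain ⟨M₁, h0, h1, h2, h3, h4, h5, h6⟩ := exists_block M hs 5 0 (ρ (.m m)) x.kind
    obtain ⟨M₂, e0, e⟩ := Val.storable (v := v) h.1 M₁ (lim + 2) (lim + 16) (by omega) hn2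
    obtain ⟨M₃, f0, f⟩ := Ctx.storable (C := C) h.2 M₂ (lim + 3) (lim + 16 + 8 * v.nb) (by omega) hn3
    have g : ∀ c < lim + 16, c ≠ lim + 2 → c ≠ lim + 3 → M₃ c = M₁ c := fun c hc hc' hc'' => by
      rw [f0 c (by omega) hc'', e0 c hc hc']
    have e := e.congr fun c hc => f0 c (by simp only [Ctx.nb] at hc; omega) (by omega)
    have m0 : M₃ s = lim := by rw [g _ (by omega) (by omega) (by omega), h1]
    refine ⟨M₃, fun c hc hc' => by rw [g _ (by omega) (by omega) (by omega), h0 c hc hc'],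
      ?_, ?_, ?_, ?_⟩
    · simp only [Ctx.At, m0, hn1]
      exact ⟨by rw [g _ (by omega) (by omega) (by omega), h2],
        by rw [g _ (by omega) (by omega) (by omega), h3],
        by rw [g _ (by omega) (by omega) (by omega), h4],
        by rw [g _ (by omega) (by omega) (by omega), h5], e.at_, f.at_⟩
    · intro c hc
      simp only [Ctx.rd, m0, hn1, List.mem_cons, List.mem_append, List.not_mem_nil,
        or_false, false_or] at hc
      simp only [Ctx.nb]
      rcases hc with hc | hc | hc | hc
      · omega
      · omega
      · have : _ ∨ lim + 16 ≤ c ∧ c < lim + 16 + 8 * v.nb := e.rd c hc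
        omega
      · have := f.rd c hc
        omega
    · have h5 : v.blocks M₃ ρ (lim + 2) = _ := e.blocks
      simp only [Ctx.nb] at h5
      simp only [Ctx.blocks, m0, hn1, h5, f.blocks, Ctx.nb, List.range'_succ]
      rw [← List.range'_append]
    · simp only [Ctx.bv, List.mem_cons, hn1, List.mem_append, or_imp, forall_and, forall_eq]
      exact ⟨by rw [g _ (by omega) (by omega) (by omega), h6], e.kind, f.kind⟩
  | .der m x C, h => fun M s lim hs hn => by
    simp only [Ctx.bv, List.map_cons, Ctx.newVars, List.cons.injEq] at hn
    obtain ⟨M₁, h0, h1, h2, h3, h4, h5, h6⟩ := exists_block M hs 6 0 (ρ (.e m)) x.kind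
    obtain ⟨M₂, e0, e⟩ := Ctx.storable (C := C) h M₁ (lim + 3) (lim + 16) (by omega) hn.2
    have m0 : M₂ s = lim := by rw [e0 _ (by omega) (by omega), h1]
    refine ⟨M₂, fun c hc hc' => by rw [e0 _ (by omega) (by omega), h0 c hc hc'], ?_, ?_, ?_, ?_⟩
    · simp only [Ctx.At, m0, hn.1]
      exact ⟨by rw [e0 _ (by omega) (by omega), h2], by rw [e0 _ (by omega) (by omega), h3],
        by rw [e0 _ (by omega) (by omega), h4], by rw [e0 _ (by omega) (by omega), h5], e.at_⟩
    · intro c hc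
      simp only [Ctx.rd, m0, hn.1, List.mem_cons, List.mem_append, List.not_mem_nil,
        or_false, false_or] at hc
      simp only [Ctx.nb]
      rcases hc with hc | hc | hc
      · omega
      · omega
      · have := e.rd c hc
        omega
    · simp only [Ctx.blocks, m0, hn.1, e.blocks, Ctx.nb, List.range'_succ]
    · simp only [Ctx.bv, List.mem_cons, forall_eq_or_imp, hn.1]
      exact ⟨by rw [e0 _ (by omega) (by omega), h6], e.kind⟩
end

end

end Sesame
set_option linter.unusedSimpArgs false
namespace Sesame

/-- Initial states are represented by some memory. -/
theorem Init.exists_represents {t : Ctx} {Q : State} (ht : t.IsTerm) (h : Init t Q) :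
    ∃ (σ : Config) (ρ : Var → ℕ), σ.pc = 0 ∧ Represents σ ρ Q := by
  obtain ⟨a, t', ⟨h1, h2, h3⟩, rfl⟩ := h
  have ht' : t'.holes = [] := h1.holes_eq.symm.trans ht
  set F := t'.fv.dedup with hF
  set lim := 24 + 8 * F.length with hlim
  obtain ⟨ρ₀, e1, -⟩ := exists_update (ns := List.range' 24 F.length 8) (by simp [hF])
    (List.nodup_dedup t'.fv) fun _ => 0
  obtain ⟨ρ, e2, e3⟩ := exists_update (Ctx.newVars_length (v := t') (b := lim)) h2 ρ₀
  have hbv : ∀ x ∈ F, x ∉ t'.bv := fun x hx hx' =>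
    h3 x hx' ((h1.mem_fv_iff x).2 (List.mem_dedup.1 hx))
  have e3 : ∀ x ∈ F, ρ x = ρ₀ x := fun x hx => e3 x (hbv x hx)
  have e1 : F.map ρ = List.range' 24 F.length 8 := (List.map_congr_left e3).trans e1
  have hinj : ∀ x ∈ F, ∀ y ∈ F, ρ x = ρ y → x = y := fun x hx y hy =>
    List.inj_on_of_nodup_map (e1 ▸ List.nodup_range' (step := 8) (h := by decide)) hx hy
  have hρ : ∀ x ∈ F, ∃ i < F.length, ρ x = 24 + 8 * i := fun x hx =>
    List.mem_range'.1 (e1 ▸ List.mem_map_of_mem hx)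
  classical
  obtain ⟨M, m1, m2⟩ := Ctx.storable (ρ := ρ) (η := fun _ => 8) ht' (fun c => if c = 16 then 8 else
    if ∃ n, Var.e n ∈ F ∧ c = ρ (.e n) + 2 then 1 else 0) 8 lim (by omega) e2
  have hvars : ∀ x ∈ State.vars ⟨.hole a, [(a, t')]⟩, x ∈ F ∨ x ∈ t'.bv := by
    intro x hx
    rw [hF, List.mem_dedup, ← Ctx.mem_vars_iff]
    simpa [State.mem_vars, Ctx.vars, Val.vars] using hx
  have hfree : ∀ x ∈ State.free ⟨.hole a, [(a, t')]⟩, x ∈ F := by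
    intro x hx
    rw [State.mem_free, State.mem_bv_cons] at hx
    have := hvars x hx.1
    tauto
  refine ⟨⟨0, fun r => if r = 0 then 8 else if r = 1 then 16 else lim + 8 * t'.nb, M⟩, ρ, rfl,
    fun _ => 8, rfl, ⟨?_, m2.at_, ?_⟩, fun x hx => ?_, fun x hx => ?_, ?_, ?_, ?_⟩
  · simp [m1 16 (by omega)]
  · show M 17 = 0
    rw [m1 17 (by omega) (by omega), if_neg (by omega), if_neg]
    rintro ⟨n, hn, e⟩
    obtain ⟨i, hi, e'⟩ := hρ _ hn
    omega
  · obtain ⟨i, hi, e⟩ := hρ x (hfree x hx)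
    show M (ρ x) = 0
    rw [m1 _ (by omega) (by omega), if_neg (by omega), if_neg]
    rintro ⟨n, hn, e'⟩
    obtain ⟨j, hj, e''⟩ := hρ _ hn
    omega
  · rcases hvars x hx with hx | hx
    · obtain ⟨i, hi, e⟩ := hρ x hx
      show M (ρ x + 2) = _
      rw [m1 _ (by omega) (by omega), if_neg (by omega)]
      cases x with
      | m n =>
        rw [if_neg, Var.kind]
        rintro ⟨k, hk, e'⟩
        exact absurd (hinj _ hx _ hk (by omega)) (by simp)
      | e n => rw [if_pos ⟨n, hx, rfl⟩, Var.kind]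
    · exact m2.kind x hx
  · have hn : ((State.free ⟨.hole a, [(a, t')]⟩).map ρ).Nodup :=
      (List.nodup_dedup _).map_on fun x hx y hy => hinj x (hfree x hx) y (hfree y hy)
    have hr : (t'.blocks M ρ 8).Nodup := m2.blocks ▸ List.nodup_range' (step := 8) (h := by decide)
    have hb : ∀ b ∈ t'.blocks M ρ 8, lim ≤ b := fun b hb => by
      obtain ⟨i, hi, rfl⟩ := List.mem_range'.1 (m2.blocks ▸ hb)
      omega
    have hc : ∀ b ∈ (State.free ⟨.hole a, [(a, t')]⟩).map ρ, 24 ≤ b ∧ b < lim := fun b hb => by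
      obtain ⟨x, hx, rfl⟩ := List.mem_map.1 hb
      obtain ⟨i, hi, e⟩ := hρ x (hfree x hx)
      omega
    simp only [Ctx.blocks, Val.blocks, poolBlocks, List.append_nil, List.nil_append, if_true,
      if_neg one_ne_zero, List.cons_append, List.nodup_cons, List.nodup_append', List.mem_cons,
      List.mem_append, not_or]
    refine ⟨⟨by decide, fun h => ?_, fun h => ?_⟩, ⟨fun h => ?_, fun h => ?_⟩, hr, hn,
      fun b hb' hb'' => ?_⟩
    · have := hb _ h
      omega
    · have := hc _ h
      omega
    · have := hb _ h
      omega
    · have := hc _ h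
      omega
    · have := hb _ hb'
      have := hc _ hb''
      omega
  · intro b hb
    simp only [Ctx.blocks, Val.blocks, poolBlocks, List.append_nil, List.nil_append, if_true,
      if_neg one_ne_zero, List.cons_append, List.mem_cons, List.mem_append, m2.blocks,
      List.mem_range', List.mem_map] at hb
    show 8 ∣ b ∧ 0 < b ∧ b < lim + 8 * t'.nb
    rcases hb with rfl | rfl | ⟨i, hi, rfl⟩ | ⟨x, hx, rfl⟩
    · omega
    · omega
    · omega
    · obtain ⟨i, hi, e⟩ := hρ x (hfree x hx)
      omega
  · show 8 ∣ lim + 8 * t'.nb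
    omega

end Sesame

theorem mainTheorem3 :
    (∀ (t : Sesame.Ctx) (Q : Sesame.State), t.IsTerm → t.Proper → Sesame.Init t Q →
      ∃ (σ : Sesame.Config) (ρ : Sesame.Var → ℕ), σ.pc = 0 ∧ Sesame.Represents σ ρ Q) ∧
    ∃ (p : Sesame.Program) (K : ℕ),
      ∀ (t : Sesame.Ctx) (r : Sesame.Run), t.IsTerm → t.Proper → Sesame.Init t (r.state 0) →
        r.search ≤ t.size * (r.principal + 1) ∧
        ∀ (σ : Sesame.Config) (ρ : Sesame.Var → ℕ), σ.pc = 0 →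
          Sesame.Represents σ ρ (r.state 0) → Sesame.Implements p K t r σ ρ := by
  refine ⟨fun t Q ht _ h => h.exists_represents ht, Sesame.program, 300, fun t r ht _ h =>
    ⟨Sesame.Run.search_le ht h, fun σ ρ hσ hR => Sesame.implements_program ht h hσ hR⟩⟩
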